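/- **Setting.** Let $I\subset\mathbb R$ be an interval with non-empty interior, symmetric about $0$. Functions on $\mathbb T$ have zero mean and are identified with their Fourier coefficients $u=\sum_{j\neq0}u_je^{ijx}/\sqrt{2\pi}$; $\|u\|_{\dot H^s}^2=\sum_j|j|^{2s}|u_j|^2$. $\Pi_n$ ($n\in\mathbb N$) is the projector on the frequencies $\pm n$, and $\tau_\varsigma u(x)=u(x+\varsigma)$. $C^K_*(I,\dot H^s)=\bigcap_{k\le K}C^k(I,\dot H^{s-\frac32k})$, $\|U(t)\|_{K,s}=\sum_{k\le K}\|\partial_t^kU(t)\|_{\dot H^{s-\frac32k}}$, and $B^K_s(I;r)$ is the ball $\sup_{t\in I}\|U(t)\|_{K,s}<r$ in $C^K_*(I,\dot H^s(\mathbb T,\mathbb C^2))$. For $\mathbb C^2$-valued $V=(V^+,V^-)$, $W$: $\langle V,W\rangle_r=\int V^+W^++\int V^-W^-$, $J_c=E_c=\begin{pmatrix}0&-i\\ i&0\end{pmatrix}$, $\Omega_c(V,W)=\langle E_cV,W\rangle_r$, and $\nabla H$ is defined by $dH(U)[V]=\langle\nabla H(U),V\rangle_r$. $U$ is real if $U=(u,\bar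 u)$. A matrix of operators is real-to-real if, for real $U$, it has the form $\begin{pmatrix}R_1&R_2\\ \overline{R_2}&\overline{R_1}\end{pmatrix}$ with $\overline R\,v=\overline{R\bar v}$. **Homogeneous operators.** $\widetilde{\mathcal M}^m_q$ is the space of $(q+1)$-linear operators $M(U_1,\dots,U_q)U_{q+1}$ ($U_1,\dots,U_q$ being $\mathbb C^2$-valued), symmetric in $U_1,\dots,U_q$, such that for some $\mu\ge0$, $C>0$ $$\|\Pi_{n_0}M(\Pi_{n_1}U_1,\dots,\Pi_{n_q}U_q)\Pi_{n_{q+1}}U_{q+1}\|_{L^2}\le C\,{\max}_2(n_1,\dots,n_{q+1})^\mu\max(n_1,\dots,n_{q+1})^m\prod_{j=1}^{q+1}\|\Pi_{n_j}U_j\|_{L^2},$$ the left side is nonzero only if $\sum_{j=0}^{q+1}\sigma_jn_j=0$ for some signs $\sigma_j$, and $M(\tau_\varsigma U_1,\dots,\tau_\varsigma U_q)\tau_\varsigma U_{q+1}=\tau_\varsigma(M(U_1,\dots,U_q)U_{q+1})$ for all $\varsigma\in\mathbb R$. Here $\max_2$ is the second largest entry. Smoothing: $\widetilde{\mathcal R}^{-\varrho}_q=\widetilde{\mathcal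 M}^{-\varrho}_q$. The spectrally localized maps $\widetilde{\mathcal S}^m_q\subset\widetilde{\mathcal M}^m_q$ are those for which, with some $\delta>0$, $C>1$, the left side is nonzero only if $\max(n_1,\dots,n_q)\le\delta n_{q+1}$ and $C^{-1}n_0\le n_{q+1}\le Cn_0$. Write $M_q(U)=M_q(U,\dots,U)$. **Non-homogeneous operators.** $\mathcal M^m_{K,K',p}[r]$ is the space of operators $M(U;t)V$, linear in $V$, for which there is $s_0>0$ such that for each $s\ge s_0$ there are $C>0$, $r(s)\in(0,r)$ such that for all $U\in B^K_{s_0}(I;r(s))\cap C^K_*(I,\dot H^s)$ and $V\in C^{K-K'}_*(I,\dot H^s)$, $M(U;t)V$ lies in $C^{K-K'}_*(I,\dot H^{s-m})$ and for $0\le k\le K-K'$, $t\in I$, $$\|\partial_t^k(M(U;t)V)\|_{\dot H^{s-\frac32k-m}}\le C\sum_{k'+k''=k}\Big(\|V\|_{k'',s}\|U\|^p_{k'+K',s_0}+\|V\|_{k'',s_0}\|U\|^{p-1}_{k'+K',s_0}\|U\|_{k'+K',s}\Big),$$ the right side being $C\|V\|_{k,s}$ if $p=0$. $\mathcal S^m_{K,K',p}[r]$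 is defined in the same way, with all $s\in\mathbb R$ in place of $s\ge s_0$ and right side $C\sum_{k'+k''=k}\|U\|^p_{k'+K',s_0}\|V\|_{k'',s}$ ($C\|V\|_{k,s}$ if $p=0$). $\Sigma\mathcal M_{K,K',p}[r,N]$ (resp. $\Sigma\mathcal S_{K,K',p}[r,N]$) is the set of operators equal, for $U$ in a small ball of $C^K_*(I,\dot H^{s_0})$, to $\sum_{q=p}^NM_q(U)V+M_{>N}(U;t)V$ with $M_q\in\widetilde{\mathcal M}^m_q$, $M_{>N}\in\mathcal M^m_{K,K',N+1}[r]$ (resp. $\widetilde{\mathcal S}^m_q$, $\mathcal S^m_{K,K',N+1}[r]$) for some $m\ge0$. The subscript $\le N$ denotes removal of $M_{>N}$. The same notation is used for $2\times2$ matrices of such operators. **Forms.** A homogeneous $k$-form of degree $q$ is a function $\Lambda(U_1,\dots,U_q)[V_1,\dots,V_k]$, $q$-linear and symmetric in the $U_i$, $k$-linear and alternating in the $V_i$, real on real arguments, invariant under simultaneous translation of all arguments, whose values on arguments $\Pi_{n_i}U_i$, $\Pi_{l_i}V_i$ are bounded, for some $m\ge0$, $C>0$, by $C\max(n,l)^m$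 times the product of the $L^2$ norms of these arguments, and vanish unless some signed sum of all the $n_i$, $l_i$ is $0$. A $0$-form $H_q$ is identified with the polynomial $H_q(U)=H_q(U,\dots,U)$. **Notions up to homogeneity $N$.** Let $M_0(U;t)$ be a matrix of operators in $\mathcal M^0_{K,K',0}[r]$. * A system $\partial_tZ=J_c\nabla H(Z)+M_{>N}(U;t)U$ for $Z=M_0(U;t)U$ is *Hamiltonian up to homogeneity $N$* if $H=\sum_{q=2}^{N+2}H_q$ with $H_q$ a homogeneous $0$-form of degree $q$ and $M_{>N}$ has entries in $\bigcup_{m\ge0}\mathcal M^m_{K,K'+1,N+1}[r]$. * A matrix $B$ as below is *linearly symplectic up to homogeneity $N$* if it is real-to-real and $B(Z;t)^\top E_cB(Z;t)=E_c+S_{>N}(Z;t)$, with the entries of $S_{>N}$ in some $\mathcal S^m_{\cdot,\cdot,N+1}[\cdot]$ with the indices of the class of $B$. * A map $\mathcal D(Z;t)=M(Z;t)Z$ is *symplectic up to homogeneity $N$* (in the class $K,K',r$) if $M-\mathrm{Id}\in\Sigma\mathcal M_{K,K',p}[r,N]$ and $\mathcal D_{\le N}(Z)=Z+\sum_{q=p}^NM_q(Z)Z$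 satisfies $(\mathcal D_{\le N})^*\Omega_c=\Omega_c+\Omega_{>N}$ with $\Omega_{>N}$ a finite sum of homogeneous $2$-forms of degrees $\ge N+1$. **Theorem.** Let $1\le p\le N$, $K'+1\le K$, $r>0$, let $M_0\in\mathcal M^0_{K,K',0}[r]\otimes\mathcal M_2(\mathbb C)$, and let $H$ and $M_{>N}$ be the data of a system $$\partial_tZ=J_c\nabla H(Z)+M_{>N}(U;t)U,\qquad Z=M_0(U;t)U,\tag{1}$$ Hamiltonian up to homogeneity $N$. Let $\Phi(Z)=B(Z;t)Z$, where $B$ is linearly symplectic up to homogeneity $N$ and * if $M_0=\mathrm{Id}$: $B-\mathrm{Id}\in\Sigma\mathcal S_{K,K',p}[r,N]\otimes\mathcal M_2(\mathbb C)$; * otherwise: $B-\mathrm{Id}\in\Sigma\mathcal S_{\kappa,0,p}[\breve r,N]\otimes\mathcal M_2(\mathbb C)$ for all $\breve r>0$ and all $0\le\kappa\le K$ (with the same homogeneous components). (In the second case, linear symplecticity of $B$ is meant in the class with indices $K,0,\breve r$, for every $\breve r>0$.) Then there is a real-to-real matrix of pluri-homogeneous operators $R_{\le N}=\sum_{q=p}^NR_q$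 such that $R_q\in\widetilde{\mathcal R}^{-\varrho}_q\otimes\mathcal M_2(\mathbb C)$ for every $\varrho>0$, and: 1. the map $$Z\mapsto Z_+=\big(\mathrm{Id}+R_{\le N}(\Phi(Z))\big)\Phi(Z)$$ is symplectic up to homogeneity $N$, in the class $K,K',r$ if $M_0=\mathrm{Id}$, and in the classes $\kappa,0,\breve r$ for all $\kappa\le K$, $\breve r>0$ otherwise; 2. there are data $H^+$, $M^+_{>N}$ of a system that is Hamiltonian up to homogeneity $N$ (with $H^+=\sum_{q=2}^{N+2}H^+_q$ and $M^+_{>N}$ in the class $\mathcal M_{K,K'+1,N+1}[r]\otimes\mathcal M_2(\mathbb C)$), and $s_0>0$, $r_0\in(0,r]$, such that for every $U\in B^K_{s_0}(I;r_0)$ for which $Z=M_0(U;t)U$ solves (1) on $I$, $Z_+$ solves $$\partial_tZ_+=J_c\nabla H^+(Z_+)+M^+_{>N}(U;t)U\quad\text{on } I.$$ -/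

import Mathlib

/-! Zero-mean periodic distributions are identified with their sequences of Fourier coefficients
`u j`, `j` a nonzero integer, normalised by `u = ∑ u j e^{ijx} / √(2π)`.
A `ℂ²`-valued one is a pair; the component `0` is `u⁺`, the component `1` is `u⁻`. -/

noncomputable section

namespace PluriHom

/-! ### Fourier coefficients, Sobolev spaces, spaces of paths -/

/-- Nonzero integer frequencies. -/
abbrev Freq : Type := {j : ℤ // j ≠ 0}

/-- The opposite frequency. -/
def Freq.opp (j : Freq) : Freq := ⟨-j.1, neg_ne_zero.2 j.2⟩

/-- Scalar objects: Fourier coefficients. -/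
abbrev Coef : Type := Freq → ℂ

/-- `ℂ²`-valued objects. -/
abbrev Vec : Type := Fin 2 → Coef

/-- Scalar trigonometric polynomials with zero mean. -/
abbrev TP : Type := Freq →₀ ℂ

/-- `ℂ²`-valued trigonometric polynomials with zero mean. -/
abbrev VTP : Type := Fin 2 → TP

/-- A trigonometric polynomial as a sequence of coefficients. -/
def VTP.toVec (U : VTP) : Vec := fun σ j => U σ j

/-- Coefficients of the complex conjugate function. -/
def conjC (u : Coef) : Coef := fun j => (starRingEnd ℂ) (u j.opp)

/-- `U = (u, ū)`. -/
def IsRealVec (U : Vec) : Prop := U 1 = conjC (U 0)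

/-- Membership in the homogeneous Sobolev space of order `s`. -/
def InH (s : ℝ) (u : Coef) : Prop :=
  Summable fun j : Freq => |(j.1 : ℝ)| ^ (2 * s) * ‖u j‖ ^ 2

/-- The homogeneous Sobolev norm of order `s` (for `s = 0` the `L²` norm). -/
def hnorm (s : ℝ) (u : Coef) : ℝ :=
  Real.sqrt (∑' j : Freq, |(j.1 : ℝ)| ^ (2 * s) * ‖u j‖ ^ 2)

def InHV (s : ℝ) (U : Vec) : Prop := ∀ σ, InH s (U σ)

def hnormV (s : ℝ) (U : Vec) : ℝ := Real.sqrt (∑ σ, hnorm s (U σ) ^ 2)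

/-- The path `u` is of class `C^k` on `I` with values in the Sobolev space of order `a`, which is
isometric to `ℓ²` through `u ↦ (|j|^a u j)`. -/
def InCk (I : Set ℝ) (k : ℕ) (a : ℝ) (u : ℝ → Coef) : Prop :=
  ∃ f : ℝ → lp (fun _ : Freq => ℂ) 2, ContDiffOn ℝ k f I ∧
    ∀ t ∈ I, ∀ j : Freq, f t j = ((|(j.1 : ℝ)| ^ a : ℝ) : ℂ) * u t j

/-- The intersection, over `k ≤ K`, of the spaces of `C^k` paths in the Sobolev space of order
`s - 3k/2`. -/
def InCStar (I : Set ℝ) (K : ℕ) (s : ℝ) (u : ℝ → Coef) : Prop :=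
  ∀ k ≤ K, InCk I k (s - 3 / 2 * (k : ℝ)) u

def InCStarV (I : Set ℝ) (K : ℕ) (s : ℝ) (U : ℝ → Vec) : Prop :=
  ∀ σ, InCStar I K s fun t => U t σ

/-- The `k`-th time derivative, on the interval `I`. -/
def dt (I : Set ℝ) (k : ℕ) (u : ℝ → Coef) (t : ℝ) : Coef :=
  fun j => iteratedDerivWithin k (fun τ => u τ j) I t

/-- The norm `‖u(t)‖_{K,s} = ∑_{k ≤ K} ‖∂_t^k u(t)‖_{s - 3k/2}`. -/
def normK (I : Set ℝ) (K : ℕ) (s : ℝ) (u : ℝ → Coef) (t : ℝ) : ℝ :=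
  ∑ k ∈ Finset.range (K + 1), hnorm (s - 3 / 2 * (k : ℝ)) (dt I k u t)

def normKV (I : Set ℝ) (K : ℕ) (s : ℝ) (U : ℝ → Vec) (t : ℝ) : ℝ :=
  ∑ k ∈ Finset.range (K + 1),
    hnormV (s - 3 / 2 * (k : ℝ)) fun σ => dt I k (fun τ => U τ σ) t

/-- The open ball of radius `r`, for the norm `sup_t ‖U(t)‖_{K,s}`. -/
def InBall (I : Set ℝ) (K : ℕ) (s r : ℝ) (U : ℝ → Vec) : Prop :=
  InCStarV I K s U ∧ ∃ ρ < r, ∀ t ∈ I, normKV I K s U t ≤ ρ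

/-! ### Bilinear form, symplectic form, translations, spectral projectors -/

/-- `⟨V, W⟩_r = ∫ V⁺ W⁺ + ∫ V⁻ W⁻` (no conjugation), written in Fourier coefficients. -/
def pair (V W : Vec) : ℂ := ∑ σ, ∑' j : Freq, V σ j * W σ j.opp

/-- `E_c = J_c = [[0, -i], [i, 0]]`. -/
def Ec (V : Vec) : Vec := ![fun j => -Complex.I * V 1 j, fun j => Complex.I * V 0 j]

/-- `Ω_c(V, W) = ⟨E_c V, W⟩_r`. -/
def Omega (V W : Vec) : ℂ := pair (Ec V) W

/-- The finitely many frequencies `j` with `|j| ≤ n`. -/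
def modes (n : ℕ) : Finset Freq :=
  (Finset.Icc (-(n : ℤ)) (n : ℤ)).subtype fun j => j ≠ 0

/-- The projector `Π_n` on the frequencies `±n`. -/
def proj (n : ℕ) (u : Coef) : TP :=
  Finsupp.onFinset (modes n) (fun j => if j.1.natAbs = n then u j else 0) (by
    intro j hj
    have h : j.1.natAbs = n := by
      by_contra h
      exact hj (if_neg h)
    simp only [modes, Finset.mem_subtype, Finset.mem_Icc]
    omega)

def projV (n : ℕ) (U : Vec) : VTP := fun σ => proj n (U σ)

/-- The translation `u(x) ↦ u(x + a)`. -/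
def trans (a : ℝ) (u : TP) : TP :=
  Finsupp.onFinset u.support
    (fun j => Complex.exp (Complex.I * ((j.1 : ℂ) * (a : ℂ))) * u j) (by
    intro j hj
    rw [Finsupp.mem_support_iff]
    intro h
    exact hj (by simp [h]))

def transV (a : ℝ) (U : VTP) : VTP := fun σ => trans a (U σ)

/-- The largest and the second largest entry of a tuple. -/
def maxOf {q : ℕ} (n : Fin q → ℕ) : ℕ := Finset.univ.sup n

def max2Of {q : ℕ} (n : Fin q → ℕ) : ℕ :=
  (Finset.univ : Finset (Fin q)).offDiag.sup fun ij => min (n ij.1) (n ij.2)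

/-! ### Homogeneous operators -/

/-- The `(p+1)`-linear operators `M(U_1, …, U_p) U_{p+1}`. An `m`-operator (see below) is determined
by its values on trigonometric polynomials, which the estimates control; on less regular functions
it acts through the series `HomOp.eval`. -/
abbrev HomOp (p : ℕ) : Type :=
  MultilinearMap ℂ (fun _ : Fin p => VTP) (TP →ₗ[ℂ] TP)

/-- `M(U_1, …, U_p) V = ∑_n M(Π_{n_1} U_1, …, Π_{n_p} U_p) Π_{n_{p+1}} V`. -/
def HomOp.eval {p : ℕ} (M : HomOp p) (U : Fin p → Vec) (V : Coef) : Coef :=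
  fun k => ∑' n : Fin (p + 1) → ℕ,
    M (fun i => projV (n i.castSucc) (U i)) (proj (n (Fin.last p)) V) k

/-- `p`-homogeneous `m`-operators (for `m = -ϱ ≤ 0`: smoothing operators). -/
structure IsHomM {p : ℕ} (m : ℝ) (M : HomOp p) : Prop where
  symm : ∀ (π : Equiv.Perm (Fin p)) (U : Fin p → VTP), M (fun i => U (π i)) = M U
  bound : ∃ μ ≥ (0 : ℝ), ∃ C > (0 : ℝ), ∀ (U : Fin p → Vec) (V : Coef) (n : Fin (p + 1) → ℕ)
    (n₀ : ℕ),
    hnorm 0 (proj n₀ (M (fun i => projV (n i.castSucc) (U i)) (proj (n (Fin.last p)) V)))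
      ≤ C * (max2Of n : ℝ) ^ μ * (maxOf n : ℝ) ^ m
        * (∏ i : Fin p, hnormV 0 (projV (n i.castSucc) (U i)).toVec)
        * hnorm 0 (proj (n (Fin.last p)) V)
  momentum : ∀ (U : Fin p → Vec) (V : Coef) (n : Fin (p + 1) → ℕ) (n₀ : ℕ),
    proj n₀ (M (fun i => projV (n i.castSucc) (U i)) (proj (n (Fin.last p)) V)) ≠ 0 →
    ∃ (ε₀ : ℤˣ) (ε : Fin (p + 1) → ℤˣ), (ε₀ : ℤ) * n₀ + ∑ i, (ε i : ℤ) * n i = 0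
  translation : ∀ (a : ℝ) (U : Fin p → VTP) (V : TP),
    M (fun i => transV a (U i)) (trans a V) = trans a (M U V)

/-- Spectrally localized `p`-homogeneous maps of order `m`. -/
structure IsHomS {p : ℕ} (m : ℝ) (S : HomOp p) : Prop extends IsHomM m S where
  spectral : ∃ δ > (0 : ℝ), ∃ C > (1 : ℝ), ∀ (U : Fin p → Vec) (V : Coef)
    (n : Fin (p + 1) → ℕ) (n₀ : ℕ),
    proj n₀ (S (fun i => projV (n i.castSucc) (U i)) (proj (n (Fin.last p)) V)) ≠ 0 →
    (∀ i : Fin p, (n i.castSucc : ℝ) ≤ δ * n (Fin.last p)) ∧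
      C⁻¹ * (n₀ : ℝ) ≤ n (Fin.last p) ∧ (n (Fin.last p) : ℝ) ≤ C * n₀

/-- `2 × 2` matrices of `p`-homogeneous operators. -/
abbrev HomMat (p : ℕ) : Type := Fin 2 → Fin 2 → HomOp p

/-- `M(U) V = M(U, …, U) V` for a matrix `M`, on trigonometric polynomials. -/
def HomMat.app {p : ℕ} (M : HomMat p) (U : Fin p → VTP) (V : VTP) : VTP :=
  fun σ => ∑ σ', M σ σ' U (V σ')

/-- `M(U) V = M(U, …, U) V` for a matrix `M`. -/
def HomMat.eval {p : ℕ} (M : HomMat p) (U V : Vec) : Vec :=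
  fun σ => ∑ σ', (M σ σ').eval (fun _ => U) (V σ')

/-- The differential at `U`, in the direction `V`, of the polynomial map `U ↦ M(U) U`. -/
def HomMat.dApp {p : ℕ} (M : HomMat p) (U V : VTP) : VTP :=
  M.app (fun _ => U) V + ∑ i : Fin p, M.app (Function.update (fun _ => U) i V) U

/-- A matrix of operators has the form `[[R₁, R₂], [R̄₂, R̄₁]]`, where `R̄ v` is the conjugate of
`R v̄`. -/
def HasRealForm (A : Fin 2 → Fin 2 → Coef → Coef) : Prop :=
  ∀ v : Coef, (∀ s, InH s v) →
    A 1 1 v = conjC (A 0 0 (conjC v)) ∧ A 1 0 v = conjC (A 0 1 (conjC v))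

/-- Real-to-real matrices of homogeneous operators. -/
def HomMat.IsRealToReal {p : ℕ} (M : HomMat p) : Prop :=
  ∀ U : Vec, (∀ s, InHV s U) → IsRealVec U →
    HasRealForm fun σ σ' => (M σ σ').eval fun _ => U

/-! ### Homogeneous forms and Hamiltonians -/

/-- `k`-forms `Λ(U_1, …, U_r)[V_1, …, V_k]`, on trigonometric polynomials. -/
abbrev KForm (r k : ℕ) : Type :=
  MultilinearMap ℂ (fun _ : Fin r => VTP) (VTP [⋀^Fin k]→ₗ[ℂ] ℂ)

/-- `r`-homogeneous `k`-forms. -/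
structure IsForm {r k : ℕ} (Λ : KForm r k) : Prop where
  symm : ∀ (π : Equiv.Perm (Fin r)) (U : Fin r → VTP), Λ (fun i => U (π i)) = Λ U
  bound : ∃ m ≥ (0 : ℝ), ∃ C > (0 : ℝ), ∀ (U : Fin r → Vec) (V : Fin k → Vec)
    (n : Fin r → ℕ) (l : Fin k → ℕ),
    ‖Λ (fun i => projV (n i) (U i)) (fun i => projV (l i) (V i))‖
      ≤ C * (max (maxOf n) (maxOf l) : ℕ) ^ m
        * (∏ i, hnormV 0 (projV (n i) (U i)).toVec) * ∏ i, hnormV 0 (projV (l i) (V i)).toVec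
  momentum : ∀ (U : Fin r → Vec) (V : Fin k → Vec) (n : Fin r → ℕ) (l : Fin k → ℕ),
    Λ (fun i => projV (n i) (U i)) (fun i => projV (l i) (V i)) ≠ 0 →
    ∃ (ε : Fin r → ℤˣ) (η : Fin k → ℤˣ), ∑ i, (ε i : ℤ) * n i + ∑ i, (η i : ℤ) * l i = 0
  translation : ∀ (a : ℝ) (U : Fin r → VTP) (V : Fin k → VTP),
    Λ (fun i => transV a (U i)) (fun i => transV a (V i)) = Λ U V
  real : ∀ (U : Fin r → VTP) (V : Fin k → VTP), (∀ i, IsRealVec (U i).toVec) →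
    (∀ i, IsRealVec (V i).toVec) → (Λ U V).im = 0

/-- The value of a `0`-form on functions that need not be trigonometric polynomials. -/
def KForm.eval {q : ℕ} (H : KForm q 0) (W : Fin q → Vec) : ℂ :=
  ∑' n : Fin q → ℕ, H (fun i => projV (n i) (W i)) ![]

/-- The exponential of frequency `j` in the component `σ`. -/
def mode (σ : Fin 2) (j : Freq) : Vec := fun σ' j' => if σ' = σ ∧ j' = j then 1 else 0

/-- The gradient of the polynomial `H(U) = H(U, …, U)`, i.e. `dH(U)[V] = ⟨∇H(U), V⟩_r`: its
coefficient of index `(σ, j)` is `dH(U)[mode σ (-j)]`. -/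
def KForm.grad {q : ℕ} (H : KForm q 0) (U : Vec) : Vec :=
  fun σ j => ∑ i : Fin q, H.eval (Function.update (fun _ => U) i (mode σ j.opp))

/-- `J_c ∇H(U)` for the pluri-homogeneous Hamiltonian `H = H_2 + ⋯ + H_{N+2}`. -/
def hamField (N : ℕ) (H : ∀ q, KForm q 0) (U : Vec) : Vec :=
  Ec (∑ q ∈ Finset.Icc 2 (N + 2), (H q).grad U)

/-! ### Non-homogeneous operators -/

/-- Operators `(U, t, V) ↦ M(U; t) V`, linear in `V`; `U` is a path. Nothing is required of
`M(U; t) V` for `U`, `V` outside the domains in the classes below. -/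
abbrev NHOp : Type := (ℝ → Vec) → ℝ → Coef →ₗ[ℂ] Coef

/-- Non-homogeneous `m`-operators, vanishing at degree at least `p` in `U`, `K - K'` times
differentiable in time. -/
def IsM (I : Set ℝ) (K K' : ℕ) (m : ℝ) (p : ℕ) (r : ℝ) (M : NHOp) : Prop :=
  ∃ s₀ > (0 : ℝ), ∀ s ≥ s₀, ∃ C > (0 : ℝ), ∃ rs > (0 : ℝ), rs < r ∧
    ∀ U, InBall I K s₀ rs U → InCStarV I K s U → ∀ V, InCStar I (K - K') s V →
      InCStar I (K - K') (s - m) (fun t => M U t (V t)) ∧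
      ∀ k ≤ K - K', ∀ t ∈ I,
        hnorm (s - 3 / 2 * (k : ℝ) - m) (dt I k (fun τ => M U τ (V τ)) t) ≤ C *
          if p = 0 then normK I k s V t else
            ∑ k' ∈ Finset.range (k + 1),
              (normK I (k - k') s V t * normKV I (k' + K') s₀ U t ^ p +
                normK I (k - k') s₀ V t * normKV I (k' + K') s₀ U t ^ (p - 1)
                  * normKV I (k' + K') s U t)

/-- Non-homogeneous spectrally localized maps of order `m`. -/
def IsS (I : Set ℝ) (K K' : ℕ) (m : ℝ) (p : ℕ) (r : ℝ) (S : NHOp) : Prop :=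
  ∃ s₀ > (0 : ℝ), ∀ s : ℝ, ∃ C > (0 : ℝ), ∃ rs > (0 : ℝ), rs < r ∧
    ∀ U, InBall I K s₀ rs U → InCStarV I K s U → ∀ V, InCStar I (K - K') s V →
      InCStar I (K - K') (s - m) (fun t => S U t (V t)) ∧
      ∀ k ≤ K - K', ∀ t ∈ I,
        hnorm (s - 3 / 2 * (k : ℝ) - m) (dt I k (fun τ => S U τ (V τ)) t) ≤ C *
          if p = 0 then normK I k s V t else
            ∑ k' ∈ Finset.range (k + 1),
              normKV I (k' + K') s₀ U t ^ p * normK I (k - k') s V t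

/-- `2 × 2` matrices of non-homogeneous operators. -/
abbrev NHMat : Type := Fin 2 → Fin 2 → NHOp

def NHMat.app (M : NHMat) (U : ℝ → Vec) (t : ℝ) (V : Vec) : Vec :=
  fun σ => ∑ σ', M σ σ' U t (V σ')

/-- The matrix is the identity, on the domain of the operators of the class `[r]`. -/
def NHMat.IsId (I : Set ℝ) (K' : ℕ) (r : ℝ) (M : NHMat) : Prop :=
  ∃ s₀ > (0 : ℝ), ∀ U, InBall I K' s₀ r U → ∀ t ∈ I, ∀ V, InHV s₀ V → M.app U t V = V

/-- `M(U; t) - Id = ∑_{q=p}^N M_q(U, …, U) + M_{>N}(U; t)`, for `U` in a small ball. -/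
def HasExpansion (I : Set ℝ) (K p N : ℕ) (r : ℝ) (M : (ℝ → Vec) → ℝ → Vec → Vec)
    (Mq : ∀ q, HomMat q) (Mgt : NHMat) : Prop :=
  ∃ s₀ > (0 : ℝ), ∃ r' > (0 : ℝ), r' ≤ r ∧ ∀ U, InBall I K s₀ r' U → ∀ t ∈ I, ∀ V, InHV s₀ V →
    M U t V = V + ∑ q ∈ Finset.Icc p N, (Mq q).eval (U t) V + Mgt.app U t V

/-- `M - Id` is a matrix of `m`-operators for some `m ≥ 0`, with homogeneous components `M_q`,
`p ≤ q ≤ N`. -/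
def IdPlusSigmaM (I : Set ℝ) (K K' p N : ℕ) (r : ℝ) (M : (ℝ → Vec) → ℝ → Vec → Vec)
    (Mq : ∀ q, HomMat q) : Prop :=
  ∃ m ≥ (0 : ℝ), (∀ q ∈ Finset.Icc p N, ∀ σ σ', IsHomM m (Mq q σ σ')) ∧
    ∃ Mgt : NHMat, (∀ σ σ', IsM I K K' m (N + 1) r (Mgt σ σ')) ∧ HasExpansion I K p N r M Mq Mgt

/-- `M - Id` is a matrix of spectrally localized maps of some order `m ≥ 0`, with homogeneous
components `M_q`, `p ≤ q ≤ N`. -/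
def IdPlusSigmaS (I : Set ℝ) (K K' p N : ℕ) (r : ℝ) (M : (ℝ → Vec) → ℝ → Vec → Vec)
    (Mq : ∀ q, HomMat q) : Prop :=
  ∃ m ≥ (0 : ℝ), (∀ q ∈ Finset.Icc p N, ∀ σ σ', IsHomS m (Mq q σ σ')) ∧
    ∃ Mgt : NHMat, (∀ σ σ', IsS I K K' m (N + 1) r (Mgt σ σ')) ∧ HasExpansion I K p N r M Mq Mgt

/-! ### Symplectic maps and Hamiltonian systems up to homogeneity `N` -/

/-- `B` is real-to-real and linearly symplectic up to homogeneity `N`: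
`B(U;t)ᵀ E_c B(U;t) = E_c + S_{>N}(U;t)`, tested against smooth functions. -/
def IsLinSymplecticUpTo (I : Set ℝ) (K K' N : ℕ) (r : ℝ) (B : NHMat) : Prop :=
  ∃ m : ℝ, ∃ S : NHMat, (∀ σ σ', IsS I K K' m (N + 1) r (S σ σ')) ∧
    ∃ s₀ > (0 : ℝ), ∃ r' > (0 : ℝ), r' ≤ r ∧ ∀ U, InBall I K s₀ r' U →
      ((∀ t ∈ I, IsRealVec (U t)) → ∀ t ∈ I, HasRealForm fun σ σ' => B σ σ' U t) ∧
      ∀ t ∈ I, ∀ V W : Vec, (∀ s, InHV s V) → (∀ s, InHV s W) →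
        Omega (B.app U t V) (B.app U t W) = Omega V W + pair (S.app U t V) W

/-- The differential at `U`, in the direction `V`, of `D_{≤N}(U) = U + ∑_{q=p}^N M_q(U) U`. -/
def dPluri (p N : ℕ) (Mq : ∀ q, HomMat q) (U V : VTP) : VTP :=
  V + ∑ q ∈ Finset.Icc p N, (Mq q).dApp U V

/-- The map `D(Z;t) = M(Z;t) Z` is symplectic up to homogeneity `N`: `M - Id` is a matrix of
`m`-operators and the pluri-homogeneous component `D_{≤N}` satisfies
`(D_{≤N})^* Ω_c = Ω_c + Ω_{>N}` with `Ω_{>N}` a pluri-homogeneous `2`-form of degrees `> N`. -/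
def IsSymplecticUpTo (I : Set ℝ) (K K' p N : ℕ) (r : ℝ) (M : (ℝ → Vec) → ℝ → Vec → Vec) : Prop :=
  ∃ Mq : ∀ q, HomMat q, IdPlusSigmaM I K K' p N r M Mq ∧
    ∃ (L : ℕ) (Λ : ∀ q, KForm q 2), (∀ q ∈ Finset.Icc (N + 1) L, IsForm (Λ q)) ∧
      ∀ U V W : VTP,
        Omega (dPluri p N Mq U V).toVec (dPluri p N Mq U W).toVec =
          Omega V.toVec W.toVec + ∑ q ∈ Finset.Icc (N + 1) L, Λ q (fun _ => U) ![V, W]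

/-- The data of a system `∂_t Z = J_c ∇H(Z) + M_{>N}(U;t) U` that is Hamiltonian up to
homogeneity `N`. -/
structure IsHamDataUpTo (I : Set ℝ) (K K' N : ℕ) (r : ℝ) (H : ∀ q, KForm q 0) (Mgt : NHMat) :
    Prop where
  ham : ∀ q ∈ Finset.Icc 2 (N + 2), IsForm (H q)
  rem : ∃ m ≥ (0 : ℝ), ∀ σ σ', IsM I K (K' + 1) m (N + 1) r (Mgt σ σ')

/-- `Z` solves `∂_t Z = J_c ∇H(Z) + M_{>N}(U;t) U` on `I`. -/
def Solves (I : Set ℝ) (N : ℕ) (H : ∀ q, KForm q 0) (Mgt : NHMat) (U Z : ℝ → Vec) : Prop :=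
  ∀ t ∈ I, ∀ σ j, HasDerivWithinAt (fun τ => Z τ σ j)
    (hamField N H (Z t) σ j + Mgt.app U t (U t) σ j) I t

/-- `U ↦ M(U;t) U`, as a path. -/
def pathOf (M : (ℝ → Vec) → ℝ → Vec → Vec) (U : ℝ → Vec) : ℝ → Vec := fun t => M U t (U t)

/-- `(Id + R_{≤N}(Φ(Z))) B(Z;t)` with `Φ(Z) = B(Z;t) Z` and `R_{≤N} = ∑_{q=p}^N R_q`. -/
def corrected (p N : ℕ) (R : ∀ q, HomMat q) (B : NHMat) (Z : ℝ → Vec) (t : ℝ) (V : Vec) : Vec :=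
  B.app Z t V + ∑ q ∈ Finset.Icc p N, (R q).eval (B.app Z t (Z t)) (B.app Z t V)

end PluriHom

end

open PluriHom

noncomputable section

namespace PluriHom

set_option linter.unusedSectionVars false

open Filter Topology
open Finset (abs_sum_le_sum_abs card_erase_of_mem sum_le_card_nsmul prod_mul_distrib
  sum_erase_eq_sub sum_add_distrib sum_sub_distrib sum_range_succ' ne_of_mem_erase prod_const_one
  mul_prod_erase sum_range_succ sum_eq_single add_sum_erase single_le_sum sum_range_one induction_on
  prod_eq_zero prod_nonneg sum_eq_zero prod_le_one sum_le_sum sum_subset sum_insert range_mono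
  prod_const sum_filter sum_nonneg prod_congr card_range mem_filter sum_congr card_univ sum_const
  mem_erase mem_range sum_sdiff mem_univ smul_sum sum_comm prod_pos prod_pow mul_sum sum_mul mem_Icc
  le_sup range univ Ico Icc)
open Function (update_eq_self update_of_ne update_self update_comm update)
open Fin (castSucc_lt_last snoc_castSucc sum_univ_two lastCases snoc_last last snoc init)

/-- Multilinear maps on pairs of trigonometric polynomials. -/
notation "ML(" α ", " Y ")" => MultilinearMap ℂ (fun _ : α => VTP) Y

section

/-! ### Additivity in each slot -/

theorem closure_slots {α : Type*} [Fintype α] [DecidableEq α] {M : α → Type*}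
    [∀ a, AddCommMonoid (M a)] {N : Type*} [AddCommMonoid N] (Ψ : (∀ a, M a) → N)
    (hadd : ∀ x a u v, Ψ (update x a (u + v)) = Ψ (update x a u) + Ψ (update x a v))
    (hzero : ∀ x a, Ψ (update x a 0) = 0)
    (S : ∀ a, Set (M a)) (p : AddSubmonoid N) (h : ∀ x, (∀ a, x a ∈ S a) → Ψ x ∈ p)
    (x : ∀ a, M a) (hx : ∀ a, x a ∈ AddSubmonoid.closure (S a)) : Ψ x ∈ p := by
  suffices H : ∀ T : Finset α, ∀ x : ∀ a, M a, (∀ a ∈ T, x a ∈ AddSubmonoid.closure (S a)) →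
      (∀ a ∉ T, x a ∈ S a) → Ψ x ∈ p by
    exact H univ x (fun a _ => hx a) (fun a ha => absurd (mem_univ a) ha)
  intro T
  induction T using induction_on with
  | empty => exact fun x _ h2 => h x fun a => h2 a (Finset.notMem_empty a)
  | insert b T hb ih =>
    intro x h1 h2
    have key : ∀ y ∈ AddSubmonoid.closure (S b), Ψ (update x b y) ∈ p := by
      intro y hy
      induction hy using AddSubmonoid.closure_induction with
      | mem y hy =>
        refine ih _ (fun a ha => ?_) (fun a ha => ?_)
        · rw [update_of_ne (by rintro rfl; exact hb ha)]
          exact h1 a (Finset.mem_insert_of_mem ha)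
        · by_cases hab : a = b
          · subst hab; simpa using hy
          · rw [update_of_ne hab]
            exact h2 a (by simp [hab, ha])
      | zero => rw [hzero]; exact p.zero_mem
      | add u v _ _ hu hv => rw [hadd]; exact p.add_mem hu hv
    have := key (x b) (h1 b (Finset.mem_insert_self _ _))
    rwa [update_eq_self] at this

theorem multilinear_closure_mem {α : Type*} [Fintype α] {M : α → Type*}
    [∀ a, AddCommGroup (M a)] [∀ a, Module ℂ (M a)] {N : Type*} [AddCommGroup N] [Module ℂ N]
    (A : MultilinearMap ℂ M N) (S : ∀ a, Set (M a)) (p : AddSubmonoid N)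
    (h : ∀ x, (∀ a, x a ∈ S a) → A x ∈ p) (x : ∀ a, M a)
    (hx : ∀ a, x a ∈ AddSubmonoid.closure (S a)) : A x ∈ p := by
  classical
  exact closure_slots A (fun x a u v => A.map_update_add x a u v)
    (fun x a => A.map_update_zero x a) S p h x hx

/-! ### Modes -/

abbrev Idx : Type := Σ _ : Fin 2, Freq

def Freq.wt (j : Freq) : ℕ := j.1.natAbs

theorem Freq.one_le_wt (j : Freq) : 1 ≤ j.wt := by
  have := j.2; unfold Freq.wt; omega

@[simp] theorem Freq.opp_opp (j : Freq) : j.opp.opp = j := by simp [Freq.opp]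

def Freq.oppEquiv : Freq ≃ Freq := ⟨Freq.opp, Freq.opp, Freq.opp_opp, Freq.opp_opp⟩

def Idx.conj (i : Idx) : Idx := ⟨i.1.rev, i.2.opp⟩

@[simp] theorem Idx.conj_conj (i : Idx) : i.conj.conj = i := by
  cases i; simp [Idx.conj]

def bas : Module.Basis Idx ℂ VTP := Pi.basis fun _ => Finsupp.basisSingleOne

@[simp] theorem bas_repr (U : VTP) (i : Idx) : bas.repr U i = U i.1 i.2 := by
  simp [bas, Pi.basis_repr]

theorem bas_apply (i : Idx) : bas i = Pi.single i.1 (Finsupp.single i.2 1) := by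
  simp [bas, Pi.basis_apply]

theorem bas_apply_apply (i : Idx) (σ : Fin 2) (j : Freq) :
    bas i σ j = if i.1 = σ ∧ i.2 = j then 1 else 0 := by
  have := bas_repr (bas i) ⟨σ, j⟩
  rw [Module.Basis.repr_self, Finsupp.single_apply] at this
  rw [← this]
  obtain ⟨a, b⟩ := i
  congr 1
  simp

theorem vtp_ext {U V : VTP} (h : ∀ i : Idx, U i.1 i.2 = V i.1 i.2) : U = V := by
  funext σ; ext j; exact h ⟨σ, j⟩

theorem sum_bas (U : VTP) : ∑ i ∈ (bas.repr U).support, U i.1 i.2 • bas i = U := by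
  conv_rhs => rw [← bas.linearCombination_repr U]
  simp [Finsupp.linearCombination_apply, Finsupp.sum]

/-! ### Scales -/

class Scale (Y : Type) [AddCommGroup Y] [Module ℂ Y] where
  nrmS : ℕ → Seminorm ℂ Y
  trL : ℝ → Y →ₗ[ℂ] Y
  cjL : Y →ₛₗ[starRingEnd ℂ] Y
  cj_cj' : ∀ y, cjL (cjL y) = y

section ops

variable {Y : Type} [AddCommGroup Y] [Module ℂ Y] [Scale Y]

def nrm (s : ℕ) (y : Y) : ℝ := Scale.nrmS s y
def tr (x : ℝ) (y : Y) : Y := Scale.trL x y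
def cj (y : Y) : Y := Scale.cjL y

@[simp] theorem cj_cj (y : Y) : cj (cj y) = y := Scale.cj_cj' y
@[simp] theorem cj_add (y z : Y) : cj (y + z) = cj y + cj z := map_add _ _ _
@[simp] theorem cj_sub (y z : Y) : cj (y - z) = cj y - cj z := map_sub _ _ _
@[simp] theorem cj_zero : cj (0 : Y) = 0 := map_zero _
@[simp] theorem cj_smul (c : ℂ) (y : Y) : cj (c • y) = (starRingEnd ℂ) c • cj y :=
  LinearMap.map_smulₛₗ _ _ _
@[simp] theorem tr_add (x : ℝ) (y z : Y) : tr x (y + z) = tr x y + tr x z := map_add _ _ _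
@[simp] theorem tr_zero (x : ℝ) : tr x (0 : Y) = 0 := map_zero _
@[simp] theorem tr_smul (x : ℝ) (c : ℂ) (y : Y) : tr x (c • y) = c • tr x y := map_smul _ _ _
@[simp] theorem nrm_zero (s : ℕ) : nrm s (0 : Y) = 0 := map_zero _
theorem nrm_nonneg (s : ℕ) (y : Y) : 0 ≤ nrm s y := apply_nonneg _ _
theorem nrm_add_le (s : ℕ) (y z : Y) : nrm s (y + z) ≤ nrm s y + nrm s z := map_add_le_add _ _ _
theorem nrm_smul (s : ℕ) (c : ℂ) (y : Y) : nrm s (c • y) = ‖c‖ * nrm s y := map_smul_eq_mul _ _ _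
theorem nrm_sum_le {ι : Type*} (s : ℕ) (F : Finset ι) (f : ι → Y) :
    nrm s (∑ i ∈ F, f i) ≤ ∑ i ∈ F, nrm s (f i) :=
  Finset.le_sum_of_subadditive _ (nrm_zero s).le (nrm_add_le s) _ _

end ops

instance : Scale ℂ where
  nrmS _ := normSeminorm ℂ ℂ
  trL _ := LinearMap.id
  cjL := { toFun := starRingEnd ℂ, map_add' := map_add _, map_smul' := by intro a b; simp }
  cj_cj' := by intro y; simp

@[simp] theorem nrm_complex (s : ℕ) (y : ℂ) : nrm s y = ‖y‖ := rfl
@[simp] theorem tr_complex (x : ℝ) (y : ℂ) : tr x y = y := rfl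
@[simp] theorem cj_complex (y : ℂ) : cj y = (starRingEnd ℂ) y := rfl

def wsn (s : ℕ) : Seminorm ℂ (Idx →₀ ℂ) :=
  Seminorm.of (fun u => u.sum fun i c => (i.2.wt : ℝ) ^ s * ‖c‖) (by
      intro u v
      classical
      rw [Finsupp.sum_of_support_subset (s := u.support ∪ v.support) (u + v) Finsupp.support_add _
          (by simp),
        Finsupp.sum_of_support_subset (s := u.support ∪ v.support) u
          Finset.subset_union_left _ (by simp),
        Finsupp.sum_of_support_subset (s := u.support ∪ v.support) v
          Finset.subset_union_right _ (by simp), ← sum_add_distrib]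
      refine sum_le_sum fun i _ => ?_
      rw [← mul_add, Finsupp.add_apply]
      exact mul_le_mul_of_nonneg_left (norm_add_le _ _) (by positivity))
    (by
      intro c u
      rw [Finsupp.sum_of_support_subset (s := u.support) (c • u) Finsupp.support_smul _ (by simp),
        Finsupp.sum, mul_sum]
      refine sum_congr rfl fun i _ => ?_
      rw [Finsupp.smul_apply, norm_smul]; ring)

def cjT (u : TP) : TP := (u.equivMapDomain Freq.oppEquiv).mapRange (starRingEnd ℂ) (map_zero _)

@[simp] theorem cjT_apply (u : TP) (j : Freq) : cjT u j = (starRingEnd ℂ) (u j.opp) := by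
  simp [cjT, Freq.oppEquiv]

@[simp] theorem trans_apply (a : ℝ) (u : TP) (j : Freq) :
    trans a u j = Complex.exp (Complex.I * ((j.1 : ℂ) * (a : ℂ))) * u j := rfl

instance : Scale VTP where
  nrmS s := (wsn s).comp bas.repr.toLinearMap
  trL x :=
    { toFun := transV x
      map_add' := fun U V => by
        refine vtp_ext fun i => ?_
        simp [transV, mul_add]
      map_smul' := fun c U => by
        refine vtp_ext fun i => ?_
        simp [transV]; ring }
  cjL :=
    { toFun := fun U σ => cjT (U σ.rev)
      map_add' := fun U V => by
        refine vtp_ext fun i => ?_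
        simp
      map_smul' := fun c U => by
        refine vtp_ext fun i => ?_
        simp }
  cj_cj' U := by
    refine vtp_ext fun i => ?_
    simp

theorem nrm_vtp (s : ℕ) (U : VTP) :
    nrm s U = ∑ i ∈ (bas.repr U).support, (i.2.wt : ℝ) ^ s * ‖U i.1 i.2‖ := by
  change (bas.repr U).sum (fun i c => (i.2.wt : ℝ) ^ s * ‖c‖) = _
  simp [Finsupp.sum]

theorem nrm_vtp_of_subset (s : ℕ) (U : VTP) (F : Finset Idx)
    (hF : ∀ i : Idx, U i.1 i.2 ≠ 0 → i ∈ F) :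
    nrm s U = ∑ i ∈ F, (i.2.wt : ℝ) ^ s * ‖U i.1 i.2‖ := by
  rw [nrm_vtp]
  refine sum_subset (fun i hi => hF i (by simpa using hi)) fun i _ hi => ?_
  have : U i.1 i.2 = 0 := by simpa using hi
  simp [this]

theorem tr_vtp (x : ℝ) (U : VTP) : tr x U = transV x U := rfl
theorem cj_vtp (U : VTP) (σ : Fin 2) : (cj U : VTP) σ = cjT (U σ.rev) := rfl

@[simp] theorem nrm_bas (s : ℕ) (i : Idx) : nrm s (bas i) = (i.2.wt : ℝ) ^ s := by
  change (bas.repr (bas i)).sum (fun i c => (i.2.wt : ℝ) ^ s * ‖c‖) = _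
  rw [Module.Basis.repr_self, Finsupp.sum_single_index] <;> simp

def Idx.ph (x : ℝ) (i : Idx) : ℂ := Complex.exp (Complex.I * ((i.2.1 : ℂ) * (x : ℂ)))

theorem tr_bas (x : ℝ) (i : Idx) : tr x (bas i) = i.ph x • bas i := by
  refine vtp_ext fun k => ?_
  simp only [tr_vtp, transV, trans_apply, Pi.smul_apply, Finsupp.smul_apply, smul_eq_mul,
    bas_apply_apply, Idx.ph]
  split_ifs with h
  · rw [h.2]
  · simp

theorem cj_bas (i : Idx) : cj (bas i) = bas i.conj := by
  refine vtp_ext fun k => ?_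
  obtain ⟨a, b⟩ := i
  obtain ⟨c, d⟩ := k
  simp only [cj_vtp, cjT_apply, bas_apply_apply, Idx.conj]
  have h1 : (a = c.rev) ↔ (a.rev = c) := by rw [Fin.rev_eq_iff]
  have h2 : (b = d.opp) ↔ (b.opp = d) := by
    constructor
    · rintro rfl; simp
    · rintro rfl; simp
  simp only [h1, h2]
  split_ifs <;> simp

theorem isRealVec_iff (U : VTP) : IsRealVec U.toVec ↔ cj U = U := by
  constructor
  · intro h
    have h' : ∀ j, U 1 j = (starRingEnd ℂ) (U 0 j.opp) := fun j => congrFun h j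
    refine vtp_ext fun k => ?_
    obtain ⟨c, d⟩ := k
    simp only [cj_vtp, cjT_apply]
    fin_cases c
    · have := h' d.opp
      simp only [Freq.opp_opp] at this
      change (starRingEnd ℂ) (U 1 d.opp) = U 0 d
      rw [this]; simp
    · exact (h' d).symm
  · intro h
    funext j
    change U 1 j = (starRingEnd ℂ) (U 0 j.opp)
    conv_lhs => rw [← h]
    rfl

/-! ### Good multilinear maps -/

variable {Y : Type} [AddCommGroup Y] [Module ℂ Y] [Scale Y]

structure Good {α : Type*} [Fintype α] (A : ML(α, Y)) : Prop where
  bd : ∀ s, ∃ C ≥ (0 : ℝ), ∃ s', ∀ U, nrm s (A U) ≤ C * ∏ a, nrm s' (U a)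
  tr : ∀ x U, A (fun a => tr x (U a)) = tr x (A U)
  cj : ∀ U, A (fun a => cj (U a)) = cj (A U)

theorem nrm_vtp_mono {s s' : ℕ} (h : s ≤ s') (U : VTP) : nrm s U ≤ nrm s' U := by
  rw [nrm_vtp, nrm_vtp]
  refine sum_le_sum fun i _ => ?_
  have : (1 : ℝ) ≤ i.2.wt := by exact_mod_cast i.2.one_le_wt
  gcongr

theorem Good.bd' {α : Type*} [Fintype α] {A : ML(α, Y)}
    (hA : Good A) (s : ℕ) : ∃ C ≥ (0 : ℝ), ∃ s₀, ∀ s' ≥ s₀, ∀ U,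
      nrm s (A U) ≤ C * ∏ a, nrm s' (U a) := by
  obtain ⟨C, hC, s₀, h⟩ := hA.bd s
  refine ⟨C, hC, s₀, fun s' hs' U => (h U).trans ?_⟩
  refine mul_le_mul_of_nonneg_left ?_ hC
  exact Finset.prod_le_prod (fun a _ => nrm_nonneg _ _) fun a _ => nrm_vtp_mono hs' _

section closure

variable {α : Type*} [Fintype α] {A B : ML(α, Y)}

theorem Good.zero : Good (0 : ML(α, Y)) :=
  ⟨fun s => ⟨0, le_rfl, 0, fun U => by simp⟩, fun x U => by simp, fun U => by simp⟩

theorem Good.add (hA : Good A) (hB : Good B) : Good (A + B) := by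
  refine ⟨fun s => ?_, fun x U => ?_, fun U => ?_⟩
  · obtain ⟨C₁, h₁, s₁, b₁⟩ := hA.bd' s
    obtain ⟨C₂, h₂, s₂, b₂⟩ := hB.bd' s
    refine ⟨C₁ + C₂, by positivity, max s₁ s₂, fun U => ?_⟩
    rw [add_mul]
    exact (nrm_add_le _ _ _).trans
      (add_le_add (b₁ _ (le_max_left _ _) U) (b₂ _ (le_max_right _ _) U))
  · simp [hA.tr, hB.tr]
  · simp [hA.cj, hB.cj]

theorem Good.smul (c : ℝ) (hA : Good A) : Good ((c : ℂ) • A) := by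
  refine ⟨fun s => ?_, fun x U => ?_, fun U => ?_⟩
  · obtain ⟨C₁, h₁, s₁, b₁⟩ := hA.bd s
    refine ⟨‖(c : ℂ)‖ * C₁, by positivity, s₁, fun U => ?_⟩
    rw [_root_.smul_apply, nrm_smul, mul_assoc]
    exact mul_le_mul_of_nonneg_left (b₁ U) (norm_nonneg _)
  · rw [_root_.smul_apply, _root_.smul_apply, hA.tr, tr_smul]
  · rw [_root_.smul_apply, _root_.smul_apply, hA.cj, cj_smul, Complex.conj_ofReal]

theorem Good.neg (hA : Good A) : Good (-A) := by
  have := hA.smul (-1)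
  simpa using this

theorem Good.sum {ι : Type*} (S : Finset ι) (F : ι → ML(α, Y))
    (h : ∀ i ∈ S, Good (F i)) : Good (∑ i ∈ S, F i) := by
  classical
  induction S using induction_on with
  | empty => simpa using Good.zero
  | insert a S ha ih =>
    rw [sum_insert ha]
    exact (h a (by simp)).add (ih fun i hi => h i (by simp [hi]))

theorem Good.domDomCongr {β : Type*} [Fintype β] (e : α ≃ β) (hA : Good A) :
    Good (A.domDomCongr e) := by
  refine ⟨fun s => ?_, fun x U => ?_, fun U => ?_⟩
  · obtain ⟨C₁, h₁, s₁, b₁⟩ := hA.bd s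
    refine ⟨C₁, h₁, s₁, fun U => ?_⟩
    rw [MultilinearMap.domDomCongr_apply]
    refine (b₁ _).trans_eq ?_
    rw [Equiv.prod_comp e fun b => nrm s₁ (U b)]
  · simpa using hA.tr x fun a => U (e a)
  · simpa using hA.cj fun a => U (e a)

theorem Good.comp {β : α → Type*} [∀ a, Fintype (β a)]
    {B : ∀ a, ML(β a, VTP)} (hA : Good A) (hB : ∀ a, Good (B a)) :
    Good (A.compMultilinearMap B) := by
  refine ⟨fun s => ?_, fun x U => ?_, fun U => ?_⟩
  · obtain ⟨C, hC, s', b⟩ := hA.bd s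
    choose D hD s₀ hs₀ using fun a => (hB a).bd' s'
    refine ⟨C * ∏ a, D a, mul_nonneg hC (prod_nonneg fun a _ => hD a),
      univ.sup s₀, fun U => (b _).trans ?_⟩
    rw [mul_assoc]
    refine mul_le_mul_of_nonneg_left ?_ hC
    rw [Fintype.prod_sigma, ← prod_mul_distrib]
    refine Finset.prod_le_prod (fun a _ => nrm_nonneg _ _) fun a _ => ?_
    exact hs₀ a _ (le_sup (mem_univ a)) _
  · have : ∀ a, (B a) (fun b => PluriHom.tr x (U ⟨a, b⟩))
        = PluriHom.tr x (B a (fun b => U ⟨a, b⟩)) := fun a => (hB a).tr x _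
    change A (fun a => (B a) (fun b => PluriHom.tr x (U ⟨a, b⟩))) =
      PluriHom.tr x (A fun a => (B a) (fun b => U ⟨a, b⟩))
    simp only [this, hA.tr]
  · have : ∀ a, (B a) (fun b => PluriHom.cj (U ⟨a, b⟩))
        = PluriHom.cj (B a (fun b => U ⟨a, b⟩)) := fun a => (hB a).cj _
    change A (fun a => (B a) (fun b => PluriHom.cj (U ⟨a, b⟩))) =
      PluriHom.cj (A fun a => (B a) (fun b => U ⟨a, b⟩))
    simp only [this, hA.cj]

theorem map_expand (A : ML(α, Y)) [DecidableEq α] (U : α → VTP) :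
    A U = ∑ i ∈ Fintype.piFinset fun a => (bas.repr (U a)).support,
      (∏ a, U a (i a).1 (i a).2) • A fun a => bas (i a) := by
  conv_lhs => rw [show U = fun a => ∑ i ∈ (bas.repr (U a)).support, U a i.1 i.2 • bas i from
    funext fun a => (sum_bas (U a)).symm]
  rw [MultilinearMap.map_sum_finset]
  refine sum_congr rfl fun i _ => ?_
  rw [MultilinearMap.map_smul_univ]

theorem ext_bas {A B : ML(α, Y)}
    (h : ∀ i : α → Idx, A (fun a => bas (i a)) = B fun a => bas (i a)) : A = B :=
  Module.Basis.ext_multilinear (fun _ => bas) h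

theorem nrm_le_of_kernel (A : ML(α, Y)) {s s' : ℕ} {C : ℝ}
    (h : ∀ i : α → Idx, nrm s (A fun a => bas (i a)) ≤ C * ∏ a, ((i a).2.wt : ℝ) ^ s')
    (U : α → VTP) : nrm s (A U) ≤ C * ∏ a, nrm s' (U a) := by
  classical
  rw [map_expand A U]
  refine (nrm_sum_le _ _ _).trans ?_
  simp_rw [nrm_vtp]
  rw [Finset.prod_univ_sum, mul_sum]
  refine sum_le_sum fun i _ => ?_
  rw [nrm_smul, norm_prod, prod_mul_distrib]
  calc _ ≤ (∏ a, ‖U a (i a).1 (i a).2‖) * (C * ∏ a, ((i a).2.wt : ℝ) ^ s') :=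
        mul_le_mul_of_nonneg_left (h i) (by positivity)
    _ = _ := by ring

/-- The multilinear map `U ↦ cj (A (cj U))`. -/
def cjConj (A : ML(α, Y)) : ML(α, Y) where
  toFun U := cj (A fun a => cj (U a))
  map_update_add' U a u v := by
    have : ∀ w, (fun b => cj (update U a w b)) = update (fun b => cj (U b)) a (cj w) := fun w => by
      funext b; by_cases h : b = a
      · subst h; simp
      · simp [h]
    simp only [this, cj_add, A.map_update_add]
  map_update_smul' U a c u := by
    have : ∀ w, (fun b => cj (update U a w b)) = update (fun b => cj (U b)) a (cj w) := fun w => by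
      funext b; by_cases h : b = a
      · subst h; simp
      · simp [h]
    simp [this]

theorem cjConj_apply (A : ML(α, Y)) (U : α → VTP) : cjConj A U = cj (A fun a => cj (U a)) := rfl

theorem good_of_kernel (A : ML(α, Y)) (hbd : ∀ s, ∃ C ≥ (0 : ℝ), ∃ s', ∀ i : α → Idx,
      nrm s (A fun a => bas (i a)) ≤ C * ∏ a, ((i a).2.wt : ℝ) ^ s')
    (htr : ∀ x (i : α → Idx), tr x (A fun a => bas (i a)) =
      (∏ a, (i a).ph x) • A fun a => bas (i a))
    (hcj : ∀ i : α → Idx, A (fun a => bas (i a).conj) = cj (A fun a => bas (i a))) : Good A := by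
  refine ⟨fun s => ?_, fun x U => ?_, fun U => ?_⟩
  · obtain ⟨C, hC, s', h⟩ := hbd s
    exact ⟨C, hC, s', nrm_le_of_kernel A h⟩
  · have : A.compLinearMap (fun _ => Scale.trL x) = (Scale.trL x).compMultilinearMap A := by
      refine ext_bas fun i => ?_
      change A (fun a => PluriHom.tr x (bas (i a))) = PluriHom.tr x (A fun a => bas (i a))
      simp only [tr_bas, htr, MultilinearMap.map_smul_univ]
    exact DFunLike.congr_fun this U
  · have : cjConj A = A := by
      refine ext_bas fun i => ?_
      simp only [cjConj_apply, cj_bas, hcj, cj_cj]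
    have h2 := DFunLike.congr_fun this U
    rw [cjConj_apply] at h2
    rw [← h2, cj_cj]

theorem Good.kernel_bd (hA : Good A) (s : ℕ) : ∃ C ≥ (0 : ℝ), ∃ s', ∀ i : α → Idx,
      nrm s (A fun a => bas (i a)) ≤ C * ∏ a, ((i a).2.wt : ℝ) ^ s' := by
  obtain ⟨C, hC, s', h⟩ := hA.bd s
  exact ⟨C, hC, s', fun i => by simpa using h fun a => bas (i a)⟩

theorem Good.kernel_tr (hA : Good A) (x : ℝ) (i : α → Idx) :
    PluriHom.tr x (A fun a => bas (i a)) = (∏ a, (i a).ph x) • A fun a => bas (i a) := by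
  rw [← hA.tr]; simp only [tr_bas, MultilinearMap.map_smul_univ]

theorem Good.kernel_cj (hA : Good A) (i : α → Idx) :
    A (fun a => bas (i a).conj) = PluriHom.cj (A fun a => bas (i a)) := by
  rw [← hA.cj]; simp only [cj_bas]

end closure

/-! ### Multilinear maps with a given kernel -/

section mk
variable {α : Type*} [Fintype α]

/-- The coordinate product `U ↦ ∏ U_a(i_a)`. -/
def coordProd (i : α → Idx) : ML(α, ℂ) :=
  (MultilinearMap.mkPiAlgebra ℂ α ℂ).compLinearMap fun a => bas.coord (i a)

theorem coordProd_apply (i : α → Idx) (U : α → VTP) : coordProd i U = ∏ a, U a (i a).1 (i a).2 := by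
  simp [coordProd]

theorem coordProd_finite (K : (α → Idx) → Y) (U : α → VTP) :
    (Function.support fun i => coordProd i U • K i).Finite := by
  classical
  refine (Finset.finite_toSet (Fintype.piFinset fun a => (bas.repr (U a)).support)).subset ?_
  intro i hi
  simp only [Finset.mem_coe, Fintype.mem_piFinset, Finsupp.mem_support_iff, bas_repr]
  intro a ha
  apply hi
  simp only [coordProd_apply]
  rw [prod_eq_zero (mem_univ a) ha, zero_smul]

def mkMap (K : (α → Idx) → Y) : ML(α, Y) where
  toFun U := ∑ᶠ i, coordProd i U • K i
  map_update_add' U a u v := by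
    rw [← finsum_add_distrib (coordProd_finite K _) (coordProd_finite K _)]
    simp only [MultilinearMap.map_update_add, add_smul]
  map_update_smul' U a c u := by
    rw [smul_finsum' _ (coordProd_finite K _)]
    simp only [MultilinearMap.map_update_smul, smul_assoc]

theorem mkMap_bas (K : (α → Idx) → Y) (i : α → Idx) : mkMap K (fun a => bas (i a)) = K i := by
  change ∑ᶠ k, coordProd k (fun a => bas (i a)) • K k = K i
  have h : ∀ k, coordProd k (fun a => bas (i a)) = if k = i then 1 else 0 := by
    intro k
    rw [coordProd_apply]
    split_ifs with h
    · subst h; exact Finset.prod_eq_one fun a _ => by simp [bas_apply_apply]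
    · obtain ⟨a, ha⟩ : ∃ a, k a ≠ i a := by by_contra! hh; exact h (funext hh)
      refine prod_eq_zero (mem_univ a) ?_
      rw [bas_apply_apply, if_neg]
      rintro ⟨h1, h2⟩
      exact ha (Sigma.ext h1.symm (heq_of_eq h2.symm))
  rw [finsum_eq_single _ i fun k hk => by simp [h, hk]]
  simp [h]

end mk

end

section

/-! ### Polynomial functions of one variable, graded by order of vanishing -/

section Pn

variable {M N : Type*} [AddCommGroup M] [Module ℂ M] [AddCommGroup N] [Module ℂ N]

def Pn (n : ℕ) (M : Type*) [AddCommGroup M] [Module ℂ M] : AddSubmonoid (ℂ → M) :=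
  AddSubmonoid.closure {f | ∃ k ≥ n, ∃ y : M, f = fun z => z ^ k • y}

theorem Pn.mono {m n : ℕ} (h : m ≤ n) {f : ℂ → M} (hf : f ∈ Pn n M) : f ∈ Pn m M := by
  refine AddSubmonoid.closure_mono ?_ hf
  rintro _ ⟨k, hk, y, rfl⟩
  exact ⟨k, h.trans hk, y, rfl⟩

theorem Pn.monomial (n : ℕ) {k : ℕ} (hk : n ≤ k) (y : M) : (fun z : ℂ => z ^ k • y) ∈ Pn n M :=
  AddSubmonoid.subset_closure ⟨k, hk, y, rfl⟩

theorem Pn.const (y : M) : (fun _ : ℂ => y) ∈ Pn 0 M := by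
  simpa using Pn.monomial 0 (le_refl 0) y

theorem Pn.zero (n : ℕ) : (fun _ : ℂ => (0 : M)) ∈ Pn n M := (Pn n M).zero_mem

theorem Pn.add {n : ℕ} {f g : ℂ → M} (hf : f ∈ Pn n M) (hg : g ∈ Pn n M) :
    (fun z => f z + g z) ∈ Pn n M := (Pn n M).add_mem hf hg

theorem Pn.map {n : ℕ} (L : M →ₗ[ℂ] N) {f : ℂ → M} (hf : f ∈ Pn n M) :
    (fun z => L (f z)) ∈ Pn n N := by
  induction hf using AddSubmonoid.closure_induction with
  | mem f hf =>
    obtain ⟨k, hk, y, rfl⟩ := hf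
    simpa using Pn.monomial n hk (L y)
  | zero => simpa using Pn.zero n
  | add f g _ _ hf hg => simpa using Pn.add hf hg

theorem Pn.neg {n : ℕ} {f : ℂ → M} (hf : f ∈ Pn n M) : (fun z => -f z) ∈ Pn n M :=
  Pn.map (-LinearMap.id) hf

theorem Pn.sub {n : ℕ} {f g : ℂ → M} (hf : f ∈ Pn n M) (hg : g ∈ Pn n M) :
    (fun z => f z - g z) ∈ Pn n M := by
  simpa [sub_eq_add_neg] using Pn.add hf (Pn.neg hg)

theorem Pn.sum {ι : Type*} {n : ℕ} (S : Finset ι) (f : ι → ℂ → M) (h : ∀ i ∈ S, f i ∈ Pn n M) :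
    (fun z => ∑ i ∈ S, f i z) ∈ Pn n M := by
  have := (Pn n M).sum_mem h
  convert this using 1
  funext z; simp

theorem Pn.multilinear {α : Type*} [Fintype α] {E : α → Type*} [∀ a, AddCommGroup (E a)]
    [∀ a, Module ℂ (E a)] (A : MultilinearMap ℂ E N) (n : α → ℕ) (f : ∀ a, ℂ → E a)
    (hf : ∀ a, f a ∈ Pn (n a) (E a)) : (fun z => A fun a => f a z) ∈ Pn (∑ a, n a) N := by
  classical
  have hu : ∀ (x : ∀ a, ℂ → E a) a (u : ℂ → E a) z,
      (fun b => update x a u b z) = update (fun b => x b z) a (u z) := by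
    intro x a u z
    funext b
    by_cases h : b = a
    · subst h; simp
    · simp [h]
  refine closure_slots (fun (x : ∀ a, ℂ → E a) => (fun z => A fun a => x a z)) ?_ ?_ _ _ ?_ f hf
  · intro x a u v
    funext z
    simp only [Pi.add_apply, hu, A.map_update_add]
  · intro x a
    funext z
    simp only [hu, Pi.zero_apply, A.map_update_zero]
  · intro x hx
    choose k hk y hy using hx
    have : (fun z => A fun a => x a z) = fun z : ℂ => z ^ (∑ a, k a) • A y := by
      funext z
      simp only [hy]
      rw [A.map_smul_univ, Finset.prod_pow_eq_pow_sum]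
    change (fun z => A fun a => x a z) ∈ _
    rw [this]
    exact Pn.monomial _ (sum_le_sum fun a _ => hk a) _

theorem Pn.bilinear {M' : Type*} [AddCommGroup M'] [Module ℂ M'] {m n : ℕ}
    (L : M →ₗ[ℂ] M' →ₗ[ℂ] N) {f : ℂ → M} {g : ℂ → M'}
    (hf : f ∈ Pn m M) (hg : g ∈ Pn n M') : (fun z => L (f z) (g z)) ∈ Pn (m + n) N := by
  induction hf using AddSubmonoid.closure_induction with
  | mem f hf =>
    obtain ⟨k, hk, y, rfl⟩ := hf
    induction hg using AddSubmonoid.closure_induction with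
    | mem g hg =>
      obtain ⟨l, hl, y', rfl⟩ := hg
      have := Pn.monomial (m + n) (add_le_add hk hl) (L y y')
      convert this using 2 with z
      simp [pow_add, mul_smul, smul_comm (z ^ k)]
    | zero => simpa using Pn.zero (m + n)
    | add f g _ _ hf hg => simpa using Pn.add hf hg
  | zero => simpa using Pn.zero (m + n)
  | add f g _ _ hf hg => simpa using Pn.add hf hg

theorem Pn.smul {m n : ℕ} {f : ℂ → ℂ} {g : ℂ → M}
    (hf : f ∈ Pn m ℂ) (hg : g ∈ Pn n M) : (fun z => f z • g z) ∈ Pn (m + n) M :=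
  Pn.bilinear (LinearMap.lsmul ℂ M) hf hg

theorem Pn.normal {n : ℕ} {f : ℂ → M} (hf : f ∈ Pn n M) : ∃ (L : ℕ) (y : ℕ → M),
    (∀ k < n, y k = 0) ∧ (∀ k ≥ L, y k = 0) ∧ ∀ z, f z = ∑ k ∈ range L, z ^ k • y k := by
  induction hf using AddSubmonoid.closure_induction with
  | mem f hf =>
    obtain ⟨k, hk, y, rfl⟩ := hf
    refine ⟨k + 1, fun l => if l = k then y else 0, fun l hl => if_neg (by omega),
      fun l hl => if_neg (by omega), fun z => ?_⟩
    simp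
  | zero => exact ⟨0, 0, fun _ _ => rfl, fun _ _ => rfl, fun z => by simp⟩
  | add f g _ _ hf hg =>
    obtain ⟨L₁, y₁, a₁, b₁, c₁⟩ := hf
    obtain ⟨L₂, y₂, a₂, b₂, c₂⟩ := hg
    refine ⟨max L₁ L₂, y₁ + y₂, fun k hk => by simp [a₁ k hk, a₂ k hk], fun k hk => by
      simp [b₁ k ((le_max_left _ _).trans hk), b₂ k ((le_max_right _ _).trans hk)], fun z => ?_⟩
    rw [Pi.add_apply, c₁, c₂]
    simp only [Pi.add_apply, smul_add, sum_add_distrib]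
    congr 1
    · refine sum_subset (range_mono (le_max_left _ _)) fun k _ hk => ?_
      rw [b₁ k (by simpa using hk), smul_zero]
    · refine sum_subset (range_mono (le_max_right _ _)) fun k _ hk => ?_
      rw [b₂ k (by simpa using hk), smul_zero]

theorem coeff_eq_zero (L : ℕ) (y : ℕ → M) (S : Set ℂ) (hS : S.Infinite)
    (h : ∀ z ∈ S, ∑ k ∈ range L, z ^ k • y k = 0) : ∀ k < L, y k = 0 := by
  intro k hk
  rw [← Module.forall_dual_apply_eq_zero_iff ℂ]
  intro φ
  let p : Polynomial ℂ := ∑ k ∈ range L, Polynomial.monomial k (φ (y k))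
  have hp : p = 0 := by
    refine Polynomial.eq_zero_of_infinite_isRoot p (hS.mono fun z hz => ?_)
    have := congrArg φ (h z hz)
    simp only [map_sum, map_smul, map_zero, smul_eq_mul] at this
    simp only [p, Set.mem_ofPred_eq, Polynomial.IsRoot.def, Polynomial.eval_finsetSum,
      Polynomial.eval_monomial]
    rw [← this]
    exact sum_congr rfl fun i _ => mul_comm _ _
  have := congrArg (fun q => Polynomial.coeff q k) hp
  simpa [p, Polynomial.finsetSum_coeff, Polynomial.coeff_monomial, hk] using this

theorem Pn.coeff_eq_zero {n L : ℕ} {y : ℕ → M}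
    (h : (fun z : ℂ => ∑ k ∈ range L, z ^ k • y k) ∈ Pn n M) :
    ∀ k < L, k < n → y k = 0 := by
  obtain ⟨L', y', h1, h2, h3⟩ := Pn.normal h
  have key : ∀ k < max L L', (if k < L then y k else 0) - y' k = 0 := by
    refine PluriHom.coeff_eq_zero _ _ Set.univ Set.infinite_univ fun z _ => ?_
    simp only [smul_sub, sum_sub_distrib]
    rw [sub_eq_zero]
    have e1 : ∑ k ∈ range (max L L'), z ^ k • (if k < L then y k else 0) =
        ∑ k ∈ range L, z ^ k • y k := by
      rw [← sum_subset (range_mono (le_max_left L L'))]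
      · exact sum_congr rfl fun k hk => by simp [mem_range.1 hk]
      · intro k _ hk
        rw [if_neg (by simpa using hk), smul_zero]
    have e2 : ∑ k ∈ range (max L L'), z ^ k • y' k = ∑ k ∈ range L', z ^ k • y' k := by
      rw [← sum_subset (range_mono (le_max_right L L'))]
      intro k _ hk
      rw [h2 k (by simpa using hk), smul_zero]
    rw [e1, e2]
    exact h3 z
  intro k hk hn
  have := key k (lt_max_of_lt_left hk)
  rw [if_pos hk, h1 k hn, sub_zero] at this
  exact this

end Pn

/-! ### Diagonals, derivatives and polarization of multilinear maps -/

section diag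

variable {M N : Type*} [AddCommGroup M] [Module ℂ M] [AddCommGroup N] [Module ℂ N]
variable {α : Type*} [Fintype α]

theorem map_const_smul (A : MultilinearMap ℂ (fun _ : α => M) N) (c : ℂ) (U : M) :
    A (fun _ => c • U) = c ^ Fintype.card α • A fun _ => U := by
  rw [A.map_smul_univ (fun _ => c)]; simp

theorem map_update_const_smul [DecidableEq α] (A : MultilinearMap ℂ (fun _ : α => M) N) (c : ℂ)
    (U V : M) (a : α) : A (update (fun _ => c • U) a V) =
      c ^ (Fintype.card α - 1) • A (update (fun _ => U) a V) := by
  have : update (fun _ : α => c • U) a V =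
      fun b => (if b = a then (1 : ℂ) else c) • update (fun _ => U) a V b := by
    funext b
    by_cases h : b = a
    · subst h; simp
    · simp [h]
  rw [this, A.map_smul_univ]
  congr 1
  rw [Finset.prod_ite]
  simp only [prod_const_one, one_mul, prod_const]
  congr 1
  rw [Finset.filter_ne' , card_erase_of_mem (mem_univ a), card_univ]

theorem map_update_update_const_smul [DecidableEq α] (A : MultilinearMap ℂ (fun _ : α => M) N)
    (c : ℂ) (U V W : M) {a b : α} (hab : a ≠ b) :
    A (update (update (fun _ => c • U) a V) b W) =
      c ^ (Fintype.card α - 2) • A (update (update (fun _ => U) a V) b W) := by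
  have : update (update (fun _ : α => c • U) a V) b W =
      fun d => (if d ∈ ({a, b} : Finset α) then (1 : ℂ) else c) •
        update (update (fun _ => U) a V) b W d := by
    funext d
    by_cases h : d = b
    · subst h; simp
    · by_cases h' : d = a
      · subst h'; simp [h]
      · simp [h, h']
  rw [this, A.map_smul_univ]
  congr 1
  rw [Finset.prod_ite]
  simp only [prod_const_one, one_mul, prod_const]
  congr 1
  rw [← card_univ, ← Finset.card_pair hab, ← Finset.card_sdiff_of_subset (Finset.subset_univ _)]
  congr 1
  ext d; simp

theorem map_add_smul_mod [DecidableEq α] (A : MultilinearMap ℂ (fun _ : α => M) N) (U V : M) :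
    (fun z : ℂ => A (fun _ => U + z • V) - A (fun _ => U) -
      z • ∑ a, A (update (fun _ => U) a V)) ∈ Pn 2 N := by
  have h : ∀ z : ℂ, A (fun _ => U + z • V) - A (fun _ => U) - z • ∑ a, A (update (fun _ => U) a V) =
      ∑ s : Finset α with 2 ≤ s.card, z ^ s.card • A (s.piecewise (fun _ => V) fun _ => U) := by
    intro z
    have := A.map_add_eq_map_add_linearDeriv_add (fun _ => U) (fun _ => z • V)
    rw [MultilinearMap.linearDeriv_apply] at this
    simp only [A.map_update_smul] at this
    rw [← smul_sum] at this
    change A (fun _ => U + z • V) = _ at this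
    rw [this, add_sub_right_comm, add_sub_cancel_left, add_sub_right_comm, sub_self, zero_add]
    refine sum_congr rfl fun s _ => ?_
    have e : s.piecewise (fun _ => z • V) (fun _ => U) =
        s.piecewise (fun b => z • s.piecewise (fun _ => V) (fun _ => U) b)
          (s.piecewise (fun _ => V) fun _ => U) := by
      funext b
      by_cases hb : b ∈ s <;> simp [hb]
    rw [e, A.map_piecewise_smul (fun _ => z)]
    simp
  simp only [h]
  refine Pn.sum _ _ fun s hs => Pn.monomial _ (mem_filter.1 hs).2 _

theorem deriv_eq_zero [DecidableEq α] (A : MultilinearMap ℂ (fun _ : α => M) N) (U V : M)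
    (h : ∀ z : ℂ, A (fun _ => U + z • V) = 0) :
    ∑ a, A (update (fun _ => U) a V) = 0 := by
  have h1 := map_add_smul_mod A U V
  have h0 : A (fun _ => U) = 0 := by simpa using h 0
  simp only [h, h0, zero_sub, neg_zero] at h1
  have h2 := Pn.neg h1
  have h3 : (fun z : ℂ => ∑ k ∈ range 2,
      z ^ k • (if k = 1 then ∑ a, A (update (fun _ => U) a V) else 0)) ∈ Pn 2 N := by
    convert h2 using 2 with z
    simp
  simpa using Pn.coeff_eq_zero h3 1 (by norm_num) (by norm_num)

def IsSymm (A : MultilinearMap ℂ (fun _ : α => M) N) : Prop :=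
  ∀ (π : Equiv.Perm α) (U : α → M), A (fun a => U (π a)) = A U

/-- Polarization: a symmetric multilinear map vanishing on the diagonal of a subspace vanishes on
this subspace. -/
theorem polarization {n : ℕ} (A : MultilinearMap ℂ (fun _ : Fin n => M) N) (hA : IsSymm A)
    (S : Submodule ℂ M) (h : ∀ U ∈ S, A (fun _ => U) = 0) (U : Fin n → M) (hU : ∀ a, U a ∈ S) :
    A U = 0 := by
  induction n with
  | zero =>
    rw [Subsingleton.elim U fun _ => 0]
    exact h 0 S.zero_mem
  | succ n ih =>
    rw [← Fin.cons_self_tail U, ← MultilinearMap.curryLeft_apply]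
    refine ih (A.curryLeft (U 0)) ?_ ?_ _ fun a => hU _
    · intro π W
      rw [MultilinearMap.curryLeft_apply, MultilinearMap.curryLeft_apply]
      have := hA (Equiv.Perm.decomposeFin.symm (0, π)) (Fin.cons (U 0) W)
      rw [← this]
      congr 1
      funext a
      refine Fin.cases ?_ (fun b => ?_) a <;> simp
    · intro W hW
      rw [MultilinearMap.curryLeft_apply]
      have h1 := deriv_eq_zero A W (U 0) fun z => h _ (S.add_mem hW (S.smul_mem _ (hU 0)))
      have h2 : ∀ a : Fin (n + 1), A (update (fun _ => W) a (U 0)) =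
          A (Fin.cons (U 0) fun _ => W) := by
        intro a
        rw [← hA (Equiv.swap 0 a)]
        congr 1
        funext b
        by_cases hb : b = 0
        · subst hb; simp
        · obtain ⟨c, rfl⟩ := Fin.exists_succ_eq.2 hb
          rw [Fin.cons_succ, update_of_ne]
          intro h
          apply hb
          rw [Equiv.swap_apply_eq_iff] at h
          simpa using h
      simp only [h2, sum_const, card_univ, Fintype.card_fin] at h1
      rw [← Nat.cast_smul_eq_nsmul ℂ] at h1
      exact (smul_eq_zero.1 h1).resolve_left (Nat.cast_ne_zero.2 (Nat.succ_ne_zero n))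

/-- The symmetrization of a multilinear map. -/
def symmz [DecidableEq α] (A : MultilinearMap ℂ (fun _ : α => M) N) :
    MultilinearMap ℂ (fun _ : α => M) N :=
  (((Fintype.card (Equiv.Perm α) : ℝ)⁻¹ : ℝ) : ℂ) • ∑ π : Equiv.Perm α, A.domDomCongr π

variable [DecidableEq α]

theorem symmz_apply (A : MultilinearMap ℂ (fun _ : α => M) N) (U : α → M) :
    symmz A U = (((Fintype.card (Equiv.Perm α) : ℝ)⁻¹ : ℝ) : ℂ) •
      ∑ π : Equiv.Perm α, A fun a => U (π a) := by
  simp [symmz]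

theorem symmz_symm (A : MultilinearMap ℂ (fun _ : α => M) N) : IsSymm (symmz A) := by
  intro π U
  rw [symmz_apply, symmz_apply]
  congr 1
  exact Fintype.sum_equiv (Equiv.mulLeft π) _ _ fun ρ => rfl

theorem avg_const (y : N) : (((Fintype.card (Equiv.Perm α) : ℝ)⁻¹ : ℝ) : ℂ) •
      ∑ _π : Equiv.Perm α, y = y := by
  rw [sum_const, ← Nat.cast_smul_eq_nsmul ℂ, smul_smul, card_univ]
  have : (Fintype.card (Equiv.Perm α) : ℂ) ≠ 0 := by exact_mod_cast Fintype.card_ne_zero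
  rw [Complex.ofReal_inv, Complex.ofReal_natCast, inv_mul_cancel₀ this, one_smul]

theorem symmz_diag (A : MultilinearMap ℂ (fun _ : α => M) N) (U : M) :
    symmz A (fun _ => U) = A fun _ => U := by
  rw [symmz_apply, avg_const]

theorem symmz_deriv (A : MultilinearMap ℂ (fun _ : α => M) N) (U V : M) :
    ∑ a, symmz A (update (fun _ => U) a V) = ∑ a, A (update (fun _ => U) a V) := by
  simp only [symmz_apply]
  rw [← smul_sum, sum_comm]
  conv_rhs => rw [← avg_const (α := α) (∑ a, A (update (fun _ => U) a V))]
  congr 1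
  refine sum_congr rfl fun π _ => ?_
  refine Fintype.sum_equiv π.symm _ _ fun a => ?_
  congr 1
  funext b
  by_cases h : b = π.symm a
  · subst h; simp
  · rw [update_of_ne h, update_of_ne]
    rintro rfl; simp at h

end diag

end

section

/-! ### Spectral supports and momentum -/

def supS (Q : Idx → Prop) : Submodule ℂ VTP where
  carrier := {U | ∀ i : Idx, U i.1 i.2 ≠ 0 → Q i}
  add_mem' := by
    intro U V hU hV i h
    by_contra hQ
    have h1 : U i.1 i.2 = 0 := by by_contra h'; exact hQ (hU i h')
    have h2 : V i.1 i.2 = 0 := by by_contra h'; exact hQ (hV i h')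
    exact h (by simp [h1, h2])
  zero_mem' := by intro i h; simp at h
  smul_mem' := by
    intro c U hU i h
    refine hU i fun h0 => h ?_
    simp [h0]

theorem bas_mem_supS {Q : Idx → Prop} {i : Idx} (h : Q i) : bas i ∈ supS Q := by
  intro k hk
  rw [bas_apply_apply] at hk
  have : i.1 = k.1 ∧ i.2 = k.2 := by by_contra h'; simp [h'] at hk
  rwa [show k = i from Sigma.ext this.1.symm (heq_of_eq this.2.symm)]

theorem supS_closure {Q : Idx → Prop} {U : VTP} (h : U ∈ supS Q) :
    U ∈ AddSubmonoid.closure {V | ∃ (c : ℂ) (i : Idx), Q i ∧ V = c • bas i} := by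
  rw [← sum_bas U]
  refine AddSubmonoid.sum_mem _ fun i hi => AddSubmonoid.subset_closure ⟨_, i, ?_, rfl⟩
  exact h i (by simpa using hi)

def lowS (L : ℕ) : Submodule ℂ VTP := supS fun i => i.2.wt ≤ L
def highS (L : ℕ) : Submodule ℂ VTP := supS fun i => L < i.2.wt

theorem lowS_mono {L L' : ℕ} (h : L ≤ L') : lowS L ≤ lowS L' := fun _ hU i hi => (hU i hi).trans h
theorem highS_anti {L L' : ℕ} (h : L ≤ L') : highS L' ≤ highS L :=
  fun _ hU i hi => lt_of_le_of_lt h (hU i hi)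

section vanish

variable {α : Type*} [Fintype α] {N : Type*} [AddCommGroup N] [Module ℂ N]

theorem mem_of_kernel (A : ML(α, N)) (Q : α → Idx → Prop)
    (S : Submodule ℂ N) (h : ∀ i : α → Idx, (∀ a, Q a (i a)) → A (fun a => bas (i a)) ∈ S)
    (U : α → VTP) (hU : ∀ a, U a ∈ supS (Q a)) : A U ∈ S := by
  refine multilinear_closure_mem A _ S.toAddSubmonoid ?_ U fun a => supS_closure (hU a)
  intro x hx
  choose c i hi hx using hx
  rw [show x = fun a => c a • bas (i a) from funext hx, A.map_smul_univ]
  exact S.smul_mem _ (h i hi)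

theorem eq_zero_of_kernel (A : ML(α, N)) (Q : α → Idx → Prop)
    (h : ∀ i : α → Idx, (∀ a, Q a (i a)) → A (fun a => bas (i a)) = 0)
    (U : α → VTP) (hU : ∀ a, U a ∈ supS (Q a)) : A U = 0 := by
  have := mem_of_kernel A Q ⊥ (fun i hi => by simpa using h i hi) U hU
  simpa using this

end vanish

theorem phase_injective {m n : ℤ} (h : ∀ x : ℝ, Complex.exp (Complex.I * ((m : ℂ) * (x : ℂ))) =
      Complex.exp (Complex.I * ((n : ℂ) * (x : ℂ)))) : m = n := by
  by_contra hne
  have hd : ((m : ℝ) - n) ≠ 0 := by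
    rw [sub_ne_zero]; exact_mod_cast hne
  have := h (Real.pi / (m - n))
  rw [Complex.exp_eq_exp_iff_exists_int] at this
  obtain ⟨k, hk⟩ := this
  have hI : Complex.I ≠ 0 := Complex.I_ne_zero
  have hk' : ((m : ℂ) - n) * ((Real.pi / (m - n) : ℝ) : ℂ) = k * (2 * Real.pi) := by
    apply mul_left_cancel₀ hI
    linear_combination hk
  have hk2 : ((m : ℝ) - n) * (Real.pi / (m - n)) = k * (2 * Real.pi) := by exact_mod_cast hk'
  rw [mul_div_cancel₀ _ hd] at hk2
  have h3 : (1 : ℝ) = k * 2 := by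
    have := Real.pi_pos.ne'
    field_simp at hk2 ⊢
    linarith
  have h4 : (1 : ℤ) = k * 2 := by exact_mod_cast h3
  omega

section momentum

variable {α : Type*} [Fintype α]

def mom (i : α → Idx) : ℤ := ∑ a, (i a).2.1

theorem prod_ph (x : ℝ) (i : α → Idx) :
    ∏ a, (i a).ph x = Complex.exp (Complex.I * ((mom i : ℂ) * (x : ℂ))) := by
  simp only [Idx.ph, ← Complex.exp_sum, mom]
  congr 1
  push_cast
  rw [sum_mul, mul_sum]

theorem Good.momentum {A : ML(α, VTP)} (hA : Good A) (i : α → Idx)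
    (k : Idx) (hk : A (fun a => bas (i a)) k.1 k.2 ≠ 0) : k.2.1 = mom i := by
  apply phase_injective
  intro x
  have := congrFun (hA.kernel_tr x i) k.1
  have h2 := DFunLike.congr_fun this k.2
  rw [prod_ph] at h2
  exact mul_right_cancel₀ hk h2

theorem Good.momentum_scalar {A : ML(α, ℂ)} (hA : Good A)
    (i : α → Idx) (hk : A (fun a => bas (i a)) ≠ 0) : mom i = 0 := by
  symm
  apply phase_injective
  intro x
  have h2 := hA.kernel_tr x i
  rw [prod_ph] at h2
  simpa using mul_right_cancel₀ (a := 1) hk (by simpa using h2)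

theorem tr_of_momentum (x : ℝ) (i : α → Idx) (V : VTP)
    (h : ∀ k : Idx, V k.1 k.2 ≠ 0 → k.2.1 = mom i) : tr x V = (∏ a, (i a).ph x) • V := by
  refine vtp_ext fun k => ?_
  rw [prod_ph]
  change Complex.exp (Complex.I * ((k.2.1 : ℂ) * (x : ℂ))) * V k.1 k.2 = _ * V k.1 k.2
  by_cases h0 : V k.1 k.2 = 0
  · simp [h0]
  · rw [h k h0]

theorem abs_mom_le (i : α → Idx) : |mom i| ≤ ∑ a, ((i a).2.wt : ℤ) := by
  refine (abs_sum_le_sum_abs _ _).trans_eq (sum_congr rfl fun a _ => ?_)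
  rw [Freq.wt, Int.natCast_natAbs]

theorem wt_le_prod (i : α → Idx) (a : α) : (i a).2.wt ≤ ∏ b, (i b).2.wt := by
  classical
  rw [← mul_prod_erase univ _ (mem_univ a)]
  exact Nat.le_mul_of_pos_right _ (prod_pos fun b _ => (i b).2.one_le_wt)

theorem sum_wt_le (i : α → Idx) : ∑ a, (i a).2.wt ≤ Fintype.card α * ∏ b, (i b).2.wt := by
  refine (sum_le_card_nsmul _ _ _ fun a _ => wt_le_prod i a).trans_eq ?_
  simp

end momentum

/-! ### Weights on kernels -/

section weights

variable {α : Type*} [Fintype α] {Y : Type} [AddCommGroup Y] [Module ℂ Y] [Scale Y]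

def wmap (ϕ : (α → Idx) → ℝ) (A : ML(α, Y)) : ML(α, Y) :=
  mkMap fun i => (ϕ i : ℂ) • A fun a => bas (i a)

theorem wmap_bas (ϕ : (α → Idx) → ℝ) (A : ML(α, Y)) (i : α → Idx) :
    wmap ϕ A (fun a => bas (i a)) = (ϕ i : ℂ) • A fun a => bas (i a) := mkMap_bas _ _

theorem Good.wmap {A : ML(α, Y)} (hA : Good A)
    (ϕ : (α → Idx) → ℝ) (h1 : ∀ i, |ϕ i| ≤ 1) (h2 : ∀ i, ϕ (fun a => (i a).conj) = ϕ i) :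
    Good (wmap ϕ A) := by
  refine good_of_kernel _ (fun s => ?_) (fun x i => ?_) fun i => ?_
  · obtain ⟨C, hC, s', h⟩ := hA.kernel_bd s
    refine ⟨C, hC, s', fun i => ?_⟩
    rw [wmap_bas, nrm_smul, Complex.norm_real]
    exact (mul_le_of_le_one_left (nrm_nonneg _ _) (h1 i)).trans (h i)
  · rw [wmap_bas, tr_smul, hA.kernel_tr, smul_comm]
  · rw [wmap_bas ϕ A i, cj_smul, Complex.conj_ofReal, ← hA.kernel_cj,
      wmap_bas ϕ A fun a => (i a).conj, h2]

end weights

/-! ### Bilinear pairing and symplectic form -/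

def pr : VTP →ₗ[ℂ] VTP →ₗ[ℂ] ℂ := bas.constr ℂ fun i => bas.coord ⟨i.1, i.2.opp⟩

theorem pr_bas_left (i : Idx) (W : VTP) : pr (bas i) W = W i.1 i.2.opp := by
  simp [pr]

theorem sum_single_tp (V : VTP) (W : VTP) (σ : Fin 2) :
    ∑' j : Freq, V.toVec σ j * W.toVec σ j.opp = (V σ).sum fun j c => c * W σ j.opp := by
  rw [tsum_eq_sum (s := (V σ).support)]
  · rfl
  · intro j hj
    have : V σ j = 0 := by simpa using hj
    simp [VTP.toVec, this]

theorem pair_toVec (V W : VTP) : pair V.toVec W.toVec = pr V W := by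
  let P : VTP →ₗ[ℂ] ℂ :=
    { toFun := fun V => ∑ σ, (V σ).sum fun j c => c * W σ j.opp
      map_add' := fun V V' => by
        rw [← sum_add_distrib]
        refine sum_congr rfl fun σ _ => ?_
        exact Finsupp.sum_add_index' (by simp) (by intros; ring)
      map_smul' := fun c V => by
        rw [RingHom.id_apply, smul_eq_mul, mul_sum]
        refine sum_congr rfl fun σ _ => ?_
        rw [Pi.smul_apply, Finsupp.sum_smul_index' (by simp), Finsupp.mul_sum]
        exact Finsupp.sum_congr fun j _ => by simp [mul_assoc] }
  have hP : P = pr.flip W := by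
    refine bas.ext fun i => ?_
    change ∑ σ, (bas i σ).sum (fun j c => c * W σ j.opp) = pr (bas i) W
    rw [pr_bas_left, bas_apply, sum_eq_single i.1]
    · simp
    · intro σ _ hσ; simp [hσ]
    · simp
  unfold pair
  simp only [sum_single_tp]
  exact DFunLike.congr_fun hP V

theorem pr_bas_right (V : VTP) (i : Idx) : pr V (bas i) = V i.1 i.2.opp := by
  have : pr.flip (bas i) = bas.coord ⟨i.1, i.2.opp⟩ := by
    refine bas.ext fun k => ?_
    rw [LinearMap.flip_apply, pr_bas_left, Module.Basis.coord_apply, bas_repr, bas_apply_apply,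
      bas_apply_apply]
    have h2 : (i.2 = k.2.opp) ↔ (k.2 = i.2.opp) :=
      ⟨fun h => by rw [h, Freq.opp_opp], fun h => by rw [h, Freq.opp_opp]⟩
    have h1 : (i.1 = k.1) ↔ (k.1 = i.1) := eq_comm
    simp only [h1, h2]
  have h := DFunLike.congr_fun this V
  simpa using h

theorem pr_ext {V W : VTP} (h : ∀ X, pr V X = pr W X) : V = W := by
  refine vtp_ext fun i => ?_
  have := h (bas ⟨i.1, i.2.opp⟩)
  simpa [pr_bas_right] using this

/-- The operator `E_c` on trigonometric polynomials. -/
def EcL : VTP →ₗ[ℂ] VTP where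
  toFun V := ![(-Complex.I) • V 1, Complex.I • V 0]
  map_add' V W := by funext σ; fin_cases σ <;> simp
  map_smul' c V := by funext σ; fin_cases σ <;> simp [smul_comm c]

theorem toVec_EcL (V : VTP) : (EcL V).toVec = Ec V.toVec := by
  funext σ j
  fin_cases σ <;> simp [EcL, Ec, VTP.toVec]

theorem EcL_EcL (V : VTP) : EcL (EcL V) = V := by
  refine vtp_ext fun i => ?_
  obtain ⟨σ, j⟩ := i
  fin_cases σ <;> simp [EcL, ← mul_assoc]

theorem EcL_apply_zero (V : VTP) (j : Freq) : EcL V 0 j = -Complex.I * V 1 j := by simp [EcL]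
theorem EcL_apply_one (V : VTP) (j : Freq) : EcL V 1 j = Complex.I * V 0 j := by simp [EcL]

def om : VTP →ₗ[ℂ] VTP →ₗ[ℂ] ℂ := pr.comp EcL

theorem om_apply (V W : VTP) : om V W = pr (EcL V) W := rfl

theorem omega_toVec (V W : VTP) : Omega V.toVec W.toVec = om V W := by
  rw [Omega, ← toVec_EcL, pair_toVec, om_apply]

theorem om_bas (i k : Idx) : om (bas i) (bas k) =
    if i.1 ≠ k.1 ∧ i.2.1 + k.2.1 = 0 then (if i.1 = 0 then Complex.I else -Complex.I) else 0 := by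
  rw [om_apply, pr_bas_right]
  obtain ⟨σ, j⟩ := i
  obtain ⟨τ, l⟩ := k
  have h : (j = l.opp) ↔ j.1 + l.1 = 0 := by
    rw [Subtype.ext_iff]; change j.1 = -l.1 ↔ _; omega
  fin_cases σ <;> fin_cases τ <;> simp [EcL_apply_zero, EcL_apply_one, bas_apply_apply, h]

theorem om_antisymm (V W : VTP) : om V W = -om W V := by
  have : om = -om.flip := by
    refine bas.ext fun i => bas.ext fun k => ?_
    rw [LinearMap.neg_apply, LinearMap.neg_apply, LinearMap.flip_apply, om_bas, om_bas,
      add_comm k.2.1]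
    obtain ⟨σ, j⟩ := i
    obtain ⟨τ, l⟩ := k
    fin_cases σ <;> fin_cases τ <;> simp <;> (split_ifs <;> simp)
  conv_lhs => rw [this]
  rfl

/-- A bilinear map as a multilinear map. -/
def bil {N : Type*} [AddCommGroup N] [Module ℂ N] (L : VTP →ₗ[ℂ] VTP →ₗ[ℂ] N) : ML(Fin 2, N) where
  toFun v := L (v 0) (v 1)
  map_update_add' := by
    intro inst v i x y
    rw [Subsingleton.elim inst (instDecidableEqFin 2)]
    fin_cases i <;> simp
  map_update_smul' := by
    intro inst v i x y
    rw [Subsingleton.elim inst (instDecidableEqFin 2)]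
    fin_cases i <;> simp

theorem bil_apply {N : Type*} [AddCommGroup N] [Module ℂ N] (L : VTP →ₗ[ℂ] VTP →ₗ[ℂ] N)
    (v : Fin 2 → VTP) : bil L v = L (v 0) (v 1) := rfl

theorem good_om : Good (bil om) := by
  refine good_of_kernel _ (fun s => ⟨1, zero_le_one, 0, fun i => ?_⟩) (fun x i => ?_) fun i => ?_
  · rw [bil_apply, om_bas, nrm_complex]
    simp only [pow_zero, prod_const_one, mul_one]
    split_ifs <;> simp
  · rw [tr_complex, bil_apply, om_bas, prod_ph]
    split_ifs with h1 h2
    · simp [mom, h1.2]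
    · simp [mom, h1.2]
    · simp
  · rw [cj_complex, bil_apply, bil_apply, om_bas, om_bas]
    have hz : ((i 0).conj.2.1 + (i 1).conj.2.1 = 0) ↔ ((i 0).2.1 + (i 1).2.1 = 0) := by
      change -(i 0).2.1 + -(i 1).2.1 = 0 ↔ _; omega
    have hc : ∀ k : Idx, k.conj.1 = k.1.rev := fun k => rfl
    simp only [hz, hc]
    generalize (i 0).1 = σ
    generalize (i 1).1 = τ
    fin_cases σ <;> fin_cases τ <;> simp <;> split_ifs <;> simp

section postcomp

variable {α : Type*} [Fintype α] {A : ML(α, VTP)}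

theorem nrm_EcL (s : ℕ) (V : VTP) : nrm s (EcL V) ≤ nrm s V := by
  have h1 := nrm_expand_le s V
  exact h1
where
  nrm_expand_le (s : ℕ) (V : VTP) : nrm s (EcL V) ≤ nrm s V := by
    conv_lhs => rw [← sum_bas V, map_sum]
    rw [nrm_vtp s V]
    refine (nrm_sum_le _ _ _).trans (sum_le_sum fun i _ => ?_)
    rw [map_smul, nrm_smul, mul_comm]
    refine mul_le_mul_of_nonneg_right ?_ (norm_nonneg _)
    obtain ⟨σ, j⟩ := i
    have : EcL (bas ⟨σ, j⟩) = (if σ = 0 then Complex.I else -Complex.I) • bas ⟨σ.rev, j⟩ := by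
      refine vtp_ext fun k => ?_
      obtain ⟨τ, l⟩ := k
      fin_cases σ <;> fin_cases τ <;> simp [EcL_apply_zero, EcL_apply_one, bas_apply_apply] <;>
        split_ifs <;> simp
    rw [this, nrm_smul, nrm_bas]
    split_ifs <;> simp

theorem Good.ec (hA : Good A) : Good (EcL.compMultilinearMap A) := by
  refine ⟨fun s => ?_, fun x U => ?_, fun U => ?_⟩
  · obtain ⟨C, hC, s', h⟩ := hA.bd s
    exact ⟨C, hC, s', fun U => (nrm_EcL s _).trans (h U)⟩
  · rw [LinearMap.compMultilinearMap_apply, LinearMap.compMultilinearMap_apply, hA.tr]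
    generalize A U = V
    refine vtp_ext fun i => ?_
    obtain ⟨σ, j⟩ := i
    fin_cases σ <;> simp [EcL_apply_zero, EcL_apply_one, tr_vtp, transV] <;> ring
  · rw [LinearMap.compMultilinearMap_apply, LinearMap.compMultilinearMap_apply, hA.cj]
    generalize A U = V
    refine vtp_ext fun i => ?_
    obtain ⟨σ, j⟩ := i
    fin_cases σ <;> simp [EcL_apply_zero, EcL_apply_one, cj_vtp]

end postcomp

/-! ### Riesz representation of linear slots -/

section riesz

variable {k : ℕ}

def rieszKer (T : ML(Fin (k + 1), ℂ)) (i : Fin k → Idx) : VTP := if h : mom i ≠ 0 then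
    ∑ σ, T (snoc (fun a => bas (i a)) (bas ⟨σ, ⟨-mom i, neg_ne_zero.2 h⟩⟩)) • bas ⟨σ, ⟨mom i, h⟩⟩
  else 0

def riesz (T : ML(Fin (k + 1), ℂ)) : ML(Fin k, VTP) := mkMap (rieszKer T)

theorem snoc_bas (i : Fin k → Idx) (l : Idx) :
    (snoc (fun a => bas (i a)) (bas l) : Fin (k + 1) → VTP) =
      fun a => bas ((snoc i l : Fin (k + 1) → Idx) a) := by
  funext a
  refine lastCases ?_ (fun b => ?_) a <;> simp

theorem mom_snoc (i : Fin k → Idx) (l : Idx) :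
    mom (snoc i l : Fin (k + 1) → Idx) = mom i + l.2.1 := by
  simp [mom, Fin.sum_univ_castSucc]

theorem pr_rieszKer {T : ML(Fin (k + 1), ℂ)} (hT : Good T) (i : Fin k → Idx) (l : Idx) :
    pr (rieszKer T i) (bas l) = T (snoc (fun a => bas (i a)) (bas l)) := by
  by_cases hl : mom i + l.2.1 = 0
  · have h : mom i ≠ 0 := fun h => l.2.2 (by omega)
    have hl' : l.2 = ⟨-mom i, neg_ne_zero.2 h⟩ := Subtype.ext (by simp; omega)
    have hl2 : l.2.opp = ⟨mom i, h⟩ := Subtype.ext (by simp [Freq.opp]; omega)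
    rw [rieszKer, dif_pos h, map_sum, LinearMap.sum_apply, sum_eq_single l.1]
    · rw [map_smul, LinearMap.smul_apply, pr_bas_right, bas_apply_apply, if_pos ⟨rfl, hl2.symm⟩,
        smul_eq_mul, mul_one, ← hl']
    · intro σ _ hσ
      rw [map_smul, LinearMap.smul_apply, pr_bas_right, bas_apply_apply, if_neg (fun h => hσ h.1),
        smul_zero]
    · simp
  · have h0 : T (snoc (fun a => bas (i a)) (bas l)) = 0 := by
      rw [snoc_bas]
      by_contra hne
      exact hl (by rw [← mom_snoc]; exact hT.momentum_scalar _ hne)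
    rw [h0, rieszKer]
    split_ifs with h
    · rw [map_sum, LinearMap.sum_apply]
      refine sum_eq_zero fun σ _ => ?_
      rw [map_smul, LinearMap.smul_apply, pr_bas_right, bas_apply_apply, if_neg, smul_zero]
      rintro ⟨_, h2⟩
      apply hl
      have := congrArg Subtype.val h2
      simp [Freq.opp] at this
      omega
    · simp

theorem pr_riesz {T : ML(Fin (k + 1), ℂ)} (hT : Good T)
    (U : Fin k → VTP) (V : VTP) : pr (riesz T U) V = T (snoc U V) := by
  have : ((LinearMap.llcomp ℂ VTP (VTP →ₗ[ℂ] ℂ) (VTP →ₗ[ℂ] ℂ) LinearMap.id) pr).compMultilinearMap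
      (riesz T) = T.curryRight := by
    refine Module.Basis.ext_multilinear (fun _ => bas) fun i => bas.ext fun l => ?_
    change pr (riesz T fun a => bas (i a)) (bas l) = T (snoc (fun a => bas (i a)) (bas l))
    rw [← pr_rieszKer hT, riesz, mkMap_bas]
  have h := DFunLike.congr_fun (DFunLike.congr_fun this U) V
  exact h

theorem Good.riesz {T : ML(Fin (k + 1), ℂ)} (hT : Good T) : Good (riesz T) := by
  have hmom : ∀ (i : Fin k → Idx) (l : Idx), rieszKer T i l.1 l.2 ≠ 0 → l.2.1 = mom i := by
    intro i l hl
    have := pr_rieszKer hT i ⟨l.1, l.2.opp⟩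
    rw [pr_bas_right, Freq.opp_opp] at this
    rw [this, snoc_bas] at hl
    have := hT.momentum_scalar _ hl
    rw [mom_snoc] at this
    simp [Freq.opp] at this
    omega
  refine good_of_kernel _ (fun s => ?_) (fun x i => ?_) fun i => ?_
  · obtain ⟨C, hC, s', h⟩ := hT.kernel_bd 0
    refine ⟨2 * (C * (k : ℝ) ^ s' * (k : ℝ) ^ s), by positivity, s' + s' + s, fun i => ?_⟩
    rw [PluriHom.riesz, mkMap_bas]
    unfold rieszKer
    split_ifs with h0
    · refine (nrm_sum_le _ _ _).trans ?_
      have hw : ((mom i).natAbs : ℝ) ≤ k * ∏ a, ((i a).2.wt : ℝ) := by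
        have h1 := abs_mom_le i
        have h2 := sum_wt_le i
        rw [Fintype.card_fin] at h2
        have : (mom i).natAbs ≤ k * ∏ a, (i a).2.wt := by zify at h2 ⊢; omega
        exact_mod_cast this
      have hP : (0 : ℝ) ≤ ∏ a, ((i a).2.wt : ℝ) := by positivity
      have key : ∀ σ : Fin 2, nrm s (T (snoc (fun a => bas (i a))
          (bas ⟨σ, ⟨-mom i, neg_ne_zero.2 h0⟩⟩)) • bas ⟨σ, ⟨mom i, h0⟩⟩) ≤
          C * (k : ℝ) ^ s' * (k : ℝ) ^ s * ∏ a, ((i a).2.wt : ℝ) ^ (s' + s' + s) := by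
        intro σ
        rw [nrm_smul, nrm_bas, snoc_bas]
        have h3 := h (snoc i ⟨σ, ⟨-mom i, neg_ne_zero.2 h0⟩⟩)
        rw [nrm_complex, Fin.prod_univ_castSucc] at h3
        simp only [snoc_castSucc, snoc_last] at h3
        have e1 : (Freq.wt ⟨-mom i, neg_ne_zero.2 h0⟩ : ℝ) = (mom i).natAbs := by
          unfold Freq.wt; rw [Int.natAbs_neg]
        have e2 : (Freq.wt ⟨mom i, h0⟩ : ℝ) = (mom i).natAbs := rfl
        rw [e1] at h3
        rw [e2]
        rw [prod_pow] at h3 ⊢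
        calc _ ≤ (C * ((∏ a, ((i a).2.wt : ℝ)) ^ s' * (k * ∏ a, ((i a).2.wt : ℝ)) ^ s')) *
              (k * ∏ a, ((i a).2.wt : ℝ)) ^ s := by
              refine mul_le_mul (h3.trans ?_) ?_ (by positivity) (by positivity)
              · gcongr
              · gcongr
          _ = _ := by ring
      refine (sum_le_sum fun σ _ => key σ).trans ?_
      rw [sum_const, card_univ, Fintype.card_fin]
      simp only [nsmul_eq_mul, Nat.cast_ofNat]
      rw [← mul_assoc]
    · rw [nrm_zero]; positivity
  · rw [PluriHom.riesz, mkMap_bas]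
    exact tr_of_momentum x i _ (hmom i)
  · rw [PluriHom.riesz, mkMap_bas (rieszKer T) i, mkMap_bas (rieszKer T) fun a => (i a).conj]
    refine pr_ext fun X => ?_
    have e : pr (rieszKer T fun a => (i a).conj) = pr (PluriHom.cj (rieszKer T i)) := by
      refine bas.ext fun l => ?_
      rw [pr_rieszKer hT]
      have h1 := hT.kernel_cj (snoc i l.conj : Fin (k + 1) → Idx)
      have h2 : (fun a => bas ((snoc i l.conj : Fin (k + 1) → Idx) a).conj) =
          (snoc (fun a => bas (i a).conj) (bas l) : Fin (k + 1) → VTP) := by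
        funext a
        refine lastCases ?_ (fun b => ?_) a <;> simp
      rw [h2, ← snoc_bas, cj_complex, ← pr_rieszKer hT i l.conj] at h1
      rw [h1, pr_bas_right, pr_bas_right]
      rfl
    rw [e]

end riesz

end

section

/-! ### Polynomial maps: operator form, values and differentials -/

section poly

variable {Y : Type} [AddCommGroup Y] [Module ℂ Y] [Scale Y]

/-- Data of a polynomial map: its operator form `(U, V) ↦ C(U)V`, its values `U ↦ C(U)U` and its
differential `(U, V)`. -/
abbrev Tri (Y : Type) : Type := (VTP → VTP → Y) × (VTP → Y) × (VTP → VTP → Y)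

section tri

variable {α : Type} [Fintype α] [DecidableEq α]

def tri (a₀ : α) : ML(α, Y) →+ Tri Y where
  toFun A := (fun U V => A (update (fun _ => U) a₀ V), fun U => A fun _ => U,
    fun U V => ∑ a, A (update (fun _ => U) a V))
  map_zero' := by ext <;> simp
  map_add' A B := by ext <;> simp [sum_add_distrib]

/-- The differential of the one-form `U ↦ T(U, …, U; ·)`, the distinguished slot being `a₀`. -/
def d2 (a₀ : α) : ML(α, Y) →+ (VTP → VTP → VTP → Y) where
  toFun T := fun U V W => ∑ c ∈ univ.erase a₀, (T (update (update (fun _ => U) a₀ W) c V) -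
      T (update (update (fun _ => U) a₀ V) c W))
  map_zero' := by ext; simp
  map_add' A B := by
    ext
    simp only [_root_.add_apply, Pi.add_apply, ← sum_add_distrib]
    exact sum_congr rfl fun c _ => by abel

theorem exists_equiv_last (a₀ : α) : ∃ (k : ℕ) (e : α ≃ Fin (k + 1)), e a₀ = last k := by
  obtain ⟨k, hk⟩ : ∃ k, Fintype.card α = k + 1 :=
    Nat.exists_eq_succ_of_ne_zero (Fintype.card_pos_iff.2 ⟨a₀⟩).ne'
  let e := Fintype.equivFinOfCardEq hk
  exact ⟨k, e.trans (Equiv.swap (e a₀) (last k)), by simp⟩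

theorem update_comp_equiv' {β : Type} [DecidableEq β] (e : α ≃ β) (U : β → VTP) (a : α)
    (V : VTP) : (fun x => update U (e a) V (e x)) = update (fun x => U (e x)) a V := by
  funext x
  by_cases h : x = a
  · subst h; simp
  · rw [update_of_ne h, update_of_ne (e.injective.ne h)]

variable {β : Type} [Fintype β] [DecidableEq β]

theorem tri_domDomCongr (e : α ≃ β) (a₀ : α) (A : ML(α, Y)) :
    tri (e a₀) (A.domDomCongr e) = tri a₀ A := by
  ext U V
  · simp only [tri, AddMonoidHom.coe_mk, ZeroHom.coe_mk, MultilinearMap.domDomCongr_apply,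
      update_comp_equiv']
  · rfl
  · simp only [tri, AddMonoidHom.coe_mk, ZeroHom.coe_mk, MultilinearMap.domDomCongr_apply]
    refine (Fintype.sum_equiv e _ _ fun a => ?_).symm
    rw [update_comp_equiv']

theorem d2_domDomCongr (e : α ≃ β) (a₀ : α) (A : ML(α, Y)) :
    d2 (e a₀) (A.domDomCongr e) = d2 a₀ A := by
  ext U V W
  simp only [d2, AddMonoidHom.coe_mk, ZeroHom.coe_mk, MultilinearMap.domDomCongr_apply]
  refine (Finset.sum_nbij' e e.symm ?_ ?_ ?_ ?_ ?_).symm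
  · intro a ha; simpa using ha
  · intro b hb
    have : b ≠ e a₀ := by simpa using hb
    simpa [Equiv.symm_apply_eq] using this
  · simp
  · simp
  · intro a _
    simp only [update_comp_equiv']

end tri

/-- Sums of images of good multilinear maps with `k + 1` slots under additive maps `G k`. -/
def GSum {Z : Type} [AddCommMonoid Z] (G : ∀ k, ML(Fin (k + 1), Y) →+ Z) : AddSubmonoid Z :=
  AddSubmonoid.closure {z | ∃ (k : ℕ) (A : ML(Fin (k + 1), Y)), Good A ∧ z = G k A}

theorem GSum.graded {Z : Type} [AddCommMonoid Z]
    (G : ∀ k, ML(Fin (k + 1), Y) →+ Z) {z : Z} (hz : z ∈ GSum G) :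
    ∃ (M : ℕ) (A : ∀ k, ML(Fin (k + 1), Y)),
      (∀ k, Good (A k)) ∧ (∀ k ≥ M, A k = 0) ∧ z = ∑ k ∈ range M, G k (A k) := by
  induction hz using AddSubmonoid.closure_induction with
  | mem z hz =>
    obtain ⟨k, A, hA, rfl⟩ := hz
    refine ⟨k + 1, update (fun _ => 0) k A, fun l => ?_, fun l hl => ?_, ?_⟩
    · by_cases h : l = k
      · subst h; simpa using hA
      · rw [update_of_ne h]; exact Good.zero
    · rw [update_of_ne (by omega)]
    · rw [sum_range_succ, sum_eq_zero, zero_add, update_self]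
      intro l hl
      rw [update_of_ne (by simp at hl; omega), map_zero]
  | zero => exact ⟨0, fun _ => 0, fun _ => Good.zero, fun _ _ => rfl, by simp⟩
  | add x y _ _ hx hy =>
    obtain ⟨M₁, A₁, a₁, b₁, rfl⟩ := hx
    obtain ⟨M₂, A₂, a₂, b₂, rfl⟩ := hy
    refine ⟨max M₁ M₂, fun k => A₁ k + A₂ k, fun k => (a₁ k).add (a₂ k), fun k hk => ?_, ?_⟩
    · simp [b₁ k ((le_max_left _ _).trans hk), b₂ k ((le_max_right _ _).trans hk)]
    · simp only [map_add, sum_add_distrib]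
      congr 1
      · refine sum_subset (range_mono (le_max_left _ _)) fun k _ hk => ?_
        rw [b₁ k (by simpa using hk), map_zero]
      · refine sum_subset (range_mono (le_max_right _ _)) fun k _ hk => ?_
        rw [b₂ k (by simpa using hk), map_zero]

def Poly (Y : Type) [AddCommGroup Y] [Module ℂ Y] [Scale Y] : AddSubmonoid (Tri Y) :=
  GSum fun k => tri (last k)

theorem tri_mem {α : Type} [Fintype α] [DecidableEq α] (a₀ : α)
    {A : ML(α, Y)} (hA : Good A) : tri a₀ A ∈ Poly Y := by
  obtain ⟨k, e, he⟩ := exists_equiv_last a₀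
  refine AddSubmonoid.subset_closure ⟨k, A.domDomCongr e, hA.domDomCongr e, ?_⟩
  rw [← tri_domDomCongr e, he]

theorem Poly.smul {t : Tri Y} (ht : t ∈ Poly Y) (c : ℝ) : (c : ℂ) • t ∈ Poly Y := by
  induction ht using AddSubmonoid.closure_induction with
  | mem t ht =>
    obtain ⟨k, A, hA, rfl⟩ := ht
    refine AddSubmonoid.subset_closure ⟨k, (c : ℂ) • A, hA.smul c, ?_⟩
    ext U V
    · rfl
    · rfl
    · simp [tri, smul_sum]
  | zero => simp [(Poly Y).zero_mem]
  | add x y _ _ hx hy => rw [smul_add]; exact (Poly Y).add_mem hx hy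

theorem Poly.neg {t : Tri Y} (ht : t ∈ Poly Y) : -t ∈ Poly Y := by
  have := Poly.smul ht (-1)
  simpa using this

theorem Poly.sub {t u : Tri Y} (ht : t ∈ Poly Y) (hu : u ∈ Poly Y) : t - u ∈ Poly Y := by
  rw [sub_eq_add_neg]; exact (Poly Y).add_mem ht (Poly.neg hu)

/-- Substitution of polynomial maps in the slots of a multilinear map. -/
def subst {α : Type} [Fintype α] [DecidableEq α] (A : ML(α, Y))
    (a₀ : α) (t : α → Tri VTP) : Tri Y :=
  (fun U V => A (update (fun a => (t a).2.1 U) a₀ ((t a₀).1 U V)), fun U => A fun a => (t a).2.1 U,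
    fun U V => ∑ a, A (update (fun a => (t a).2.1 U) a ((t a).2.2 U V)))

theorem map_update_slot {α : Type} [Fintype α] [DecidableEq α] {Z : Type*} [AddCommGroup Z]
    (A : ML(α, Y)) (ℓ : α → Z →+ VTP) (t : α → Z) (a : α) (w : Z) :
    A (fun b => ℓ b (update t a w b)) = A (update (fun b => ℓ b (t b)) a (ℓ a w)) := by
  congr 1
  funext b
  by_cases h : b = a
  · subst h; simp
  · simp [h]

theorem subst_mem {α : Type} [Fintype α] [DecidableEq α]
    {A : ML(α, Y)} (hA : Good A) (a₀ : α) (t : α → Tri VTP)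
    (ht : ∀ a, t a ∈ Poly VTP) : subst A a₀ t ∈ Poly Y := by
  let ℓ₁ (U V : VTP) : Tri VTP →+ VTP := ⟨⟨fun t => t.1 U V, rfl⟩, fun _ _ => rfl⟩
  let ℓ₂ (U : VTP) : Tri VTP →+ VTP := ⟨⟨fun t => t.2.1 U, rfl⟩, fun _ _ => rfl⟩
  let ℓ₃ (U V : VTP) : Tri VTP →+ VTP := ⟨⟨fun t => t.2.2 U V, rfl⟩, fun _ _ => rfl⟩
  have key : ∀ (ℓ : VTP → VTP → Tri VTP →+ VTP) (a : α) (t : α → Tri VTP) (U V : VTP),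
      A (update (fun b => (t b).2.1 U) a (ℓ U V (t a))) =
        A fun b => (if b = a then ℓ U V else ℓ₂ U) (t b) := by
    intro ℓ a t U V
    congr 1
    funext b
    by_cases h : b = a
    · subst h; simp
    · rw [update_of_ne h, if_neg h]; rfl
  have e : ∀ t, subst A a₀ t = (fun U V => A fun b => (if b = a₀ then ℓ₁ U V else ℓ₂ U) (t b),
        fun U => A fun b => ℓ₂ U (t b),
        fun U V => ∑ a, A fun b => (if b = a then ℓ₃ U V else ℓ₂ U) (t b)) := by
    intro t
    refine Prod.ext (funext₂ fun U V => key ℓ₁ a₀ t U V) (Prod.ext rfl (funext₂ fun U V => ?_))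
    exact sum_congr rfl fun a _ => key ℓ₃ a t U V
  refine closure_slots (fun t => subst A a₀ t) (fun x a u v => ?_) (fun x a => ?_)
    (fun _ => {z | ∃ (k : ℕ) (B : ML(Fin (k + 1), VTP)),
      Good B ∧ z = tri (last k) B}) (Poly Y) (fun x hx => ?_) t ht
  · simp only [e]
    refine Prod.ext (funext₂ fun U V => ?_) (Prod.ext (funext fun U => ?_) (funext₂ fun U V => ?_))
    · change A _ = A _ + A _
      simp only [map_update_slot A fun b => if b = a₀ then ℓ₁ U V else ℓ₂ U]
      rw [map_add, A.map_update_add]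
    · change A _ = A _ + A _
      simp only [map_update_slot A fun _ => ℓ₂ U]
      rw [map_add, A.map_update_add]
    · change ∑ c, A _ = ∑ c, A _ + ∑ c, A _
      rw [← sum_add_distrib]
      refine sum_congr rfl fun c _ => ?_
      simp only [map_update_slot A fun b => if b = c then ℓ₃ U V else ℓ₂ U]
      rw [map_add, A.map_update_add]
  · simp only [e]
    refine Prod.ext (funext₂ fun U V => ?_) (Prod.ext (funext fun U => ?_) (funext₂ fun U V => ?_))
    · change A _ = 0
      simp only [map_update_slot A fun b => if b = a₀ then ℓ₁ U V else ℓ₂ U]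
      rw [map_zero, A.map_update_zero]
    · change A _ = 0
      simp only [map_update_slot A fun _ => ℓ₂ U]
      rw [map_zero, A.map_update_zero]
    · change ∑ c, A _ = 0
      refine sum_eq_zero fun c _ => ?_
      simp only [map_update_slot A fun b => if b = c then ℓ₃ U V else ℓ₂ U]
      rw [map_zero, A.map_update_zero]
  · choose k B hB hx using hx
    have hz : subst A a₀ x = tri (⟨a₀, last (k a₀)⟩ : Σ a, Fin (k a + 1))
        (A.compMultilinearMap B) := by
      have hup : ∀ (U V : VTP) (a : α) (b : Fin (k a + 1)),
          A.compMultilinearMap B (update (fun _ => U) ⟨a, b⟩ V) =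
            A (update (fun c => B c fun _ => U) a (B a (update (fun _ => U) b V))) := by
        intro U V a b
        rw [MultilinearMap.compMultilinearMap_apply]
        congr 1
        funext c
        by_cases h : c = a
        · subst h
          rw [update_self]
          congr 1
          funext d
          by_cases h' : d = b
          · subst h'
            change update (fun _ => U) (⟨c, d⟩ : Σ a, Fin (k a + 1)) V ⟨c, d⟩ = _
            simp
          · change update (fun _ => U) (⟨c, b⟩ : Σ a, Fin (k a + 1)) V ⟨c, d⟩ = _
            rw [update_of_ne h', update_of_ne (by simpa using h')]
        · rw [update_of_ne h]
          congr 1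
          funext d
          change update (fun _ => U) (⟨a, b⟩ : Σ a, Fin (k a + 1)) V ⟨c, d⟩ = _
          rw [update_of_ne (fun h' => h (congrArg Sigma.fst h'))]
      rw [show x = fun a => tri (last (k a)) (B a) from funext hx]
      refine Prod.ext (funext₂ fun U V => ?_) (Prod.ext (funext fun U => ?_)
        (funext₂ fun U V => ?_))
      · exact (hup U V a₀ (last (k a₀))).symm
      · rfl
      · refine Eq.symm ((Fintype.sum_sigma _).trans ?_)
        refine sum_congr rfl fun a _ => ?_
        simp only [hup]
        exact (A.map_update_sum univ a _ _).symm
    rw [hz]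
    exact tri_mem _ (hA.comp hB)

end poly

/-! ### The pull-back of the symplectic form is exact -/

theorem good_om_comp_update {k : Fin 2 → ℕ} (B : ∀ a, ML(Fin (k a + 1), VTP))
    (U : (Σ a, Fin (k a + 1)) → VTP) : (bil om).compMultilinearMap B U =
      om (B 0 fun b => U ⟨0, b⟩) (B 1 fun b => U ⟨1, b⟩) := rfl

theorem update_sigma_same {k : Fin 2 → ℕ} (U : (Σ a, Fin (k a + 1)) → VTP) (a : Fin 2)
    (b : Fin (k a + 1)) (V : VTP) : (fun d => update U ⟨a, b⟩ V ⟨a, d⟩) =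
      update (fun d => U ⟨a, d⟩) b V := by
  funext d
  by_cases h : d = b
  · subst h; simp
  · rw [update_of_ne h, update_of_ne (by simpa using h)]

theorem update_sigma_ne {k : Fin 2 → ℕ} (U : (Σ a, Fin (k a + 1)) → VTP) {a c : Fin 2}
    (hac : c ≠ a) (b : Fin (k a + 1)) (V : VTP) : (fun d => update U ⟨a, b⟩ V ⟨c, d⟩) =
      fun d => U ⟨c, d⟩ := by
  funext d
  rw [update_of_ne (fun h => hac (congrArg Sigma.fst h))]

theorem om_pullback_gen {k : Fin 2 → ℕ} (B : ∀ a, ML(Fin (k a + 1), VTP)) (U V W : VTP) :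
    ∑ b : Fin (k 1 + 1), d2 (⟨1, b⟩ : Σ a, Fin (k a + 1)) ((bil om).compMultilinearMap B) U V W =
      om (∑ a, B 0 (update (fun _ => U) a V)) (∑ b, B 1 (update (fun _ => U) b W))
      - om (∑ a, B 0 (update (fun _ => U) a W)) (∑ b, B 1 (update (fun _ => U) b V)) := by
  let S (V W : VTP) := ∑ b : Fin (k 1 + 1), ∑ b' : Fin (k 1 + 1), if b' = b then 0 else
    om (B 0 fun _ => U) (B 1 (update (update (fun _ => U) b W) b' V))
  have hS : ∀ V W, S V W = S W V := by
    intro V W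
    simp only [S]
    rw [sum_comm]
    refine sum_congr rfl fun b _ => sum_congr rfl fun b' _ => ?_
    by_cases h : b = b'
    · simp [h]
    · rw [if_neg h, if_neg (Ne.symm h), update_comm h]
  have hG : ∀ V W, ∑ b : Fin (k 1 + 1), ∑ c ∈ univ.erase (⟨1, b⟩ : Σ a, Fin (k a + 1)),
      (bil om).compMultilinearMap B (update (update (fun _ => U) ⟨1, b⟩ W) c V) =
      om (∑ a, B 0 (update (fun _ => U) a V)) (∑ b, B 1 (update (fun _ => U) b W)) + S V W := by
    intro V W
    rw [map_sum (om _), ← sum_add_distrib]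
    refine sum_congr rfl fun b _ => ?_
    rw [← Finset.filter_ne', sum_filter, Fintype.sum_sigma, sum_univ_two, map_sum,
      LinearMap.sum_apply]
    refine congrArg₂ (· + ·) ?_ ?_
    · refine sum_congr rfl fun a _ => ?_
      rw [if_pos (fun h => absurd (congrArg Sigma.fst h) (by simp)), good_om_comp_update,
        update_sigma_same, update_sigma_ne _ (by simp), update_sigma_ne _ (by simp),
        update_sigma_same]
    · refine sum_congr rfl fun b' _ => ?_
      by_cases h : b' = b
      · simp [h]
      · rw [if_pos (by simpa using h), if_neg h, good_om_comp_update, update_sigma_same,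
          update_sigma_ne _ (by simp), update_sigma_ne _ (by simp), update_sigma_same]
  simp only [d2, AddMonoidHom.coe_mk, ZeroHom.coe_mk, sum_sub_distrib]
  rw [hG, hG, hS W V]
  ring

theorem d2_mem {α : Type} [Fintype α] [DecidableEq α] (a₀ : α)
    {A : ML(α, ℂ)} (hA : Good A) :
    d2 a₀ A ∈ GSum (Y := ℂ) fun k => d2 (last k) := by
  obtain ⟨k, e, he⟩ := exists_equiv_last a₀
  refine AddSubmonoid.subset_closure ⟨k, A.domDomCongr e, hA.domDomCongr e, ?_⟩
  rw [← d2_domDomCongr e, he]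

theorem om_pullback {d : Tri VTP} (hd : d ∈ Poly VTP) : ∃ (M : ℕ) (T : ∀ k, ML(Fin (k + 1), ℂ)),
      (∀ k, Good (T k)) ∧ (∀ k ≥ M, T k = 0) ∧ ∀ U V W : VTP,
        om (d.2.2 U V) (d.2.2 U W) = ∑ k ∈ range M, d2 (last k) (T k) U V W := by
  have h : (fun U V W => om (d.2.2 U V) (d.2.2 U W) - om (d.2.2 U W) (d.2.2 U V)) ∈
      GSum (Y := ℂ) fun k => d2 (last k) := by
    refine closure_slots (M := fun _ : Fin 2 => Tri VTP) (fun x => fun U V W : VTP =>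
      om ((x 0).2.2 U V) ((x 1).2.2 U W) - om ((x 0).2.2 U W) ((x 1).2.2 U V))
      (fun x a u v => ?_) (fun x a => ?_)
      (fun _ => {z | ∃ (k : ℕ) (B : ML(Fin (k + 1), VTP)),
      Good B ∧ z = tri (last k) B}) _ (fun x hx => ?_) (fun _ => d) fun _ => hd
    · funext U V W
      fin_cases a <;> simp <;> ring
    · funext U V W
      fin_cases a <;> simp
    · choose k B hB hx using hx
      have := AddSubmonoid.sum_mem (GSum (Y := ℂ) fun k => d2 (last k)) (t := univ)
        (f := fun b => d2 (⟨1, b⟩ : Σ a, Fin (k a + 1)) ((bil om).compMultilinearMap B))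
        fun b _ => d2_mem _ (good_om.comp hB)
      convert this using 1
      funext U V W
      rw [Finset.sum_apply, Finset.sum_apply, Finset.sum_apply, om_pullback_gen, hx 0, hx 1]
      rfl
  obtain ⟨M, T, h1, h2, h3⟩ := GSum.graded _ h
  refine ⟨M, fun k => (((1 / 2 : ℝ)) : ℂ) • T k, fun k => (h1 k).smul _, fun k hk => ?_,
    fun U V W => ?_⟩
  · simp [h2 k hk]
  · have h4 := congrFun (congrFun (congrFun h3 U) V) W
    rw [om_antisymm (d.2.2 U W), sub_neg_eq_add, Finset.sum_apply, Finset.sum_apply,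
      Finset.sum_apply] at h4
    have h5 : ∀ k, d2 (last k) ((((1 / 2 : ℝ)) : ℂ) • T k) U V W =
        (1 / 2 : ℂ) * d2 (last k) (T k) U V W := by
      intro k
      simp [d2, mul_sum, mul_sub]
    simp only [h5, ← mul_sum]
    linear_combination (1 / 2 : ℂ) * h4

end

section

/-! ### Exact forms and vanishing interactions -/

section forms

variable {k : ℕ}

theorem sum_erase_last {M : Type*} [AddCommGroup M] (f : Fin (k + 1) → M) :
    ∑ c ∈ univ.erase (last k), f c = ∑ a : Fin k, f a.castSucc := by
  rw [sum_erase_eq_sub (mem_univ _), Fin.sum_univ_castSucc, add_sub_cancel_right]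

theorem snoc_update_const (U V W : VTP) (a : Fin k) :
    (snoc (update (fun _ => U) a V) W : Fin (k + 1) → VTP) =
      update (update (fun _ => U) (last k) W) a.castSucc V := by
  funext c
  refine lastCases ?_ (fun b => ?_) c
  · rw [snoc_last, update_of_ne (castSucc_lt_last a).ne', update_self]
  · rw [snoc_castSucc]
    by_cases h : b = a
    · subst h; simp
    · rw [update_of_ne h, update_of_ne (fun h' => h (Fin.castSucc_injective _ h')),
        update_of_ne (castSucc_lt_last b).ne]

theorem d2_last (T : ML(Fin (k + 1), ℂ)) (U V W : VTP) :
    d2 (last k) T U V W = ∑ a : Fin k, T (snoc (update (fun _ => U) a V) W) -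
      ∑ a : Fin k, T (snoc (update (fun _ => U) a W) V) := by
  simp only [d2, AddMonoidHom.coe_mk, ZeroHom.coe_mk]
  rw [sum_erase_last (fun c => T (update (update (fun _ => U) (last k) W) c V)
    - T (update (update (fun _ => U) (last k) V) c W)),
    sum_sub_distrib]
  simp only [snoc_update_const]

theorem d2_smul {α : Type} [Fintype α] [DecidableEq α] (a₀ : α)
    (T : ML(α, ℂ)) (z : ℂ) (U V W : VTP) :
    d2 a₀ T (z • U) V W = z ^ (Fintype.card α - 2) • d2 a₀ T U V W := by
  simp only [d2, AddMonoidHom.coe_mk, ZeroHom.coe_mk, smul_sum]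
  refine sum_congr rfl fun c hc => ?_
  have hc' : a₀ ≠ c := (ne_of_mem_erase hc).symm
  rw [map_update_update_const_smul T z U W V hc', map_update_update_const_smul T z U V W hc',
    smul_sub]

/-- The differential of an exact one-form vanishes. -/
theorem sum_d2_eq_zero {α : Type} [Fintype α] [DecidableEq α]
    (T : ML(α, ℂ)) (U V W : VTP) : ∑ c, d2 c T U V W = 0 := by
  simp only [d2, AddMonoidHom.coe_mk, ZeroHom.coe_mk, sum_sub_distrib]
  rw [sub_eq_zero]
  have h : ∀ V W : VTP, ∑ c : α, ∑ e ∈ univ.erase c, T (update (update (fun _ => U) c W) e V) =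
      ∑ c : α, ∑ e : α, if e = c then 0 else
        T (update (update (fun _ => U) c W) e V) := by
    intro V W
    refine sum_congr rfl fun c _ => ?_
    rw [← Finset.filter_ne', sum_filter]
    refine sum_congr rfl fun e _ => ?_
    by_cases h : e = c <;> simp [h]
  rw [h, h, sum_comm]
  refine sum_congr rfl fun b _ => sum_congr rfl fun b' _ => ?_
  by_cases h : b = b'
  · simp [h]
  · rw [if_neg h, if_neg (Ne.symm h), update_comm h]

theorem om_eq_zero {V : VTP} (h : ∀ i, om V (bas i) = 0) : V = 0 := by
  have h1 : om V = 0 := bas.ext fun i => by simpa using h i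
  have h2 : EcL V = 0 := pr_ext fun X => by
    have := DFunLike.congr_fun h1 X
    simpa [om_apply] using this
  rw [← EcL_EcL V, h2, map_zero]

/-- The vector field of the one-form `-T`. -/
def field (T : ML(Fin (k + 1), ℂ)) : ML(Fin k, VTP) := EcL.compMultilinearMap (riesz (-T))

theorem om_field {T : ML(Fin (k + 1), ℂ)} (hT : Good T)
    (U : Fin k → VTP) (V : VTP) : om (field T U) V = -T (snoc U V) := by
  rw [field, LinearMap.compMultilinearMap_apply, om_apply, EcL_EcL, pr_riesz hT.neg]
  rfl

theorem om_field_deriv {T : ML(Fin (k + 1), ℂ)} (hT : Good T) (U V W : VTP) :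
    om (∑ a, field T (update (fun _ => U) a V)) W +
      om V (∑ a, field T (update (fun _ => U) a W)) = -d2 (last k) T U V W := by
  rw [om_antisymm V, map_sum, map_sum, LinearMap.sum_apply, LinearMap.sum_apply, d2_last]
  simp only [om_field hT, Finset.sum_neg_distrib]
  ring

/-- The one-form cohomologous to `T` obtained by subtracting half the differential of the part of
`T` whose distinguished slot carries a large share of the frequencies. -/
def wgt {α : Type} [Fintype α] (a₀ : α) (i : α → Idx) : ℝ :=
  if ∑ a, (i a).2.wt < 8 * (i a₀).2.wt then 1 else 0

def balanced (T : ML(Fin (k + 1), ℂ)) : ML(Fin (k + 1), ℂ) :=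
  T - ((1 / 2 : ℝ) : ℂ) • ∑ c, (wmap (wgt (last k)) T).domDomCongr (Equiv.swap c (last k))

theorem good_wgt {α : Type} [Fintype α] (a₀ : α) {T : ML(α, ℂ)}
    (hT : Good T) : Good (wmap (wgt a₀) T) := by
  refine hT.wmap _ (fun i => ?_) fun i => ?_
  · unfold wgt; split_ifs <;> simp
  · unfold wgt
    have : ∀ j : Idx, j.conj.2.wt = j.2.wt := fun j => Int.natAbs_neg _
    simp only [this]

theorem good_balanced {T : ML(Fin (k + 1), ℂ)} (hT : Good T) : Good (balanced T) := by
  rw [balanced, sub_eq_add_neg]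
  exact hT.add (Good.neg ((Good.sum _ _ fun c _ => (good_wgt _ hT).domDomCongr _).smul _))

theorem d2_real_smul {α : Type} [Fintype α] [DecidableEq α] (a₀ : α)
    (T : ML(α, ℂ)) (c : ℂ) : d2 a₀ (c • T) = c • d2 a₀ T := by
  funext U V W
  simp [d2, mul_sum, mul_sub]

theorem d2_swap (S : ML(Fin (k + 1), ℂ)) (c : Fin (k + 1)) :
    d2 (last k) (S.domDomCongr (Equiv.swap c (last k))) = d2 c S := by
  have := d2_domDomCongr (Equiv.swap c (last k)) c S
  rwa [Equiv.swap_apply_left] at this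

theorem d2_balanced (T : ML(Fin (k + 1), ℂ)) (U V W : VTP) :
    d2 (last k) (balanced T) U V W = d2 (last k) T U V W := by
  rw [balanced, map_sub, d2_real_smul, map_sum]
  simp only [d2_swap, Pi.sub_apply, Pi.smul_apply, Finset.sum_apply, sum_d2_eq_zero, smul_zero,
    sub_zero]

theorem balanced_interaction (T : ML(Fin (k + 1), ℂ)) (hT : Good T)
    {L M : ℕ} (hM : (k + 8) * L ≤ M) {U X Y : VTP} (hU : U ∈ lowS L) (hX : X ∈ highS M)
    (hY : Y ∈ highS M) :
    ∑ a : Fin k, balanced T (snoc (update (fun _ => U) a Y) X) =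
      ((1 / 2 : ℝ) : ℂ) * d2 (last k) T U Y X := by
  set l := last k
  set S := wmap (wgt l) T with hS
  let f : Fin (k + 1) → Fin (k + 1) → ℂ := fun e c =>
    T (update (update (fun _ => U) e X) c Y)
  have hker : ∀ e c, e ≠ c → S (update (update (fun _ => U) e X) c Y) =
      if e = l ∨ c = l then f e c else 0 := by
    intro e c hec
    let Q : Fin (k + 1) → Idx → Prop := fun a i =>
      if a = e ∨ a = c then M < i.2.wt else i.2.wt ≤ L
    have hQ : ∀ a, update (update (fun _ => U) e X) c Y a ∈ supS (Q a) := by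
      intro a
      by_cases h1 : a = c
      · subst h1; simpa [Q, highS] using hY
      · by_cases h2 : a = e
        · subst h2; simpa [Q, h1, highS] using hX
        · simpa [Q, h1, h2, lowS] using hU
    have hlow : ∀ i : Fin (k + 1) → Idx, (∀ a, Q a (i a)) →
        ∑ a ∈ (univ.erase c).erase e, (i a).2.wt ≤ k * L := by
      intro i hi
      refine (sum_le_card_nsmul _ _ L fun a ha => ?_).trans ?_
      · have := hi a
        simp only [mem_erase] at ha
        simpa [Q, ha.1, ha.2.1] using this
      · rw [smul_eq_mul]
        refine Nat.mul_le_mul_right _ ?_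
        rw [card_erase_of_mem (by simp [hec]), card_erase_of_mem (mem_univ _)]
        simp
    have hsum : ∀ g : Fin (k + 1) → ℤ, ∑ a, g a =
        g c + (g e + ∑ a ∈ (univ.erase c).erase e, g a) := by
      intro g
      rw [add_sum_erase _ g (by simp [hec]), add_sum_erase _ g (mem_univ _)]
    split_ifs with h
    · rw [← sub_eq_zero]
      refine eq_zero_of_kernel (S - T) Q (fun i hi => ?_) _ hQ
      rw [_root_.sub_apply, hS, wmap_bas]
      by_cases h0 : T (fun a => bas (i a)) = 0
      · simp [h0]
      · have hm := hT.momentum_scalar i h0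
        rw [mom, hsum] at hm
        have hl := hlow i hi
        have h1 : |∑ a ∈ (univ.erase c).erase e, (i a).2.1| ≤
            ∑ a ∈ (univ.erase c).erase e, ((i a).2.wt : ℤ) :=
          (abs_sum_le_sum_abs _ _).trans_eq
            (sum_congr rfl fun a _ => by rw [Freq.wt, Int.natCast_natAbs])
        have hs := hsum fun a => ((i a).2.wt : ℤ)
        have hwe : M < (i e).2.wt := by simpa [Q] using hi e
        have hwc : M < (i c).2.wt := by simpa [Q] using hi c
        have e1 : ((i e).2.wt : ℤ) = |(i e).2.1| := by rw [Freq.wt, Int.natCast_natAbs]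
        have e2 : ((i c).2.wt : ℤ) = |(i c).2.1| := by rw [Freq.wt, Int.natCast_natAbs]
        have hw : wgt l i = 1 := by
          rw [wgt, if_pos]
          zify at hl hM hwe hwc ⊢
          rw [hs]
          rw [abs_le] at h1
          have hL : (0 : ℤ) ≤ L := by positivity
          rcases h with h | h
          · rw [← h]
            have : ((i c).2.wt : ℤ) ≤ (i e).2.wt + k * L := by
              rw [e1, e2]
              rcases abs_cases (i e).2.1 with h3 | h3 <;> rcases abs_cases (i c).2.1 with h4 | h4 <;>
                omega
            nlinarith
          · rw [← h]
            have : ((i e).2.wt : ℤ) ≤ (i c).2.wt + k * L := by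
              rw [e1, e2]
              rcases abs_cases (i e).2.1 with h3 | h3 <;> rcases abs_cases (i c).2.1 with h4 | h4 <;>
                omega
            nlinarith
        rw [hw]
        simp
    · refine eq_zero_of_kernel S Q (fun i hi => ?_) _ hQ
      rw [hS, wmap_bas, wgt, if_neg]
      · simp
      · have hle : (i e).2.wt ≤ ∑ a, (i a).2.wt :=
          single_le_sum (f := fun a => (i a).2.wt) (fun _ _ => Nat.zero_le _) (mem_univ e)
        have hwe : M < (i e).2.wt := by simpa [Q] using hi e
        have hl : (i l).2.wt ≤ L := by
          have := hi l
          rw [not_or] at h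
          simpa [Q, Ne.symm h.1, Ne.symm h.2] using this
        nlinarith
  have h1 : ∀ e : Fin (k + 1), ∑ a : Fin k, (S.domDomCongr (Equiv.swap e l))
      (snoc (update (fun _ => U) a Y) X) =
      ∑ c ∈ univ.erase e, if e = l ∨ c = l then f e c else 0 := by
    intro e
    simp only [snoc_update_const]
    rw [← sum_erase_last fun c => (S.domDomCongr (Equiv.swap e l))
      (update (update (fun _ => U) l X) c Y)]
    refine Finset.sum_nbij' (Equiv.swap e l) (Equiv.swap e l) ?_ ?_ (by simp) (by simp) ?_
    · intro c hc
      have : c ≠ l := by simpa using hc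
      simp only [mem_erase, mem_univ, and_true]
      intro h
      apply this
      rw [← (Equiv.swap e l).injective.eq_iff, h, Equiv.swap_apply_right]
    · intro c hc
      have : c ≠ e := by simpa using hc
      simp only [mem_erase, mem_univ, and_true]
      intro h
      apply this
      rw [← (Equiv.swap e l).injective.eq_iff]
      erw [h]
      rw [Equiv.swap_apply_left]
    · intro c hc
      have hcl : c ≠ l := by simpa using hc
      rw [← hker, MultilinearMap.domDomCongr_apply]
      · congr 1
        have h2 := update_comp_equiv' (Equiv.swap e l)
          (update (fun _ => U) e X) (Equiv.swap e l c) Y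
        have h3 := update_comp_equiv' (Equiv.swap e l) (update (fun _ => U) l X)
          (Equiv.swap e l c) Y
        funext b
        simp only [Function.update_apply]
        have e3 : (Equiv.swap e l b = c) ↔ b = Equiv.swap e l c := by
          rw [← (Equiv.swap e l).injective.eq_iff, Equiv.swap_apply_self]
        have e4 : (Equiv.swap e l b = l) ↔ b = e := by
          rw [← (Equiv.swap e l).injective.eq_iff, Equiv.swap_apply_self, Equiv.swap_apply_right]
        simp only [e3, e4]
      · intro h
        apply hcl
        rw [← (Equiv.swap e l).injective.eq_iff, ← h, Equiv.swap_apply_right]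
  simp only [balanced, _root_.sub_apply, _root_.smul_apply, _root_.sum_apply,
    sum_sub_distrib, smul_eq_mul, ← mul_sum]
  rw [sum_comm]
  simp only [← hS, ← show l = last k from rfl, h1]
  rw [← add_sum_erase _ _ (mem_univ l)]
  have h2 : ∑ e ∈ univ.erase l, ∑ c ∈ univ.erase e,
      (if e = l ∨ c = l then f e c else 0) = ∑ e ∈ univ.erase l, f e l := by
    refine sum_congr rfl fun e he => ?_
    have hel : e ≠ l := by simpa using he
    simp only [hel, false_or]
    rw [Finset.sum_ite_eq', if_pos (by simp [hel.symm])]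
  rw [h2]
  simp only [true_or, if_true]
  rw [d2_last]
  have h3 : ∑ a : Fin k, T (snoc (update (fun _ => U) a Y) X) = ∑ c ∈ univ.erase l, f l c := by
    rw [sum_erase_last]
    simp only [snoc_update_const]
    rfl
  have h4 : ∑ a : Fin k, T (snoc (update (fun _ => U) a X) Y) = ∑ e ∈ univ.erase l, f e l := by
    rw [sum_erase_last (fun e => f e l)]
    refine sum_congr rfl fun a _ => ?_
    rw [snoc_update_const, update_comm (castSucc_lt_last a).ne']
  rw [h3, h4]
  push_cast
  ring

end forms

end

section

/-! ### Symplectic correction of polynomial maps -/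

/-- The kernel of `R` is supported where the two largest frequencies are comparable. -/
def Balanced {k : ℕ} (R : ML(Fin k, VTP)) : Prop :=
  ∃ C : ℕ, ∀ (L : ℕ) (i : Fin k → Idx) (a : Fin k), (∀ b, b ≠ a → (i b).2.wt ≤ L) →
    C * L < (i a).2.wt → R (fun b => bas (i b)) = 0

theorem Good.symmz {α : Type} [Fintype α] [DecidableEq α] {Y : Type} [AddCommGroup Y] [Module ℂ Y]
    [Scale Y] {A : ML(α, Y)} (hA : Good A) : Good (symmz A) :=
  Good.smul _ (Good.sum _ _ fun π _ => hA.domDomCongr π)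

theorem map_snoc_const_eq_zero {q : ℕ} {A : ML(Fin (q + 1), VTP)}
    (hA : IsSymm A) {U Y : VTP} (h : ∑ a, A (update (fun _ => U) a Y) = 0) :
    A (snoc (fun _ : Fin q => U) Y) = 0 := by
  have h1 : ∀ a, A (update (fun _ => U) a Y) = A (snoc (fun _ : Fin q => U) Y) := by
    intro a
    rw [← hA (Equiv.swap a (last q))]
    congr 1
    funext b
    refine lastCases ?_ (fun c => ?_) b
    · simp
    · rw [snoc_castSucc]
      by_cases h : c.castSucc = a
      · rw [← h, Equiv.swap_apply_left, update_of_ne (castSucc_lt_last c).ne']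
      · rw [Equiv.swap_apply_of_ne_of_ne h (castSucc_lt_last c).ne, update_of_ne h]
  simp only [h1, sum_const, card_univ, Fintype.card_fin] at h
  rw [← Nat.cast_smul_eq_nsmul ℂ] at h
  exact (smul_eq_zero.1 h).resolve_left (by exact_mod_cast Nat.succ_ne_zero q)

def extendPerm {q : ℕ} (π : Equiv.Perm (Fin q)) : Equiv.Perm (Fin (q + 1)) where
  toFun := lastCases (last q) fun b => (π b).castSucc
  invFun := lastCases (last q) fun b => (π.symm b).castSucc
  left_inv a := by refine lastCases ?_ (fun b => ?_) a <;> simp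
  right_inv a := by refine lastCases ?_ (fun b => ?_) a <;> simp

theorem extendPerm_snoc {q : ℕ} (π : Equiv.Perm (Fin q)) {M : Type*} (U : Fin q → M) (Y : M) :
    (fun a => (snoc U Y : Fin (q + 1) → M) (extendPerm π a)) = snoc (fun a => U (π a)) Y := by
  funext a
  refine lastCases ?_ (fun b => ?_) a <;> simp [extendPerm]

theorem balanced_of_deriv {q : ℕ} {A : ML(Fin (q + 1), VTP)}
    (hA : IsSymm A) (C : ℕ) (h : ∀ L, ∀ U ∈ lowS L, ∀ Y ∈ highS (C * L),
      ∑ a, A (update (fun _ => U) a Y) = 0) : Balanced A := by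
  refine ⟨C, fun L i a hi ha => ?_⟩
  have hY : bas (i a) ∈ highS (C * L) := bas_mem_supS ha
  let A' : ML(Fin q, VTP) := (LinearMap.applyₗ (bas (i a))).compMultilinearMap A.curryRight
  have hA' : ∀ U, A' U = A (snoc U (bas (i a))) := fun U => rfl
  have h1 : ∀ U : Fin q → VTP, (∀ b, U b ∈ lowS L) → A' U = 0 := by
    refine polarization A' (fun π U => ?_) (lowS L) fun U hU => ?_
    · rw [hA', hA']
      rw [← hA (extendPerm π) (snoc U _), extendPerm_snoc]
    · rw [hA']
      exact map_snoc_const_eq_zero hA (h L U hU _ hY)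
  have h2 := h1 (fun b => bas (i (Equiv.swap a (last q) b.castSucc))) fun b => by
    refine bas_mem_supS (hi _ fun h => ?_)
    rw [Equiv.swap_apply_eq_iff, Equiv.swap_apply_left] at h
    exact (castSucc_lt_last b).ne h
  rw [hA', ← hA (Equiv.swap a (last q))] at h2
  rw [← h2]
  congr 1
  funext b
  generalize hc : Equiv.swap a (last q) b = c
  have hb : b = Equiv.swap a (last q) c := by rw [← hc, Equiv.swap_apply_self]
  rw [hb]
  refine lastCases ?_ (fun d => ?_) c <;> simp

/-- Orders of vanishing. -/
theorem map_sub_map_mem {Y : Type} [AddCommGroup Y] [Module ℂ Y] {α : Type} [Fintype α]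
    [DecidableEq α] (A : ML(α, Y)) (n : α → ℕ) (f g : α → ℂ → VTP)
    (hf : ∀ a, f a ∈ Pn (n a) VTP) (hg : ∀ a, g a ∈ Pn (n a) VTP)
    (h : ∀ a, (fun z => f a z - g a z) ∈ Pn (n a + 1) VTP) :
    (fun z => A (fun a => f a z) - A fun a => g a z) ∈ Pn (∑ a, n a + 1) Y := by
  suffices H : ∀ T : Finset α,
      (fun z => A (T.piecewise (fun a => f a z) fun a => g a z) - A fun a => g a z) ∈
        Pn (∑ a, n a + 1) Y by
    simpa using H univ
  intro T
  induction T using induction_on with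
  | empty => simpa using Pn.zero _
  | insert a T ha ih =>
    let x : α → ℂ → VTP := update (T.piecewise f g) a fun z => f a z - g a z
    have h1 : (fun z => A fun b => x b z) ∈ Pn (∑ b, (n b + if b = a then 1 else 0)) Y := by
      refine Pn.multilinear A _ x fun b => ?_
      by_cases hb : b = a
      · subst hb; simpa [x] using h b
      · simp only [x, update_of_ne hb, hb, if_false, add_zero]
        by_cases hT : b ∈ T
        · simpa [hT] using hf b
        · simpa [hT] using hg b
    rw [sum_add_distrib, Finset.sum_ite_eq', if_pos (mem_univ a)] at h1
    have := Pn.add h1 ih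
    convert this using 1
    funext z
    have e1 : (fun b => x b z) =
        update (T.piecewise (fun a => f a z) fun a => g a z) a (f a z - g a z) := by
      funext b
      by_cases hb : b = a
      · subst hb; simp [x]
      · by_cases hT : b ∈ T <;> simp [x, hb, hT]
    have e2 : (insert a T).piecewise (fun a => f a z) (fun a => g a z) =
        update (T.piecewise (fun a => f a z) fun a => g a z) a (f a z) :=
      Finset.piecewise_insert _ _ _ _
    have e3 : T.piecewise (fun a => f a z) (fun a => g a z) =
        update (T.piecewise (fun a => f a z) fun a => g a z) a (g a z) := by
      rw [← Finset.piecewise_eq_of_notMem T (fun a => f a z) (fun a => g a z) ha]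
      simp
    rw [e1, A.map_update_sub, e2]
    nth_rewrite 4 [e3]
    abel

def idT : Tri VTP := (fun _ V => V, fun U => U, fun _ V => V)

theorem idT_mem : idT ∈ Poly VTP := by
  let A : ML(Fin 1, VTP) := MultilinearMap.ofSubsingleton ℂ VTP VTP 0 LinearMap.id
  have hA : Good A := ⟨fun s => ⟨1, zero_le_one, s, fun U => by simp [A]⟩, fun x U => rfl,
    fun U => rfl⟩
  have := tri_mem (0 : Fin 1) hA
  convert this using 1
  refine Prod.ext (funext₂ fun U V => ?_) (Prod.ext (funext fun U => ?_) (funext₂ fun U V => ?_))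
  · simp [idT, tri, A]
  · simp [idT, tri, A]
  · simp [idT, tri, A]

/-- The polynomial map vanishes at order at least `n` (as an operator). -/
def OrdT (n : ℕ) (t : Tri VTP) : Prop :=
  ∀ U V, (fun z : ℂ => t.1 (z • U) V) ∈ Pn n VTP ∧ (fun z : ℂ => t.2.1 (z • U)) ∈ Pn (n + 1) VTP ∧
    (fun z : ℂ => t.2.2 (z • U) V) ∈ Pn n VTP

theorem OrdT.mono {m n : ℕ} (h : m ≤ n) {t : Tri VTP} (ht : OrdT n t) : OrdT m t := fun U V =>
  ⟨Pn.mono h (ht U V).1, Pn.mono (by omega) (ht U V).2.1, Pn.mono h (ht U V).2.2⟩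

theorem OrdT.add {n : ℕ} {t u : Tri VTP} (ht : OrdT n t) (hu : OrdT n u) : OrdT n (t + u) :=
  fun U V => ⟨Pn.add (ht U V).1 (hu U V).1, Pn.add (ht U V).2.1 (hu U V).2.1,
    Pn.add (ht U V).2.2 (hu U V).2.2⟩

theorem OrdT.zero (n : ℕ) : OrdT n 0 := fun _ _ => ⟨Pn.zero n, Pn.zero _, Pn.zero n⟩

theorem OrdT.sum {ι : Type*} {n : ℕ} (S : Finset ι) (f : ι → Tri VTP) (h : ∀ i ∈ S, OrdT n (f i)) :
    OrdT n (∑ i ∈ S, f i) := by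
  classical
  induction S using induction_on with
  | empty => simpa using OrdT.zero n
  | insert a S ha ih =>
    rw [sum_insert ha]
    exact (h a (by simp)).add (ih fun i hi => h i (by simp [hi]))

theorem ordT_tri {k : ℕ} (A : ML(Fin (k + 1), VTP)) : OrdT k (tri (last k) A) := by
  intro U V
  refine ⟨?_, ?_, ?_⟩
  · simp only [tri, AddMonoidHom.coe_mk, ZeroHom.coe_mk, map_update_const_smul]
    exact Pn.monomial _ (by simp) _
  · simp only [tri, AddMonoidHom.coe_mk, ZeroHom.coe_mk, map_const_smul]
    exact Pn.monomial _ (by simp) _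
  · simp only [tri, AddMonoidHom.coe_mk, ZeroHom.coe_mk, map_update_const_smul, ← smul_sum]
    exact Pn.monomial _ (by simp) _

theorem OrdT.val_sub {b : Tri VTP} (hord : OrdT 1 (b - idT)) (U : VTP) :
    (fun z : ℂ => b.2.1 (z • U) - z • U) ∈ Pn 2 VTP := (hord U 0).2.1

theorem OrdT.der_sub {b : Tri VTP} (hord : OrdT 1 (b - idT)) (U V : VTP) :
    (fun z : ℂ => b.2.2 (z • U) V - V) ∈ Pn 1 VTP := (hord U V).2.2

theorem OrdT.op_sub {b : Tri VTP} (hord : OrdT 1 (b - idT)) (U V : VTP) :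
    (fun z : ℂ => b.1 (z • U) V - V) ∈ Pn 1 VTP := (hord U V).1

theorem Pn.of_sub {n m : ℕ} {f g : ℂ → VTP} (h : (fun z => f z - g z) ∈ Pn n VTP) (hmn : m ≤ n)
    (hg : g ∈ Pn m VTP) : f ∈ Pn m VTP := by
  have := Pn.add (Pn.mono hmn h) hg
  simpa using this

theorem linear_mem (U : VTP) : (fun z : ℂ => z • U) ∈ Pn 1 VTP := by
  simpa using Pn.monomial 1 le_rfl U

/-- Orders of vanishing in a substitution: replacing a map tangent to the identity by the identity
produces an error of higher order. -/
theorem subst_sub_mem {Y : Type} [AddCommGroup Y] [Module ℂ Y] {k : ℕ} (A : ML(Fin (k + 1), Y))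
    {b : Tri VTP} (hord : OrdT 1 (b - idT)) (U : VTP) (a : Fin (k + 1)) (v : ℂ → VTP) (V : VTP)
    (hv : (fun z => v z - V) ∈ Pn 1 VTP) :
    (fun z : ℂ => A (update (fun _ => b.2.1 (z • U)) a (v z)) -
      z ^ k • A (update (fun _ => U) a V)) ∈ Pn (k + 1) Y := by
  have h1 := map_sub_map_mem A (fun c => if c = a then 0 else 1)
    (fun c => if c = a then v else fun z => b.2.1 (z • U))
    (fun c => if c = a then fun _ => V else fun z => z • U)
    (fun c => ?_) (fun c => ?_) (fun c => ?_)
  · have hs : ∑ c : Fin (k + 1), (if c = a then 0 else 1) = k := by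
      rw [← Finset.sum_erase_add _ _ (mem_univ a), if_pos rfl, add_zero,
        sum_congr rfl fun c hc => if_neg (ne_of_mem_erase hc)]
      simp
    rw [hs] at h1
    convert h1 using 1
    funext z
    congr 1
    · congr 1
      funext c
      by_cases h : c = a
      · subst h; simp
      · simp [h]
    · rw [show z ^ k = z ^ (Fintype.card (Fin (k + 1)) - 1) by simp, ← map_update_const_smul]
      congr 1
      funext c
      by_cases h : c = a
      · subst h; simp
      · simp [h]
  · by_cases h : c = a
    · simp only [h, if_true]; exact Pn.of_sub hv (by omega) (Pn.const V)
    · simp only [h, if_false]; exact Pn.of_sub (hord.val_sub U) (by omega) (linear_mem U)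
  · by_cases h : c = a
    · simp only [h, if_true]; exact Pn.const V
    · simp only [h, if_false]; exact linear_mem U
  · by_cases h : c = a
    · simp only [h, if_true]; exact hv
    · simp only [h, if_false]; exact hord.val_sub U

theorem om_pullback_scaled {d : Tri VTP} (hd : d ∈ Poly VTP) :
    ∃ (M : ℕ) (T : ∀ k, ML(Fin (k + 2), ℂ)),
      (∀ k, Good (T k)) ∧ (∀ k ≥ M, T k = 0) ∧ ∀ (U V W : VTP) (z : ℂ),
        om (d.2.2 (z • U) V) (d.2.2 (z • U) W) =
          ∑ k ∈ range M, z ^ k • d2 (last (k + 1)) (T k) U V W := by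
  obtain ⟨M, T, h1, h2, h3⟩ := om_pullback hd
  refine ⟨M, fun k => T (k + 1), fun k => h1 _, fun k hk => h2 _ (by omega), fun U V W z => ?_⟩
  rw [h3]
  have h0 : ∀ U V W, d2 (last 0) (T 0) U V W = 0 := fun U V W => by rw [d2_last]; simp
  have hM : d2 (last M) (T M) (z • U) V W = 0 := by rw [h2 M le_rfl, map_zero]; rfl
  rw [← add_zero (∑ k ∈ range M, d2 (last k) (T k) (z • U) V W), ← hM,
    ← sum_range_succ, sum_range_succ', h0, add_zero]
  refine sum_congr rfl fun k _ => ?_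
  rw [d2_smul, Fintype.card_fin]
  rfl

/-- The pulled back symplectic form, minus the symplectic form, as a polynomial in the scaling
parameter. -/
theorem om_pullback_coeff {d : Tri VTP} (hd : d ∈ Poly VTP) {q : ℕ} (hq : 1 ≤ q) :
    ∃ T : ML(Fin (q + 2), ℂ), Good T ∧ ∀ U V W : VTP,
      (∀ n > q, (fun z : ℂ => om (d.2.2 (z • U) V) (d.2.2 (z • U) W) - om V W) ∈ Pn n ℂ →
        d2 (last (q + 1)) T U V W = 0) ∧
      ((fun z : ℂ => om (d.2.2 (z • U) V) (d.2.2 (z • U) W) - om V W) ∈ Pn q ℂ →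
        (fun z : ℂ => om (d.2.2 (z • U) V) (d.2.2 (z • U) W) - om V W -
          z ^ q • d2 (last (q + 1)) T U V W) ∈ Pn (q + 1) ℂ) := by
  obtain ⟨M, T, h1, h2, h3⟩ := om_pullback_scaled hd
  refine ⟨T q, h1 q, fun U V W => ?_⟩
  let y : ℕ → ℂ := fun k => d2 (last (k + 1)) (T k) U V W - if k = 0 then om V W else 0
  have hT0 : ∀ k ≥ M, d2 (last (k + 1)) (T k) U V W = 0 := fun k hk => by
    rw [h2 k hk, map_zero]; rfl
  have hy : ∀ z : ℂ, om (d.2.2 (z • U) V) (d.2.2 (z • U) W) - om V W =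
      ∑ k ∈ range (M + q + 1), z ^ k • y k := by
    intro z
    simp only [y, smul_sub, sum_sub_distrib]
    congr 1
    · rw [h3]
      refine sum_subset (range_mono (by omega)) fun k _ hk => ?_
      rw [hT0 k (by simpa using hk), smul_zero]
    · simp
  have hyq : y q = d2 (last (q + 1)) (T q) U V W := by
    simp only [y]; rw [if_neg (by omega), sub_zero]
  refine ⟨fun n hn h => ?_, fun h => ?_⟩
  · simp only [hy] at h
    rw [← hyq]
    exact Pn.coeff_eq_zero h q (by omega) hn
  · have h' := h
    simp only [hy] at h'
    have h0 := Pn.coeff_eq_zero h'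
    simp only [hy]
    have : ∀ z : ℂ, ∑ k ∈ range (M + q + 1), z ^ k • y k - z ^ q • d2 (last (q + 1)) (T q) U V W =
        ∑ k ∈ (range (M + q + 1)).erase q, z ^ k • y k := by
      intro z
      rw [← hyq, sum_erase_eq_sub (by simp)]
    simp only [this]
    refine Pn.sum _ _ fun k hk => ?_
    simp only [mem_erase, mem_range] at hk
    rcases lt_or_gt_of_ne hk.1 with h | h
    · rw [h0 k hk.2 h]
      simpa using Pn.zero _
    · exact Pn.monomial _ (by omega) _

/-- `f` is symplectic up to order `n`. -/
def OmInv (n : ℕ) (f : VTP → VTP → VTP) : Prop :=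
  ∀ U V W, (fun z : ℂ => om (f (z • U) V) (f (z • U) W) - om V W) ∈ Pn n ℂ

/-- A polynomial map tangent to the identity, linearly symplectic up to order `N` and paradifferential
at high frequencies. -/
structure ParaLin (N : ℕ) (b : Tri VTP) : Prop where
  poly : b ∈ Poly VTP
  ord : OrdT 1 (b - idT)
  low : ∃ C : ℕ, ∀ L, ∀ U ∈ lowS L, b.2.1 U ∈ lowS (C * L)
  der : ∃ C : ℕ, ∀ L, ∀ U ∈ lowS L, ∀ V ∈ highS (C * L), b.2.2 U V = b.1 U V
  high : ∃ C : ℕ, ∀ L, ∀ U, ∀ V ∈ highS (C * L), b.1 U V ∈ highS L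
  lin : OmInv (N + 1) b.1

/-- The state of the correction procedure. -/
structure Corr (b : Tri VTP) (q : ℕ) (d : Tri VTP) : Prop where
  poly : d ∈ Poly VTP
  ord : OrdT 1 (d - idT)
  der : ∃ C : ℕ, ∀ L, ∀ U ∈ lowS L, ∀ V ∈ highS (C * L), d.2.2 U V = b.1 U V
  sym : OmInv q d.2.2

theorem exists_correction {N q : ℕ} (hq : 1 ≤ q) (hqN : q ≤ N) {b d : Tri VTP} (hb : ParaLin N b)
    (hd : Corr b q d) : ∃ R : ML(Fin (q + 1), VTP), Good R ∧ IsSymm R ∧ Balanced R ∧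
      Corr b (q + 1) (d + subst R (last q) fun _ => b) := by
  obtain ⟨T, hT, hT2⟩ := om_pullback_coeff hd.poly hq
  obtain ⟨C₀, hC₀⟩ := hd.der
  set F := field (balanced T) with hF
  have hFg : Good F := Good.ec ((good_balanced hT).neg.riesz)
  have hFd : ∀ U V W : VTP, om (∑ a, F (update (fun _ => U) a V)) W +
      om V (∑ a, F (update (fun _ => U) a W)) = -d2 (last (q + 1)) T U V W := by
    intro U V W
    rw [hF, om_field_deriv (good_balanced hT), d2_balanced]
  -- high-high interactions are absent
  have hzero : ∀ L, ∀ U ∈ lowS L, ∀ Y ∈ highS ((C₀ + q + 9 + q + 2) * L),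
      ∑ a, F (update (fun _ => U) a Y) = 0 := by
    intro L U hU Y hY
    refine om_eq_zero fun l => ?_
    rw [map_sum, LinearMap.sum_apply]
    simp only [hF, om_field (good_balanced hT), Finset.sum_neg_distrib, neg_eq_zero]
    by_cases hl : (C₀ + q + 9) * L < l.2.wt
    · have hY' : Y ∈ highS ((C₀ + q + 9) * L) := highS_anti (by nlinarith) hY
      have hX : bas l ∈ highS ((C₀ + q + 9) * L) := bas_mem_supS hl
      rw [balanced_interaction T hT (M := (C₀ + q + 9) * L) (by nlinarith) hU hX hY',
        (hT2 U Y (bas l)).1 (N + 1) (by omega) ?_, mul_zero]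
      have h1 := hb.lin U Y (bas l)
      convert h1 using 2 with z
      rw [hC₀ L (z • U) ((lowS L).smul_mem z hU) Y (highS_anti (by nlinarith) hY'),
        hC₀ L (z • U) ((lowS L).smul_mem z hU) _ (highS_anti (by nlinarith) hX)]
    · refine sum_eq_zero fun a _ => ?_
      refine eq_zero_of_kernel _ (fun c i => if c = a.castSucc then
        (C₀ + q + 9 + q + 2) * L < i.2.wt else if c = last (q + 1) then
          i.2.wt ≤ (C₀ + q + 9) * L else i.2.wt ≤ L) (fun i hi => ?_) _ fun c => ?_
      · by_contra hne
        have hm := (good_balanced hT).momentum_scalar i hne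
        rw [mom, ← add_sum_erase _ _ (mem_univ a.castSucc),
          ← add_sum_erase _ _ (show last (q + 1) ∈ univ.erase a.castSucc by
            simp [(castSucc_lt_last a).ne'])] at hm
        have h1 : |∑ c ∈ (univ.erase a.castSucc).erase (last (q + 1)), (i c).2.1| ≤ q * L := by
          refine (abs_sum_le_sum_abs _ _).trans
            ((sum_le_card_nsmul _ _ (L : ℤ) fun c hc => ?_).trans_eq ?_)
          · have := hi c
            simp only [mem_erase] at hc
            rw [if_neg hc.2.1, if_neg hc.1, Freq.wt] at this
            rw [Int.abs_eq_natAbs]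
            exact_mod_cast this
          · rw [card_erase_of_mem (by simp [(castSucc_lt_last a).ne']),
              card_erase_of_mem (mem_univ _)]
            simp
        have h2 := hi a.castSucc
        have h3 := hi (last (q + 1))
        rw [if_pos rfl, Freq.wt] at h2
        rw [if_neg (castSucc_lt_last a).ne', if_pos rfl, Freq.wt] at h3
        rw [abs_le] at h1
        zify at h2 h3
        have hL : (0 : ℤ) ≤ L := by positivity
        rcases abs_cases (i a.castSucc).2.1 with h4 | h4 <;>
          rcases abs_cases (i (last (q + 1))).2.1 with h5 | h5 <;> nlinarith
      · rw [snoc_update_const]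
        by_cases h1 : c = a.castSucc
        · subst h1; simpa [highS] using hY
        · by_cases h2 : c = last (q + 1)
          · subst h2
            simp only [h1, if_false, if_true, update_of_ne h1, update_self]
            exact bas_mem_supS (not_lt.1 hl)
          · simp only [h1, h2, if_false, update_of_ne h1, update_of_ne h2]
            exact hU
  set R := symmz F with hR
  have hRd : ∀ U V : VTP, ∑ a, R (update (fun _ => U) a V) =
      ∑ a, F (update (fun _ => U) a V) := symmz_deriv F
  have hRg : Good R := hFg.symmz
  have hRz : ∀ L, ∀ U ∈ lowS L, ∀ Y ∈ highS ((C₀ + q + 9 + q + 2) * L),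
      ∑ a, R (update (fun _ => U) a Y) = 0 := fun L U hU Y hY => by
    rw [hRd]; exact hzero L U hU Y hY
  refine ⟨R, hRg, symmz_symm F, balanced_of_deriv (symmz_symm F) _ hRz, ?_⟩
  have hr : ∀ U V, (fun z : ℂ => (subst R (last q) fun _ => b).2.2 (z • U) V -
      z ^ q • ∑ a, R (update (fun _ => U) a V)) ∈ Pn (q + 1) VTP := by
    intro U V
    have := Pn.sum univ _ fun a _ => subst_sub_mem R hb.ord U a _ V (hb.ord.der_sub U V)
    simpa [smul_sum, subst] using this
  refine ⟨?_, ?_, ?_, ?_⟩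
  · exact (Poly VTP).add_mem hd.poly (subst_mem hRg _ _ fun _ => hb.poly)
  · rw [add_sub_right_comm]
    refine hd.ord.add (OrdT.mono hq fun U V => ⟨?_, ?_, ?_⟩)
    · have := subst_sub_mem R hb.ord U (last q) _ V (hb.ord.op_sub U V)
      exact Pn.of_sub this (by omega) (Pn.monomial _ le_rfl _)
    · have := Pn.multilinear R (fun _ => 1) (fun _ z => b.2.1 (z • U)) fun _ =>
        Pn.of_sub (hb.ord.val_sub U) (by omega) (linear_mem U)
      simpa [subst] using this
    · exact Pn.of_sub (hr U V) (by omega) (Pn.monomial _ le_rfl _)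
  · obtain ⟨C₁, h₁⟩ := hb.low
    obtain ⟨C₂, h₂⟩ := hb.der
    obtain ⟨C₃, h₃⟩ := hb.high
    refine ⟨C₀ + C₂ + C₃ * ((C₀ + q + 9 + q + 2) * C₁), fun L U hU V hV => ?_⟩
    have e1 := hC₀ L U hU V (highS_anti (Nat.mul_le_mul_right _ (by omega)) hV)
    have e2 := h₂ L U hU V (highS_anti (Nat.mul_le_mul_right _ (by omega)) hV)
    have e3 := h₃ ((C₀ + q + 9 + q + 2) * (C₁ * L)) U V (highS_anti (by nlinarith) hV)
    rw [← e2] at e3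
    have e4 := hRz (C₁ * L) _ (h₁ L U hU) _ e3
    have : (subst R (last q) fun _ => b).2.2 U V = 0 := e4
    change d.2.2 U V + (subst R (last q) fun _ => b).2.2 U V = _
    rw [this, add_zero, e1]
  · intro U V W
    let r : ℂ → VTP → VTP := fun z V => (subst R (last q) fun _ => b).2.2 (z • U) V
    let ρ : VTP → VTP := fun V => ∑ a, R (update (fun _ => U) a V)
    have key := hFd U V W
    rw [← hRd, ← hRd] at key
    have h0 := (hT2 U V W).2 (hd.sym U V W)
    have hrV := hr U V
    have hrW := hr U W
    have hdV := hd.ord.der_sub U V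
    have hdW := hd.ord.der_sub U W
    have hrV' : (fun z => r z V) ∈ Pn q VTP := Pn.of_sub hrV (by omega) (Pn.monomial _ le_rfl _)
    have hrW' : (fun z => r z W) ∈ Pn q VTP := Pn.of_sub hrW (by omega) (Pn.monomial _ le_rfl _)
    have t1 := Pn.bilinear om hdV hrW'
    have t2 := Pn.bilinear om (Pn.const V) hrW
    have t3 := Pn.bilinear om hrV' hdW
    have t4 := Pn.bilinear om hrV (Pn.const W)
    have t5 := Pn.bilinear om hrV' hrW'
    have := Pn.add h0 (Pn.add (Pn.mono (by omega) t1) (Pn.add (Pn.mono (by omega) t2)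
      (Pn.add (Pn.mono (by omega) t3) (Pn.add (Pn.mono (by omega) t4)
        (Pn.mono (show q + 1 ≤ q + q by omega) t5)))))
    convert this using 1
    funext z
    change om (d.2.2 (z • U) V + r z V) (d.2.2 (z • U) W + r z W) - om V W = _
    have k2 : z ^ q • d2 (last (q + 1)) T U V W + om V (z ^ q • ρ W) + om (z ^ q • ρ V) W = 0 := by
      rw [map_smul, map_smul, LinearMap.smul_apply, ← smul_add, ← smul_add]
      have : d2 (last (q + 1)) T U V W + om V (ρ W) + om (ρ V) W = 0 := by
        linear_combination key
      rw [this, smul_zero]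
    change _ = _ - _ - _ + (om (d.2.2 (z • U) V - V) (r z W) + (om V (r z W - z ^ q • ρ W) +
      (om (r z V) (d.2.2 (z • U) W - W) + (om (r z V - z ^ q • ρ V) W + om (r z V) (r z W)))))
    simp only [map_add, map_sub, LinearMap.add_apply, LinearMap.sub_apply]
    linear_combination k2

theorem exists_symplectic_correction {p N : ℕ} (hp : 1 ≤ p) {b : Tri VTP}
    (hb : ParaLin N b) (hord : OrdT p (b - idT)) :
    ∃ R : ∀ q, ML(Fin (q + 1), VTP), (∀ q, Good (R q) ∧ IsSymm (R q) ∧ Balanced (R q)) ∧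
      ∀ n ≥ p, n ≤ N + 1 → Corr b n (b + ∑ q ∈ Ico p n, subst (R q) (last q) fun _ => b) := by
  suffices H : ∀ n ≥ p, n ≤ N + 1 → ∃ R : ∀ q, ML(Fin (q + 1), VTP),
        (∀ q, Good (R q) ∧ IsSymm (R q) ∧ Balanced (R q)) ∧ ∀ m ≥ p, m ≤ n →
        Corr b m (b + ∑ q ∈ Ico p m, subst (R q) (last q) fun _ => b) by
    by_cases h : p ≤ N + 1
    · exact H (N + 1) h le_rfl
    · obtain ⟨R, h1, -⟩ : ∃ R : ∀ q, ML(Fin (q + 1), VTP),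
        (∀ q, Good (R q) ∧ IsSymm (R q) ∧ Balanced (R q)) ∧ True :=
          ⟨fun _ => 0, fun q => ⟨Good.zero, fun _ _ => rfl, 0, fun _ _ _ _ _ => rfl⟩, trivial⟩
      exact ⟨R, h1, fun n hn hn' => absurd (hn.trans hn') h⟩
  intro n hn
  induction n, hn using Nat.le_induction with
  | base =>
    intro _
    refine ⟨fun _ => 0, fun q => ⟨Good.zero, fun _ _ => rfl, 0, fun _ _ _ _ _ => rfl⟩,
      fun m hm hm' => ?_⟩
    obtain rfl := le_antisymm hm' hm
    rw [Finset.Ico_self, Finset.sum_empty, add_zero]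
    refine ⟨hb.poly, hb.ord, hb.der, fun U V W => ?_⟩
    have t1 := Pn.bilinear om (hord U V).2.2 (Pn.const W)
    have t2 := Pn.bilinear om (Pn.const V) (hord U W).2.2
    have t3 := Pn.bilinear om (hord U V).2.2 (hord U W).2.2
    have := Pn.add (Pn.mono (by omega) t1) (Pn.add (Pn.mono (by omega) t2)
      (Pn.mono (show m ≤ m + m by omega) t3))
    convert this using 1
    funext z
    change _ = om (b.2.2 (z • U) V - V) W + (om V (b.2.2 (z • U) W - W) +
      om (b.2.2 (z • U) V - V) (b.2.2 (z • U) W - W))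
    simp only [map_sub, LinearMap.sub_apply]
    ring
  | succ n hn ih =>
    intro hn'
    obtain ⟨R, h1, h2⟩ := ih (by omega)
    obtain ⟨S, s1, s2, s3, s4⟩ := exists_correction (by omega) (by omega) hb (h2 n hn le_rfl)
    have hsum : ∀ m ≤ n, ∑ q ∈ Ico p m, subst (update R n S q) (last q)
        (fun _ => b) = ∑ q ∈ Ico p m, subst (R q) (last q) fun _ => b := by
      intro m hm
      refine sum_congr rfl fun q hq => ?_
      rw [update_of_ne]
      simp at hq
      omega
    refine ⟨update R n S, fun q => ?_, fun m hm hm' => ?_⟩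
    · by_cases h : q = n
      · subst h; simpa using ⟨s1, s2, s3⟩
      · rw [update_of_ne h]; exact h1 q
    · rcases Nat.le_succ_iff.1 hm' with h | rfl
      · rw [hsum m h]; exact h2 m hm h
      · rw [Finset.sum_Ico_succ_top hn, hsum n le_rfl, update_self, ← add_assoc]
        exact s4

end

section

/-! ### Graded polynomial maps and transported Hamiltonians -/

section graded

variable {Y : Type} [AddCommGroup Y] [Module ℂ Y] [Scale Y]

theorem Pn.apply {M : Type*} [AddCommGroup M] [Module ℂ M] {m n : ℕ} (F : ℂ → VTP →ₗ[ℂ] M)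
    (hF : ∀ V, (fun z => F z V) ∈ Pn n M) {v : ℂ → VTP} (hv : v ∈ Pn m VTP) :
    (fun z => F z (v z)) ∈ Pn (n + m) M := by
  induction hv using AddSubmonoid.closure_induction with
  | mem v hv =>
    obtain ⟨k, hk, y, rfl⟩ := hv
    have := Pn.smul (Pn.monomial m hk (1 : ℂ)) (hF y)
    rw [add_comm n m]
    simpa using this
  | zero => simpa using Pn.zero _
  | add f g _ _ hf hg => simpa using Pn.add hf hg

theorem Poly.exists_der {t : Tri Y} (ht : t ∈ Poly Y) (U : VTP) :
    ∃ F : VTP →ₗ[ℂ] Y, ∀ V, t.2.2 U V = F V := by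
  induction ht using AddSubmonoid.closure_induction with
  | mem t ht =>
    obtain ⟨k, A, -, rfl⟩ := ht
    refine ⟨∑ a, A.toLinearMap (fun _ => U) a, fun V => ?_⟩
    simp [tri]
  | zero => exact ⟨0, fun V => rfl⟩
  | add x y _ _ hx hy =>
    obtain ⟨F, hF⟩ := hx
    obtain ⟨G, hG⟩ := hy
    exact ⟨F + G, fun V => by rw [LinearMap.add_apply, ← hF, ← hG]; rfl⟩

theorem tri_smul_val {k : ℕ} (A : ML(Fin (k + 1), Y)) (z : ℂ)
    (U : VTP) : (tri (last k) A).2.1 (z • U) = z ^ (k + 1) • (tri (last k) A).2.1 U := by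
  simp [tri, map_const_smul]

theorem tri_smul_op {k : ℕ} (A : ML(Fin (k + 1), Y)) (z : ℂ)
    (U V : VTP) : (tri (last k) A).1 (z • U) V = z ^ k • (tri (last k) A).1 U V := by
  simp [tri, map_update_const_smul]

theorem tri_smul_der {k : ℕ} (A : ML(Fin (k + 1), Y)) (z : ℂ)
    (U V : VTP) : (tri (last k) A).2.2 (z • U) V = z ^ k • (tri (last k) A).2.2 U V := by
  simp [tri, map_update_const_smul, smul_sum]

theorem Poly.sum_op {ι : Type*} (S : Finset ι) (f : ι → Tri Y) (U V : VTP) :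
    (∑ i ∈ S, f i).1 U V = ∑ i ∈ S, (f i).1 U V := by
  rw [Prod.fst_sum, Finset.sum_apply, Finset.sum_apply]

theorem Poly.sum_val {ι : Type*} (S : Finset ι) (f : ι → Tri Y) (U : VTP) :
    (∑ i ∈ S, f i).2.1 U = ∑ i ∈ S, (f i).2.1 U := by
  rw [Prod.snd_sum, Prod.fst_sum, Finset.sum_apply]

theorem Poly.sum_der {ι : Type*} (S : Finset ι) (f : ι → Tri Y) (U V : VTP) :
    (∑ i ∈ S, f i).2.2 U V = ∑ i ∈ S, (f i).2.2 U V := by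
  rw [Prod.snd_sum, Prod.snd_sum, Finset.sum_apply, Finset.sum_apply]

theorem Poly.normal {t : Tri Y} (ht : t ∈ Poly Y) {n : ℕ}
    (h : ∀ U, (fun z : ℂ => t.2.1 (z • U)) ∈ Pn (n + 1) Y) :
    ∃ (M : ℕ) (A : ∀ k, ML(Fin (k + 1), Y)),
      (∀ k, Good (A k)) ∧ (∀ k ≥ M, A k = 0) ∧ (∀ k < n, A k = 0) ∧
      t.2 = (∑ k ∈ range M, tri (last k) (A k)).2 ∧
      ((∀ U V, (fun z : ℂ => t.1 (z • U) V) ∈ Pn n Y) → t = ∑ k ∈ range M, tri (last k) (A k)) := by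
  obtain ⟨M, A, h1, h2, h3⟩ := GSum.graded _ ht
  have hval : ∀ k < n, ∀ U, A k (fun _ => U) = 0 := by
    intro k hk U
    by_cases hkM : k < M
    · have h4 := h U
      simp only [h3, Poly.sum_val, tri_smul_val] at h4
      have h5 := Pn.coeff_eq_zero (L := M + 1) (y := fun j => if j = 0 then 0 else
        (tri (last (j - 1)) (A (j - 1))).2.1 U) (n := n + 1) ?_ (k + 1) (by omega) (by omega)
      · exact h5
      · simpa [sum_range_succ'] using h4
    · rw [h2 k (by omega)]; rfl
  have hder : ∀ k < n, ∀ U V, ∑ a, A k (update (fun _ => U) a V) = 0 :=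
    fun k hk U V => deriv_eq_zero (A k) U V fun z => hval k hk _
  have e1 : t.2 = (∑ k ∈ range M, tri (last k) (if n ≤ k then A k else 0)).2 := by
    rw [h3]
    refine Prod.ext (funext fun U => ?_) (funext₂ fun U V => ?_)
    · rw [Poly.sum_val, Poly.sum_val]
      refine sum_congr rfl fun k _ => ?_
      split_ifs with hk
      · rfl
      · rw [map_zero]; exact hval k (by omega) U
    · rw [Poly.sum_der, Poly.sum_der]
      refine sum_congr rfl fun k _ => ?_
      split_ifs with hk
      · rfl
      · rw [map_zero]; exact hder k (by omega) U V
  refine ⟨M, fun k => if n ≤ k then A k else 0, fun k => ?_, fun k hk => ?_,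
    fun k hk => if_neg (by omega), e1, fun h' => Prod.ext (funext₂ fun U V => ?_) e1⟩
  · beta_reduce; split_ifs
    · exact h1 k
    · exact Good.zero
  · beta_reduce; rw [h2 k hk, ite_self]
  · rw [h3, Poly.sum_op, Poly.sum_op]
    refine sum_congr rfl fun k hk => ?_
    beta_reduce
    split_ifs with hk'
    · rfl
    · have h4 := h' U V
      simp only [h3, Poly.sum_op, tri_smul_op] at h4
      rw [map_zero]
      exact Pn.coeff_eq_zero h4 k (by simpa using hk) (by omega)

theorem Poly.der_mem {t : Tri Y} (ht : t ∈ Poly Y) {n : ℕ}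
    (h : ∀ U, (fun z : ℂ => t.2.1 (z • U)) ∈ Pn (n + 1) Y) (U V : VTP) :
    (fun z : ℂ => t.2.2 (z • U) V) ∈ Pn n Y := by
  obtain ⟨M, A, h1, h2, h3, h4, -⟩ := Poly.normal ht h
  simp only [h4, Poly.sum_der, tri_smul_der]
  refine Pn.sum _ _ fun k _ => ?_
  by_cases hk : k < n
  · simpa [h3 k hk] using Pn.zero n
  · exact Pn.monomial _ (by omega) _

theorem Poly.exists_der_val {t : Tri Y} (ht : t ∈ Poly Y) {X : Tri VTP} (hX : X ∈ Poly VTP) :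
    ∃ Q ∈ Poly Y, ∀ U, Q.2.1 U = t.2.2 U (X.2.1 U) := by
  induction ht using AddSubmonoid.closure_induction with
  | mem t ht =>
    obtain ⟨k, A, hA, rfl⟩ := ht
    refine ⟨∑ a, subst A (last k) (update (fun _ => idT) a X),
      AddSubmonoid.sum_mem _ fun a _ => subst_mem hA _ _ fun b => ?_, fun U => ?_⟩
    · by_cases h : b = a
      · subst h; simpa using hX
      · simpa [h] using idT_mem
    · rw [Poly.sum_val]
      refine sum_congr rfl fun a _ => ?_
      change A _ = A _
      congr 1
      funext b
      by_cases h : b = a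
      · subst h; simp
      · simp [h, idT]
  | zero => exact ⟨0, (Poly Y).zero_mem, fun U => rfl⟩
  | add x y _ _ hx hy =>
    obtain ⟨F, hF, hF'⟩ := hx
    obtain ⟨G, hG, hG'⟩ := hy
    exact ⟨F + G, (Poly Y).add_mem hF hG, fun U => by
      change F.2.1 U + G.2.1 U = _; rw [hF', hG']; rfl⟩

end graded

section hamiltonian

/-- The Hamiltonian vector field of the polynomial `U ↦ H(U, …, U)`. -/
def hamMap {k : ℕ} (H : ML(Fin (k + 2), ℂ)) : ML(Fin (k + 1), VTP) :=
  (((k + 2 : ℕ) : ℝ) : ℂ) • EcL.compMultilinearMap (riesz H)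

theorem good_hamMap {k : ℕ} {H : ML(Fin (k + 2), ℂ)} (hH : Good H) :
    Good (hamMap H) := Good.smul _ hH.riesz.ec

theorem IsSymm.sum_update {k : ℕ} {H : ML(Fin (k + 1), ℂ)}
    (hs : IsSymm H) (U V : VTP) : ∑ a, H (update (fun _ => U) a V) =
      ((k + 1 : ℕ) : ℂ) * H (snoc (fun _ : Fin k => U) V) := by
  have h1 : ∀ a, H (update (fun _ => U) a V) = H (snoc (fun _ : Fin k => U) V) := by
    intro a
    rw [← hs (Equiv.swap a (last k))]
    congr 1
    funext b
    refine lastCases ?_ (fun c => ?_) b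
    · simp
    · rw [snoc_castSucc]
      by_cases h : c.castSucc = a
      · rw [← h, Equiv.swap_apply_left, update_of_ne (castSucc_lt_last c).ne']
      · rw [Equiv.swap_apply_of_ne_of_ne h (castSucc_lt_last c).ne, update_of_ne h]
  simp [h1]

theorem om_hamMap {k : ℕ} {H : ML(Fin (k + 2), ℂ)} (hH : Good H) (hs : IsSymm H) (U V : VTP) :
    om (hamMap H fun _ => U) V = ∑ a, H (update (fun _ => U) a V) := by
  rw [hs.sum_update, hamMap, _root_.smul_apply, map_smul, LinearMap.smul_apply,
    LinearMap.compMultilinearMap_apply, om_apply, EcL_EcL, pr_riesz hH, smul_eq_mul,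
    Complex.ofReal_natCast]

/-- The polynomial `∑ H_k(U, …, U)` and its vector field. -/
def hamT (n : ℕ) (H : ∀ k, ML(Fin (k + 2), ℂ)) : Tri ℂ := ∑ k ∈ range n, tri (last (k + 1)) (H k)

def fieldT (n : ℕ) (H : ∀ k, ML(Fin (k + 2), ℂ)) : Tri VTP :=
  ∑ k ∈ range n, tri (last k) (hamMap (H k))

variable {n : ℕ} {H : ∀ k, ML(Fin (k + 2), ℂ)}

theorem hamT_mem (hH : ∀ k, Good (H k)) : hamT n H ∈ Poly ℂ :=
  AddSubmonoid.sum_mem _ fun _ _ => tri_mem _ (hH _)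

theorem fieldT_mem (hH : ∀ k, Good (H k)) : fieldT n H ∈ Poly VTP :=
  AddSubmonoid.sum_mem _ fun _ _ => tri_mem _ (good_hamMap (hH _))

theorem om_fieldT (hH : ∀ k, Good (H k)) (hs : ∀ k, IsSymm (H k)) (U V : VTP) :
    om ((fieldT n H).2.1 U) V = (hamT n H).2.2 U V := by
  rw [fieldT, hamT, Poly.sum_val, Poly.sum_der, map_sum, LinearMap.sum_apply]
  exact sum_congr rfl fun k _ => om_hamMap (hH k) (hs k) U V

theorem fieldT_val_mem (U : VTP) : (fun z : ℂ => (fieldT n H).2.1 (z • U)) ∈ Pn 1 VTP := by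
  simp only [fieldT, Poly.sum_val, tri_smul_val]
  exact Pn.sum _ _ fun k _ => Pn.monomial _ (by omega) _

theorem subst_der_sum (D : Tri VTP) (U V : VTP) :
    (∑ k ∈ range n, subst (H k) (last (k + 1)) fun _ => D).2.2 U V =
      (hamT n H).2.2 (D.2.1 U) (D.2.2 U V) := by
  rw [hamT, Poly.sum_der, Poly.sum_der]
  rfl

theorem subst_val_sum (D : Tri VTP) (U : VTP) :
    (∑ k ∈ range n, subst (H k) (last (k + 1)) fun _ => D).2.1 U = (hamT n H).2.1 (D.2.1 U) := by
  rw [hamT, Poly.sum_val, Poly.sum_val]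
  rfl

theorem exists_transported {D : Tri VTP} (hD : D ∈ Poly VTP) (hord : OrdT 1 (D - idT))
    (hH : ∀ k, Good (H k)) (m : ℕ) :
    ∃ H' : ∀ k, ML(Fin (k + 2), ℂ), (∀ k, Good (H' k)) ∧ (∀ k, IsSymm (H' k)) ∧
      ∀ U, (fun z : ℂ => (hamT m H').2.1 (D.2.1 (z • U)) - (hamT n H).2.1 (z • U)) ∈
        Pn (m + 2) ℂ := by
  induction m with
  | zero =>
    refine ⟨fun _ => 0, fun k => Good.zero, fun k _ _ => rfl, fun U => ?_⟩
    have : ∀ U, (hamT 0 fun k => (0 : ML(Fin (k + 2), ℂ))).2.1 U = 0 := fun U => by simp [hamT]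
    simp only [this]
    refine Pn.sub (Pn.zero _) ?_
    simp only [hamT, Poly.sum_val, tri_smul_val]
    exact Pn.sum _ _ fun k _ => Pn.monomial _ (by omega) _
  | succ m ih =>
    obtain ⟨G, g1, g2, g3⟩ := ih
    let t : Tri ℂ := (∑ k ∈ range m, subst (G k) (last (k + 1)) fun _ => D) - hamT n H
    have ht : t ∈ Poly ℂ := Poly.sub (AddSubmonoid.sum_mem _ fun k _ =>
      subst_mem (g1 k) _ _ fun _ => hD) (hamT_mem hH)
    have htv : ∀ U, t.2.1 U = (hamT m G).2.1 (D.2.1 U) - (hamT n H).2.1 U := fun U => by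
      rw [← subst_val_sum]; rfl
    obtain ⟨M, A, h1, h2, h3, h4, -⟩ := Poly.normal (n := m + 1) ht fun U => by
      simp only [htv]; exact g3 U
    let S : ML(Fin (m + 2), ℂ) := symmz (-A (m + 1))
    have hS : ∀ U, S (fun _ => U) = -A (m + 1) fun _ => U := fun U => symmz_diag _ _
    have hsum : ∀ U, (hamT (m + 1) (update G m S)).2.1 U = (hamT m G).2.1 U + S fun _ => U := by
      intro U
      rw [hamT, hamT, Poly.sum_val, Poly.sum_val, sum_range_succ, update_self]
      congr 1
      refine sum_congr rfl fun k hk => ?_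
      rw [update_of_ne (by simp at hk; omega)]
    refine ⟨update G m S, fun k => ?_, fun k => ?_, fun U => ?_⟩
    · by_cases h : k = m
      · subst h; simpa using (h1 _).neg.symmz
      · rw [update_of_ne h]; exact g1 k
    · by_cases h : k = m
      · subst h; simpa using symmz_symm _
      · rw [update_of_ne h]; exact g2 k
    · have e1 : (fun z : ℂ => S (fun _ => D.2.1 (z • U)) - z ^ (m + 2) • S fun _ => U) ∈
          Pn (m + 3) ℂ := by
        have := map_sub_map_mem S (fun _ => 1) (fun _ z => D.2.1 (z • U)) (fun _ z => z • U)
          (fun _ => Pn.of_sub (hord.val_sub U) (by omega) (linear_mem U)) (fun _ => linear_mem U)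
          fun _ => hord.val_sub U
        simpa [map_const_smul] using this
      have e2 : (fun z : ℂ => t.2.1 (z • U) + z ^ (m + 2) • S fun _ => U) ∈ Pn (m + 3) ℂ := by
        have e3 : ∀ z : ℂ, t.2.1 (z • U) = ∑ k ∈ range (M + m + 2),
            z ^ (k + 1) • A k fun _ => U := by
          intro z
          rw [h4, Poly.sum_val]
          simp only [tri_smul_val]
          refine sum_subset (range_mono (by omega)) fun k _ hk => ?_
          rw [h2 k (by simpa using hk), map_zero]
          simp
        simp only [e3, hS]
        have e4 : ∀ z : ℂ, ∑ k ∈ range (M + m + 2), z ^ (k + 1) • (A k fun _ => U) +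
            z ^ (m + 2) • -(A (m + 1) fun _ => U) =
            ∑ k ∈ (range (M + m + 2)).erase (m + 1), z ^ (k + 1) • A k fun _ => U := by
          intro z
          rw [sum_erase_eq_sub (by simp), smul_neg, sub_eq_add_neg]
        simp only [e4]
        refine Pn.sum _ _ fun k hk => ?_
        by_cases hk' : k < m + 1
        · simpa [h3 k hk'] using Pn.zero _
        · refine Pn.monomial _ ?_ _
          have := (mem_erase.1 hk).1
          omega
      have := Pn.add e1 e2
      convert this using 1
      funext z
      rw [hsum, htv]
      ring

theorem mem_Pn_of_om {v : ℂ → VTP} (hv : v ∈ Pn 0 VTP) {n : ℕ}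
    (h : ∀ V, (fun z => om (v z) V) ∈ Pn n ℂ) : v ∈ Pn n VTP := by
  obtain ⟨L, y, -, -, h3⟩ := Pn.normal hv
  have h4 : ∀ k < L, k < n → y k = 0 := by
    intro k hk hkn
    refine om_eq_zero fun i => ?_
    have h5 := h (bas i)
    simp only [h3, map_sum, LinearMap.sum_apply, map_smul, LinearMap.smul_apply] at h5
    exact Pn.coeff_eq_zero h5 k hk hkn
  rw [show v = fun z => ∑ k ∈ range L, z ^ k • y k from funext h3]
  refine Pn.sum _ _ fun k hk => ?_
  by_cases hkn : k < n
  · simpa [h4 k (by simpa using hk) hkn] using Pn.zero n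
  · exact Pn.monomial _ (by omega) _

/-- A polynomial map symplectic up to order `N` transports Hamiltonian fields to Hamiltonian fields
up to order `N`. -/
theorem transported_field {N : ℕ} {D : Tri VTP} (hD : D ∈ Poly VTP) (hord : OrdT 1 (D - idT))
    (hsym : OmInv (N + 1) D.2.2) (hH : ∀ k, Good (H k)) (hHs : ∀ k, IsSymm (H k)) :
    ∃ H' : ∀ k, ML(Fin (k + 2), ℂ), (∀ k, Good (H' k)) ∧ (∀ k, IsSymm (H' k)) ∧
      ∃ (M : ℕ) (P : ∀ k, ML(Fin (k + 1), VTP)),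
        (∀ k, Good (P k)) ∧ ∀ U, D.2.2 U ((fieldT n H).2.1 U) - (fieldT (N + 1) H').2.1 (D.2.1 U) =
          ∑ k ∈ Ico (N + 1) M, P k fun _ => U := by
  obtain ⟨H', g1, g2, g3⟩ := exists_transported (n := n) hD hord hH (N + 1)
  refine ⟨H', g1, g2, ?_⟩
  obtain ⟨Q, hQ, hQ'⟩ := Poly.exists_der_val hD (fieldT_mem (n := n) hH)
  let F' : Tri VTP := ∑ k ∈ range (N + 1), subst (hamMap (H' k)) (last k) fun _ => D
  have hF' : F' ∈ Poly VTP := AddSubmonoid.sum_mem _ fun k _ =>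
    subst_mem (good_hamMap (g1 k)) _ _ fun _ => hD
  have hF'v : ∀ U, F'.2.1 U = (fieldT (N + 1) H').2.1 (D.2.1 U) := by
    intro U
    rw [fieldT, Poly.sum_val, Poly.sum_val]
    rfl
  have hP : Q - F' ∈ Poly VTP := Poly.sub hQ hF'
  have hPv : ∀ U, (Q - F').2.1 U =
      D.2.2 U ((fieldT n H).2.1 U) - (fieldT (N + 1) H').2.1 (D.2.1 U) := by
    intro U
    rw [← hF'v, ← hQ']; rfl
  let t : Tri ℂ := (∑ k ∈ range (N + 1), subst (H' k) (last (k + 1)) fun _ => D) - hamT n H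
  have ht : t ∈ Poly ℂ := Poly.sub (AddSubmonoid.sum_mem _ fun k _ =>
    subst_mem (g1 k) _ _ fun _ => hD) (hamT_mem hH)
  have htd : ∀ U V, t.2.2 U V = om ((fieldT (N + 1) H').2.1 (D.2.1 U)) (D.2.2 U V) -
      om ((fieldT n H).2.1 U) V := fun U V => by
    rw [om_fieldT g1 g2, om_fieldT hH hHs, ← subst_der_sum]; rfl
  have h1 : ∀ U V, (fun z : ℂ => t.2.2 (z • U) V) ∈ Pn (N + 2) ℂ := Poly.der_mem ht fun U => by
      have := g3 U
      simp only [← subst_val_sum] at this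
      exact this
  choose F hF using Poly.exists_der hD
  have h2 : ∀ U V, (fun z : ℂ => om (D.2.2 (z • U) ((fieldT n H).2.1 (z • U))) (D.2.2 (z • U) V) -
      om ((fieldT n H).2.1 (z • U)) V) ∈ Pn (N + 2) ℂ := by
    intro U V
    have := Pn.apply (n := N + 1) (m := 1)
      (fun z : ℂ => (om.flip (D.2.2 (z • U) V)).comp (F (z • U)) - om.flip V) (fun W => ?_)
      (fieldT_val_mem (n := n) (H := H) U)
    · simpa [← hF] using this
    · simpa [← hF] using hsym U W V
  have h3 : ∀ U V, (fun z : ℂ => om ((Q - F').2.1 (z • U)) (D.2.2 (z • U) V)) ∈ Pn (N + 2) ℂ := by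
    intro U V
    have := Pn.sub (h2 U V) (h1 U V)
    convert this using 1
    funext z
    rw [htd, hPv, map_sub, LinearMap.sub_apply]
    ring
  have h4 : ∀ m ≤ N + 2, ∀ U, (fun z : ℂ => (Q - F').2.1 (z • U)) ∈ Pn m VTP := by
    intro m
    induction m with
    | zero =>
      intro _ U
      obtain ⟨M, A, -, -, h⟩ := GSum.graded _ hP
      rw [h]
      simp only [Poly.sum_val, tri_smul_val]
      exact Pn.sum _ _ fun k _ => Pn.monomial _ (by omega) _
    | succ m ih =>
      intro hm U
      refine mem_Pn_of_om (Pn.mono (Nat.zero_le _) (ih (by omega) U)) fun V => ?_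
      have e1 := Pn.bilinear om (ih (by omega) U) (hord.der_sub U V)
      have := Pn.sub (Pn.mono hm (h3 U V)) e1
      convert this using 1
      funext z
      rw [map_sub]
      ring
  obtain ⟨M, P, p1, p2, p3, p4, -⟩ := Poly.normal (n := N + 1) hP (h4 _ le_rfl)
  refine ⟨M, P, p1, fun U => ?_⟩
  rw [← hPv, p4, Poly.sum_val]
  symm
  refine sum_subset (fun k hk => by simp at hk ⊢; omega) fun k hk hk' => ?_
  rw [p3 k (by simp at hk hk'; omega)]
  rfl

end hamiltonian

end

section

/-! ### Sobolev norms -/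

def Idx.abs (i : Idx) : ℝ := |(i.2.1 : ℝ)|

theorem Idx.one_le_abs (i : Idx) : 1 ≤ i.abs := by
  unfold Idx.abs
  rw [← Int.cast_abs]
  exact_mod_cast Int.one_le_abs i.2.2

theorem Idx.abs_pos (i : Idx) : 0 < i.abs := zero_lt_one.trans_le i.one_le_abs

theorem Idx.abs_eq_wt (i : Idx) : i.abs = i.2.wt := by
  rw [Idx.abs, Freq.wt, Nat.cast_natAbs, Int.cast_abs]

def Vec.at (U : Vec) (i : Idx) : ℂ := U i.1 i.2

@[simp] theorem Vec.add_at (U V : Vec) (i : Idx) : Vec.at (U + V) i = U.at i + V.at i := rfl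
@[simp] theorem Vec.sub_at (U V : Vec) (i : Idx) : Vec.at (U - V) i = U.at i - V.at i := rfl
@[simp] theorem Vec.smul_at (c : ℂ) (U : Vec) (i : Idx) : Vec.at (c • U) i = c * U.at i := rfl
theorem Vec.ext_at {U V : Vec} (h : ∀ i, U.at i = V.at i) : U = V := funext₂ fun σ j => h ⟨σ, j⟩

def wseq (s : ℝ) (U : Vec) (i : Idx) : ℂ := ((i.abs ^ s : ℝ) : ℂ) * U.at i

theorem norm_wseq (s : ℝ) (U : Vec) (i : Idx) : ‖wseq s U i‖ = i.abs ^ s * ‖U.at i‖ := by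
  rw [wseq, norm_mul, Complex.norm_real, Real.norm_of_nonneg (by have := i.abs_pos; positivity)]

theorem norm_wseq_sq (s : ℝ) (U : Vec) (i : Idx) :
    ‖wseq s U i‖ ^ 2 = |(i.2.1 : ℝ)| ^ (2 * s) * ‖U i.1 i.2‖ ^ 2 := by
  rw [norm_wseq, mul_pow, ← Real.rpow_natCast (i.abs ^ s), ← Real.rpow_mul i.abs_pos.le]
  congr 2
  rw [mul_comm]
  norm_num

theorem memlp_two_iff {ι : Type*} (f : ι → ℂ) : Memℓp f 2 ↔ Summable fun i => ‖f i‖ ^ 2 := by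
  rw [memℓp_gen_iff (by norm_num)]
  simp

theorem inHV_iff {s : ℝ} {U : Vec} : InHV s U ↔ Memℓp (wseq s U) 2 := by
  rw [memlp_two_iff]
  simp only [norm_wseq_sq]
  rw [summable_sigma_of_nonneg (fun i => by positivity)]
  constructor
  · exact fun h => ⟨h, (hasSum_fintype _).summable⟩
  · exact fun h => h.1

/-- The model of `U` in `ℓ²`. -/
def toLp {s : ℝ} {U : Vec} (h : InHV s U) : lp (fun _ : Idx => ℂ) 2 := ⟨wseq s U, inHV_iff.1 h⟩

theorem hnorm_sq (s : ℝ) (u : Coef) :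
    hnorm s u ^ 2 = ∑' j : Freq, |(j.1 : ℝ)| ^ (2 * s) * ‖u j‖ ^ 2 :=
  Real.sq_sqrt (tsum_nonneg fun j => by positivity)

theorem hnormV_sq {s : ℝ} {U : Vec} (h : InHV s U) :
    hnormV s U ^ 2 = ∑' i : Idx, ‖wseq s U i‖ ^ 2 := by
  have hs := (memlp_two_iff _).1 (inHV_iff.1 h)
  rw [hnormV, Real.sq_sqrt (by positivity), hs.tsum_sigma, tsum_fintype]
  refine sum_congr rfl fun σ _ => ?_
  rw [hnorm_sq]
  exact tsum_congr fun j => (norm_wseq_sq s U ⟨σ, j⟩).symm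

theorem hnormV_nonneg (s : ℝ) (U : Vec) : 0 ≤ hnormV s U := Real.sqrt_nonneg _

theorem norm_toLp {s : ℝ} {U : Vec} (h : InHV s U) : ‖toLp h‖ = hnormV s U := by
  rw [← sq_eq_sq₀ (norm_nonneg _) (hnormV_nonneg _ _), hnormV_sq h]
  have := lp.norm_rpow_eq_tsum (p := 2) (by norm_num) (toLp h)
  simp only [ENNReal.toReal_ofNat, Real.rpow_ofNat] at this
  exact this

theorem wseq_add (s : ℝ) (U V : Vec) : wseq s (U + V) = wseq s U + wseq s V := by
  funext i; simp [wseq, mul_add]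

theorem wseq_smul (s : ℝ) (c : ℂ) (U : Vec) : wseq s (c • U) = c • wseq s U := by
  funext i; simp [wseq]; ring

theorem InHV.zero (s : ℝ) : InHV s 0 := fun _ => by simp [InH, summable_zero]

@[simp] theorem hnormV_zero (s : ℝ) : hnormV s 0 = 0 := by simp [hnormV, hnorm]

theorem InHV.add {s : ℝ} {U V : Vec} (hU : InHV s U) (hV : InHV s V) : InHV s (U + V) := by
  rw [inHV_iff, wseq_add]; exact (inHV_iff.1 hU).add (inHV_iff.1 hV)

theorem hnormV_add_le {s : ℝ} {U V : Vec} (hU : InHV s U) (hV : InHV s V) :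
    hnormV s (U + V) ≤ hnormV s U + hnormV s V := by
  rw [← norm_toLp hU, ← norm_toLp hV, ← norm_toLp (hU.add hV)]
  have : toLp (hU.add hV) = toLp hU + toLp hV := Subtype.ext (wseq_add s U V)
  rw [this]; exact norm_add_le _ _

theorem InHV.smul {s : ℝ} {U : Vec} (c : ℂ) (hU : InHV s U) : InHV s (c • U) := by
  rw [inHV_iff, wseq_smul]; exact (inHV_iff.1 hU).const_smul c

theorem hnormV_smul {s : ℝ} {U : Vec} (c : ℂ) (hU : InHV s U) :
    hnormV s (c • U) = ‖c‖ * hnormV s U := by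
  rw [← norm_toLp hU, ← norm_toLp (hU.smul c)]
  have : toLp (hU.smul c) = c • toLp hU := Subtype.ext (wseq_smul s c U)
  rw [this, norm_smul]

theorem InHV.neg {s : ℝ} {U : Vec} (hU : InHV s U) : InHV s (-U) := by
  simpa using hU.smul (-1)

theorem hnormV_neg {s : ℝ} {U : Vec} (hU : InHV s U) : hnormV s (-U) = hnormV s U := by
  simpa using hnormV_smul (-1) hU

theorem InHV.sub {s : ℝ} {U V : Vec} (hU : InHV s U) (hV : InHV s V) : InHV s (U - V) := by
  rw [sub_eq_add_neg]; exact hU.add hV.neg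

theorem hnormV_sub_le {s : ℝ} {U V : Vec} (hU : InHV s U) (hV : InHV s V) :
    hnormV s (U - V) ≤ hnormV s U + hnormV s V := by
  rw [sub_eq_add_neg, ← hnormV_neg hV]; exact hnormV_add_le hU hV.neg

theorem InHV.sum {ι : Type*} {s : ℝ} (S : Finset ι) {f : ι → Vec} (h : ∀ i ∈ S, InHV s (f i)) :
    InHV s (∑ i ∈ S, f i) := by
  classical
  induction S using induction_on with
  | empty => simpa using InHV.zero s
  | insert a S ha ih =>
    rw [sum_insert ha]
    exact (h a (by simp)).add (ih fun i hi => h i (by simp [hi]))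

theorem hnormV_sum_le {ι : Type*} {s : ℝ} (S : Finset ι) {f : ι → Vec}
    (h : ∀ i ∈ S, InHV s (f i)) : hnormV s (∑ i ∈ S, f i) ≤ ∑ i ∈ S, hnormV s (f i) := by
  classical
  induction S using induction_on with
  | empty => simp
  | insert a S ha ih =>
    rw [sum_insert ha, sum_insert ha]
    have h' : ∀ i ∈ S, InHV s (f i) := fun i hi => h i (by simp [hi])
    exact (hnormV_add_le (h a (by simp)) (InHV.sum S h')).trans (add_le_add le_rfl (ih h'))

theorem InHV.of_norm_le {s : ℝ} {U : Vec} {g : Idx → ℝ} (hg : Summable fun i => g i ^ 2)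
    (h : ∀ i, ‖wseq s U i‖ ≤ g i) : InHV s U ∧ hnormV s U ≤ Real.sqrt (∑' i, g i ^ 2) := by
  have h2 : ∀ i, ‖wseq s U i‖ ^ 2 ≤ g i ^ 2 := fun i => pow_le_pow_left₀ (norm_nonneg _) (h i) 2
  have h1 : Summable fun i => ‖wseq s U i‖ ^ 2 := hg.of_nonneg_of_le (fun i => by positivity) h2
  have h3 : InHV s U := inHV_iff.2 ((memlp_two_iff _).2 h1)
  refine ⟨h3, Real.le_sqrt_of_sq_le ?_⟩
  rw [hnormV_sq h3]
  exact h1.tsum_le_tsum h2 hg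

theorem wseq_mono {s' s : ℝ} (h : s' ≤ s) (U : Vec) (i : Idx) : ‖wseq s' U i‖ ≤ ‖wseq s U i‖ := by
  rw [norm_wseq, norm_wseq]
  exact mul_le_mul_of_nonneg_right (Real.rpow_le_rpow_of_exponent_le i.one_le_abs h) (norm_nonneg _)

theorem norm_wseq_succ (s : ℝ) (U : Vec) (i : Idx) :
    ‖wseq s U i‖ = i.abs ^ (-1 : ℝ) * ‖wseq (s + 1) U i‖ := by
  rw [norm_wseq, norm_wseq, ← mul_assoc, ← Real.rpow_add i.abs_pos]
  ring_nf

theorem InHV.mono {s' s : ℝ} (h : s' ≤ s) {U : Vec} (hU : InHV s U) : InHV s' U :=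
  (InHV.of_norm_le ((memlp_two_iff _).1 (inHV_iff.1 hU)) (wseq_mono h U)).1

theorem hnormV_mono {s' s : ℝ} (h : s' ≤ s) {U : Vec} (hU : InHV s U) :
    hnormV s' U ≤ hnormV s U := by
  refine (InHV.of_norm_le ((memlp_two_iff _).1 (inHV_iff.1 hU)) (wseq_mono h U)).2.trans_eq ?_
  rw [← hnormV_sq hU, Real.sqrt_sq (hnormV_nonneg _ _)]

theorem norm_wseq_le {s : ℝ} {U : Vec} (hU : InHV s U) (i : Idx) : ‖wseq s U i‖ ≤ hnormV s U := by
  rw [← norm_toLp hU]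
  exact lp.norm_apply_le_norm (by norm_num) (toLp hU) i

theorem coef_le {s : ℝ} {U : Vec} (hU : InHV s U) (i : Idx) :
    ‖U.at i‖ ≤ hnormV s U * i.abs ^ (-s) := by
  have := norm_wseq_le hU i
  rw [norm_wseq] at this
  rw [Real.rpow_neg i.abs_pos.le, ← div_eq_mul_inv, le_div_iff₀ (by have := i.abs_pos; positivity),
    mul_comm]
  exact this

theorem summable_abs_sq : Summable fun i : Idx => (i.abs ^ (-1 : ℝ)) ^ 2 := by
  rw [summable_sigma_of_nonneg (fun i => by positivity)]
  refine ⟨fun σ => ?_, (hasSum_fintype _).summable⟩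
  have h1 : Summable fun n : ℤ => |(n : ℝ)| ^ (-2 : ℝ) := by
    have := (Real.summable_one_div_int_pow (p := 2)).2 (by norm_num)
    refine this.congr fun n => ?_
    rw [Real.rpow_neg (abs_nonneg _), one_div]
    congr 1
    rw [← sq_abs]
    norm_cast
  have h2 := h1.comp_injective (i := fun j : Freq => j.1) Subtype.val_injective
  refine h2.congr fun j => ?_
  change |(j.1 : ℝ)| ^ (-2 : ℝ) = (|(j.1 : ℝ)| ^ (-1 : ℝ)) ^ 2
  rw [← Real.rpow_natCast, ← Real.rpow_mul (abs_nonneg _)]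
  norm_num

def c₀ : ℝ := Real.sqrt (∑' i : Idx, (i.abs ^ (-1 : ℝ)) ^ 2)

theorem c₀_nonneg : 0 ≤ c₀ := Real.sqrt_nonneg _

theorem inHV_of_coef {s B : ℝ} (hB : 0 ≤ B) {U : Vec} (h : ∀ i, ‖U.at i‖ ≤ B * i.abs ^ (-s)) :
    InHV (s - 1) U ∧ hnormV (s - 1) U ≤ B * c₀ := by
  have h1 : ∀ i, ‖wseq (s - 1) U i‖ ≤ B * i.abs ^ (-1 : ℝ) := by
    intro i
    rw [norm_wseq]
    have hp : 0 < i.abs ^ (s - 1) := Real.rpow_pos_of_pos i.abs_pos _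
    calc _ ≤ i.abs ^ (s - 1) * (B * i.abs ^ (-s)) := mul_le_mul_of_nonneg_left (h i) hp.le
      _ = B * (i.abs ^ (s - 1) * i.abs ^ (-s)) := by ring
      _ = _ := by rw [← Real.rpow_add i.abs_pos]; ring_nf
  have h2 : Summable fun i : Idx => (B * i.abs ^ (-1 : ℝ)) ^ 2 := by
    simp only [mul_pow]; exact summable_abs_sq.mul_left _
  obtain ⟨h3, h4⟩ := InHV.of_norm_le h2 h1
  refine ⟨h3, h4.trans_eq ?_⟩
  simp only [mul_pow]
  rw [tsum_mul_left, Real.sqrt_mul (by positivity), Real.sqrt_sq hB]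
  rfl

theorem inHV_of_l1 {s : ℝ} {U : Vec} (h : Summable fun i => ‖wseq s U i‖) :
    InHV s U ∧ hnormV s U ≤ ∑' i, ‖wseq s U i‖ := by
  have h1 : ∀ i, ‖wseq s U i‖ ≤ ∑' i, ‖wseq s U i‖ := fun i => h.le_tsum i fun _ _ => norm_nonneg _
  have h0 : 0 ≤ ∑' i, ‖wseq s U i‖ := tsum_nonneg fun _ => norm_nonneg _
  have h3 : ∀ i, ‖wseq s U i‖ ^ 2 ≤ (∑' i, ‖wseq s U i‖) * ‖wseq s U i‖ := fun i => by
    rw [sq]; exact mul_le_mul_of_nonneg_right (h1 i) (norm_nonneg _)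
  have h2 : Summable fun i => ‖wseq s U i‖ ^ 2 :=
    (h.mul_left _).of_nonneg_of_le (fun i => by positivity) h3
  have hU : InHV s U := inHV_iff.2 ((memlp_two_iff _).2 h2)
  refine ⟨hU, le_of_sq_le_sq ?_ h0⟩
  rw [hnormV_sq hU, sq]
  refine (h2.tsum_le_tsum h3 (h.mul_left _)).trans_eq tsum_mul_left
where
  le_of_sq_le_sq {a b : ℝ} (h : a ^ 2 ≤ b ^ 2) (hb : 0 ≤ b) : a ≤ b := abs_le_of_sq_le_sq' h hb |>.2

theorem l1_of_inHV {s : ℝ} {U : Vec} (hU : InHV (s + 1) U) :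
    Summable (fun i => ‖wseq s U i‖) ∧ ∑' i, ‖wseq s U i‖ ≤ c₀ * hnormV (s + 1) U := by
  have key := Real.summable_and_inner_le_Lp_mul_Lq_tsum_of_nonneg (p := 2) (q := 2)
    (Real.HolderConjugate.two_two) (f := fun i : Idx => i.abs ^ (-1 : ℝ))
    (g := fun i => ‖wseq (s + 1) U i‖) (fun i => (Real.rpow_pos_of_pos i.abs_pos _).le)
    (fun i => norm_nonneg _) (by simpa using summable_abs_sq)
    (by simpa using (memlp_two_iff _).1 (inHV_iff.1 hU))
  simp only [norm_wseq_succ s]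
  refine ⟨key.1, key.2.trans_eq ?_⟩
  rw [c₀, Real.sqrt_eq_rpow, ← Real.sqrt_sq (hnormV_nonneg (s + 1) U), hnormV_sq hU,
    Real.sqrt_eq_rpow]
  simp

theorem inHV_toVec (s : ℝ) (U : VTP) : InHV s U.toVec := by
  refine fun σ => summable_of_ne_finset_zero (s := (U σ).support) fun j hj => ?_
  have : U σ j = 0 := by simpa using hj
  simp [VTP.toVec, this]

/-! Scalar components. -/

def inc (σ : Fin 2) (u : Coef) : Vec := update 0 σ u

theorem inHV_inc {s : ℝ} {σ : Fin 2} {u : Coef} : InHV s (inc σ u) ↔ InH s u := by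
  have h0 : InH s 0 := by simp [InH, summable_zero]
  constructor
  · intro h
    simpa [inc] using h σ
  · intro h τ
    by_cases hτ : τ = σ
    · subst hτ; simpa [inc] using h
    · simpa [inc, hτ] using h0

theorem hnormV_inc {s : ℝ} {σ : Fin 2} {u : Coef} : hnormV s (inc σ u) = hnorm s u := by
  have h0 : hnorm s 0 = 0 := by simp [hnorm]
  have : ∑ τ, hnorm s (inc σ u τ) ^ 2 = hnorm s u ^ 2 := by
    rw [sum_eq_single σ]
    · simp [inc]
    · intro τ _ hτ; simp [inc, hτ, h0]
    · simp
  rw [hnormV, this]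
  exact Real.sqrt_sq (Real.sqrt_nonneg _)

theorem hnorm_nonneg (s : ℝ) (u : Coef) : 0 ≤ hnorm s u := Real.sqrt_nonneg _

theorem hnorm_le_hnormV (s : ℝ) (U : Vec) (σ : Fin 2) : hnorm s (U σ) ≤ hnormV s U := by
  refine Real.le_sqrt_of_sq_le ?_
  exact single_le_sum (f := fun σ => hnorm s (U σ) ^ 2) (fun _ _ => sq_nonneg _) (mem_univ σ)

theorem hnormV_le_sum (s : ℝ) (U : Vec) : hnormV s U ≤ hnorm s (U 0) + hnorm s (U 1) := by
  refine Real.sqrt_le_iff.2 ⟨add_nonneg (hnorm_nonneg _ _) (hnorm_nonneg _ _), ?_⟩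
  rw [sum_univ_two]
  nlinarith [mul_nonneg (hnorm_nonneg s (U 0)) (hnorm_nonneg s (U 1))]

/-! ### Local boundedness -/

/-- `f` is bounded in the Sobolev space of order `s` along the filter `l`. -/
def Bdd {β : Type*} (l : Filter β) (s : ℝ) (f : β → Vec) : Prop :=
  ∃ B, ∀ᶠ x in l, InHV s (f x) ∧ hnormV s (f x) ≤ B

section bdd

variable {β : Type*} {l : Filter β} {s : ℝ} {f g : β → Vec}

theorem Bdd.mono (h : Bdd l s f) {s' : ℝ} (hs : s' ≤ s) : Bdd l s' f :=
  h.imp fun _ h => h.mono fun _ h => ⟨h.1.mono hs, (hnormV_mono hs h.1).trans h.2⟩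

theorem Bdd.filter_mono (h : Bdd l s f) {l' : Filter β} (hl : l' ≤ l) : Bdd l' s f :=
  h.imp fun _ h => h.filter_mono hl

theorem Bdd.const {v : Vec} (h : InHV s v) : Bdd l s fun _ => v :=
  ⟨_, Eventually.of_forall fun _ => ⟨h, le_rfl⟩⟩

theorem Bdd.sub (hf : Bdd l s f) (hg : Bdd l s g) : Bdd l s fun x => f x - g x := by
  obtain ⟨B, hB⟩ := hf
  obtain ⟨B', hB'⟩ := hg
  refine ⟨B + B', ?_⟩
  filter_upwards [hB, hB'] with x h h'
  exact ⟨h.1.sub h'.1, (hnormV_sub_le h.1 h'.1).trans (add_le_add h.2 h'.2)⟩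

theorem Bdd.sum {ι : Type*} (S : Finset ι) {f : ι → β → Vec} (h : ∀ i ∈ S, Bdd l s (f i)) :
    Bdd l s fun x => ∑ i ∈ S, f i x := by
  choose! B hB using h
  refine ⟨∑ i ∈ S, B i, ?_⟩
  filter_upwards [(Filter.eventually_all_finset S).2 hB] with x hx
  exact ⟨InHV.sum S fun i hi => (hx i hi).1, (hnormV_sum_le S fun i hi => (hx i hi).1).trans
    (sum_le_sum fun i hi => (hx i hi).2)⟩

theorem Bdd.inHV {I : Set ℝ} {t : ℝ} {f : ℝ → Vec} (h : Bdd (𝓝[I] t) s f) (ht : t ∈ I) :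
    InHV s (f t) := by
  obtain ⟨B, hB⟩ := h
  exact (hB.self_of_nhdsWithin ht).1

theorem hnormV_tendsto_zero (hb : Bdd l (s + 1) f)
    (hc : ∀ i, Tendsto (fun x => (f x).at i) l (𝓝 0)) : Tendsto (fun x => hnormV s (f x)) l (𝓝 0) := by
  obtain ⟨B, hB⟩ := hb
  have h1 : Tendsto (fun x => ∑' i, ‖wseq s (f x) i‖ ^ 2) l (𝓝 (∑' _ : Idx, (0 : ℝ))) := by
    refine tendsto_tsum_of_dominated_convergence (summable_abs_sq.mul_right (B ^ 2)) (fun i => ?_)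
      (hB.mono fun x hx i => ?_)
    · simpa [norm_wseq] using ((hc i).norm.const_mul (i.abs ^ s)).pow 2
    · rw [Real.norm_of_nonneg (by positivity), norm_wseq_succ, mul_pow]
      gcongr
      exact (norm_wseq_le hx.1 i).trans hx.2
  rw [tsum_zero] at h1
  refine ((by simpa using h1.sqrt : Tendsto (fun x => √_) l (𝓝 0))).congr' (hB.mono fun x hx => ?_)
  rw [← hnormV_sq (hx.1.mono (by linarith)), Real.sqrt_sq (hnormV_nonneg _ _)]

theorem tendsto_at_of_hnormV (hh : ∀ᶠ x in l, InHV s (f x))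
    (h0 : Tendsto (fun x => hnormV s (f x)) l (𝓝 0)) (i : Idx) :
    Tendsto (fun x => (f x).at i) l (𝓝 0) := by
  have h1 := h0.mul_const (i.abs ^ (-s))
  rw [zero_mul] at h1
  exact squeeze_zero_norm' (hh.mono fun x hx => coef_le hx i) h1

/-- Difference quotients are bounded when the derivative is. -/
theorem slope_bound {I : Set ℝ} (hI : I.OrdConnected) {w w' : ℝ → Vec} {t : ℝ} (ht : t ∈ I)
    (hw : ∀ τ ∈ I, ∀ i, HasDerivWithinAt (fun τ => (w τ).at i) ((w' τ).at i) I τ)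
    (hb : Bdd (𝓝[I] t) s w') :
    Bdd (𝓝[I] t) (s - 1) fun τ => ((τ - t : ℝ) : ℂ)⁻¹ • (w τ - w t) := by
  obtain ⟨B, hB⟩ := hb
  obtain ⟨ε, hε, h⟩ := Metric.mem_nhdsWithin_iff.1 hB
  have hB : 0 ≤ B := (hnormV_nonneg _ _).trans (h ⟨Metric.mem_ball_self hε, ht⟩).2
  refine ⟨_, Metric.mem_nhdsWithin_iff.2 ⟨ε, hε, fun τ hτ => inHV_of_coef hB fun i => ?_⟩⟩
  have hp : ∀ i : Idx, 0 ≤ i.abs ^ (-s) := fun i => Real.rpow_nonneg i.abs_pos.le _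
  have key := ((convex_ball t ε).inter hI.convex).norm_image_sub_le_of_norm_hasDerivWithin_le
    (f := fun τ => (w τ).at i) (f' := fun τ => (w' τ).at i) (C := B * i.abs ^ (-s))
    (fun x hx => (hw x hx.2 i).mono Set.inter_subset_right) (fun x hx => (coef_le (h hx).1 i).trans
      (mul_le_mul_of_nonneg_right (h hx).2 (hp i))) ⟨Metric.mem_ball_self hε, ht⟩ hτ
  rw [Vec.smul_at, norm_mul, norm_inv, Complex.norm_real, Vec.sub_at]
  exact inv_mul_le_of_le_mul₀ (norm_nonneg _) (mul_nonneg hB (hp i)) (by rwa [mul_comm])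

theorem slope_tendsto {I : Set ℝ} (hI : I.OrdConnected) {w w' : ℝ → Vec} {t : ℝ} (ht : t ∈ I)
    (hw : ∀ τ ∈ I, ∀ i, HasDerivWithinAt (fun τ => (w τ).at i) ((w' τ).at i) I τ)
    (hb : Bdd (𝓝[I] t) (s + 2) w') :
    Bdd (𝓝[I \ {t}] t) (s + 1) (fun τ => ((τ - t : ℝ) : ℂ)⁻¹ • (w τ - w t) - w' t) ∧
      Tendsto (fun τ => hnormV s (((τ - t : ℝ) : ℂ)⁻¹ • (w τ - w t) - w' t)) (𝓝[I \ {t}] t)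
        (𝓝 0) := by
  have h : Bdd (𝓝[I \ {t}] t) (s + 1) fun τ => ((τ - t : ℝ) : ℂ)⁻¹ • (w τ - w t) - w' t :=
    (((slope_bound hI ht hw hb).mono (by linarith)).sub
      (.const ((hb.inHV ht).mono (by linarith)))).filter_mono (nhdsWithin_mono _ Set.sdiff_subset)
  refine ⟨h, hnormV_tendsto_zero h fun i => ?_⟩
  have := (hasDerivWithinAt_iff_tendsto_slope.1 (hw t ht i)).sub_const ((w' t).at i)
  rw [sub_self] at this
  refine this.congr fun τ => ?_
  rw [slope_def_module, Complex.real_smul, Complex.ofReal_inv]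
  rfl

end bdd

end

section

/-! ### Extension of multilinear maps to Sobolev spaces -/

section prodsum

variable {α : Type*} [Fintype α]

theorem summable_prod_pi {f : α → Idx → ℝ} (h0 : ∀ a i, 0 ≤ f a i) (hf : ∀ a, Summable (f a)) :
    Summable (fun i : α → Idx => ∏ a, f a (i a)) ∧
      ∑' i : α → Idx, ∏ a, f a (i a) ≤ ∏ a, ∑' j, f a j := by
  classical
  have h1 : ∀ F : Finset (α → Idx), ∑ i ∈ F, ∏ a, f a (i a) ≤ ∏ a, ∑' j, f a j := by
    intro F
    calc _ ≤ ∑ i ∈ Fintype.piFinset fun a => F.image fun i => i a, ∏ a, f a (i a) := by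
          refine Finset.sum_le_sum_of_subset_of_nonneg (fun i hi => ?_) fun i _ _ =>
            prod_nonneg fun a _ => h0 a _
          exact Fintype.mem_piFinset.2 fun a => Finset.mem_image_of_mem _ hi
      _ = ∏ a, ∑ j ∈ F.image fun i => i a, f a j := (Finset.prod_univ_sum _ _).symm
      _ ≤ _ := Finset.prod_le_prod (fun a _ => sum_nonneg fun j _ => h0 a j)
          fun a _ => (hf a).sum_le_tsum _ fun j _ => h0 a j
  have h2 : Summable (fun i : α → Idx => ∏ a, f a (i a)) :=
    summable_of_sum_le (fun i => prod_nonneg fun a _ => h0 a _) h1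
  exact ⟨h2, h2.tsum_le_of_sum_le h1⟩

end prodsum

section extS

variable {α : Type*} [Fintype α]

def term (T : ML(α, ℂ)) (U : α → Vec) (i : α → Idx) : ℂ :=
  (∏ a, (U a).at (i a)) * T fun a => bas (i a)

def extS (T : ML(α, ℂ)) (U : α → Vec) : ℂ := ∑' i, term T U i

/-- Polynomial bound of order `S` on the kernel. -/
def KB (T : ML(α, ℂ)) (C S : ℝ) : Prop :=
  ∀ i : α → Idx, ‖T fun a => bas (i a)‖ ≤ C * ∏ a, (i a).abs ^ S

variable {T : ML(α, ℂ)} {C S : ℝ}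

theorem norm_term_le (hT : KB T C S) (U : α → Vec) (i : α → Idx) :
    ‖term T U i‖ ≤ C * ∏ a, ‖wseq S (U a) (i a)‖ := by
  rw [term, norm_mul, norm_prod]
  refine (mul_le_mul_of_nonneg_left (hT i) (prod_nonneg fun _ _ => norm_nonneg _)).trans_eq ?_
  simp only [norm_wseq, prod_mul_distrib]
  ring

theorem norm_term_le_of_bdd (hC : 0 ≤ C) (hT : KB T C S) {U : α → Vec} {B : α → ℝ}
    (hU : ∀ a, InHV (S + 2) (U a) ∧ hnormV (S + 2) (U a) ≤ B a) (i : α → Idx) :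
    ‖term T U i‖ ≤ C * ∏ a, B a * ((i a).abs ^ (-1 : ℝ)) ^ 2 := by
  refine (norm_term_le hT _ i).trans (mul_le_mul_of_nonneg_left
    (Finset.prod_le_prod (fun a _ => norm_nonneg _) fun a _ => ?_) hC)
  rw [norm_wseq_succ, norm_wseq_succ, ← mul_assoc, ← sq, mul_comm, add_assoc, one_add_one_eq_two]
  exact mul_le_mul_of_nonneg_right ((norm_wseq_le (hU a).1 _).trans (hU a).2) (by positivity)

theorem summable_term (hT : KB T C S) {U : α → Vec} (hU : ∀ a, InHV (S + 1) (U a)) :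
    Summable (term T U) :=
  Summable.of_norm_bounded ((summable_prod_pi (fun _ _ => norm_nonneg _)
    fun a => (l1_of_inHV (hU a)).1).1.mul_left C) (norm_term_le hT U)

section
variable [DecidableEq α]

theorem term_update (U : α → Vec) (a : α) (x : Vec) (i : α → Idx) :
    term T (update U a x) i = x.at (i a) *
      ((∏ b ∈ univ.erase a, (U b).at (i b)) * T fun a => bas (i a)) := by
  rw [term, ← mul_prod_erase _ _ (mem_univ a), update_self, mul_assoc]
  congr 2
  refine prod_congr rfl fun b hb => ?_
  rw [update_of_ne (ne_of_mem_erase hb)]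

theorem inHV_update {s : ℝ} {U : α → Vec} (hU : ∀ a, InHV s (U a)) (a : α) {x : Vec}
    (hx : InHV s x) (b : α) : InHV s (update U a x b) := by
  by_cases h : b = a
  · subst h; simpa using hx
  · simpa [h] using hU b

theorem extS_update_add (hT : KB T C S) {U : α → Vec} (hU : ∀ a, InHV (S + 1) (U a)) (a : α)
    {x y : Vec} (hx : InHV (S + 1) x) (hy : InHV (S + 1) y) :
    extS T (update U a (x + y)) = extS T (update U a x) + extS T (update U a y) := by
  rw [extS, extS, extS, ← (summable_term hT (inHV_update hU a hx)).tsum_add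
    (summable_term hT (inHV_update hU a hy))]
  refine tsum_congr fun i => ?_
  rw [term_update, term_update, term_update, Vec.add_at, add_mul]

theorem extS_update_smul (U : α → Vec) (a : α) (c : ℂ) (x : Vec) :
    extS T (update U a (c • x)) = c * extS T (update U a x) := by
  rw [extS, extS, ← tsum_mul_left]
  refine tsum_congr fun i => ?_
  rw [term_update, term_update, Vec.smul_at, mul_assoc]

end

theorem extS_tendsto {β : Type*} {l : Filter β} (hC : 0 ≤ C) (hT : KB T C S) {X : α → β → Vec}
    {Y : α → Vec} (hb : ∀ a, Bdd l (S + 2) (X a))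
    (hX : ∀ a i, Tendsto (fun x => (X a x).at i) l (𝓝 ((Y a).at i))) :
    Tendsto (fun x => extS T fun a => X a x) l (𝓝 (extS T Y)) := by
  choose B hB using hb
  refine tendsto_tsum_of_dominated_convergence ((summable_prod_pi (f := fun a i =>
    |B a| * (i.abs ^ (-1 : ℝ)) ^ 2) (fun a i => by positivity)
      fun a => summable_abs_sq.mul_left _).1.mul_left C)
    (fun i => (tendsto_finsetProd _ fun a _ => hX a (i a)).mul_const _) ?_
  filter_upwards [eventually_all.2 hB] with x hx
  exact norm_term_le_of_bdd hC hT fun a => ⟨(hx a).1, (hx a).2.trans (le_abs_self _)⟩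

theorem extS_toVec (U : α → VTP) : extS T (fun a => (U a).toVec) = T U := by
  classical
  rw [map_expand T U, extS, tsum_eq_sum (s := Fintype.piFinset fun a => (bas.repr (U a)).support)]
  · rfl
  · intro i hi
    simp only [Fintype.mem_piFinset, Finsupp.mem_support_iff, bas_repr, not_forall, not_not] at hi
    obtain ⟨a, ha⟩ := hi
    rw [term, prod_eq_zero (mem_univ a) ha, zero_mul]

theorem projV_at (n : ℕ) (U : Vec) (i : Idx) :
    (projV n U).toVec.at i = if i.2.wt = n then U.at i else 0 := rfl

theorem extS_blocks {U : α → Vec} (hU : Summable (term T U)) :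
    ∑' n : α → ℕ, T (fun a => projV (n a) (U a)) = extS T U := by
  have h1 := (hU.hasSum.tsum_fiberwise fun i a => (i a).2.wt).tsum_eq
  rw [extS, ← h1]
  refine tsum_congr fun n => ?_
  rw [← extS_toVec, extS, tsum_subtype ((fun (i : α → Idx) a => (i a).2.wt) ⁻¹' {n}) (term T U)]
  refine tsum_congr fun i => ?_
  by_cases h : (fun a => (i a).2.wt) = n
  · rw [Set.indicator_of_mem (by exact h), term, term]
    congr 1
    refine prod_congr rfl fun a _ => ?_
    rw [projV_at, if_pos (congrFun h a)]
  · rw [Set.indicator_of_notMem (by exact h), term]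
    obtain ⟨a, ha⟩ := Function.ne_iff.1 h
    rw [prod_eq_zero (mem_univ a), zero_mul]
    rw [projV_at, if_neg ha]

theorem extS_hasDerivWithinAt (hC : 0 ≤ C) (hT : KB T C S) [DecidableEq α] {I : Set ℝ}
    (hI : I.OrdConnected) {t : ℝ} (ht : t ∈ I) {w w' : α → ℝ → Vec}
    (hb : ∀ a, Bdd (𝓝[I] t) (S + 2) (w a)) (hb' : ∀ a, Bdd (𝓝[I] t) (S + 2) (w' a))
    (hw : ∀ a, ∀ τ ∈ I, ∀ i, HasDerivWithinAt (fun τ => (w a τ).at i) ((w' a τ).at i) I τ) :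
    HasDerivWithinAt (fun τ => extS T fun a => w a τ)
      (∑ b, extS T (update (fun a => w a t) b (w' b t))) I t := by
  choose B hB using hb
  choose B' hB' using hb'
  have hs := (summable_prod_pi (f := fun a i => (|B a| + |B' a|) * (i.abs ^ (-1 : ℝ)) ^ 2)
    (fun a i => by positivity) fun a => summable_abs_sq.mul_left _).1.mul_left C
  obtain ⟨ε, hε, h⟩ := Metric.mem_nhdsWithin_iff.1
    ((eventually_all.2 hB).and (eventually_all.2 hB'))
  have h₀ : ∀ τ ∈ Metric.ball t ε ∩ I, ∀ a, InHV (S + 2) (w a τ) ∧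
      hnormV (S + 2) (w a τ) ≤ |B a| + |B' a| := fun τ hτ a => ⟨((h hτ).1 a).1,
    ((h hτ).1 a).2.trans ((le_abs_self _).trans (le_add_of_nonneg_right (abs_nonneg _)))⟩
  have hu : ∀ τ ∈ Metric.ball t ε ∩ I, ∀ b a, InHV (S + 2) (update (fun a => w a τ) b (w' b τ) a) ∧
      hnormV (S + 2) (update (fun a => w a τ) b (w' b τ) a) ≤ |B a| + |B' a| := fun τ hτ b a => by
    by_cases hab : a = b
    · subst hab
      rw [update_self]
      exact ⟨((h hτ).2 a).1,
        ((h hτ).2 a).2.trans ((le_abs_self _).trans (le_add_of_nonneg_left (abs_nonneg _)))⟩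
    · rw [update_of_ne hab]
      exact h₀ τ hτ a
  have hd : ∀ τ ∈ I, ∀ i, HasDerivWithinAt (fun τ => term T (fun a => w a τ) i)
      (∑ b, term T (update (fun a => w a τ) b (w' b τ)) i) I τ := fun τ hτ i => by
    refine ((HasDerivWithinAt.fun_finsetProd fun a _ => hw a τ hτ (i a)).mul_const _).congr_deriv ?_
    rw [sum_mul]
    refine sum_congr rfl fun b _ => ?_
    rw [term_update, smul_eq_mul]
    ring
  have ht' : t ∈ Metric.ball t ε ∩ I := ⟨Metric.mem_ball_self hε, ht⟩
  have hmem : ∀ᶠ τ in 𝓝[I \ {t}] t, τ ∈ Metric.ball t ε ∩ I := nhdsWithin_mono _ Set.sdiff_subset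
    (inter_mem (mem_nhdsWithin_of_mem_nhds (Metric.ball_mem_nhds t hε)) self_mem_nhdsWithin)
  have key := tendsto_tsum_of_dominated_convergence (𝓕 := 𝓝[I \ {t}] t)
    (f := fun τ i => slope (fun τ => term T (fun a => w a τ) i) t τ)
    (hs.mul_left (Fintype.card α : ℝ)) (fun i => hasDerivWithinAt_iff_tendsto_slope.1 (hd t ht i)) (by
      filter_upwards [hmem] with τ hτ i
      have := ((convex_ball t ε).inter hI.convex).norm_image_sub_le_of_norm_hasDerivWithin_le
        (fun x hx => (hd x hx.2 i).mono Set.inter_subset_right) (fun x hx => (norm_sum_le _ _).trans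
          ((sum_le_card_nsmul _ _ _ fun b _ => norm_term_le_of_bdd hC hT (hu x hx b) i).trans_eq
            (nsmul_eq_mul _ _))) ht' hτ
      rw [slope_def_module, norm_smul, norm_inv]
      exact inv_mul_le_of_le_mul₀ (norm_nonneg _) (by positivity) (by rwa [mul_comm]))
  rw [Summable.tsum_finsetSum fun b _ => summable_term hT fun a =>
    (hu t ht' b a).1.mono (by linarith)] at key
  refine hasDerivWithinAt_iff_tendsto_slope.2 (key.congr' (hmem.mono fun τ hτ => ?_))
  have hS := fun τ hτ => summable_term hT fun a => (h₀ τ hτ a).1.mono (show S + 1 ≤ S + 2 by linarith)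
  simp only [slope_def_module]
  rw [tsum_const_smul'', (hS τ hτ).tsum_sub (hS t ht')]
  rfl

end extS

section ext

variable {α : Type*} [Fintype α]

def coefM (k : Idx) (A : ML(α, VTP)) : ML(α, ℂ) := (bas.coord k).compMultilinearMap A

theorem coefM_apply (k : Idx) (A : ML(α, VTP)) (U : α → VTP) : coefM k A U = (A U).toVec.at k := by
  simp [coefM, VTP.toVec, Vec.at]

def ext (A : ML(α, VTP)) (U : α → Vec) : Vec := fun σ j => extS (coefM ⟨σ, j⟩ A) U

theorem ext_at (A : ML(α, VTP)) (U : α → Vec) (k : Idx) : (ext A U).at k = extS (coefM k A) U := rfl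

theorem ext_toVec (A : ML(α, VTP)) (U : α → VTP) : ext A (fun a => (U a).toVec) = (A U).toVec :=
  Vec.ext_at fun k => by rw [ext_at, extS_toVec, coefM_apply]

theorem norm_at_le_nrm (V : VTP) (k : Idx) : ‖V.toVec.at k‖ ≤ nrm 0 V := by
  classical
  rw [nrm_vtp_of_subset 0 V (insert k (bas.repr V).support) fun i hi =>
    Finset.mem_insert_of_mem (by simpa using hi)]
  have := single_le_sum (f := fun i : Idx => (i.2.wt : ℝ) ^ 0 * ‖V i.1 i.2‖)
    (fun i _ => by positivity) (Finset.mem_insert_self k (bas.repr V).support)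
  simp only [pow_zero, one_mul] at this ⊢
  exact this

variable {A : ML(α, VTP)}

/-- Bound on the total kernel. -/
def NB (A : ML(α, VTP)) (C S : ℝ) : Prop :=
  ∀ i : α → Idx, nrm 0 (A fun a => bas (i a)) ≤ C * ∏ a, (i a).abs ^ S

theorem Good.exists_nb (hA : Good A) : ∃ C ≥ 0, ∃ S ≥ 0, NB A C S := by
  obtain ⟨C, hC, s, h⟩ := hA.kernel_bd 0
  refine ⟨C, hC, s, by positivity, fun i => ?_⟩
  simpa [Idx.abs_eq_wt] using h i

theorem NB.kb {C S : ℝ} (h : NB A C S) (k : Idx) : KB (coefM k A) C S := fun i => by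
  rw [coefM_apply]; exact (norm_at_le_nrm _ _).trans (h i)

theorem Good.exists_kb {T : ML(α, ℂ)} (hT : Good T) : ∃ C ≥ 0, ∃ S ≥ 0, KB T C S := by
  obtain ⟨C, hC, s, h⟩ := hT.kernel_bd 0
  refine ⟨C, hC, s, by positivity, fun i => ?_⟩
  simpa [Idx.abs_eq_wt] using h i

theorem abs_le_sum_of_momentum (hA : Good A) (i : α → Idx) (k : Idx)
    (hk : (A fun a => bas (i a)).toVec.at k ≠ 0) : k.abs ≤ ∑ a, (i a).abs := by
  have h1 := hA.momentum i k hk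
  rw [Idx.abs, h1, mom]
  push_cast
  exact abs_sum_le_sum_abs _ _

theorem sum_rpow_le [Nonempty α] {σ : ℝ} (hσ : 0 ≤ σ) (i : α → Idx) :
    (∑ a, (i a).abs) ^ σ ≤ (Fintype.card α : ℝ) ^ σ * ∑ a, (i a).abs ^ σ := by
  obtain ⟨b, hb⟩ := Finite.exists_max fun a => (i a).abs
  have h1 : ∑ a, (i a).abs ≤ Fintype.card α * (i b).abs := by
    refine (sum_le_card_nsmul _ _ _ fun a _ => hb a).trans_eq ?_
    simp
  calc _ ≤ (Fintype.card α * (i b).abs) ^ σ :=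
        Real.rpow_le_rpow (sum_nonneg fun a _ => (i a).abs_pos.le) h1 hσ
    _ = (Fintype.card α : ℝ) ^ σ * (i b).abs ^ σ := Real.mul_rpow (by positivity) (i b).abs_pos.le
    _ ≤ _ := by
      refine mul_le_mul_of_nonneg_left ?_ (by positivity)
      exact single_le_sum (f := fun a => (i a).abs ^ σ)
        (fun a _ => Real.rpow_nonneg (i a).abs_pos.le _) (mem_univ b)

theorem ext_bound_aux [Nonempty α] [DecidableEq α] (hA : Good A) {C S : ℝ} (hC : 0 ≤ C)
    (hN : NB A C S) {σ : ℝ} (hσ : 0 ≤ σ) (U : α → Vec) (hU : ∀ a, InHV (σ + S + 1) (U a)) :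
    InHV σ (ext A U) ∧ hnormV σ (ext A U) ≤ C * (Fintype.card α : ℝ) ^ σ * ∑ b,
      ∏ a, (c₀ * hnormV ((if a = b then σ else 0) + S + 1) (U a)) := by
  let g : α → α → Idx → ℝ := fun b a i => ‖wseq ((if a = b then σ else 0) + S) (U a) i‖
  have hU' : ∀ b a, InHV ((if a = b then σ else 0) + S + 1) (U a) := fun b a => by
    refine (hU a).mono ?_
    split_ifs <;> linarith
  have hg := fun b => summable_prod_pi (f := g b) (fun _ _ => norm_nonneg _)
    fun a => (l1_of_inHV (hU' b a)).1
  let F : (α → Idx) × Idx → ℝ := fun x =>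
    x.2.abs ^ σ * (∏ a, ‖(U a).at (x.1 a)‖) * ‖(A fun a => bas (x.1 a)).toVec.at x.2‖
  have hF0 : ∀ x, 0 ≤ F x := fun x => by have := x.2.abs_pos; positivity
  let G : (α → Idx) → ℝ := fun i => C * (Fintype.card α : ℝ) ^ σ * ∑ b, ∏ a, g b a (i a)
  have hG : Summable G := (summable_sum fun b _ => (hg b).1).mul_left _
  have hfin : ∀ i : α → Idx, ∀ k, F (i, k) ≠ 0 → (A fun a => bas (i a)).toVec.at k ≠ 0 := by
    intro i k h h0
    apply h
    simp [F, h0]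
  have hFs : ∀ i : α → Idx, Summable fun k => F (i, k) := by
    intro i
    refine summable_of_ne_finset_zero (s := (bas.repr (A fun a => bas (i a))).support)
      fun k hk => ?_
    by_contra h
    exact hk (Finsupp.mem_support_iff.2 (by rw [bas_repr]; exact hfin i k h))
  have hFG : ∀ i : α → Idx, ∑' k, F (i, k) ≤ G i := by
    intro i
    rw [tsum_eq_sum (s := (bas.repr (A fun a => bas (i a))).support) fun k hk => by
      by_contra h
      exact hk (Finsupp.mem_support_iff.2 (by rw [bas_repr]; exact hfin i k h))]
    have h1 : ∑ k ∈ (bas.repr (A fun a => bas (i a))).support, F (i, k) ≤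
        (∏ a, ‖(U a).at (i a)‖) * (∑ a, (i a).abs) ^ σ * nrm 0 (A fun a => bas (i a)) := by
      rw [nrm_vtp, mul_sum]
      refine sum_le_sum fun k hk => ?_
      have hk' : (A fun a => bas (i a)).toVec.at k ≠ 0 := by
        have := Finsupp.mem_support_iff.1 hk
        rw [bas_repr] at this
        exact this
      have h2 := Real.rpow_le_rpow k.abs_pos.le (abs_le_sum_of_momentum hA i k hk') hσ
      simp only [F, pow_zero, one_mul]
      rw [mul_comm (∏ a, ‖(U a).at (i a)‖)]
      refine mul_le_mul_of_nonneg_right (mul_le_mul_of_nonneg_right h2 ?_) (norm_nonneg _)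
      exact prod_nonneg fun _ _ => norm_nonneg _
    refine h1.trans ?_
    have h3 : (∏ a, ‖(U a).at (i a)‖) * (∑ a, (i a).abs) ^ σ * nrm 0 (A fun a => bas (i a)) ≤
        (∏ a, ‖(U a).at (i a)‖) * ((Fintype.card α : ℝ) ^ σ * ∑ b, (i b).abs ^ σ) *
          (C * ∏ a, (i a).abs ^ S) := by
      have := sum_nonneg fun (a : α) (_ : a ∈ univ) => (i a).abs_pos.le
      exact mul_le_mul (mul_le_mul_of_nonneg_left (sum_rpow_le hσ i) (by positivity)) (hN i)
        (nrm_nonneg _ _) (mul_nonneg (by positivity) (mul_nonneg (by positivity)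
          (sum_nonneg fun a _ => Real.rpow_nonneg (i a).abs_pos.le _)))
    refine h3.trans_eq ?_
    simp only [G, g]
    have h4 : ∀ b, ∏ a, ‖wseq ((if a = b then σ else 0) + S) (U a) (i a)‖ =
        (∏ a, ‖(U a).at (i a)‖) * (i b).abs ^ σ * ∏ a, (i a).abs ^ S := by
      intro b
      have h5 : (i b).abs ^ σ = ∏ a, (i a).abs ^ (if a = b then σ else 0) := by
        rw [Finset.prod_eq_single b]
        · simp
        · intro a _ hab; simp [hab]
        · simp
      rw [h5, ← prod_mul_distrib, ← prod_mul_distrib]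
      refine prod_congr rfl fun a _ => ?_
      rw [norm_wseq, Real.rpow_add (i a).abs_pos]
      ring
    simp only [h4, ← sum_mul, ← mul_sum]
    ring
  have hFsum : Summable F := (summable_prod_of_nonneg hF0).2
    ⟨hFs, hG.of_nonneg_of_le (fun i => tsum_nonneg fun k => hF0 _) hFG⟩
  have hFswap := hFsum.prod_symm
  have hk1 : ∀ k, ‖wseq σ (ext A U) k‖ ≤ ∑' i, F (i, k) := by
    intro k
    rw [norm_wseq, ext_at, extS]
    have hsk : Summable fun i => F (i, k) := hFswap.prod_factor k
    have e : ∀ i, F (i, k) = k.abs ^ σ * ‖term (coefM k A) U i‖ := by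
      intro i
      rw [term, norm_mul, norm_prod, coefM_apply, ← mul_assoc]
    simp only [e] at hsk ⊢
    have hp : 0 < k.abs ^ σ := Real.rpow_pos_of_pos k.abs_pos _
    rw [tsum_mul_left]
    refine mul_le_mul_of_nonneg_left (norm_tsum_le_tsum_norm ?_) hp.le
    exact (summable_mul_left_iff hp.ne').1 hsk
  have hk2 : Summable fun k => ∑' i, F (i, k) := hFswap.prod
  have hk3 : Summable fun k => ‖wseq σ (ext A U) k‖ :=
    hk2.of_nonneg_of_le (fun _ => norm_nonneg _) hk1
  obtain ⟨h5, h6⟩ := inHV_of_l1 hk3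
  refine ⟨h5, h6.trans ((hk3.tsum_le_tsum hk1 hk2).trans ?_)⟩
  rw [show ∑' k, ∑' i, F (i, k) = ∑' i, ∑' k, F (i, k) from
    Summable.tsum_comm' (f := fun i k => F (i, k)) hFsum hFs fun k => hFswap.prod_factor k]
  refine (((summable_prod_of_nonneg hF0).1 hFsum).2.tsum_le_tsum hFG hG).trans ?_
  rw [tsum_mul_left, Summable.tsum_finsetSum fun b _ => (hg b).1]
  refine mul_le_mul_of_nonneg_left (sum_le_sum fun b _ => (hg b).2.trans ?_) (by positivity)
  exact Finset.prod_le_prod (fun a _ => tsum_nonneg fun _ => norm_nonneg _)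
    fun a _ => (l1_of_inHV (hU' b a)).2

/-- Tame estimate for the extension of a good multilinear map. -/
theorem Good.ext_bound [Nonempty α] [DecidableEq α] (hA : Good A) :
    ∃ S ≥ (0 : ℝ), ∀ σ ≥ (0 : ℝ), ∃ C ≥ (0 : ℝ), ∀ U : α → Vec, (∀ a, InHV (σ + S) (U a)) →
      InHV σ (ext A U) ∧ hnormV σ (ext A U) ≤
        C * ∑ b, hnormV (σ + S) (U b) * ∏ a ∈ univ.erase b, hnormV S (U a) := by
  obtain ⟨C, hC, S, hS, hN⟩ := hA.exists_nb
  refine ⟨S + 1, by linarith, fun σ hσ => ⟨C * (Fintype.card α : ℝ) ^ σ * c₀ ^ Fintype.card α,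
    by have := c₀_nonneg; positivity, fun U hU => ?_⟩⟩
  obtain ⟨h1, h2⟩ := ext_bound_aux hA hC hN hσ U fun a => by rw [add_assoc]; exact hU a
  refine ⟨h1, h2.trans_eq ?_⟩
  rw [mul_assoc, mul_assoc (C * _)]
  simp only [prod_mul_distrib, prod_const, card_univ]
  rw [← mul_sum]
  simp only [mul_assoc]
  congr 4
  funext b
  rw [← mul_prod_erase _ _ (mem_univ b), if_pos rfl, add_assoc]
  congr 1
  refine prod_congr rfl fun a ha => ?_
  rw [if_neg (ne_of_mem_erase ha), zero_add]

end ext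

/-! ### Truncation -/

def trunc (n : ℕ) (U : Vec) : VTP := fun σ =>
  Finsupp.onFinset (modes n) (fun j => if j ∈ modes n then U σ j else 0) fun j hj => by
    by_contra h; exact hj (if_neg h)

theorem mem_modes {n : ℕ} {j : Freq} : j ∈ modes n ↔ j.wt ≤ n := by
  simp only [modes, Finset.mem_subtype, mem_Icc, Freq.wt]
  omega

theorem trunc_at (n : ℕ) (U : Vec) (i : Idx) :
    (trunc n U).toVec.at i = if i.2.wt ≤ n then U.at i else 0 := by
  change (if i.2 ∈ modes n then U i.1 i.2 else 0) = _
  simp only [mem_modes]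
  rfl

theorem tendsto_trunc (U : Vec) (i : Idx) :
    Tendsto (fun n => (trunc n U).toVec.at i) atTop (𝓝 (U.at i)) := by
  refine tendsto_const_nhds.congr' ?_
  filter_upwards [eventually_ge_atTop i.2.wt] with n hn
  rw [trunc_at, if_pos hn]

theorem hnormV_trunc_le {s : ℝ} {U : Vec} (hU : InHV s U) (n : ℕ) :
    hnormV s (trunc n U).toVec ≤ hnormV s U := by
  have h := InHV.of_norm_le (s := s) (U := (trunc n U).toVec) ((memlp_two_iff _).1 (inHV_iff.1 hU))
    fun i => ?_
  · refine h.2.trans_eq ?_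
    rw [← hnormV_sq hU, Real.sqrt_sq (hnormV_nonneg _ _)]
  · rw [norm_wseq, norm_wseq, trunc_at]
    have : 0 ≤ i.abs ^ s := Real.rpow_nonneg i.abs_pos.le _
    refine mul_le_mul_of_nonneg_left ?_ this
    split_ifs <;> simp

end

section

/-! ### Paths in Sobolev spaces -/

theorem inH_iff_memlp {a : ℝ} {u : Coef} :
    InH a u ↔ Memℓp (fun j : Freq => ((|(j.1 : ℝ)| ^ a : ℝ) : ℂ) * u j) 2 := by
  rw [memlp_two_iff]
  refine summable_congr fun j => ?_
  exact (norm_wseq_sq a (fun _ => u) ⟨0, j⟩).symm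

def toL {a : ℝ} {u : Coef} (h : InH a u) : lp (fun _ : Freq => ℂ) 2 := ⟨_, inH_iff_memlp.1 h⟩

theorem inH_of_lp {a : ℝ} {u : Coef} (f : lp (fun _ : Freq => ℂ) 2)
    (hf : ∀ j : Freq, f j = ((|(j.1 : ℝ)| ^ a : ℝ) : ℂ) * u j) : InH a u ∧ hnorm a u = ‖f‖ := by
  have e : (f : Freq → ℂ) = fun j : Freq => ((|(j.1 : ℝ)| ^ a : ℝ) : ℂ) * u j := funext hf
  refine ⟨inH_iff_memlp.2 (e ▸ lp.memℓp f), ?_⟩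
  rw [← sq_eq_sq₀ (hnorm_nonneg _ _) (norm_nonneg _), hnorm_sq]
  have := lp.norm_rpow_eq_tsum (p := 2) (by norm_num) f
  simp only [ENNReal.toReal_ofNat, Real.rpow_ofNat] at this
  rw [this]
  refine tsum_congr fun j => ?_
  rw [hf]
  exact (norm_wseq_sq a (fun _ => u) ⟨0, j⟩).symm

theorem inH_mono {s' s : ℝ} (h : s' ≤ s) {u : Coef} (hu : InH s u) : InH s' u :=
  (inHV_inc (σ := 0)).1 ((inHV_inc.2 hu).mono h)

section paths

/-- An interval with nonempty interior. -/
class TimeInterval (I : Set ℝ) : Prop where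
  ord : I.OrdConnected
  uniq : UniqueDiffOn ℝ I

variable {I : Set ℝ} [TimeInterval I] {k : ℕ} {a : ℝ} {u u' : ℝ → Coef}

theorem InCk.congr (h : InCk I k a u) (e : ∀ t ∈ I, u t = u' t) : InCk I k a u' := by
  obtain ⟨f, hf, hfu⟩ := h
  exact ⟨f, hf, fun t ht j => by rw [hfu t ht j, e t ht]⟩

theorem InCk.of_le (h : InCk I k a u) {k' : ℕ} (hk : k' ≤ k) : InCk I k' a u := by
  obtain ⟨f, hf, hfu⟩ := h
  exact ⟨f, hf.of_le (by exact_mod_cast hk), hfu⟩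

theorem InCk.mono (h : InCk I k a u) {a' : ℝ} (ha : a' ≤ a) : InCk I k a' u := by
  obtain ⟨f, hf, hfu⟩ := h
  have hw : ∀ j : Freq, ‖((|(j.1 : ℝ)| ^ (a' - a) : ℝ) : ℂ)‖ ≤ 1 := fun j => by
    have h1 := Idx.one_le_abs ⟨0, j⟩
    rw [Complex.norm_real, Real.norm_of_nonneg (by positivity)]
    exact Real.rpow_le_one_of_one_le_of_nonpos h1 (by linarith)
  let L : lp (fun _ : Freq => ℂ) 2 →ₗ[ℝ] lp (fun _ : Freq => ℂ) 2 :=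
    { toFun := fun g => ⟨fun j => ((|(j.1 : ℝ)| ^ (a' - a) : ℝ) : ℂ) * g j, by
        refine (lp.memℓp g).mono' fun j => ?_
        rw [norm_mul]
        exact mul_le_of_le_one_left (norm_nonneg _) (hw j)⟩
      map_add' := fun g g' => Subtype.ext (funext fun j => mul_add _ _ _)
      map_smul' := fun c g => Subtype.ext (funext fun j => by
        simp only [lp.coeFn_smul, Pi.smul_apply, RingHom.id_apply, mul_smul_comm]) }
  have hL : ∀ g, ‖L g‖ ≤ 1 * ‖g‖ := fun g => by
    rw [one_mul]
    refine lp.norm_mono (by norm_num) fun j => ?_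
    change ‖((|(j.1 : ℝ)| ^ (a' - a) : ℝ) : ℂ) * g j‖ ≤ _
    rw [norm_mul]
    exact mul_le_of_le_one_left (norm_nonneg _) (hw j)
  refine ⟨fun t => L.mkContinuous 1 hL (f t), (L.mkContinuous 1 hL).contDiff.comp_contDiffOn hf,
    fun t ht j => ?_⟩
  change ((|(j.1 : ℝ)| ^ (a' - a) : ℝ) : ℂ) * f t j = _
  rw [hfu t ht j, ← mul_assoc, ← Complex.ofReal_mul]
  have := Idx.abs_pos ⟨0, j⟩
  rw [show |(j.1 : ℝ)| = Idx.abs ⟨0, j⟩ from rfl, ← Real.rpow_add this]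
  ring_nf

theorem InCk.add (h : InCk I k a u) (h' : InCk I k a u') : InCk I k a fun t => u t + u' t := by
  obtain ⟨f, hf, hfu⟩ := h
  obtain ⟨f', hf', hfu'⟩ := h'
  exact ⟨fun t => f t + f' t, hf.add hf', fun t ht j => by
    rw [lp.coeFn_add, Pi.add_apply, hfu t ht j, hfu' t ht j, ← mul_add]; rfl⟩

theorem InCk.smul (h : InCk I k a u) (c : ℂ) : InCk I k a fun t => c • u t := by
  obtain ⟨f, hf, hfu⟩ := h
  exact ⟨fun t => c • f t, hf.const_smul c, fun t ht j => by
    rw [lp.coeFn_smul, Pi.smul_apply, hfu t ht j, smul_eq_mul, mul_left_comm]; rfl⟩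

theorem InCk.const {v : Coef} (h : InH a v) : InCk I k a fun _ => v :=
  ⟨fun _ => toL h, contDiffOn_const, fun _ _ _ => rfl⟩

theorem InCk.inH (h : InCk I k a u) {t : ℝ} (ht : t ∈ I) : InH a (u t) := by
  obtain ⟨f, hf, hfu⟩ := h
  exact (inH_of_lp (f t) (hfu t ht)).1

theorem InCk.bdd (h : InCk I k a u) {t : ℝ} (ht : t ∈ I) :
    ∃ B, ∀ᶠ τ in 𝓝[I] t, InH a (u τ) ∧ hnorm a (u τ) ≤ B := by
  obtain ⟨f, hf, hfu⟩ := h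
  refine ⟨‖f t‖ + 1, ?_⟩
  filter_upwards [(hf.continuousOn t ht).norm.eventually (gt_mem_nhds (lt_add_one ‖f t‖)),
    self_mem_nhdsWithin] with τ h1 hτ
  obtain ⟨h2, h3⟩ := inH_of_lp (f τ) (hfu τ hτ)
  exact ⟨h2, h3.trans_le h1.le⟩

theorem coef_eq_of_lp {j : Freq} {f : lp (fun _ : Freq => ℂ) 2} {x : ℂ}
    (h : f j = ((|(j.1 : ℝ)| ^ a : ℝ) : ℂ) * x) :
    x = ((|(j.1 : ℝ)| ^ a : ℝ) : ℂ)⁻¹ * f j := by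
  have : ((|(j.1 : ℝ)| ^ a : ℝ) : ℂ) ≠ 0 := by
    exact Complex.ofReal_ne_zero.2 (Real.rpow_pos_of_pos (Idx.abs_pos ⟨0, j⟩) a).ne'
  rw [h, inv_mul_cancel_left₀ this]

theorem InCk.contDiffOn (h : InCk I k a u) (j : Freq) : ContDiffOn ℝ k (fun t => u t j) I := by
  obtain ⟨f, hf, hfu⟩ := h
  have h1 : ContDiffOn ℝ k (fun t => ((|(j.1 : ℝ)| ^ a : ℝ) : ℂ)⁻¹ * f t j) I :=
    contDiffOn_const.mul ((lp.evalCLM ℝ (fun _ : Freq => ℂ) 2 j).contDiff.comp_contDiffOn hf)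
  exact h1.congr fun t ht => coef_eq_of_lp (hfu t ht j)

theorem dt_zero (u : ℝ → Coef) : dt I 0 u = u := by
  funext t j; simp [dt]

theorem dt_one (u : ℝ → Coef) (t : ℝ) (j : Freq) :
    dt I 1 u t j = derivWithin (fun τ => u τ j) I t := by
  simp [dt, iteratedDerivWithin_one]

theorem dt_succ (k : ℕ) (u : ℝ → Coef) : dt I (k + 1) u = dt I k (dt I 1 u) := by
  funext t j
  simp only [dt]
  rw [iteratedDerivWithin_succ']
  congr 1
  funext τ
  rw [iteratedDerivWithin_one]

theorem dt_congr (e : ∀ t ∈ I, u t = u' t) (k : ℕ) {t : ℝ} (ht : t ∈ I) :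
    dt I k u t = dt I k u' t :=
  funext fun j => iteratedDerivWithin_congr (fun τ hτ => congrFun (e τ hτ) j) ht

theorem InCk.hasDeriv (h : InCk I (k + 1) a u) {t : ℝ} (ht : t ∈ I) (j : Freq) :
    HasDerivWithinAt (fun τ => u τ j) (dt I 1 u t j) I t := by
  rw [dt_one]
  exact ((h.contDiffOn j).differentiableOn (by simp) t ht).hasDerivWithinAt

theorem InCk.dt (h : InCk I (k + 1) a u) : InCk I k a (dt I 1 u) := by
  have hd := fun t (ht : t ∈ I) j => h.hasDeriv ht j
  obtain ⟨f, hf, hfu⟩ := h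
  refine ⟨derivWithin f I, hf.derivWithin TimeInterval.uniq (by norm_cast), fun t ht j => ?_⟩
  have h1 : HasDerivWithinAt f (derivWithin f I t) I t :=
    (hf.differentiableOn (by simp) t ht).hasDerivWithinAt
  have h2 := (lp.evalCLM ℝ (fun _ : Freq => ℂ) 2 j).hasFDerivAt.comp_hasDerivWithinAt t h1
  have h3 : HasDerivWithinAt (fun τ => ((|(j.1 : ℝ)| ^ a : ℝ) : ℂ) * u τ j)
      (derivWithin f I t j) I t := h2.congr (fun τ hτ => (hfu τ hτ j).symm) (hfu t ht j).symm
  exact (TimeInterval.uniq t ht).eq_deriv _ h3 ((hd t ht j).const_mul _)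

theorem inCk_zero {W : ℝ → Vec} (hc : ∀ i, ContinuousOn (fun t => (W t).at i) I)
    (hb : ∀ t ∈ I, Bdd (𝓝[I] t) (a + 1) W) (σ : Fin 2) : InCk I 0 a fun t => W t σ := by
  classical
  have hu : ∀ t ∈ I, InHV a (W t) := fun t ht => ((hb t ht).inHV ht).mono (by linarith)
  refine ⟨fun t => if h : t ∈ I then toL (hu t h σ) else 0, ?_,
    fun t ht j => by simp only [dif_pos ht]; rfl⟩
  rw [Nat.cast_zero, contDiffOn_zero]
  intro t ht
  rw [ContinuousWithinAt, tendsto_iff_norm_sub_tendsto_zero]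
  refine squeeze_zero' (Eventually.of_forall fun _ => norm_nonneg _) ?_ (hnormV_tendsto_zero
    (f := fun τ => W τ - W t) ((hb t ht).sub (.const ((hb t ht).inHV ht)))
    fun i => by simpa using (hc i t ht).tendsto.sub_const ((W t).at i))
  filter_upwards [self_mem_nhdsWithin] with τ hτ
  rw [dif_pos hτ, dif_pos ht]
  refine le_trans (le_of_eq ?_) (hnorm_le_hnormV a (W τ - W t) σ)
  refine (inH_of_lp _ fun j => ?_).2.symm
  rw [lp.coeFn_sub, Pi.sub_apply, Pi.sub_apply, Pi.sub_apply, mul_sub]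
  rfl

theorem inCk_succ {W W' : ℝ → Vec} {σ : Fin 2} (h : InCk I k a fun t => W' t σ)
    (hd : ∀ t ∈ I, ∀ i, HasDerivWithinAt (fun τ => (W τ).at i) ((W' t).at i) I t)
    (hu : ∀ t ∈ I, InHV a (W t)) (hb : ∀ t ∈ I, Bdd (𝓝[I] t) (a + 2) W') :
    InCk I (k + 1) a fun t => W t σ := by
  classical
  obtain ⟨f', hf', hfu'⟩ := h
  let f : ℝ → lp (fun _ : Freq => ℂ) 2 := fun t => if h : t ∈ I then toL (hu t h σ) else 0
  have hf : ∀ t ∈ I, HasDerivWithinAt f (f' t) I t := by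
    intro t ht
    rw [hasDerivWithinAt_iff_tendsto_slope, tendsto_iff_norm_sub_tendsto_zero]
    refine squeeze_zero' (Eventually.of_forall fun _ => norm_nonneg _) ?_
      (slope_tendsto TimeInterval.ord ht hd (hb t ht)).2
    filter_upwards [self_mem_nhdsWithin] with τ hτ
    refine le_trans (le_of_eq ?_) (hnorm_le_hnormV a _ σ)
    refine (inH_of_lp _ fun j => ?_).2.symm
    rw [slope_def_module, lp.coeFn_sub, Pi.sub_apply, lp.coeFn_smul, Pi.smul_apply, lp.coeFn_sub,
      Pi.sub_apply, hfu' t ht j]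
    simp only [f, dif_pos hτ.1, dif_pos ht]
    change (τ - t)⁻¹ • (((|(j.1 : ℝ)| ^ a : ℝ) : ℂ) * W τ σ j - ((|(j.1 : ℝ)| ^ a : ℝ) : ℂ) * W t σ j) -
      _ = _ * (((τ - t : ℝ) : ℂ)⁻¹ * (W τ σ j - W t σ j) - W' t σ j)
    rw [Complex.real_smul, Complex.ofReal_inv]
    ring
  refine ⟨f, ?_, fun t ht j => by simp only [f, dif_pos ht]; rfl⟩
  push_cast
  rw [contDiffOn_succ_iff_derivWithin TimeInterval.uniq]
  exact ⟨fun t ht => (hf t ht).differentiableWithinAt, by simp,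
    hf'.congr fun t ht => (hf t ht).derivWithin (TimeInterval.uniq t ht)⟩

end paths

end

section

/-! ### Vector-valued paths -/

theorem Vec.sum_at {ι : Type*} (S : Finset ι) (f : ι → Vec) (i : Idx) :
    Vec.at (∑ b ∈ S, f b) i = ∑ b ∈ S, (f b).at i := by
  change (∑ b ∈ S, f b) i.1 i.2 = _
  rw [Finset.sum_apply, Finset.sum_apply]
  rfl

def dtV (I : Set ℝ) (k : ℕ) (W : ℝ → Vec) (t : ℝ) : Vec := fun σ => dt I k (fun τ => W τ σ) t

section vpaths

variable {I : Set ℝ} [TimeInterval I] {n k : ℕ} {s : ℝ} {W W' : ℝ → Vec}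

theorem dtV_zero (W : ℝ → Vec) : dtV I 0 W = W := by
  funext t σ; simp only [dtV, dt_zero]

theorem dtV_succ (k : ℕ) (W : ℝ → Vec) : dtV I (k + 1) W = dtV I k (dtV I 1 W) := by
  funext t σ; simp only [dtV]; rw [dt_succ]

theorem dtV_congr (e : ∀ t ∈ I, W t = W' t) (k : ℕ) {t : ℝ} (ht : t ∈ I) :
    dtV I k W t = dtV I k W' t :=
  funext fun σ => dt_congr (fun τ hτ => congrFun (e τ hτ) σ) k ht

theorem normKV_eq (k : ℕ) (s : ℝ) (W : ℝ → Vec) (t : ℝ) :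
    normKV I k s W t = ∑ i ∈ range (k + 1), hnormV (s - 3 / 2 * (i : ℝ)) (dtV I i W t) := rfl

theorem normKV_zero (s : ℝ) (W : ℝ → Vec) (t : ℝ) : normKV I 0 s W t = hnormV s (W t) := by
  simp [normKV_eq, dtV_zero]

theorem normKV_succ (k : ℕ) (s : ℝ) (W : ℝ → Vec) (t : ℝ) :
    normKV I (k + 1) s W t = hnormV s (W t) + normKV I k (s - 3 / 2) (dtV I 1 W) t := by
  rw [normKV_eq, normKV_eq, sum_range_succ', add_comm]
  congr 1
  · simp [dtV_zero]
  · refine sum_congr rfl fun i _ => ?_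
    rw [dtV_succ]
    congr 1
    push_cast
    ring

theorem normKV_nonneg (k : ℕ) (s : ℝ) (W : ℝ → Vec) (t : ℝ) : 0 ≤ normKV I k s W t :=
  sum_nonneg fun _ _ => hnormV_nonneg _ _

theorem normKV_congr (e : ∀ t ∈ I, W t = W' t) {t : ℝ} (ht : t ∈ I) :
    normKV I k s W t = normKV I k s W' t :=
  sum_congr rfl fun i _ => congrArg (hnormV _) (dtV_congr e i ht)

theorem normKV_mono_left {k k' : ℕ} (h : k ≤ k') (s : ℝ) (W : ℝ → Vec) (t : ℝ) :
    normKV I k s W t ≤ normKV I k' s W t :=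
  Finset.sum_le_sum_of_subset_of_nonneg (range_mono (by omega)) fun _ _ _ => hnormV_nonneg _ _

theorem normKV_dt_le (k : ℕ) (s : ℝ) (W : ℝ → Vec) (t : ℝ) :
    normKV I k (s - 3 / 2) (dtV I 1 W) t ≤ normKV I (k + 1) s W t := by
  rw [normKV_succ]
  exact le_add_of_nonneg_left (hnormV_nonneg _ _)

theorem hnormV_le_normKV (k : ℕ) (s : ℝ) (W : ℝ → Vec) (t : ℝ) :
    hnormV s (W t) ≤ normKV I k s W t := by
  rw [← normKV_zero (I := I)]
  exact normKV_mono_left (Nat.zero_le k) s W t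

theorem hnormV_dtV_le_normKV {i k : ℕ} (h : i ≤ k) (s : ℝ) (W : ℝ → Vec) (t : ℝ) :
    hnormV (s - 3 / 2 * (i : ℝ)) (dtV I i W t) ≤ normKV I k s W t :=
  single_le_sum (f := fun i : ℕ => hnormV (s - 3 / 2 * (i : ℝ)) (dtV I i W t))
    (fun _ _ => hnormV_nonneg _ _) (mem_range.2 (Nat.lt_succ_of_le h))

theorem InCStarV.congr (h : InCStarV I n s W) (e : ∀ t ∈ I, W t = W' t) : InCStarV I n s W' :=
  fun σ k hk => (h σ k hk).congr fun t ht => by rw [e t ht]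

theorem InCStarV.of_le (h : InCStarV I n s W) {n' : ℕ} (hn : n' ≤ n) : InCStarV I n' s W :=
  fun σ k hk => h σ k (hk.trans hn)

theorem InCStarV.mono (h : InCStarV I n s W) {s' : ℝ} (hs : s' ≤ s) : InCStarV I n s' W :=
  fun σ k hk => (h σ k hk).mono (by linarith)

theorem InCStarV.add (h : InCStarV I n s W) (h' : InCStarV I n s W') :
    InCStarV I n s fun t => W t + W' t :=
  fun σ k hk => (h σ k hk).add (h' σ k hk)

theorem InCStarV.smul (h : InCStarV I n s W) (c : ℂ) : InCStarV I n s fun t => c • W t :=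
  fun σ k hk => (h σ k hk).smul c

theorem InCStarV.const {v : Vec} (h : InHV s v) : InCStarV I n s fun _ => v :=
  fun σ k _ => InCk.const (inH_mono (by linarith [(Nat.cast_nonneg k : (0 : ℝ) ≤ k)]) (h σ))

theorem InCStarV.sum {ι : Type*} (S : Finset ι) {f : ι → ℝ → Vec}
    (h : ∀ i ∈ S, InCStarV I n s (f i)) : InCStarV I n s fun t => ∑ i ∈ S, f i t := by
  classical
  induction S using induction_on with
  | empty => simpa using InCStarV.const (InHV.zero s)
  | insert a S ha ih =>
    simp only [sum_insert ha]
    exact (h a (by simp)).add (ih fun i hi => h i (by simp [hi]))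

theorem InCStarV.inHV (h : InCStarV I n s W) {t : ℝ} (ht : t ∈ I) : InHV s (W t) := fun σ => by
  simpa using (h σ 0 (Nat.zero_le _)).inH ht

theorem InCStarV.bdd (h : InCStarV I n s W) {t : ℝ} (ht : t ∈ I) : Bdd (𝓝[I] t) s W := by
  have h0 := fun σ => (h σ 0 (Nat.zero_le _)).bdd ht
  simp only [Nat.cast_zero, mul_zero, sub_zero] at h0
  choose B hB using h0
  refine ⟨B 0 + B 1, ?_⟩
  filter_upwards [hB 0, hB 1] with τ h1 h2
  exact ⟨Fin.forall_fin_two.2 ⟨h1.1, h2.1⟩, (hnormV_le_sum _ _).trans (add_le_add h1.2 h2.2)⟩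

theorem InCStarV.continuousOn (h : InCStarV I n s W) (i : Idx) :
    ContinuousOn (fun t => (W t).at i) I :=
  ((h i.1 0 (Nat.zero_le _)).contDiffOn i.2).continuousOn

theorem InCStarV.hasDeriv (h : InCStarV I (n + 1) s W) {t : ℝ} (ht : t ∈ I) (i : Idx) :
    HasDerivWithinAt (fun τ => (W τ).at i) ((dtV I 1 W t).at i) I t :=
  (h i.1 (n + 1) le_rfl |>.of_le (show 0 + 1 ≤ n + 1 by omega)).hasDeriv ht i.2

theorem InCStarV.dt (h : InCStarV I (n + 1) s W) :
    InCStarV I n (s - 3 / 2) (dtV I 1 W) := fun σ k hk => by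
  have := (h σ (k + 1) (by omega)).dt
  push_cast at this
  rwa [show s - 3 / 2 * ((k : ℝ) + 1) = s - 3 / 2 - 3 / 2 * (k : ℝ) by ring] at this

theorem InCStarV.inHV_dtV (h : InCStarV I n s W) {t : ℝ} (ht : t ∈ I)
    {i : ℕ} (hi : i ≤ n) : InHV (s - 3 / 2 * (i : ℝ)) (dtV I i W t) := by
  induction i generalizing n s W with
  | zero => simpa [dtV_zero] using h.inHV ht
  | succ i ih =>
    obtain ⟨n, rfl⟩ : ∃ n', n = n' + 1 := ⟨n - 1, by omega⟩
    have := ih (h.dt) (by omega)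
    rw [← dtV_succ] at this
    convert this using 1
    push_cast
    ring

theorem normKV_mono {k' : ℕ} (h : InCStarV I k' s W) {s' : ℝ}
    (hs : s' ≤ s) (hk : k ≤ k') {t : ℝ} (ht : t ∈ I) :
    normKV I k s' W t ≤ normKV I k' s W t := by
  refine le_trans (sum_le_sum fun i hi => ?_) (normKV_mono_left hk s W t)
  rw [mem_range] at hi
  exact hnormV_mono (by linarith) (h.inHV_dtV ht (by omega))

theorem dtV_one_eq {t : ℝ} (ht : t ∈ I) {w' : Vec}
    (h : ∀ i, HasDerivWithinAt (fun τ => (W τ).at i) (w'.at i) I t) : dtV I 1 W t = w' :=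
  Vec.ext_at fun i => by
    change dt I 1 (fun τ => W τ i.1) t i.2 = _
    rw [dt_one]
    exact (h i).derivWithin (TimeInterval.uniq t ht)

theorem normKV_add_le (h : InCStarV I k s W) (h' : InCStarV I k s W')
    {t : ℝ} (ht : t ∈ I) :
    normKV I k s (fun τ => W τ + W' τ) t ≤ normKV I k s W t + normKV I k s W' t := by
  induction k generalizing s W W' with
  | zero => simp only [normKV_zero]; exact hnormV_add_le (h.inHV ht) (h'.inHV ht)
  | succ k ih =>
    simp only [normKV_succ]
    have e : ∀ τ ∈ I, dtV I 1 (fun τ => W τ + W' τ) τ = dtV I 1 W τ + dtV I 1 W' τ :=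
      fun τ hτ => dtV_one_eq hτ fun i => (h.hasDeriv hτ i).add (h'.hasDeriv hτ i)
    rw [normKV_congr e ht]
    have h1 := hnormV_add_le (h.inHV ht) (h'.inHV ht)
    have h2 := ih (h.dt) (h'.dt)
    linarith

theorem normKV_smul (h : InCStarV I k s W) (c : ℂ) {t : ℝ} (ht : t ∈ I) :
    normKV I k s (fun τ => c • W τ) t = ‖c‖ * normKV I k s W t := by
  induction k generalizing s W with
  | zero => simp only [normKV_zero]; exact hnormV_smul c (h.inHV ht)
  | succ k ih =>
    simp only [normKV_succ]
    have e : ∀ τ ∈ I, dtV I 1 (fun τ => c • W τ) τ = c • dtV I 1 W τ :=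
      fun τ hτ => dtV_one_eq hτ fun i => (h.hasDeriv hτ i).const_mul c
    rw [normKV_congr e ht, ih (h.dt), hnormV_smul c (h.inHV ht), mul_add]

theorem normKV_const (v : Vec) {t : ℝ} (ht : t ∈ I) : normKV I k s (fun _ => v) t = hnormV s v := by
  induction k generalizing s v with
  | zero => simp only [normKV_zero]
  | succ k ih =>
    have e : ∀ τ ∈ I, dtV I 1 (fun _ => v) τ = 0 :=
      fun τ hτ => dtV_one_eq hτ fun i => hasDerivWithinAt_const _ _ _
    rw [normKV_succ, normKV_congr e ht, ih, hnormV_zero, add_zero]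

theorem normKV_sum_le {ι : Type*} (S : Finset ι) {f : ι → ℝ → Vec}
    (h : ∀ i ∈ S, InCStarV I k s (f i)) {t : ℝ} (ht : t ∈ I) :
    normKV I k s (fun τ => ∑ i ∈ S, f i τ) t ≤ ∑ i ∈ S, normKV I k s (f i) t := by
  classical
  induction S using induction_on with
  | empty => simp [normKV_const 0 ht]
  | insert a S ha ih =>
    simp only [sum_insert ha]
    have h' : ∀ i ∈ S, InCStarV I k s (f i) := fun i hi => h i (by simp [hi])
    exact (normKV_add_le (h a (by simp)) (InCStarV.sum S h') ht).trans (add_le_add le_rfl (ih h'))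

theorem inCStarV_zero (hc : ∀ i, ContinuousOn (fun t => (W t).at i) I)
    (hb : ∀ t ∈ I, Bdd (𝓝[I] t) (s + 1) W) : InCStarV I 0 s W := fun σ k hk => by
  obtain rfl := Nat.le_zero.1 hk
  simpa using inCk_zero hc hb σ

theorem inCStarV_succ (h : InCStarV I n (s - 3 / 2) W')
    (hd : ∀ t ∈ I, ∀ i, HasDerivWithinAt (fun τ => (W τ).at i) ((W' t).at i) I t)
    (hb : ∀ t ∈ I, Bdd (𝓝[I] t) (s + 1) W) (hb' : ∀ t ∈ I, Bdd (𝓝[I] t) (s + 1 / 2) W') :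
    InCStarV I (n + 1) s W := fun σ k hk => by
  cases k with
  | zero => exact inCStarV_zero (fun i t ht => (hd t ht i).continuousWithinAt) hb σ 0 le_rfl
  | succ k =>
    have h1 := h σ k (by omega)
    rw [show s - 3 / 2 - 3 / 2 * (k : ℝ) = s - 3 / 2 * ((k + 1 : ℕ) : ℝ) by push_cast; ring] at h1
    have hk0 : (0 : ℝ) ≤ k := Nat.cast_nonneg k
    exact inCk_succ h1 hd (fun t ht => ((hb t ht).inHV ht).mono (by push_cast; linarith))
      fun t ht => (hb' t ht).mono (by push_cast; linarith)

/-! ### Extended multilinear maps along paths -/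

variable {α : Type*} [Fintype α] [DecidableEq α]

theorem ext_hasDerivWithinAt {A : ML(α, VTP)} {C S : ℝ} (hC : 0 ≤ C)
    (hA : NB A C S) {t : ℝ} (ht : t ∈ I) {w w' : α → ℝ → Vec}
    (hb : ∀ a, Bdd (𝓝[I] t) (S + 2) (w a)) (hb' : ∀ a, Bdd (𝓝[I] t) (S + 2) (w' a))
    (hw : ∀ a, ∀ τ ∈ I, ∀ i, HasDerivWithinAt (fun τ => (w a τ).at i) ((w' a τ).at i) I τ)
    (i : Idx) :
    HasDerivWithinAt (fun τ => (ext A fun a => w a τ).at i)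
      ((∑ b, ext A (update (fun a => w a t) b (w' b t))).at i) I t := by
  rw [Vec.sum_at]
  exact extS_hasDerivWithinAt hC (hA.kb i) TimeInterval.ord ht hb hb' hw

/-- Distribution of time derivatives among the arguments; the argument `v` is singled out. -/
def extBd (I : Set ℝ) (v : α) (S : ℝ) (k : ℕ) (s : ℝ) (W : α → ℝ → Vec) (t : ℝ) : ℝ :=
  ∑ k' ∈ range (k + 1), ∑ b, normKV I (if b = v then k - k' else k') (s + S) (W b) t *
    ∏ a ∈ univ.erase b, normKV I (if a = v then k - k' else k') S (W a) t

theorem extBd_nonneg (v : α) (S : ℝ) (k : ℕ) (s : ℝ) (W : α → ℝ → Vec) (t : ℝ) :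
    0 ≤ extBd I v S k s W t :=
  sum_nonneg fun _ _ => sum_nonneg fun _ _ => mul_nonneg (normKV_nonneg _ _ _ _)
    (prod_nonneg fun _ _ => normKV_nonneg _ _ _ _)

theorem le_extBd (v : α) (S : ℝ) {k k' : ℕ} (hk : k' ≤ k) (s : ℝ) (W : α → ℝ → Vec) (t : ℝ)
    (b : α) {y : ℝ} {x : α → ℝ} (hx0 : ∀ a, 0 ≤ x a)
    (hb : y ≤ normKV I (if b = v then k - k' else k') (s + S) (W b) t)
    (ha : ∀ a ≠ b, x a ≤ normKV I (if a = v then k - k' else k') S (W a) t) :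
    y * ∏ a ∈ univ.erase b, x a ≤ extBd I v S k s W t := by
  have h1 : y * ∏ a ∈ univ.erase b, x a ≤ normKV I (if b = v then k - k' else k') (s + S) (W b) t *
        ∏ a ∈ univ.erase b, normKV I (if a = v then k - k' else k') S (W a) t :=
    mul_le_mul hb (Finset.prod_le_prod (fun a _ => hx0 a) fun a h => ha a (ne_of_mem_erase h))
      (prod_nonneg fun a _ => hx0 a) (normKV_nonneg _ _ _ _)
  have h0 : ∀ k' b, 0 ≤ normKV I (if b = v then k - k' else k') (s + S) (W b) t *
        ∏ a ∈ univ.erase b, normKV I (if a = v then k - k' else k') S (W a) t :=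
    fun _ _ => mul_nonneg (normKV_nonneg _ _ _ _) (prod_nonneg fun _ _ => normKV_nonneg _ _ _ _)
  refine h1.trans ((single_le_sum (fun b _ => h0 k' b) (mem_univ b)).trans ?_)
  exact single_le_sum (f := fun k' => ∑ b, normKV I (if b = v then k - k' else k') (s + S)
    (W b) t * ∏ a ∈ univ.erase b, normKV I (if a = v then k - k' else k') S (W a) t)
    (fun k' _ => sum_nonneg fun b _ => h0 k' b) (mem_range.2 (by omega))

theorem Bdd.ext [Nonempty α] {A : ML(α, VTP)} {S σ C : ℝ} (hσ : 0 ≤ σ) (hC : 0 ≤ C)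
    (hA : ∀ U : α → Vec, (∀ a, InHV (σ + S) (U a)) → InHV σ (ext A U) ∧ hnormV σ (ext A U) ≤
      C * ∑ b, hnormV (σ + S) (U b) * ∏ a ∈ univ.erase b, hnormV S (U a))
    {l : Filter ℝ} {f : α → ℝ → Vec} (h : ∀ a, Bdd l (σ + S) (f a)) :
    Bdd l σ fun τ => PluriHom.ext A fun a => f a τ := by
  choose B hB using h
  refine ⟨C * ∑ b, B b * ∏ a ∈ univ.erase b, B a, ?_⟩
  filter_upwards [Filter.eventually_all.2 hB] with τ hτ
  obtain ⟨h1, h2⟩ := hA _ fun a => (hτ a).1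
  refine ⟨h1, h2.trans (mul_le_mul_of_nonneg_left (sum_le_sum fun b _ => ?_) hC)⟩
  refine mul_le_mul (hτ b).2 (Finset.prod_le_prod (fun _ _ => hnormV_nonneg _ _) fun a _ => ?_)
    (prod_nonneg fun _ _ => hnormV_nonneg _ _) ((hnormV_nonneg _ _).trans (hτ b).2)
  exact (hnormV_mono (by linarith) (hτ a).1).trans (hτ a).2

theorem shift_index (b a v : α) {k k' : ℕ} (h : k' ≤ k) :
    (if a = b then (if a = v then k - k' else k') + 1 else if a = v then k - k' else k') ≤
      (if a = v then k + 1 - (if b = v then k' else k' + 1) else if b = v then k' else k' + 1) ∧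
    (if a = v then k + 1 - (if b = v then k' else k' + 1) else if b = v then k' else k' + 1) ≤
      k + 1 := by
  by_cases h1 : a = b
  · subst h1
    by_cases h2 : a = v <;> simp [h2] <;> omega
  · by_cases h2 : a = v
    · subst h2
      simp [h1, Ne.symm h1]; omega
    · by_cases h3 : b = v <;> simp [h1, h2, h3] <;> omega

theorem ext_path [Nonempty α] (v : α)
    {A : ML(α, VTP)} (hA : Good A) (n : ℕ) :
    ∃ S ≥ (0 : ℝ), ∀ s ≥ S, ∃ C ≥ (0 : ℝ), ∀ W : α → ℝ → Vec, (∀ a, InCStarV I n (s + S) (W a)) →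
      InCStarV I n s (fun t => ext A fun a => W a t) ∧
      ∀ k ≤ n, ∀ t ∈ I, normKV I k s (fun t => ext A fun a => W a t) t ≤ C * extBd I v S k s W t := by
  obtain ⟨S₀, hS₀, hb⟩ := hA.ext_bound
  obtain ⟨Cn, hCn, S₁, hS₁, hN⟩ := hA.exists_nb
  have base : ∀ S ≥ S₀ + 1, ∀ s ≥ (0 : ℝ), ∃ C ≥ (0 : ℝ), ∀ n, ∀ W : α → ℝ → Vec,
      (∀ a, InCStarV I n (s + S) (W a)) → ∀ t ∈ I, ∀ k,
        hnormV s (ext A fun a => W a t) ≤ C * extBd I v S k s W t := by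
    intro S hS s hs
    obtain ⟨C, hC, h⟩ := hb s hs
    refine ⟨C * Fintype.card α, by positivity, fun n W hW t ht k => ?_⟩
    have hWt := fun a => (hW a).inHV ht
    refine (h (fun a => W a t) fun a => (hWt a).mono (by linarith)).2.trans ?_
    rw [mul_assoc]
    refine mul_le_mul_of_nonneg_left ?_ hC
    refine (sum_le_card_nsmul _ _ (extBd I v S k s W t) fun b _ => ?_).trans_eq (by simp)
    refine le_extBd v S (Nat.zero_le k) s W t b (fun a => hnormV_nonneg _ _) ?_ fun a ha => ?_
    · exact (hnormV_mono (by linarith) (hWt b)).trans (hnormV_le_normKV _ _ _ _)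
    · exact (hnormV_mono (by linarith) ((hWt a).mono (show S ≤ s + S by linarith))).trans
        (hnormV_le_normKV _ _ _ _)
  induction n with
  | zero =>
    refine ⟨S₀ + S₁ + 2, by linarith, fun s hs => ?_⟩
    obtain ⟨C, hC, h⟩ := base (S₀ + S₁ + 2) (by linarith) s (by linarith)
    obtain ⟨C', hC', h'⟩ := hb (s + 1) (by linarith)
    refine ⟨C, hC, fun W hW => ⟨inCStarV_zero (fun i t ht => extS_tendsto hCn (hN.kb i)
      (fun a => ((hW a).mono (by linarith)).bdd ht) fun a i => ((hW a).continuousOn i t ht))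
      fun t ht => .ext (by linarith) hC' h' fun a => ((hW a).mono (by linarith)).bdd ht,
      fun k hk t ht => ?_⟩⟩
    obtain rfl := Nat.le_zero.1 hk
    rw [normKV_zero]
    exact h 0 W hW t ht 0
  | succ n ih =>
    obtain ⟨S, hS, ih⟩ := ih
    generalize hS'def : S + S₀ + S₁ + 10 = S'
    refine ⟨S', by linarith, fun s hs => ?_⟩
    obtain ⟨C₁, hC₁, h₁⟩ := base S' (by linarith) s (by linarith)
    obtain ⟨C₂, hC₂, h₂⟩ := ih (s - 3 / 2) (by linarith)
    obtain ⟨C₃, hC₃, h₃⟩ := hb (s + 1) (by linarith)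
    refine ⟨C₁ + Fintype.card α * (C₂ * ((n + 1 : ℕ) * Fintype.card α)), by positivity, fun W hW => ?_⟩
    set W₁ : α → α → ℝ → Vec := fun b => update W b (dtV I 1 (W b)) with hW₁
    have e₁ : ∀ b t, (fun a => W₁ b a t) = update (fun a => W a t) b (dtV I 1 (W b) t) := fun b t => by
      funext a
      by_cases h : a = b
      · subst h; simp [hW₁]
      · simp [hW₁, h]
    have hd := fun b => (hW b).dt
    have hW₁c : ∀ b a, InCStarV I n (s - 3 / 2 + S') (W₁ b a) := fun b a => by
      by_cases h : a = b
      · subst h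
        simp only [hW₁, update_self]
        exact (hd a).mono (by linarith)
      · simp only [hW₁, update_of_ne h]
        exact ((hW a).of_le (Nat.le_succ n)).mono (by linarith)
    have hder : ∀ t ∈ I, ∀ i, HasDerivWithinAt (fun τ => (ext A fun a => W a τ).at i)
        ((∑ b, ext A fun a => W₁ b a t).at i) I t := by
      intro t ht i
      simp only [e₁]
      exact ext_hasDerivWithinAt hCn hN ht (w' := fun a => dtV I 1 (W a))
        (fun a => ((hW a).mono (by linarith)).bdd ht) (fun a => ((hd a).mono (by linarith)).bdd ht)
        (fun a τ hτ i => (hW a).hasDeriv hτ i) i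
    have h₂' := fun b => h₂ (W₁ b) fun a => (hW₁c b a).mono (by linarith)
    refine ⟨inCStarV_succ (InCStarV.sum _ fun b _ => (h₂' b).1) hder (fun t ht => .ext
      (by linarith) hC₃ h₃ fun a => ((hW a).mono (by linarith)).bdd ht) (fun t ht => .mono
        (s := s + 1) (.sum univ fun b _ => .ext (by linarith) hC₃ h₃ fun a =>
          ((hW₁c b a).mono (by linarith)).bdd ht) (by linarith)), fun k hk t ht => ?_⟩
    have hX := extBd_nonneg (I := I) v S' k s W t
    cases k with
    | zero =>
      rw [normKV_zero]
      refine (h₁ (n + 1) W hW t ht 0).trans (mul_le_mul_of_nonneg_right ?_ hX)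
      exact le_add_of_nonneg_right (by positivity)
    | succ k =>
      rw [normKV_succ, add_mul]
      refine add_le_add (h₁ (n + 1) W hW t ht (k + 1)) ?_
      rw [normKV_congr (fun τ hτ => dtV_one_eq hτ (hder τ hτ)) ht]
      refine (normKV_sum_le _ (fun b _ => (h₂' b).1.of_le (by omega)) ht).trans ?_
      rw [mul_assoc, ← nsmul_eq_mul, ← card_univ, ← sum_const]
      refine sum_le_sum fun b _ => ((h₂' b).2 k (by omega) t ht).trans ?_
      rw [mul_assoc]
      refine mul_le_mul_of_nonneg_left ?_ hC₂
      have hW₁n : ∀ a, ∀ κ, ∀ κ' ≤ n + 1, (if a = b then κ + 1 else κ) ≤ κ' →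
          ∀ x y, x + 3 / 2 ≤ y → InCStarV I κ' y (W a) →
            normKV I κ x (W₁ b a) t ≤ normKV I κ' y (W a) t := by
        intro a κ κ' hκ' hκ x y hxy hy
        by_cases hab : a = b
        · subst hab
          rw [if_pos rfl] at hκ
          simp only [hW₁, update_self]
          refine le_trans ?_ (normKV_mono hy hxy hκ ht)
          have := normKV_dt_le (I := I) κ (x + 3 / 2) (W a) t
          rwa [add_sub_cancel_right] at this
        · rw [if_neg hab] at hκ
          simp only [hW₁, update_of_ne hab]
          exact normKV_mono hy (by linarith) hκ ht
      refine (sum_le_card_nsmul _ _ (Fintype.card α * extBd I v S' (k + 1) s W t)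
        fun k' hk' => ?_).trans ?_
      · refine (sum_le_card_nsmul _ _ (extBd I v S' (k + 1) s W t) fun b' _ => ?_).trans_eq (by simp)
        rw [mem_range] at hk'
        have hi := fun a => shift_index b a v (show k' ≤ k by omega)
        have hi' := fun a => (hi a).2.trans hk
        exact le_extBd v _ (k' := if b = v then k' else k' + 1) (by split_ifs <;> omega) s W t b'
          (fun a => normKV_nonneg _ _ _ _)
          (hW₁n b' _ _ (hi' b') (hi b').1 _ _ (by linarith) ((hW b').of_le (hi' b'))) fun a ha =>
          hW₁n a _ _ (hi' a) (hi a).1 _ _ (by linarith) (((hW a).of_le (hi' a)).mono (by linarith))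
      · rw [card_range, nsmul_eq_mul, mul_assoc]
        refine mul_le_mul_of_nonneg_right ?_ (by positivity)
        exact_mod_cast (by omega)

end vpaths

end

section

/-! ### Tame operators depending on a path -/

abbrev Op : Type := (ℝ → Vec) → ℝ → Vec → Vec

/-- Small balls of paths, for a fixed Sobolev norm. -/
def small (I : Set ℝ) (K : ℕ) (s : ℝ) : Filter (ℝ → Vec) where
  sets := {S | ∃ ρ > (0 : ℝ), ∀ U, InBall I K s ρ U → U ∈ S}
  univ_sets := ⟨1, one_pos, fun _ _ => trivial⟩
  sets_of_superset := fun ⟨ρ, hρ, h⟩ hS => ⟨ρ, hρ, fun U hU => hS (h U hU)⟩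
  inter_sets := fun ⟨ρ, hρ, h⟩ ⟨ρ', hρ', h'⟩ => ⟨min ρ ρ', lt_min hρ hρ', fun U ⟨hU, r, hr, hb⟩ =>
    ⟨h U ⟨hU, r, hr.trans_le (min_le_left _ _), hb⟩,
      h' U ⟨hU, r, hr.trans_le (min_le_right _ _), hb⟩⟩⟩

/-- Pairs of a high regularity and a path that is small in the corresponding norm. -/
def germ (I : Set ℝ) (K : ℕ) : Filter (ℝ × (ℝ → Vec)) :=
  atTop.bind fun s => (small I K s).map (Prod.mk s)

/-- Bilinear tame expression: `v`, `w` are high and low norms of the argument, `y`, `x` those of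
the path. -/
def tm (p : ℕ) (v w x y : ℝ) : ℝ := v * x ^ p + w * x ^ (p - 1) * y

variable {I : Set ℝ} [TimeInterval I] {K J n p q : ℕ} {m s₀ s t : ℝ} {U V : ℝ → Vec}

theorem small_mono (hs : s₀ ≤ s) : small I K s ≤ small I K s₀ := fun _ ⟨ρ, hρ, h⟩ =>
  ⟨ρ, hρ, fun U ⟨hU, r, hr, hb⟩ => h U ⟨hU.mono hs, r, hr, fun t ht =>
    (normKV_mono hU hs le_rfl ht).trans (hb t ht)⟩⟩

theorem small_inC : ∀ᶠ U in small I K s, InCStarV I K s U := ⟨1, one_pos, fun _ h => h.1⟩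

theorem small_le : ∀ᶠ U in small I K s, ∀ k ≤ K, ∀ t ∈ I, normKV I k s U t ≤ 1 :=
  ⟨1, one_pos, fun _ ⟨_, _, hr, hb⟩ _ hk t ht =>
    (normKV_mono_left hk _ _ _).trans ((hb t ht).trans hr.le)⟩

theorem germ_iff {P : ℝ × (ℝ → Vec) → Prop} :
    (∀ᶠ x in germ I K, P x) ↔ ∀ᶠ s in atTop, ∀ᶠ U in small I K s, P (s, U) := Iff.rfl

theorem germ_fst {P : ℝ → Prop} (h : ∀ᶠ s in atTop, P s) : ∀ᶠ x in germ I K, P x.1 :=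
  germ_iff.2 (h.mono fun _ h => Eventually.of_forall fun _ => h)

theorem germ_inHV : ∀ᶠ x in germ I K, ∀ t ∈ I, InHV x.1 (x.2 t) :=
  germ_iff.2 (Eventually.of_forall fun _ => small_inC.mono fun _ h _ ht => h.inHV ht)

theorem eventually_sub {P : ℝ → Prop} (h : ∀ᶠ s in atTop, P s) (m : ℝ) : ∀ᶠ s in atTop, P (s - m) :=
  (tendsto_atTop_add_const_right atTop (-m) tendsto_id).eventually h

/-! ### Tame expressions -/

theorem tm_nonneg {v w x y : ℝ} (hv : 0 ≤ v) (hw : 0 ≤ w) (hx : 0 ≤ x) (hy : 0 ≤ y) :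
    0 ≤ tm p v w x y := by
  unfold tm
  positivity

theorem tm_mono {v w x y v' w' x' y' : ℝ} (hv : v ≤ v') (hw : w ≤ w') (hx : x ≤ x') (hy : y ≤ y')
    (hv0 : 0 ≤ v := by exact normKV_nonneg _ _ _ _) (hw0 : 0 ≤ w := by exact normKV_nonneg _ _ _ _)
    (hx0 : 0 ≤ x := by exact normKV_nonneg _ _ _ _)
    (hy0 : 0 ≤ y := by exact normKV_nonneg _ _ _ _) : tm p v w x y ≤ tm p v' w' x' y' := by
  have := hw0.trans hw
  have := hv0.trans hv
  have := hx0.trans hx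
  unfold tm
  gcongr

theorem pow_mul_pow_le {a b x : ℝ} {i j r : ℕ} (ha : 0 ≤ a) (hb : 0 ≤ b) (hax : a ≤ x) (hbx : b ≤ x)
    (hx : x ≤ 1) (hr : r ≤ i + j) : a ^ i * b ^ j ≤ x ^ r := by
  have h0 : 0 ≤ x := ha.trans hax
  calc _ ≤ x ^ i * x ^ j := by gcongr
    _ = x ^ (i + j) := (pow_add _ _ _).symm
    _ ≤ _ := pow_le_pow_of_le_one h0 hx hr

theorem tm_comp {v w a b a' b' x y : ℝ} (hv : 0 ≤ v) (hw : 0 ≤ w) (ha : 0 ≤ a) (hb : 0 ≤ b)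
    (ha' : 0 ≤ a') (hb' : 0 ≤ b') (hax : a ≤ x) (ha'x : a' ≤ x) (hx : x ≤ 1) (hby : b ≤ y)
    (hb'y : b' ≤ y) :
    tm p (tm q v w a b) (tm q w w a a) a' b' ≤ 3 * tm (p + q) v w x y := by
  have e1 := pow_mul_pow_le (i := q) (j := p) (r := p + q) ha ha' hax ha'x hx (by omega)
  have e2 := pow_mul_pow_le (i := q - 1) (j := p) (r := p + q - 1) ha ha' hax ha'x hx (by omega)
  have e3 := pow_mul_pow_le (i := q) (j := p - 1) (r := p + q - 1) ha ha' hax ha'x hx (by omega)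
  have e4 := pow_mul_pow_le (i := q - 1 + 1) (j := p - 1) (r := p + q - 1) ha ha' hax ha'x hx
    (by omega)
  have hx0 : 0 ≤ x := ha.trans hax
  calc _ = v * (a ^ q * a' ^ p) + w * (a ^ (q - 1) * a' ^ p) * b + w * (a ^ q * a' ^ (p - 1)) * b' +
        w * (a ^ (q - 1 + 1) * a' ^ (p - 1)) * b' := by unfold tm; ring
    _ ≤ v * x ^ (p + q) + w * x ^ (p + q - 1) * y + w * x ^ (p + q - 1) * y +
        w * x ^ (p + q - 1) * y := by gcongr
    _ ≤ _ := by
      have := mul_nonneg hv (pow_nonneg hx0 (p + q))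
      unfold tm
      linarith

theorem tm_self {x y : ℝ} (hx1 : x ≤ 1) (hy : 0 ≤ y) :
    tm p y x x y ≤ 2 * (x ^ p * y) := by
  unfold tm
  cases p with
  | zero => rw [pow_zero]; nlinarith
  | succ p => rw [Nat.add_sub_cancel, pow_succ]; linarith

theorem tm_scale {v w x y x' y' D : ℝ} (hv : 0 ≤ v) (hw : 0 ≤ w) (hx' : 0 ≤ x') (hy' : 0 ≤ y')
    (hx : 0 ≤ x) (hy : 0 ≤ y) (hD : 1 ≤ D) (h : x' ≤ D * x) (h' : y' ≤ D * y) :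
    tm p v w x' y' ≤ D ^ (p + 1) * tm p v w x y := by
  calc _ ≤ v * (D * x) ^ p + w * (D * x) ^ (p - 1) * (D * y) := by unfold tm; gcongr
    _ = D ^ p * (v * x ^ p) + D ^ (p - 1 + 1) * (w * x ^ (p - 1) * y) := by
      rw [mul_pow, mul_pow]; ring
    _ ≤ D ^ (p + 1) * (v * x ^ p) + D ^ (p + 1) * (w * x ^ (p - 1) * y) := by
      gcongr <;> omega
    _ = _ := by unfold tm; ring

def bnd (I : Set ℝ) (p J k : ℕ) (s₀ s : ℝ) (U V : ℝ → Vec) (t : ℝ) : ℝ :=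
  ∑ k' ∈ range (k + 1), tm p (normKV I (k - k') s V t) (normKV I (k - k') s₀ V t)
    (normKV I (k' + J) s₀ U t) (normKV I (k' + J) s U t)

theorem bnd_nonneg (p J k : ℕ) (s₀ s : ℝ) (U V : ℝ → Vec) (t : ℝ) : 0 ≤ bnd I p J k s₀ s U V t :=
  sum_nonneg fun _ _ => tm_nonneg (normKV_nonneg _ _ _ _) (normKV_nonneg _ _ _ _)
    (normKV_nonneg _ _ _ _) (normKV_nonneg _ _ _ _)

theorem tm_le_bnd {k k' : ℕ} (h : k' ≤ k) :
    tm p (normKV I (k - k') s V t) (normKV I (k - k') s₀ V t) (normKV I (k' + J) s₀ U t)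
      (normKV I (k' + J) s U t) ≤ bnd I p J k s₀ s U V t :=
  single_le_sum (f := fun k' => tm p (normKV I (k - k') s V t) (normKV I (k - k') s₀ V t)
    (normKV I (k' + J) s₀ U t) (normKV I (k' + J) s U t))
    (fun _ _ => tm_nonneg (normKV_nonneg _ _ _ _) (normKV_nonneg _ _ _ _)
      (normKV_nonneg _ _ _ _) (normKV_nonneg _ _ _ _)) (mem_range.2 (Nat.lt_succ_of_le h))

theorem le_bnd_zero (k : ℕ) : normKV I k s V t ≤ bnd I 0 J k s₀ s U V t := by
  refine le_trans ?_ (tm_le_bnd (Nat.zero_le k))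
  rw [tm, pow_zero, mul_one, Nat.sub_zero]
  exact le_add_of_nonneg_right (mul_nonneg (mul_nonneg (normKV_nonneg _ _ _ _) (by simp))
    (normKV_nonneg _ _ _ _))

theorem sum_range_le {f : ℕ → ℝ} {x : ℝ} {k n : ℕ} (hk : k ≤ n) (hx : 0 ≤ x)
    (h : ∀ l ≤ k, f l ≤ x) : ∑ l ∈ range (k + 1), f l ≤ (n + 1 : ℕ) * x := by
  refine (sum_le_card_nsmul _ _ x fun l hl => h l (by
    rw [mem_range] at hl; omega)).trans ?_
  rw [card_range, nsmul_eq_mul]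
  exact mul_le_mul_of_nonneg_right (by exact_mod_cast Nat.succ_le_succ hk) hx

/-! ### Classes of tame operators -/

def Est (I : Set ℝ) (K J n p : ℕ) (m : ℝ) (F : Op) : Prop :=
  ∀ᶠ s₀ in atTop, ∀ s ≥ s₀, ∃ C ≥ (0 : ℝ), ∀ᶠ U in small I K s₀, InCStarV I K s U →
    ∀ V, InCStarV I n s V → InCStarV I n (s - m) (fun t => F U t (V t)) ∧
      ∀ k ≤ n, ∀ t ∈ I, normKV I k (s - m) (fun t => F U t (V t)) t ≤ C * bnd I p J k s₀ s U V t

def Lin (I : Set ℝ) (K : ℕ) (F : Op) : Prop :=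
  ∀ᶠ x in germ I K, ∀ t ∈ I, ∀ V W, InHV x.1 V → InHV x.1 W → ∀ a : ℂ,
    F x.2 t (a • V + W) = a • F x.2 t V + F x.2 t W

/-- Tame operators, linear in the final argument, of degree at least `p` in the path. -/
def Cls (I : Set ℝ) (K J n p : ℕ) (F : Op) : Prop := (∃ m ≥ (0 : ℝ), Est I K J n p m F) ∧ Lin I K F

def AgreeOn (I : Set ℝ) (K : ℕ) (F F' : Op) : Prop :=
  ∀ᶠ x in germ I K, ∀ t ∈ I, ∀ V, InHV x.1 V → F x.2 t V = F' x.2 t V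

variable {F G : Op}

theorem Est.mono (h : Est I K J n p m F) {m' : ℝ} (hm : m ≤ m') : Est I K J n p m' F := by
  filter_upwards [h] with s₀ h s hs
  obtain ⟨C, hC, h⟩ := h s hs
  refine ⟨C, hC, ?_⟩
  filter_upwards [h] with U h hU V hV
  obtain ⟨h1, h2⟩ := h hU V hV
  exact ⟨h1.mono (by linarith), fun k hk t ht =>
    (normKV_mono (h1.of_le hk) (by linarith) le_rfl ht).trans (h2 k hk t ht)⟩

theorem Est.inHV (h : Est I K J n p m F) : ∀ᶠ x in germ I K, ∀ t ∈ I, ∀ V, InHV x.1 V →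
    InHV (x.1 - m) (F x.2 t V) := by
  refine germ_iff.2 ?_
  filter_upwards [h] with s h
  obtain ⟨C, hC, h⟩ := h s le_rfl
  filter_upwards [h, small_inC] with U h hU t ht V hV
  exact (h hU _ (InCStarV.const hV)).1.inHV ht

theorem Cls.congr (h : Cls I K J n p F) (e : AgreeOn I K F G) : Cls I K J n p G := by
  obtain ⟨⟨m, hm, hE⟩, hL⟩ := h
  refine ⟨⟨m, hm, ?_⟩, ?_⟩
  · filter_upwards [hE, germ_iff.1 e] with s₀ h e s hs
    obtain ⟨C, hC, h⟩ := h s hs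
    refine ⟨C, hC, ?_⟩
    filter_upwards [h, e] with U h e hU V hV
    obtain ⟨h1, h2⟩ := h hU V hV
    have e : ∀ t ∈ I, F U t (V t) = G U t (V t) := fun t ht => e t ht _ ((hV.inHV ht).mono hs)
    exact ⟨h1.congr e, fun k hk t ht => by rw [← normKV_congr e ht]; exact h2 k hk t ht⟩
  · filter_upwards [hL, e] with x h e t ht V W hV hW a
    rw [← e t ht _ ((hV.smul a).add hW), ← e t ht _ hV, ← e t ht _ hW, h t ht V W hV hW a]

theorem Cls.mono_p (hK : J + n ≤ K) {p' : ℕ} (h : Cls I K J n p' F) (hp : p ≤ p') :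
    Cls I K J n p F := by
  obtain ⟨⟨m, hm, hE⟩, hL⟩ := h
  refine ⟨⟨m, hm, ?_⟩, hL⟩
  filter_upwards [hE] with s₀ h s hs
  obtain ⟨C, hC, h⟩ := h s hs
  refine ⟨C, hC, ?_⟩
  filter_upwards [h, small_le] with U h h1 hU V hV
  refine (h hU V hV).imp_right fun h2 k hk t ht => (h2 k hk t ht).trans
    (mul_le_mul_of_nonneg_left (sum_le_sum fun k' hk' => ?_) hC)
  rw [mem_range] at hk'
  have hA := h1 (k' + J) (by omega) t ht
  have N := fun k s V => normKV_nonneg (I := I) k s V t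
  exact add_le_add (mul_le_mul_of_nonneg_left (pow_le_pow_of_le_one (N _ _ _) hA hp) (N _ _ _))
    (mul_le_mul_of_nonneg_right (mul_le_mul_of_nonneg_left (pow_le_pow_of_le_one (N _ _ _) hA
      (by omega)) (N _ _ _)) (N _ _ _))

theorem Cls.mono_J {J' : ℕ} (h : Cls I K J n p F) (hJ : J ≤ J') : Cls I K J' n p F := by
  obtain ⟨⟨m, hm, hE⟩, hL⟩ := h
  refine ⟨⟨m, hm, ?_⟩, hL⟩
  filter_upwards [hE] with s₀ h s hs
  obtain ⟨C, hC, h⟩ := h s hs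
  refine ⟨C, hC, ?_⟩
  filter_upwards [h] with U h hU V hV
  exact (h hU V hV).imp_right fun h2 k hk t ht => (h2 k hk t ht).trans
    (mul_le_mul_of_nonneg_left (sum_le_sum fun k' _ => tm_mono le_rfl le_rfl
      (normKV_mono_left (by omega) _ _ _) (normKV_mono_left (by omega) _ _ _)) hC)

theorem Cls.id : Cls I K J n 0 fun _ _ V => V :=
  ⟨⟨0, le_rfl, Eventually.of_forall fun s₀ s _ => ⟨1, zero_le_one, Eventually.of_forall
    fun U _ V hV => ⟨by rwa [sub_zero], fun k _ t _ => by
      rw [one_mul, sub_zero]; exact le_bnd_zero k⟩⟩⟩,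
    Eventually.of_forall fun _ _ _ _ _ _ _ _ => rfl⟩

theorem Cls.zero (p : ℕ) : Cls I K J n p fun _ _ _ => 0 :=
  ⟨⟨0, le_rfl, Eventually.of_forall fun s₀ s _ => ⟨1, zero_le_one, Eventually.of_forall
    fun U _ V hV => ⟨InCStarV.const (InHV.zero _), fun k _ t ht => by
      rw [normKV_const 0 ht, hnormV_zero, one_mul]; exact bnd_nonneg _ _ _ _ _ _ _ _⟩⟩⟩,
    Eventually.of_forall fun _ t _ V W _ _ a => by simp⟩

theorem Cls.add (hF : Cls I K J n p F) (hG : Cls I K J n p G) :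
    Cls I K J n p fun U t V => F U t V + G U t V := by
  obtain ⟨⟨m, hm, hE⟩, hL⟩ := hF
  obtain ⟨⟨m', hm', hE'⟩, hL'⟩ := hG
  refine ⟨⟨m + m', by positivity, ?_⟩, ?_⟩
  · filter_upwards [hE.mono (le_add_of_nonneg_right hm'), hE'.mono (le_add_of_nonneg_left hm)]
      with s₀ h h' s hs
    obtain ⟨C, hC, h⟩ := h s hs
    obtain ⟨C', hC', h'⟩ := h' s hs
    refine ⟨C + C', by positivity, ?_⟩
    filter_upwards [h, h'] with U h h' hU V hV
    obtain ⟨h1, h2⟩ := h hU V hV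
    obtain ⟨h1', h2'⟩ := h' hU V hV
    refine ⟨h1.add h1', fun k hk t ht => ?_⟩
    refine (normKV_add_le (h1.of_le hk) (h1'.of_le hk) ht).trans ?_
    rw [add_mul]
    exact add_le_add (h2 k hk t ht) (h2' k hk t ht)
  · filter_upwards [hL, hL'] with x h h' t ht V W hV hW a
    rw [h t ht V W hV hW a, h' t ht V W hV hW a, smul_add]
    abel

theorem Cls.smul (hF : Cls I K J n p F) (b : ℂ) : Cls I K J n p fun U t V => b • F U t V := by
  obtain ⟨⟨m, hm, hE⟩, hL⟩ := hF
  refine ⟨⟨m, hm, ?_⟩, ?_⟩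
  · filter_upwards [hE] with s₀ h s hs
    obtain ⟨C, hC, h⟩ := h s hs
    refine ⟨‖b‖ * C, by positivity, ?_⟩
    filter_upwards [h] with U h hU V hV
    obtain ⟨h1, h2⟩ := h hU V hV
    refine ⟨h1.smul b, fun k hk t ht => ?_⟩
    rw [normKV_smul (h1.of_le hk) b ht, mul_assoc]
    exact mul_le_mul_of_nonneg_left (h2 k hk t ht) (norm_nonneg _)
  · filter_upwards [hL] with x h t ht V W hV hW a
    rw [h t ht V W hV hW a, smul_add, smul_comm]

theorem Cls.sum {ι : Type*} (S : Finset ι) {f : ι → Op} (h : ∀ i ∈ S, Cls I K J n p (f i)) :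
    Cls I K J n p fun U t V => ∑ i ∈ S, f i U t V := by
  classical
  induction S using induction_on with
  | empty => simpa using Cls.zero p
  | insert a S ha ih =>
    simp only [sum_insert ha]
    exact (h a (by simp)).add (ih fun i hi => h i (by simp [hi]))

/-- The estimate at high and low regularity, with one constant. -/
theorem Est.pair (h : Est I K J n p m F) : ∀ᶠ s₀ in atTop, ∀ s ≥ s₀, ∃ C ≥ (0 : ℝ),
    ∀ᶠ U in small I K s₀, InCStarV I K s U → ∀ V, InCStarV I n s V →
      InCStarV I n (s - m) (fun t => F U t (V t)) ∧ ∀ k ≤ n, ∀ t ∈ I,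
        normKV I k (s - m) (fun t => F U t (V t)) t ≤ C * bnd I p J k s₀ s U V t ∧
        normKV I k (s₀ - m) (fun t => F U t (V t)) t ≤ C * bnd I p J k s₀ s₀ U V t := by
  filter_upwards [h] with s₀ h s hs
  obtain ⟨C, hC, h₁⟩ := h s hs
  obtain ⟨C', hC', h₂⟩ := h s₀ le_rfl
  refine ⟨C + C', by positivity, ?_⟩
  filter_upwards [h₁, h₂, small_inC] with U h₁ h₂ hU0 hU V hV
  refine (h₁ hU V hV).imp_right fun h1 k hk t ht => ⟨(h1 k hk t ht).trans ?_,
    ((h₂ hU0 V (hV.mono hs)).2 k hk t ht).trans ?_⟩ <;>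
  exact mul_le_mul_of_nonneg_right (by linarith) (bnd_nonneg _ _ _ _ _ _ _ _)

theorem Cls.comp (hK : J + n ≤ K) (hF : Cls I K J n p F) (hG : Cls I K J n q G) :
    Cls I K J n (p + q) fun U t V => F U t (G U t V) := by
  obtain ⟨⟨m, hm, hE⟩, hL⟩ := hF
  obtain ⟨⟨m', hm', hE'⟩, hL'⟩ := hG
  refine ⟨⟨m' + m, by positivity, ?_⟩, ?_⟩
  · filter_upwards [hE'.pair, eventually_sub hE m'] with s₀ h h' s hs
    obtain ⟨C₁, hC₁, h₁⟩ := h s hs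
    obtain ⟨C₂, hC₂, h₂⟩ := h' (s - m') (by linarith)
    refine ⟨C₂ * ((n + 1 : ℕ) * (C₁ * ((n + 1 : ℕ) * 3))), by positivity, ?_⟩
    filter_upwards [h₁, h₂.filter_mono (small_mono (sub_le_self _ hm')), small_inC, small_le]
      with U h₁ h₂ hU0 hU1 hU V hV
    obtain ⟨g1, g2⟩ := h₁ hU V hV
    obtain ⟨g3, g4⟩ := h₂ (hU.mono (by linarith)) _ g1
    rw [show s - (m' + m) = s - m' - m by ring]
    refine ⟨g3, fun k hk t ht => (g4 k hk t ht).trans ?_⟩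
    have b0 := bnd_nonneg (I := I) (p + q) J k s₀ s U V t
    have N := fun k s V => normKV_nonneg (I := I) k s V t
    rw [mul_assoc, mul_assoc]
    refine mul_le_mul_of_nonneg_left (sum_range_le hk (by positivity) fun k' hk' => ?_) hC₂
    obtain ⟨g5, g6⟩ := g2 (k - k') (by omega) t ht
    refine (tm_mono g5 g6 (normKV_mono (hU0.of_le (by omega)) (sub_le_self _ hm') le_rfl ht)
      (normKV_mono (hU.of_le (by omega)) (sub_le_self _ hm') le_rfl ht)).trans ?_
    have e : ∀ (f g : ℕ → ℝ) (x y : ℝ), tm p (C₁ * ∑ l ∈ range (k - k' + 1), f l)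
        (C₁ * ∑ l ∈ range (k - k' + 1), g l) x y =
          C₁ * ∑ l ∈ range (k - k' + 1), tm p (f l) (g l) x y := fun f g x y => by
      simp only [tm, sum_add_distrib, ← sum_mul]
      ring
    rw [bnd, bnd, e, mul_assoc C₁, mul_assoc]
    refine mul_le_mul_of_nonneg_left (sum_range_le (by omega) (by positivity) fun l hl => ?_) hC₁
    refine le_trans ?_ (mul_le_mul_of_nonneg_left (tm_le_bnd (show k' + l ≤ k by omega)) zero_le_three)
    rw [Nat.sub_sub]
    exact tm_comp (N _ _ _) (N _ _ _) (N _ _ _) (N _ _ _) (N _ _ _) (N _ _ _)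
      (normKV_mono_left (by omega) _ _ _) (normKV_mono_left (by omega) _ _ _)
      (hU1 _ (by omega) t ht) (normKV_mono_left (by omega) _ _ _) (normKV_mono_left (by omega) _ _ _)
  · refine germ_iff.2 ?_
    filter_upwards [germ_iff.1 hL', germ_iff.1 hE'.inHV,
      eventually_sub (germ_iff.1 hL) m'] with s h h' h''
    filter_upwards [h, h', h''.filter_mono (small_mono (sub_le_self _ hm'))]
      with U h h' h'' t ht V W hV hW a
    exact (congrArg _ (h t ht V W hV hW a)).trans (h'' t ht _ _ (h' t ht V hV) (h' t ht W hW) a)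

end

section

variable {I : Set ℝ} [TimeInterval I] {K J n p : ℕ} {m : ℝ} {F : Op}

theorem Est.self (hK : J + n ≤ K) (hE : Est I K J n p m F) :
    ∀ᶠ s₀ in atTop, ∀ s ≥ s₀, ∃ C ≥ (0 : ℝ), ∀ᶠ U in small I K s₀, InCStarV I K s U →
      InCStarV I n (s - m) (fun t => F U t (U t)) ∧ ∀ k ≤ n, ∀ t ∈ I,
        normKV I k (s - m) (fun t => F U t (U t)) t ≤
          C * (normKV I (k + J) s₀ U t ^ p * normKV I (k + J) s U t) ∧
        normKV I k (s₀ - m) (fun t => F U t (U t)) t ≤ C * normKV I (k + J) s₀ U t ^ (p + 1) := by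
  filter_upwards [hE.pair] with s₀ h s hs
  obtain ⟨C, hC, h⟩ := h s hs
  refine ⟨C * ((n + 1 : ℕ) * 2), by positivity, ?_⟩
  filter_upwards [h, small_le] with U h h1 hU
  refine (h hU U (hU.of_le (by omega))).imp_right fun h2 k hk t ht => ?_
  have key : ∀ s, bnd I p J k s₀ s U U t ≤
      (n + 1 : ℕ) * (2 * (normKV I (k + J) s₀ U t ^ p * normKV I (k + J) s U t)) := fun s => by
    have hA := normKV_nonneg (I := I) (k + J) s₀ U t
    have hB := normKV_nonneg (I := I) (k + J) s U t
    refine sum_range_le hk (by positivity) fun l hl => (tm_mono ?_ ?_ ?_ ?_).trans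
      (tm_self (h1 _ (by omega) t ht) hB) <;> exact normKV_mono_left (by omega) _ _ _
  obtain ⟨g1, g2⟩ := h2 k hk t ht
  rw [pow_succ, mul_assoc C, mul_assoc, mul_assoc C, mul_assoc _ 2]
  exact ⟨g1.trans (mul_le_mul_of_nonneg_left (key s) hC),
    g2.trans (mul_le_mul_of_nonneg_left (key s₀) hC)⟩

variable {α : Type*} [Fintype α] [DecidableEq α]

theorem tm_prod {P : α → ℕ} {lo hi : α → ℝ} {D x y w w' : ℝ} (v : α) (hD : 1 ≤ D)
    (hx : 0 ≤ x) (hy : 0 ≤ y) (hw : 0 ≤ w) (hw' : 0 ≤ w') (h0 : ∀ a, 0 ≤ lo a)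
    (hlo : ∀ a ≠ v, lo a ≤ D * x ^ (P a + 1)) (hhi : ∀ a ≠ v, hi a ≤ D * (x ^ P a * y))
    (hlv : lo v ≤ w) (hhv : hi v ≤ w') (b : α) : hi b * ∏ a ∈ univ.erase b, lo a ≤
      D ^ Fintype.card α * tm (∑ a ∈ univ.erase v, (P a + 1)) w' w x y := by
  have hle : ∀ z : ℝ, 0 ≤ z → z ≤ D * z := fun z hz => le_mul_of_one_le_left hz hD
  have hD0 : 0 ≤ D := by linarith
  let l : α → ℝ := fun a => if a = v then w else x ^ (P a + 1)
  let h : α → ℝ := fun a => if a = v then w' else x ^ P a * y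
  have hl : ∀ a, lo a ≤ D * l a := fun a => by
    by_cases e : a = v
    · subst e; simpa [l] using hlv.trans (hle w hw)
    · simpa [l, e] using hlo a e
  have hh : hi b ≤ D * h b := by
    by_cases e : b = v
    · subst e; simpa [h] using hhv.trans (hle w' hw')
    · simpa [h, e] using hhi b e
  have hh0 : 0 ≤ h b := by dsimp only [h]; split_ifs <;> positivity
  have hT : ∀ T : Finset α, v ∉ T → ∏ a ∈ T, l a = x ^ ∑ a ∈ T, (P a + 1) := fun T hT => by
    rw [← Finset.prod_pow_eq_pow_sum]
    exact prod_congr rfl fun a ha => if_neg fun e : a = v => hT (e ▸ ha)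
  calc _ ≤ D * h b * ∏ a ∈ univ.erase b, D * l a :=
        mul_le_mul hh (Finset.prod_le_prod (fun a _ => h0 a) fun a _ => hl a)
          (prod_nonneg fun a _ => h0 a) (mul_nonneg hD0 hh0)
    _ = D ^ Fintype.card α * (h b * ∏ a ∈ univ.erase b, l a) := by
        rw [prod_mul_distrib, prod_const, ← card_univ, ← Finset.card_erase_add_one (mem_univ b)]
        ring
    _ ≤ _ := by
      refine mul_le_mul_of_nonneg_left ?_ (by positivity)
      by_cases e : b = v
      · subst e
        rw [hT _ (by simp), show h b = w' from if_pos rfl]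
        exact le_add_of_nonneg_right (by positivity)
      · have hvb : v ∈ univ.erase b := mem_erase.2 ⟨Ne.symm e, mem_univ v⟩
        rw [← mul_prod_erase _ _ hvb, Finset.erase_right_comm, hT _ (by simp), show l v = w from
          if_pos rfl, show h b = x ^ P b * y from if_neg e, tm,
          ← add_sum_erase _ _ (mem_erase.2 ⟨e, mem_univ b⟩ : b ∈ univ.erase v)]
        refine le_add_of_nonneg_of_le (by positivity) (le_of_eq ?_)
        rw [add_right_comm, Nat.add_sub_cancel, pow_add]
        ring

theorem Cls.ext [Nonempty α] (hK : J + n ≤ K) {A : ML(α, VTP)} (hA : Good A) (v : α) {X : α → Op}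
    {P : α → ℕ} (hX : ∀ a, Cls I K J n (P a) (X a)) :
    Cls I K J n (∑ a ∈ univ.erase v, (P a + 1)) fun U t V =>
      ext A (update (fun a => X a U t (U t)) v V) := by
  choose m hm hE using fun a => (hX a).1
  have hms : ∀ a, m a ≤ ∑ a, m a := fun a => single_le_sum (fun a _ => hm a) (mem_univ a)
  set M := ∑ a, m a
  have hM : 0 ≤ M := sum_nonneg fun a _ => hm a
  obtain ⟨S, hS, hpath⟩ := ext_path (I := I) v hA n
  obtain ⟨Cn, hCn, S₁, hS₁, hN⟩ := hA.exists_nb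
  refine ⟨⟨M + S, by positivity, ?_⟩, germ_iff.2 ?_⟩
  · filter_upwards [eventually_all.2 fun a => (hE a).self hK, eventually_ge_atTop (M + S + S)]
      with s₀ h hs₀ s hs
    choose C hC h using fun a => h a s hs
    obtain ⟨B, hB, hext⟩ := hpath (s - (M + S)) (by linarith)
    set D := 1 + ∑ a, C a with hD
    have hCD : ∀ a, C a ≤ D := fun a =>
      (single_le_sum (fun a _ => hC a) (mem_univ a)).trans (by linarith)
    have hD1 : 1 ≤ D := le_add_of_nonneg_right (sum_nonneg fun a _ => hC a)
    refine ⟨B * ((n + 1 : ℕ) * (Fintype.card α * D ^ Fintype.card α)), by positivity, ?_⟩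
    filter_upwards [eventually_all.2 h] with U h hU V hV
    have h := fun a => h a hU
    set W : α → ℝ → Vec := update (fun a t => X a U t (U t)) v V with hW
    have eW : ∀ t, (fun a => W a t) = update (fun a => X a U t (U t)) v (V t) := fun t => by
      funext a
      by_cases h : a = v
      · subst h; simp [hW]
      · simp [hW, h]
    have Wv : W v = V := by simp [hW]
    have Wa : ∀ a ≠ v, W a = fun t => X a U t (U t) := fun a h => by simp [hW, h]
    have hWC : ∀ a, InCStarV I n (s - (M + S) + S) (W a) := fun a => by
      by_cases e : a = v
      · subst e; rw [Wv]; exact hV.mono (by linarith)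
      · rw [Wa a e]; exact (h a).1.mono (by linarith [hms a])
    obtain ⟨f1, f2⟩ := hext W hWC
    simp only [eW] at f1 f2
    refine ⟨f1, fun k hk t ht => (f2 k hk t ht).trans ?_⟩
    have hb := bnd_nonneg (I := I) (∑ a ∈ univ.erase v, (P a + 1)) J k s₀ s U V t
    rw [mul_assoc, mul_assoc, mul_assoc]
    refine mul_le_mul_of_nonneg_left (sum_range_le hk (by positivity) fun k' hk' => ?_) hB
    refine (sum_le_card_nsmul _ _ (D ^ Fintype.card α *
      bnd I (∑ a ∈ univ.erase v, (P a + 1)) J k s₀ s U V t) fun b _ => ?_).trans_eq (by simp)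
    refine le_trans ?_ (mul_le_mul_of_nonneg_left (tm_le_bnd hk') (by positivity))
    have N := fun k s V => normKV_nonneg (I := I) k s V t
    refine tm_prod (lo := fun a => normKV I (if a = v then k - k' else k') S (W a) t)
      (hi := fun b => normKV I (if b = v then k - k' else k') (s - (M + S) + S) (W b) t) v hD1
      (N _ _ _) (N _ _ _) (N _ _ _) (N _ _ _) (fun a => N _ _ _) (fun a e => ?_) (fun a e => ?_)
      ?_ ?_ b
    · rw [if_neg e, Wa a e]
      refine (normKV_mono (((h a).1.of_le (by omega)).mono (by linarith)) (by linarith [hms a])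
        le_rfl ht).trans (((h a).2 k' (by omega) t ht).2.trans ?_)
      exact mul_le_mul_of_nonneg_right (hCD a) (pow_nonneg (N _ _ _) _)
    · rw [if_neg e, Wa a e]
      refine (normKV_mono ((h a).1.of_le (by omega)) (by linarith [hms a]) le_rfl ht).trans
        (((h a).2 k' (by omega) t ht).1.trans ?_)
      exact mul_le_mul_of_nonneg_right (hCD a) (mul_nonneg (pow_nonneg (N _ _ _) _) (N _ _ _))
    · rw [if_pos rfl, Wv]
      exact normKV_mono ((hV.of_le (by omega)).mono hs) (by linarith) le_rfl ht
    · rw [if_pos rfl, Wv]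
      exact normKV_mono (hV.of_le (by omega)) (by linarith) le_rfl ht
  · filter_upwards [eventually_all.2 fun a => germ_iff.1 (hE a).inHV,
      eventually_ge_atTop (M + S₁ + 1)] with s h hs
    filter_upwards [eventually_all.2 h, small_inC] with U h hU t ht V W hV hW a
    have hx : ∀ b, InHV (S₁ + 1) (X b U t (U t)) := fun b =>
      (h b t ht _ (hU.inHV ht)).mono (by linarith [hms b])
    refine Vec.ext_at fun i => ?_
    simp only [Vec.add_at, Vec.smul_at, ext_at]
    rw [extS_update_add (hN.kb i) hx v ((hV.mono (by linarith)).smul a) (hW.mono (by linarith)),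
      extS_update_smul]

/-- Maps between paths that act boundedly on every Sobolev space. -/
def PathOK (I : Set ℝ) (K K₁ : ℕ) (Z : (ℝ → Vec) → ℝ → Vec) : Prop :=
  ∀ᶠ c in atTop, ∀ s ≥ c, ∃ C ≥ (0 : ℝ), ∀ᶠ U in small I K c, InCStarV I K s U →
    InCStarV I K₁ s (Z U) ∧ ∀ k ≤ K₁, ∀ t ∈ I, normKV I k s (Z U) t ≤ C * normKV I k s U t

theorem PathOK.tendsto {K₁ : ℕ} (hK₁ : K₁ ≤ K) {Z : (ℝ → Vec) → ℝ → Vec} (hZ : PathOK I K K₁ Z) :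
    ∀ᶠ s in atTop, Tendsto Z (small I K s) (small I K₁ s) := by
  filter_upwards [hZ] with s h
  obtain ⟨C, hC, r, hr, h⟩ := h s le_rfl
  rintro T ⟨ρ, hρ, hT⟩
  refine ⟨min r (ρ / (2 * (C + 1))), by positivity, fun U hU => hT _ ?_⟩
  obtain ⟨h0, r', hr', hb⟩ := hU
  obtain ⟨h1, h2⟩ := h U ⟨h0, r', hr'.trans_le (min_le_left _ _), hb⟩ h0
  refine ⟨h1, ρ / 2, by linarith, fun t ht => (h2 K₁ le_rfl t ht).trans ?_⟩
  have h3 : normKV I K₁ s U t ≤ ρ / (2 * (C + 1)) := (normKV_mono_left hK₁ _ _ _).trans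
    ((hb t ht).trans (hr'.le.trans (min_le_right _ _)))
  calc _ ≤ (C + 1) * (ρ / (2 * (C + 1))) :=
        mul_le_mul (by linarith) h3 (normKV_nonneg _ _ _ _) (by linarith)
    _ = ρ / 2 := by field_simp

theorem Cls.path {K₁ J₁ : ℕ} (hK₁ : K₁ ≤ K) (hJ : J₁ ≤ J) (hn : J₁ + n ≤ K₁)
    {Z : (ℝ → Vec) → ℝ → Vec} (hZ : PathOK I K K₁ Z) (hF : Cls I K₁ J₁ n p F) :
    Cls I K J n p fun U t V => F (Z U) t V := by
  obtain ⟨⟨m, hm, hE⟩, hL⟩ := hF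
  refine ⟨⟨m, hm, ?_⟩, germ_iff.2 ?_⟩
  · filter_upwards [hE, hZ, hZ.tendsto hK₁] with s₀ h hZ hT s hs
    obtain ⟨C₁, hC₁, h₁⟩ := h s hs
    obtain ⟨C₂, hC₂, h₂⟩ := hZ s₀ le_rfl
    obtain ⟨C₃, hC₃, h₃⟩ := hZ s hs
    refine ⟨C₁ * (1 + C₂ + C₃) ^ (p + 1), by positivity, ?_⟩
    filter_upwards [hT.eventually h₁, h₂, h₃, small_inC] with U g h₂ h₃ hU0 hU V hV
    have h₂ := (h₂ hU0).2
    obtain ⟨h4, h₃⟩ := h₃ hU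
    obtain ⟨f1, f2⟩ := g h4 V hV
    refine ⟨f1, fun k hk t ht => (f2 k hk t ht).trans ?_⟩
    rw [mul_assoc]
    refine mul_le_mul_of_nonneg_left ?_ hC₁
    rw [bnd, bnd, mul_sum]
    refine sum_le_sum fun k' hk' => ?_
    rw [mem_range] at hk'
    have N := fun k s V => normKV_nonneg (I := I) k s V t
    exact tm_scale (N _ _ _) (N _ _ _) (N _ _ _) (N _ _ _) (N _ _ _) (N _ _ _) (by linarith)
      ((h₂ _ (by omega) t ht).trans (mul_le_mul (by linarith) (normKV_mono_left (by omega) _ _ _)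
        (N _ _ _) (by positivity)))
      ((h₃ _ (by omega) t ht).trans (mul_le_mul (by linarith) (normKV_mono_left (by omega) _ _ _)
        (N _ _ _) (by positivity)))
  · filter_upwards [germ_iff.1 hL, hZ.tendsto hK₁] with s h hT
    exact hT.eventually h

end

section

variable {I : Set ℝ} [TimeInterval I] {K J n p : ℕ} {m s₀ s : ℝ} {G : Op}

/-! ### Time derivatives of tame operators -/

/-- Product rule for an operator applied to a path. -/
theorem hasDeriv_apply {T : ℝ → Vec → Vec} {T' : Vec} {t : ℝ} (ht : t ∈ I)
    {σ σ' C : ℝ}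
    (hlin : ∀ τ ∈ I, ∀ V W, InHV σ V → InHV σ W → ∀ a : ℂ, T τ (a • V + W) = a • T τ V + T τ W)
    (hbd : ∀ τ ∈ I, ∀ v, InHV σ v → InHV σ' (T τ v) ∧ hnormV σ' (T τ v) ≤ C * hnormV σ v)
    {V V' : ℝ → Vec} (hV : ∀ τ ∈ I, ∀ i, HasDerivWithinAt (fun τ => (V τ).at i) ((V' τ).at i) I τ)
    (hVσ : ∀ τ ∈ I, InHV σ (V τ)) (hb : Bdd (𝓝[I] t) (σ + 2) V')
    (hT : ∀ i, HasDerivWithinAt (fun τ => (T τ (V t)).at i) (T'.at i) I t)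
    (hc : ∀ i, ContinuousWithinAt (fun τ => (T τ (V' t)).at i) I t) (i : Idx) :
    HasDerivWithinAt (fun τ => (T τ (V τ)).at i) ((T' + T t (V' t)).at i) I t := by
  have hV'σ := (hb.inHV ht).mono (show σ ≤ σ + 2 by linarith)
  obtain ⟨⟨B, hB⟩, hd0⟩ := slope_tendsto TimeInterval.ord ht hV hb
  set d : ℝ → Vec := fun τ => ((τ - t : ℝ) : ℂ)⁻¹ • (V τ - V t) - V' t with hd
  have hdσ : ∀ᶠ τ in 𝓝[I \ {t}] t, τ ∈ I \ {t} ∧ InHV σ (d τ) := by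
    filter_upwards [hB, self_mem_nhdsWithin] with τ hτ hτI
    exact ⟨hτI, hτ.1.mono (by linarith)⟩
  have hTd := tendsto_at_of_hnormV (hdσ.mono fun τ hτ => (hbd τ hτ.1.1 _ hτ.2).1)
    (squeeze_zero' (Eventually.of_forall fun _ => hnormV_nonneg _ _)
      (hdσ.mono fun τ hτ => (hbd τ hτ.1.1 _ hτ.2).2) (by simpa only [mul_zero] using hd0.const_mul C)) i
  rw [hasDerivWithinAt_iff_tendsto_slope]
  have h1 := (hasDerivWithinAt_iff_tendsto_slope.1 (hT i)).add
    (hTd.add ((hc i).tendsto.mono_left (nhdsWithin_mono _ Set.sdiff_subset)))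
  rw [zero_add] at h1
  refine h1.congr' (hdσ.mono fun τ ⟨hτI, hdτ⟩ => ?_)
  have hne : ((τ - t : ℝ) : ℂ) ≠ 0 := Complex.ofReal_ne_zero.2 (sub_ne_zero.2 hτI.2)
  have e : V τ = ((τ - t : ℝ) : ℂ) • ((1 : ℂ) • d τ + V' t) + V t := by
    simp only [hd, one_smul, sub_add_cancel]
    rw [smul_inv_smul₀ hne, sub_add_cancel]
  have e2 : T τ (V τ) = ((τ - t : ℝ) : ℂ) • (T τ (d τ) + T τ (V' t)) + T τ (V t) := by
    rw [e, hlin τ hτI.1 _ _ ((hdτ.smul 1).add hV'σ) (hVσ t ht), hlin τ hτI.1 _ _ hdτ hV'σ, one_smul]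
  rw [slope_def_module, slope_def_module, e2]
  simp only [Vec.add_at, Vec.smul_at, Complex.real_smul, Complex.ofReal_inv]
  field_simp
  ring

theorem dtV_add {k : ℕ} {W W' : ℝ → Vec} (h : InCStarV I k s W)
    (h' : InCStarV I k s W') {t : ℝ} (ht : t ∈ I) :
    dtV I k (fun τ => W τ + W' τ) t = dtV I k W t + dtV I k W' t := by
  induction k generalizing s W W' with
  | zero => simp only [dtV_zero]
  | succ k ih =>
    have e : ∀ τ ∈ I, dtV I 1 (fun τ => W τ + W' τ) τ = dtV I 1 W τ + dtV I 1 W' τ :=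
      fun τ hτ => dtV_one_eq hτ fun i => (h.hasDeriv hτ i).add (h'.hasDeriv hτ i)
    rw [dtV_succ, dtV_congr e k ht, ih (h.dt) (h'.dt), ← dtV_succ, ← dtV_succ]

theorem dtV_smul {k : ℕ} {W : ℝ → Vec} (h : InCStarV I k s W) (a : ℂ)
    {t : ℝ} (ht : t ∈ I) : dtV I k (fun τ => a • W τ) t = a • dtV I k W t := by
  induction k generalizing s W with
  | zero => simp only [dtV_zero]
  | succ k ih =>
    have e : ∀ τ ∈ I, dtV I 1 (fun τ => a • W τ) τ = a • dtV I 1 W τ :=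
      fun τ hτ => dtV_one_eq hτ fun i => (h.hasDeriv hτ i).const_mul a
    rw [dtV_succ, dtV_congr e k ht, ih (h.dt), ← dtV_succ]

theorem dtV_succ' (k : ℕ) (W : ℝ → Vec) : dtV I (k + 1) W = dtV I 1 (dtV I k W) := by
  induction k generalizing W with
  | zero => rw [dtV_zero]
  | succ k ih => rw [dtV_succ, ih, ← dtV_succ]

theorem InCStarV.dtk {j l : ℕ} {W : ℝ → Vec} (h : InCStarV I (j + l) s W) :
    InCStarV I l (s - 3 / 2 * (j : ℝ)) (dtV I j W) := by
  induction j generalizing s W with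
  | zero => simpa [dtV_zero] using h
  | succ j ih =>
    rw [dtV_succ]
    have := ih (InCStarV.dt (h.of_le (show j + l + 1 ≤ j + 1 + l by omega)))
    convert this using 1
    push_cast
    ring

theorem normKV_bdd {k : ℕ} {W : ℝ → Vec} (h : InCStarV I k s W) {t : ℝ}
    (ht : t ∈ I) : ∃ B, ∀ᶠ τ in 𝓝[I] t, normKV I k s W τ ≤ B := by
  induction k generalizing s W with
  | zero =>
    obtain ⟨B, hB⟩ := h.bdd ht
    exact ⟨B, hB.mono fun τ h => by rw [normKV_zero]; exact h.2⟩
  | succ k ih =>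
    obtain ⟨B, hB⟩ := h.bdd ht
    obtain ⟨B', hB'⟩ := ih (h.dt)
    refine ⟨B + B', ?_⟩
    filter_upwards [hB, hB'] with τ h1 h2
    rw [normKV_succ]
    exact add_le_add h1.2 h2

def dtOp (I : Set ℝ) (j : ℕ) (G : Op) : Op := fun U t v => dtV I j (fun τ => G U τ v) t

section dtOp

variable (hK : J + n ≤ K) (hE : Est I K J n p m G) (hL : Lin I K G)

include hE in
theorem dtOp_bound : ∀ᶠ s₀ in atTop, ∀ s ≥ s₀, ∃ C ≥ (0 : ℝ), ∀ᶠ U in small I K s₀,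
    InCStarV I K s U → ∀ j ≤ n, ∀ t ∈ I, ∀ v, InHV s v →
      InHV (s - m - 3 / 2 * (j : ℝ)) (dtOp I j G U t v) ∧
      hnormV (s - m - 3 / 2 * (j : ℝ)) (dtOp I j G U t v) ≤ C * tm p (hnormV s v) (hnormV s₀ v)
        (normKV I (J + j) s₀ U t) (normKV I (J + j) s U t) := by
  filter_upwards [hE] with s₀ h s hs
  obtain ⟨C, hC, h⟩ := h s hs
  refine ⟨C * (n + 1 : ℕ), by positivity, ?_⟩
  filter_upwards [h] with U h hU j hj t ht v hv
  obtain ⟨h1, h2⟩ := h hU _ (InCStarV.const hv)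
  refine ⟨h1.inHV_dtV ht hj, ?_⟩
  refine (hnormV_dtV_le_normKV (I := I) le_rfl _ _ _).trans ((h2 j hj t ht).trans ?_)
  rw [mul_assoc]
  have v0 := fun s => hnormV_nonneg s v
  refine mul_le_mul_of_nonneg_left (sum_range_le hj (tm_nonneg (v0 _) (v0 _)
    (normKV_nonneg _ _ _ _) (normKV_nonneg _ _ _ _)) fun l hl => ?_) hC
  exact tm_mono (normKV_const v ht).le (normKV_const v ht).le (normKV_mono_left (by omega) _ _ _)
    (normKV_mono_left (by omega) _ _ _)

include hK hE in
theorem dtOp_unif : ∀ᶠ s in atTop, ∃ C ≥ (0 : ℝ), ∀ᶠ U in small I K s, ∀ j ≤ n, ∀ t ∈ I, ∀ v,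
    InHV s v → InHV (s - m - 3 / 2 * (j : ℝ)) (dtOp I j G U t v) ∧
      hnormV (s - m - 3 / 2 * (j : ℝ)) (dtOp I j G U t v) ≤ C * hnormV s v := by
  filter_upwards [dtOp_bound hE] with s h
  obtain ⟨C, hC, h⟩ := h s le_rfl
  refine ⟨C * 2, by positivity, ?_⟩
  filter_upwards [h, small_inC, small_le] with U h hU h1 j hj t ht v hv
  have hA := h1 (J + j) (by omega) t ht
  have v0 := hnormV_nonneg s v
  refine (h hU j hj t ht v hv).imp_right fun h2 => h2.trans ?_
  rw [mul_assoc]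
  refine mul_le_mul_of_nonneg_left ((tm_mono le_rfl le_rfl hA hA v0 v0).trans_eq ?_) hC
  simp [tm, two_mul]

include hE hL in
theorem dtOp_lin : ∀ᶠ x in germ I K, ∀ j ≤ n, ∀ t ∈ I, ∀ V W, InHV x.1 V → InHV x.1 W → ∀ a : ℂ,
    dtOp I j G x.2 t (a • V + W) = a • dtOp I j G x.2 t V + dtOp I j G x.2 t W := by
  refine germ_iff.2 ?_
  filter_upwards [hE, germ_iff.1 hL] with s h hL
  obtain ⟨C, hC, h⟩ := h s le_rfl
  filter_upwards [h, hL, small_inC] with U h hL hU j hj t ht V W hV hW a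
  have hV' := (h hU _ (InCStarV.const hV)).1.of_le hj
  have hW' := (h hU _ (InCStarV.const hW)).1.of_le hj
  simp only [dtOp]
  rw [dtV_congr (fun τ hτ => hL τ hτ V W hV hW a) j ht, dtV_add (hV'.smul a) hW' ht,
    dtV_smul hV' a ht]

include hK hE hL in
/-- Product rule, for the `j`-th time derivative of a tame operator. -/
theorem dtOp_hasDeriv : ∀ᶠ x in germ I K, ∀ j, j + 1 ≤ n → ∀ V, InCStarV I 1 x.1 V →
    ∀ t ∈ I, ∀ i, HasDerivWithinAt (fun τ => (dtOp I j G x.2 τ (V τ)).at i)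
      ((dtOp I (j + 1) G x.2 t (V t) + dtOp I j G x.2 t (dtV I 1 V t)).at i) I t := by
  refine germ_iff.2 ?_
  filter_upwards [eventually_sub ((germ_iff.1 (dtOp_lin hE hL)).and ((dtOp_unif hK hE).and hE)) 4]
    with s ⟨hlin, ⟨C, hC, hb⟩, h⟩
  obtain ⟨C', hC', h⟩ := h (s - 4) le_rfl
  refine Eventually.filter_mono (small_mono (show s - 4 ≤ s by linarith)) ?_
  filter_upwards [hlin, hb, h, small_inC] with U hlin hb h hU j hj V hV t ht i
  have hcst : ∀ v, InHV (s - 4) v → InCStarV I n (s - 4 - m) fun τ => G U τ v := fun v hv =>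
    (h hU _ (InCStarV.const hv)).1
  refine hasDeriv_apply ht (fun τ hτ => hlin j (by omega) τ hτ) (hb j (by omega)) (V' := dtV I 1 V)
    (fun τ hτ i => hV.hasDeriv hτ i) (fun τ hτ => (hV.inHV hτ).mono (by linarith))
    ((hV.dt.mono (by linarith)).bdd ht) (fun i => ?_) (fun i => ?_) i
  · have := (((hcst (V t) ((hV.inHV ht).mono (by linarith))).of_le hj).dtk (l := 1)).hasDeriv ht i
    rwa [← dtV_succ'] at this
  · exact (((hcst _ ((hV.dt.inHV ht).mono (by linarith))).of_le (show j + 0 ≤ n by omega)).dtk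
      (l := 0)).continuousOn i t ht

end dtOp

theorem bnd_zero_le (p J k : ℕ) (s₀ s : ℝ) (U V : ℝ → Vec) (t : ℝ) :
    bnd I p J 0 s₀ s U V t ≤ bnd I p J k s₀ s U V t := by
  refine le_trans ?_ (tm_le_bnd (Nat.zero_le k))
  rw [bnd, sum_range_one]
  exact tm_mono (normKV_mono_left (by omega) _ _ _) (normKV_mono_left (by omega) _ _ _) le_rfl le_rfl

theorem bnd_succ_le (p J k : ℕ) (s₀ s : ℝ) (U V : ℝ → Vec) (t : ℝ) :
    bnd I p (J + 1) k s₀ s U V t ≤ bnd I p J (k + 1) s₀ s U V t := by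
  rw [bnd, bnd, sum_range_succ' _ (k + 1)]
  refine le_trans (le_of_eq (sum_congr rfl fun i _ => ?_)) (le_add_of_nonneg_right (tm_nonneg
    (normKV_nonneg _ _ _ _) (normKV_nonneg _ _ _ _) (normKV_nonneg _ _ _ _) (normKV_nonneg _ _ _ _)))
  rw [show k + 1 - (i + 1) = k - i by omega, show i + 1 + J = i + (J + 1) by omega]

theorem bnd_dt_le {U V : ℝ → Vec} {k : ℕ} (hJ : k + J ≤ K) (hs : s₀ ≤ s) (hU : InCStarV I K s U)
    {t : ℝ} (ht : t ∈ I) :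
    bnd I p J k (s₀ - 3 / 2) (s - 3 / 2) U (dtV I 1 V) t ≤ bnd I p J (k + 1) s₀ s U V t := by
  rw [bnd, bnd, sum_range_succ _ (k + 1)]
  refine le_trans (sum_le_sum fun i hi => ?_) (le_add_of_nonneg_right (tm_nonneg
    (normKV_nonneg _ _ _ _) (normKV_nonneg _ _ _ _) (normKV_nonneg _ _ _ _) (normKV_nonneg _ _ _ _)))
  rw [mem_range] at hi
  rw [show k + 1 - i = k - i + 1 by omega]
  exact tm_mono (normKV_dt_le _ _ _ _) (normKV_dt_le _ _ _ _)
    (normKV_mono ((hU.of_le (by omega)).mono hs) (by linarith) le_rfl ht)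
    (normKV_mono (hU.of_le (by omega)) (by linarith) le_rfl ht)

theorem Est.dtOp_zero (hK : J + n ≤ K) (hE : Est I K J n p m G) (hL : Lin I K G) {j : ℕ}
    (hj : j ≤ n) : Est I K (J + j) 0 p (m + 3 / 2 * (n : ℝ) + 2) (dtOp I j G) := by
  have hj' : (j : ℝ) ≤ n := by exact_mod_cast hj
  filter_upwards [dtOp_bound hE, hE, eventually_sub (dtOp_unif hK hE) 1,
    eventually_sub (germ_iff.1 (dtOp_lin hE hL)) 1] with s₀ hb hE' hb₁ hlin s hs
  obtain ⟨C, hC, hb⟩ := hb s hs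
  obtain ⟨C', hC', hE'⟩ := hE' s hs
  obtain ⟨C₁, hC₁, hb₁⟩ := hb₁
  have hle := small_mono (I := I) (K := K) (show s₀ - 1 ≤ s₀ by linarith)
  refine ⟨C, hC, ?_⟩
  filter_upwards [hb, hE', hb₁.filter_mono hle, hlin.filter_mono hle, small_le]
    with U hb hE' hb₁ hlin h1 hU V hV
  have hb := hb hU j hj
  refine ⟨inCStarV_zero (fun i t ht => ?_) fun t ht => .mono (s := s - m - 3 / 2 * (j : ℝ)) ?_
    (by linarith), fun k hk t ht => ?_⟩
  · have hVt := hV.inHV ht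
    have hsub : ∀ τ ∈ I, InHV (s₀ - 1) (V τ - V t) := fun τ hτ =>
      ((hV.inHV hτ).sub hVt).mono (by linarith)
    have h1 : Tendsto (fun τ => hnormV (s₀ - 1) (V τ - V t)) (𝓝[I] t) (𝓝 0) :=
      hnormV_tendsto_zero (((hV.bdd ht).sub (.const hVt)).mono (by linarith)) fun i => by
        simpa using (hV.continuousOn i t ht).tendsto.sub_const ((V t).at i)
    have h2 : Tendsto (fun τ => (dtOp I j G U τ (V τ - V t)).at i) (𝓝[I] t) (𝓝 0) := by
      refine tendsto_at_of_hnormV (s := s₀ - 1 - m - 3 / 2 * (j : ℝ)) ?_ ?_ i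
      · filter_upwards [self_mem_nhdsWithin] with τ hτ
        exact (hb₁ j hj τ hτ _ (hsub τ hτ)).1
      · refine squeeze_zero' (Eventually.of_forall fun _ => hnormV_nonneg _ _) ?_
          (by simpa only [mul_zero] using h1.const_mul C₁)
        filter_upwards [self_mem_nhdsWithin] with τ hτ
        exact (hb₁ j hj τ hτ _ (hsub τ hτ)).2
    have h4 := h2.add ((((hE' hU _ (InCStarV.const hVt)).1.of_le
      (show j + 0 ≤ n by omega)).dtk (l := 0)).continuousOn i t ht).tendsto
    rw [zero_add] at h4
    refine h4.congr' ?_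
    filter_upwards [self_mem_nhdsWithin] with τ hτ
    have e2 := hlin j hj τ hτ _ _ (hsub τ hτ) (hVt.mono (by linarith)) 1
    rw [one_smul, sub_add_cancel, one_smul] at e2
    rw [e2]
    rfl
  · obtain ⟨B, hB⟩ := normKV_bdd (hU.of_le (show J + j ≤ K by omega)) ht
    obtain ⟨B', hB'⟩ := hV.bdd ht
    refine ⟨C * tm p B' B' 1 B, ?_⟩
    filter_upwards [hB, hB', self_mem_nhdsWithin] with τ h2 h3 hτ
    refine (hb τ hτ _ h3.1).imp_right fun h4 => h4.trans (mul_le_mul_of_nonneg_left ?_ hC)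
    exact tm_mono h3.2 ((hnormV_mono hs h3.1).trans h3.2) (h1 _ (by omega) τ hτ) h2
      (hnormV_nonneg _ _) (hnormV_nonneg _ _)
  · obtain rfl := Nat.le_zero.1 hk
    rw [normKV_zero, bnd, sum_range_one, Nat.sub_zero, normKV_zero, normKV_zero, Nat.zero_add]
    obtain ⟨h1, h2⟩ := hb t ht (V t) (hV.inHV ht)
    exact (hnormV_mono (by linarith) h1).trans h2

theorem Est.dtOp (hK : J + n ≤ K) (hm : 0 ≤ m) (hE : Est I K J n p m G) (hL : Lin I K G) (l : ℕ) :
    ∃ M ≥ (0 : ℝ), ∀ j, j + l ≤ n → Est I K (J + j) l p M (dtOp I j G) := by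
  induction l with
  | zero => exact ⟨_, by positivity, fun j hj => hE.dtOp_zero hK hL hj⟩
  | succ l ih =>
    obtain ⟨M, hM, ih⟩ := ih
    refine ⟨M + 4, by linarith, fun j hj => ?_⟩
    filter_upwards [eventually_sub (ih j (by omega)) (3 / 2), ih (j + 1) (by omega), ih j (by omega),
      germ_iff.1 (dtOp_hasDeriv hK hE hL)] with s₀ h₁ h₂ h₃ hder s hs
    obtain ⟨C₁, hC₁, h₁⟩ := h₁ (s - 3 / 2) (by linarith)
    obtain ⟨C₂, hC₂, h₂⟩ := h₂ s hs
    obtain ⟨C₃, hC₃, h₃⟩ := h₃ s hs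
    refine ⟨C₁ + C₂ + C₃, by positivity, ?_⟩
    filter_upwards [h₁.filter_mono (small_mono (by linarith)), h₂, h₃, hder] with U h₁ h₂ h₃ hder hU V hV
    obtain ⟨f₁, g₁⟩ := h₁ (hU.mono (by linarith)) _ hV.dt
    obtain ⟨f₂, g₂⟩ := h₂ hU V (hV.of_le (Nat.le_succ l))
    obtain ⟨f₃, g₃⟩ := h₃ hU V (hV.of_le (Nat.le_succ l))
    have hd := hder j (by omega) V ((hV.of_le (by omega)).mono (by linarith))
    have f₂' := f₂.mono (show s - 3 / 2 - M ≤ s - M by linarith)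
    have hsum := f₂'.add f₁
    refine ⟨inCStarV_succ (hsum.mono (by linarith)) hd
      (fun t ht => (f₃.mono (by linarith)).bdd ht) (fun t ht => (hsum.mono (by linarith)).bdd ht),
      fun k hk t ht => ?_⟩
    have e0 : hnormV (s - (M + 4)) (PluriHom.dtOp I j G U t (V t)) ≤
        C₃ * bnd I p (J + j) k s₀ s U V t := by
      refine (hnormV_mono (show s - (M + 4) ≤ s - M by linarith) (f₃.inHV ht)).trans ?_
      have := g₃ 0 (Nat.zero_le _) t ht
      rw [normKV_zero] at this
      exact this.trans (mul_le_mul_of_nonneg_left (bnd_zero_le _ _ _ _ _ _ _ _) hC₃)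
    cases k with
    | zero =>
      rw [normKV_zero]
      exact e0.trans (mul_le_mul_of_nonneg_right (by linarith) (bnd_nonneg _ _ _ _ _ _ _ _))
    | succ k =>
      rw [normKV_succ, normKV_congr (fun τ hτ => dtV_one_eq hτ (hd τ hτ)) ht]
      have e1 := normKV_add_le (f₂'.of_le (show k ≤ l by omega)) (f₁.of_le (by omega)) ht
      have e2 : _ ≤ C₂ * bnd I p (J + j) (k + 1) s₀ s U V t := (normKV_mono (f₂.of_le (show k ≤ l by omega))
        (show s - 3 / 2 - M ≤ s - M by linarith) le_rfl ht).trans ((g₂ k (by omega) t ht).trans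
          (mul_le_mul_of_nonneg_left (bnd_succ_le _ _ _ _ _ _ _ _) hC₂))
      have e3 : _ ≤ C₁ * bnd I p (J + j) (k + 1) s₀ s U V t := (g₁ k (by omega) t ht).trans
        (mul_le_mul_of_nonneg_left (bnd_dt_le (by omega) hs hU ht) hC₁)
      have e6 := normKV_mono (hsum.of_le (show k ≤ l by omega))
        (show s - (M + 4) - 3 / 2 ≤ s - 3 / 2 - M by linarith) le_rfl ht
      exact (add_le_add e0 (e6.trans (e1.trans (add_le_add e2 e3)))).trans_eq (by ring)

theorem Cls.exists_deriv (hK : J + (n + 1) ≤ K) (hG : Cls I K J (n + 1) p G) :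
    ∃ G₁, Cls I K (J + 1) n p G₁ ∧ ∀ᶠ x in germ I K, ∀ V, InCStarV I 1 x.1 V → ∀ t ∈ I, ∀ i,
      HasDerivWithinAt (fun τ => (G x.2 τ (V τ)).at i)
        ((G₁ x.2 t (V t) + G x.2 t (dtV I 1 V t)).at i) I t := by
  obtain ⟨⟨m, hm, hE⟩, hL⟩ := hG
  obtain ⟨M, hM, h⟩ := hE.dtOp hK hm hL n
  refine ⟨dtOp I 1 G, ⟨⟨M, hM, h 1 (by omega)⟩, (dtOp_lin hE hL).mono fun x h => h 1 (by omega)⟩, ?_⟩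
  filter_upwards [dtOp_hasDeriv hK hE hL] with x h V hV t ht i
  simpa only [dtOp, dtV_zero] using h 0 (by omega) V hV t ht i

theorem Cls.of_le (hK : J + n ≤ K) (hG : Cls I K J n p G) {l : ℕ} (hl : l ≤ n) :
    Cls I K J l p G := by
  obtain ⟨⟨m, hm, hE⟩, hL⟩ := hG
  obtain ⟨M, hM, h⟩ := hE.dtOp hK hm hL l
  have e : dtOp I 0 G = G := by
    funext U t V; simp only [dtOp, dtV_zero]
  exact ⟨⟨M, hM, e ▸ h 0 (by omega)⟩, hL⟩

end

section

variable {I : Set ℝ} [TimeInterval I] {K K' J n p q : ℕ} {m r s : ℝ} {F : Op}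

/-! ### Scalar entries -/

theorem sum_inc (V : Vec) : ∑ σ, inc σ (V σ) = V := by
  funext τ
  rw [sum_univ_two]
  fin_cases τ <;> simp [inc]

theorem inc_add (σ : Fin 2) (u v : Coef) : inc σ (u + v) = inc σ u + inc σ v := by
  funext τ
  by_cases h : τ = σ
  · subst h; simp [inc]
  · simp [inc, h]

theorem inc_smul (σ : Fin 2) (a : ℂ) (u : Coef) : inc σ (a • u) = a • inc σ u := by
  funext τ
  by_cases h : τ = σ
  · subst h; simp [inc]
  · simp [inc, h]

theorem dtV_inc (σ : Fin 2) (k : ℕ) (u : ℝ → Coef) (t : ℝ) :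
    dtV I k (fun τ => inc σ (u τ)) t = inc σ (dt I k u t) := by
  funext τ
  by_cases h : τ = σ
  · subst h; simp [inc, dtV]
  · funext j
    simp [inc, dtV, h, dt, iteratedDerivWithin_fun_const_zero]

theorem normKV_inc (σ : Fin 2) (k : ℕ) (s : ℝ) (u : ℝ → Coef) (t : ℝ) :
    normKV I k s (fun τ => inc σ (u τ)) t = normK I k s u t := by
  rw [normKV_eq, normK]
  exact sum_congr rfl fun i _ => by rw [dtV_inc, hnormV_inc]

theorem InCStar.inc {u : ℝ → Coef} (h : InCStar I n s u) (σ : Fin 2) :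
    InCStarV I n s fun t => inc σ (u t) := by
  intro τ
  by_cases hτ : τ = σ
  · subst hτ; simpa [PluriHom.inc] using h
  · simpa [PluriHom.inc, hτ] using InCStarV.const (I := I) (n := n) (InHV.zero s) τ

theorem normK_le_normKV (k : ℕ) (s : ℝ) (V : ℝ → Vec) (σ : Fin 2) (t : ℝ) :
    normK I k s (fun τ => V τ σ) t ≤ normKV I k s V t :=
  sum_le_sum fun _ _ => hnorm_le_hnormV _ (dtV I _ V t) σ

theorem IsS.isM {S : NHOp} (h : IsS I K K' m p r S) : IsM I K K' m p r S := by
  obtain ⟨s₀, hs₀, h⟩ := h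
  refine ⟨s₀, hs₀, fun s _ => ?_⟩
  obtain ⟨C, hC, rs, hrs, hr, h⟩ := h s
  refine ⟨C, hC, rs, hrs, hr, fun U hU hU' V hV => ?_⟩
  obtain ⟨h1, h2⟩ := h U hU hU' V hV
  refine ⟨h1, fun k hk t ht => (h2 k hk t ht).trans (mul_le_mul_of_nonneg_left ?_ hC.le)⟩
  split_ifs
  · exact le_rfl
  · refine sum_le_sum fun k' _ => ?_
    rw [mul_comm]
    refine le_add_of_nonneg_right ?_
    have h1 : 0 ≤ normK I (k - k') s₀ V t := sum_nonneg fun _ _ => hnorm_nonneg _ _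
    have h2 := normKV_nonneg (I := I) (k' + K') s₀ U t
    have h3 := normKV_nonneg (I := I) (k' + K') s U t
    positivity

theorem IsM.bound (hK : K' ≤ K) {M : NHOp} (h : IsM I K K' m p r M) (σ σ' : Fin 2) :
    ∀ᶠ c in atTop, ∀ s ≥ c, ∃ C ≥ (0 : ℝ), ∀ᶠ U in small I K c, InCStarV I K s U →
      ∀ V, InCStarV I (K - K') s V → InCStarV I (K - K') (s - m) (fun t => inc σ (M U t (V t σ'))) ∧
        ∀ k ≤ K - K', ∀ t ∈ I, normKV I k (s - m) (fun t => inc σ (M U t (V t σ'))) t ≤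
          C * if p = 0 then normKV I k s V t else bnd I p K' k c s U V t := by
  obtain ⟨s₀, hs₀, h⟩ := h
  filter_upwards [eventually_ge_atTop s₀] with c hc s hs
  obtain ⟨C, hC, rs, hrs, -, h⟩ := h s (hc.trans hs)
  refine ⟨C * (K - K' + 1 : ℕ), by positivity, ?_⟩
  filter_upwards [small_mono hc ⟨rs, hrs, fun _ h => h⟩, small_inC] with U hb hU0 hU V hV
  obtain ⟨h1, h2⟩ := h U hb hU _ (hV σ')
  refine ⟨h1.inc σ, fun k hk t ht => ?_⟩
  rw [normKV_inc, normK, mul_assoc, mul_left_comm]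
  refine sum_range_le hk (mul_nonneg hC.le ?_) fun i hi => ?_
  · split_ifs
    exacts [normKV_nonneg _ _ _ _, bnd_nonneg _ _ _ _ _ _ _ _]
  have := h2 i (hi.trans hk) t ht
  rw [show s - 3 / 2 * (i : ℝ) - m = s - m - 3 / 2 * (i : ℝ) by ring] at this
  refine this.trans (mul_le_mul_of_nonneg_left ?_ hC.le)
  split_ifs
  · exact (normK_le_normKV i s V σ' t).trans (normKV_mono_left hi _ _ _)
  · refine (sum_le_sum fun k' hk' => ?_).trans (Finset.sum_le_sum_of_subset_of_nonneg
      (range_mono (Nat.succ_le_succ hi)) fun _ _ _ => tm_nonneg (normKV_nonneg _ _ _ _)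
        (normKV_nonneg _ _ _ _) (normKV_nonneg _ _ _ _) (normKV_nonneg _ _ _ _))
    rw [mem_range] at hk'
    have N := fun s => (normK_le_normKV (I := I) (i - k') s V σ' t).trans
      (normKV_mono_left (show i - k' ≤ k - k' by omega) _ _ _)
    exact tm_mono (N s) ((N s₀).trans (normKV_mono ((hV.of_le (by omega)).mono hs) hc le_rfl ht))
      (normKV_mono (hU0.of_le (by omega)) hc le_rfl ht) le_rfl
      (sum_nonneg fun _ _ => hnorm_nonneg _ _) (sum_nonneg fun _ _ => hnorm_nonneg _ _)

theorem NHMat.app_eq (M : NHMat) (U : ℝ → Vec) (t : ℝ) (V : Vec) :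
    M.app U t V = ∑ σ, ∑ σ', inc σ (M σ σ' U t (V σ')) := by
  rw [← sum_inc (M.app U t V)]
  refine sum_congr rfl fun σ _ => ?_
  funext τ
  by_cases h : τ = σ
  · subst h; simp [inc, NHMat.app]
  · simp [inc, h]

theorem cls_of_isM (hK : K' ≤ K) (hm : 0 ≤ m) {M : NHMat} (h : ∀ σ σ', IsM I K K' m p r (M σ σ')) :
    Cls I K K' (K - K') p M.app := by
  have e : M.app = fun U t V => ∑ σ, ∑ σ', inc σ (M σ σ' U t (V σ')) := by
    funext U t V; exact M.app_eq U t V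
  rw [e]
  refine Cls.sum _ fun σ _ => Cls.sum _ fun σ' _ => ⟨⟨m, hm, ?_⟩, Eventually.of_forall
    fun _ _ _ _ _ _ _ _ => by simp only [Pi.add_apply, Pi.smul_apply, map_add, map_smul, inc_add, inc_smul]⟩
  filter_upwards [(h σ σ').bound hK σ σ'] with s₀ h s hs
  obtain ⟨C, hC, h⟩ := h s hs
  refine ⟨C, hC, ?_⟩
  filter_upwards [h] with U h hU V hV
  refine (h hU V hV).imp_right fun h2 k hk t ht => (h2 k hk t ht).trans
    (mul_le_mul_of_nonneg_left ?_ hC)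
  split_ifs with hp
  · subst hp; exact le_bnd_zero k
  · exact le_rfl

theorem pathOK_of_isM (hK : K' ≤ K) {M : NHMat} (h : ∀ σ σ', IsM I K K' 0 0 r (M σ σ')) :
    PathOK I K (K - K') (pathOf M.app) := by
  filter_upwards [eventually_all.2 fun x : Fin 2 × Fin 2 => (h x.1 x.2).bound hK x.1 x.2] with c h s hs
  choose C hC h using fun x => h x s hs
  refine ⟨∑ x, C x, sum_nonneg fun x _ => hC x, ?_⟩
  filter_upwards [eventually_all.2 h] with U h hU
  have g := fun x => h x hU U (hU.of_le (Nat.sub_le _ _))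
  have e : pathOf M.app U = fun t => ∑ x : Fin 2 × Fin 2, inc x.1 (M x.1 x.2 U t (U t x.2)) := by
    funext t
    rw [pathOf, NHMat.app_eq, Fintype.sum_prod_type]
  rw [e]
  simp only [sub_zero, if_true] at g
  refine ⟨InCStarV.sum _ fun x _ => (g x).1, fun k hk t ht => ?_⟩
  refine (normKV_sum_le _ (fun x _ => (g x).1.of_le hk) ht).trans ?_
  rw [sum_mul]
  exact sum_le_sum fun x _ => (g x).2 k hk t ht

theorem pathOK_of_isId (hK : K' ≤ K) (hr : 0 < r) {M : NHMat} (h : M.IsId I K' r) :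
    PathOK I K K (pathOf M.app) := by
  obtain ⟨c, hc, h⟩ := h
  filter_upwards [eventually_ge_atTop c] with c' hc' s hs
  refine ⟨1, zero_le_one, ?_⟩
  filter_upwards [small_mono hc' ⟨r, hr, fun _ h => h⟩] with U hU hU'
  obtain ⟨h1, ρ, hρ, h2⟩ := hU
  have e : ∀ t ∈ I, U t = pathOf M.app U t := fun t ht => (h U ⟨h1.of_le hK, ρ, hρ, fun t ht =>
    (normKV_mono_left hK _ _ _).trans (h2 t ht)⟩ t ht (U t) (h1.inHV ht)).symm
  exact ⟨hU'.congr e, fun k _ t ht => by rw [one_mul, normKV_congr e ht]⟩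

/-- Realization of a tame operator by a matrix of operators of class `IsM`. -/
theorem Cls.exists_mat (hp : p ≠ 0) (hr : 0 < r) (hF : Cls I K K' (K - K') p F) :
    ∀ᶠ m in atTop, ∃ M : NHMat, (∀ σ σ', IsM I K K' m p r (M σ σ')) ∧ AgreeOn I K M.app F := by
  obtain ⟨⟨m₀, hm₀, hE⟩, hL⟩ := hF
  filter_upwards [eventually_ge_atTop m₀] with m hm
  obtain ⟨c, ⟨hE, hL⟩, hc⟩ := (((hE.mono hm).and (germ_iff.1 hL)).and (eventually_gt_atTop 0)).exists
  have hext : ∀ (σ σ' : Fin 2) (U : ℝ → Vec) (t : ℝ), ∃ g : Coef →ₗ[ℂ] Coef,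
      (∀ V W, InHV c V → InHV c W → ∀ a : ℂ, F U t (a • V + W) = a • F U t V + F U t W) →
      ∀ v, InH c v → g v = F U t (inc σ' v) σ := by
    intro σ σ' U t
    by_cases h : ∀ V W, InHV c V → InHV c W → ∀ a : ℂ, F U t (a • V + W) = a • F U t V + F U t W
    · have hl : ∀ v w : Coef, InH c v → InH c w → ∀ a : ℂ, F U t (inc σ' (a • v + w)) σ =
          a • F U t (inc σ' v) σ + F U t (inc σ' w) σ := fun v w hv hw a => by
        rw [inc_add, inc_smul, h _ _ (inHV_inc.2 hv) (inHV_inc.2 hw) a]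
        rfl
      have h0 : InH c 0 := (InHV.zero c) 0
      have hz : F U t (inc σ' 0) σ = 0 := by simpa using hl 0 0 h0 h0 1
      let P : Submodule ℂ Coef :=
        { carrier := {v | InH c v}
          add_mem' := fun hv hw => inHV_inc.1 (by
            rw [inc_add]; exact (inHV_inc.2 hv).add ((inHV_inc (σ := 0)).2 hw))
          zero_mem' := h0
          smul_mem' := fun a v hv => inHV_inc.1 (by
            rw [inc_smul]; exact ((inHV_inc (σ := 0)).2 hv).smul a) }
      let f : P →ₗ[ℂ] Coef :=
        { toFun := fun v => F U t (inc σ' v) σ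
          map_add' := fun v w => by simpa using hl v w v.2 w.2 1
          map_smul' := fun a v => by simpa [hz] using hl v 0 v.2 h0 a }
      obtain ⟨g, hg⟩ := LinearMap.exists_extend f
      exact ⟨g, fun _ v hv => LinearMap.congr_fun hg (⟨v, hv⟩ : P)⟩
    · exact ⟨0, fun h1 => absurd h1 h⟩
  choose M hM using hext
  refine ⟨M, fun σ σ' => ⟨c, hc, fun s hs => ?_⟩, ?_⟩
  · obtain ⟨C, hC, hE⟩ := hE s hs
    obtain ⟨ρ, hρ, hb⟩ := hE.and hL
    refine ⟨C + 1, by positivity, min ρ (r / 2), by positivity,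
      (min_le_right _ _).trans_lt (by linarith), fun U ⟨hU, ρ', hρ', hb'⟩ hU' V hV => ?_⟩
    obtain ⟨h, hL⟩ := hb U ⟨hU, ρ', hρ'.trans_le (min_le_left _ _), hb'⟩
    obtain ⟨h1, h2⟩ := h hU' _ (hV.inc σ')
    have e : ∀ t ∈ I, M σ σ' U t (V t) = F U t (inc σ' (V t)) σ := fun t ht =>
      hM σ σ' U t (hL t ht) (V t) (inHV_inc.1 (((hV.inc σ').inHV ht).mono hs))
    refine ⟨fun k hk => (h1 σ k hk).congr fun t ht => (e t ht).symm, fun k hk t ht => ?_⟩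
    rw [dt_congr e k ht, if_neg hp, show s - 3 / 2 * (k : ℝ) - m = s - m - 3 / 2 * (k : ℝ) by ring]
    refine (hnorm_le_hnormV _ (dtV I k (fun t => F U t (inc σ' (V t))) t) σ).trans ?_
    refine (hnormV_dtV_le_normKV le_rfl _ _ _).trans ((h2 k hk t ht).trans ?_)
    refine (mul_le_mul_of_nonneg_right (show C ≤ C + 1 by linarith)
      (bnd_nonneg _ _ _ _ _ _ _ _)).trans_eq ?_
    simp only [bnd, tm, normKV_inc]
  · refine germ_iff.2 ((eventually_ge_atTop c).mono fun s hs => ?_)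
    filter_upwards [hL.filter_mono (small_mono hs)] with U hL t ht V hV
    have hV : InHV c V := hV.mono hs
    funext σ
    have e : V = (1 : ℂ) • inc 0 (V 0) + inc 1 (V 1) := by
      rw [one_smul, ← sum_univ_two (fun σ => inc σ (V σ)), sum_inc]
    conv_rhs => rw [e, hL t ht _ _ (inHV_inc.2 (hV 0)) (inHV_inc.2 (hV 1)) 1, one_smul]
    rw [NHMat.app, sum_univ_two, hM σ 0 U t (hL t ht) _ (hV 0), hM σ 1 U t (hL t ht) _ (hV 1)]
    rfl

/-! ### Tame functions of a path -/

/-- Functions of the form `U ↦ F(U) U` with `F` tame of degree at least `p`. -/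
def Rem (I : Set ℝ) (K J n p : ℕ) (w : (ℝ → Vec) → ℝ → Vec) : Prop :=
  ∃ F, Cls I K J n p F ∧ ∀ᶠ x in germ I K, ∀ t ∈ I, w x.2 t = F x.2 t (x.2 t)

variable {w w' : (ℝ → Vec) → ℝ → Vec}

theorem Cls.rem (h : Cls I K J n p F) : Rem I K J n p fun U t => F U t (U t) :=
  ⟨F, h, Eventually.of_forall fun _ _ _ => rfl⟩

theorem Rem.congr (h : Rem I K J n p w) (e : ∀ᶠ x in germ I K, ∀ t ∈ I, w x.2 t = w' x.2 t) :
    Rem I K J n p w' := by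
  obtain ⟨F, hF, h⟩ := h
  refine ⟨F, hF, ?_⟩
  filter_upwards [e, h] with x e h t ht
  rw [← e t ht, h t ht]

theorem Rem.mono_p (hK : J + n ≤ K) (h : Rem I K J n q w) (hp : p ≤ q) : Rem I K J n p w := by
  obtain ⟨F, hF, h⟩ := h
  exact ⟨F, hF.mono_p hK hp, h⟩

theorem Rem.add (h : Rem I K J n p w) (h' : Rem I K J n p w') :
    Rem I K J n p fun U t => w U t + w' U t := by
  obtain ⟨F, hF, h⟩ := h
  obtain ⟨F', hF', h'⟩ := h'
  refine ⟨_, hF.add hF', ?_⟩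
  filter_upwards [h, h'] with x h h' t ht
  rw [h t ht, h' t ht]

theorem Rem.smul (h : Rem I K J n p w) (a : ℂ) : Rem I K J n p fun U t => a • w U t := by
  obtain ⟨F, hF, h⟩ := h
  exact ⟨_, hF.smul a, h.mono fun x h t ht => by simp only [h t ht]⟩

theorem Rem.sub (h : Rem I K J n p w) (h' : Rem I K J n p w') :
    Rem I K J n p fun U t => w U t - w' U t := by
  simpa [sub_eq_add_neg] using h.add (h'.smul (-1))

theorem Rem.sum {ι : Type*} (S : Finset ι) {f : ι → (ℝ → Vec) → ℝ → Vec}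
    (h : ∀ i ∈ S, Rem I K J n p (f i)) : Rem I K J n p fun U t => ∑ i ∈ S, f i U t := by
  classical
  induction S using induction_on with
  | empty => simpa using (Cls.zero p).rem
  | insert a S ha ih =>
    simp only [sum_insert ha]
    exact (h a (by simp)).add (ih fun i hi => h i (by simp [hi]))

theorem Cls.inHV (h : Cls I K J n p F) (S : ℝ) :
    ∀ᶠ x in germ I K, ∀ t ∈ I, ∀ V, InHV x.1 V → InHV S (F x.2 t V) := by
  obtain ⟨⟨m, hm, hE⟩, -⟩ := h
  filter_upwards [hE.inHV, germ_fst (eventually_ge_atTop (S + m))] with x h hx t ht V hV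
  exact (h t ht V hV).mono (by linarith)

theorem Rem.inHV (h : Rem I K J n p w) (S : ℝ) : ∀ᶠ x in germ I K, ∀ t ∈ I, InHV S (w x.2 t) := by
  obtain ⟨F, hF, e⟩ := h
  filter_upwards [e, hF.inHV S, germ_inHV] with x e h hx t ht
  exact e t ht ▸ h t ht _ (hx t ht)

theorem Cls.apply (hK : J + n ≤ K) (hF : Cls I K J n p F) (h : Rem I K J n q w) :
    Rem I K J n (p + q) fun U t => F U t (w U t) := by
  obtain ⟨G, hG, h⟩ := h
  exact ⟨_, hF.comp hK hG, h.mono fun x h t ht => by simp only [h t ht]⟩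

end

section

variable {I : Set ℝ} [TimeInterval I] {K J n p : ℕ} {F E : Op}
variable {α : Type*} [Fintype α] [DecidableEq α]

/-! ### Multilinear operators applied to tame slots -/

theorem update_const_apply {X Y : Type*} (f : X → Y) (x y : X) (v : α) :
    update (fun _ => f x) v (f y) = fun a => f (if a = v then y else x) := by
  funext a
  by_cases h : a = v
  · subst h; simp
  · simp [h]

theorem Cls.ext_slots [Nonempty α] (hK : J + n ≤ K)
    {A : ML(α, VTP)} (hA : Good A) (v : α) {X : α → Op} {P : α → ℕ}
    (hX : ∀ a, Cls I K J n (P a) (X a)) (hp : p + 1 ≤ ∑ a, P a + Fintype.card α) :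
    Cls I K J n p fun U t V => PluriHom.ext A fun a => X a U t (if a = v then V else U t) := by
  have h := (Cls.ext hK hA v hX).comp hK (hX v)
  have e : ∑ a ∈ univ.erase v, (P a + 1) + P v + 1 = ∑ a, P a + Fintype.card α := by
    rw [add_assoc, Finset.sum_erase_add _ _ (mem_univ v), sum_add_distrib]
    simp
  refine (h.mono_p hK (p := p) (by omega)).congr (Eventually.of_forall fun x t _ V _ => ?_)
  dsimp only
  congr 1
  funext a
  by_cases h : a = v
  · subst h; simp
  · simp [h]

theorem Cls.ext_add_sub [Nonempty α] (hK : J + n ≤ K) {A : ML(α, VTP)} (hA : Good A) (v : α)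
    (hF : Cls I K J n 0 F) (hE : Cls I K J n p E) :
    Cls I K J n p fun U t V =>
      PluriHom.ext A (fun a => F U t (if a = v then V else U t) + E U t (if a = v then V else U t)) -
      PluriHom.ext A fun a => F U t (if a = v then V else U t) := by
  obtain ⟨C, -, S, -, hN⟩ := hA.exists_nb
  have main : ∀ s : Finset α, Cls I K J n p fun U t V =>
      PluriHom.ext A (fun a => F U t (if a = v then V else U t) +
        if a ∈ s then E U t (if a = v then V else U t) else 0) -
      PluriHom.ext A fun a => F U t (if a = v then V else U t) := by
    intro s
    induction s using induction_on with
    | empty => simpa using Cls.zero p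
    | insert b s hb ih =>
      have hX : ∀ a, Cls I K J n (if a = b then p else 0) fun U t V =>
          if a = b then E U t V else if a ∈ s then F U t V + E U t V else F U t V := by
        intro a
        split_ifs
        exacts [hE, hF.add (hE.mono_p hK (Nat.zero_le _)), hF]
      refine (ih.add (Cls.ext_slots (p := p) hK hA v hX (by
        simp [Fintype.card_pos, Nat.succ_le_iff]))).congr ?_
      filter_upwards [hF.inHV (S + 1), hE.inHV (S + 1), germ_inHV] with ⟨L, U⟩ h₁ h₂ hU t ht V hV
      have hy : ∀ a, InHV L (if a = v then V else U t) := fun a => by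
        split_ifs
        exacts [hV, hU t ht]
      have g₁ := fun a => h₁ t ht _ (hy a)
      have g₂ := fun a => h₂ t ht _ (hy a)
      set y : α → Vec := fun a => if a = v then V else U t
      set w : α → Vec := fun a => F U t (y a) + if a ∈ s then E U t (y a) else 0
      have hw : ∀ a, InHV (S + 1) (w a) := fun a => by
        refine (g₁ a).add ?_
        split_ifs
        exacts [g₂ a, InHV.zero _]
      have e1 : (fun a => F U t (y a) + if a ∈ insert b s then E U t (y a) else 0) =
          update w b (w b + E U t (y b)) := by
        funext a
        by_cases h : a = b
        · subst h; simp [w, hb]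
        · simp [h, w]
      have e2 : (fun a => if a = b then E U t (y a) else if a ∈ s then F U t (y a) + E U t (y a)
          else F U t (y a)) = update w b (E U t (y b)) := by
        funext a
        by_cases h : a = b
        · subst h; simp
        · by_cases h' : a ∈ s <;> simp [h, h', w]
      change PluriHom.ext A w - _ + PluriHom.ext A _ = PluriHom.ext A _ - _
      rw [e1, e2, sub_add_eq_add_sub]
      congr 1
      refine Vec.ext_at fun k => ?_
      have := extS_update_add (hN.kb k) hw b (hw b) (g₂ b)
      rw [update_eq_self] at this
      exact this.symm
  simpa using main univ

theorem Rem.ext [Nonempty α] (hK : J + n ≤ K)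
    {A : ML(α, VTP)} (hA : Good A)
    {w : α → (ℝ → Vec) → ℝ → Vec} {P : α → ℕ} (hw : ∀ a, Rem I K J n (P a) (w a))
    (hp : p + 1 ≤ ∑ a, P a + Fintype.card α) :
    Rem I K J n p fun U t => PluriHom.ext A fun a => w a U t := by
  choose X hX h using hw
  refine ⟨_, Cls.ext_slots hK hA (Classical.arbitrary α) hX hp, ?_⟩
  filter_upwards [eventually_all.2 h] with x h t ht
  simp only [ite_self, h _ t ht]

/-! ### Continuous extension of polynomial maps from trigonometric polynomials -/

/-- `F` extends `f` by continuity to functions of large enough regularity. -/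
def Extends (f : VTP → VTP → VTP) (F : Vec → Vec → Vec) : Prop :=
  ∀ S : ℝ, ∀ᶠ L in atTop, ∀ U V, InHV L U → InHV L V →
    (∃ B, ∀ n, hnormV S (f (trunc n U) (trunc n V)).toVec ≤ B) ∧
    ∀ i, Tendsto (fun n => (f (trunc n U) (trunc n V)).toVec.at i) atTop (𝓝 ((F U V).at i))

theorem Extends.eq {f : VTP → VTP → VTP} {F F' : Vec → Vec → Vec} (h : Extends f F)
    (h' : Extends f F') : ∀ᶠ L in atTop, ∀ U V, InHV L U → InHV L V → F U V = F' U V := by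
  filter_upwards [h 0, h' 0] with L h h' U V hU hV
  exact Vec.ext_at fun i => tendsto_nhds_unique ((h U V hU hV).2 i) ((h' U V hU hV).2 i)

theorem Extends.fst : Extends (fun U _ => U) fun U _ => U := fun S =>
  (eventually_ge_atTop S).mono fun _ hS U _ hU _ =>
    ⟨⟨_, hnormV_trunc_le (hU.mono hS)⟩, tendsto_trunc U⟩

theorem Extends.snd : Extends (fun _ V => V) fun _ V => V := fun S =>
  (eventually_ge_atTop S).mono fun _ hS _ V _ hV =>
    ⟨⟨_, hnormV_trunc_le (hV.mono hS)⟩, tendsto_trunc V⟩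

theorem Extends.add {f g : VTP → VTP → VTP} {F G : Vec → Vec → Vec} (h : Extends f F)
    (h' : Extends g G) : Extends (fun U V => f U V + g U V) fun U V => F U V + G U V := by
  intro S
  filter_upwards [h S, h' S] with L h h' U V hU hV
  obtain ⟨⟨B, hB⟩, h1⟩ := h U V hU hV
  obtain ⟨⟨B', hB'⟩, h2⟩ := h' U V hU hV
  exact ⟨⟨B + B', fun n => (hnormV_add_le (inHV_toVec S _) (inHV_toVec S _)).trans
    (add_le_add (hB n) (hB' n))⟩, fun i => (h1 i).add (h2 i)⟩

theorem Extends.zero : Extends (fun _ _ => 0) fun _ _ => 0 := fun _ =>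
  Eventually.of_forall fun _ _ _ _ _ => ⟨⟨_, fun _ => le_rfl⟩, fun _ => tendsto_const_nhds⟩

theorem Extends.sum {ι : Type*} (s : Finset ι) {f : ι → VTP → VTP → VTP}
    {F : ι → Vec → Vec → Vec} (h : ∀ i ∈ s, Extends (f i) (F i)) :
    Extends (fun U V => ∑ i ∈ s, f i U V) fun U V => ∑ i ∈ s, F i U V := by
  classical
  induction s using induction_on with
  | empty => simpa using Extends.zero
  | insert a s ha ih =>
    simp only [sum_insert ha]
    exact (h a (by simp)).add (ih fun i hi => h i (by simp [hi]))

theorem Extends.ext [Nonempty α] {A : ML(α, VTP)} (hA : Good A)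
    {f : α → VTP → VTP → VTP} {F : α → Vec → Vec → Vec} (h : ∀ a, Extends (f a) (F a)) :
    Extends (fun U V => A fun a => f a U V) fun U V => PluriHom.ext A fun a => F a U V := by
  intro s
  obtain ⟨C, hC, S, hS, hN⟩ := hA.exists_nb
  obtain ⟨T, hT, hb⟩ := hA.ext_bound
  obtain ⟨D, hD, hb⟩ := hb (max s 0) (le_max_right _ _)
  filter_upwards [eventually_all.2 fun a => h a (max (max s 0 + T) (S + 2))] with L hL U V hU hV
  choose hB hlim using fun a => hL a U V hU hV
  choose B hB using hB
  have hB' : ∀ a n x, x ≤ max (max s 0 + T) (S + 2) →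
      hnormV x (f a (trunc n U) (trunc n V)).toVec ≤ B a := fun a n x hx =>
    (hnormV_mono hx (inHV_toVec _ _)).trans (hB a n)
  have hs : T ≤ max s 0 + T := le_add_of_nonneg_left (le_max_right _ _)
  have e : ∀ n, (A fun a => f a (trunc n U) (trunc n V)).toVec =
      PluriHom.ext A fun a => (f a (trunc n U) (trunc n V)).toVec := fun n => (ext_toVec _ _).symm
  simp only [e]
  refine ⟨⟨D * ∑ b, B b * ∏ a ∈ univ.erase b, B a, fun n => ?_⟩, fun i => ?_⟩
  · obtain ⟨h1, h2⟩ := hb _ fun a => inHV_toVec (max s 0 + T) (f a (trunc n U) (trunc n V))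
    refine (hnormV_mono (le_max_left s 0) h1).trans (h2.trans ?_)
    gcongr with b _ a _
    · exact prod_nonneg fun _ _ => hnormV_nonneg _ _
    · exact (hnormV_nonneg _ _).trans (hB b 0)
    · exact hB' b n _ (le_max_left _ _)
    · exact fun _ _ => hnormV_nonneg _ _
    · exact hB' a n _ (hs.trans (le_max_left _ _))
  · exact extS_tendsto hC (hN.kb i) (fun a => ⟨B a, Eventually.of_forall fun n =>
      ⟨inHV_toVec _ _, hB' a n _ (le_max_right _ _)⟩⟩) fun a j => hlim a j

end

section

variable {q : ℕ}

/-! ### Matrices of homogeneous operators as multilinear maps -/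

def entryL (σ σ' : Fin 2) : (VTP →ₗ[ℂ] VTP) →ₗ[ℂ] (TP →ₗ[ℂ] TP) where
  toFun L := LinearMap.proj σ ∘ₗ L ∘ₗ LinearMap.single ℂ (fun _ => TP) σ'
  map_add' _ _ := by ext; simp
  map_smul' _ _ := by ext; simp

def embL (σ σ' : Fin 2) : (TP →ₗ[ℂ] TP) →ₗ[ℂ] (VTP →ₗ[ℂ] VTP) where
  toFun L := LinearMap.pi fun τ => if τ = σ then L ∘ₗ LinearMap.proj σ' else 0
  map_add' K L := LinearMap.ext fun V => funext fun τ => by by_cases h : τ = σ <;> simp [h]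
  map_smul' c L := LinearMap.ext fun V => funext fun τ => by by_cases h : τ = σ <;> simp [h]

theorem embL_apply (σ σ' τ : Fin 2) (L : TP →ₗ[ℂ] TP) (V : VTP) :
    embL σ σ' L V τ = if τ = σ then L (V σ') else 0 := by
  by_cases h : τ = σ <;> simp [embL, h]

def toMat (A : ML(Fin (q + 1), VTP)) : HomMat q :=
  fun σ σ' => (entryL σ σ').compMultilinearMap A.curryRight

def toMap (M : HomMat q) : ML(Fin (q + 1), VTP) :=
  MultilinearMap.uncurryRight (∑ σ, ∑ σ', (embL σ σ').compMultilinearMap (M σ σ'))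

theorem toMat_apply (A : ML(Fin (q + 1), VTP)) (σ σ' : Fin 2)
    (U : Fin q → VTP) (v : TP) : toMat A σ σ' U v = A (snoc U (Pi.single σ' v)) σ := rfl

theorem toMap_apply (M : HomMat q) (U : Fin (q + 1) → VTP) :
    toMap M U = M.app (fun a => U a.castSucc) (U (last q)) := by
  have e : toMap M U = (∑ σ, ∑ σ', (embL σ σ').compMultilinearMap (M σ σ'))
    (init U) (U (last q)) := rfl
  rw [e]
  funext σ
  simp only [sum_apply, LinearMap.sum_apply, Finset.sum_apply, HomMat.app,
    LinearMap.compMultilinearMap_apply, embL_apply]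
  rw [sum_eq_single σ (fun τ _ h => by simp [h.symm]) (by simp)]
  simp
  rfl

theorem toMap_snoc (M : HomMat q) (U : Fin q → VTP) (V : VTP) :
    toMap M (snoc U V) = M.app U V := by simp [toMap_apply]

theorem toMat_app (A : ML(Fin (q + 1), VTP)) (U : Fin q → VTP)
    (V : VTP) : (toMat A).app U V = A (snoc U V) := by
  funext σ
  have h : V = ∑ σ', Pi.single σ' (V σ') := (Finset.univ_sum_single V).symm
  conv_rhs => rw [h]
  change _ = (A.curryRight U (∑ σ', Pi.single σ' (V σ'))) σ
  rw [map_sum, Finset.sum_apply]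
  rfl

theorem toMap_toMat (A : ML(Fin (q + 1), VTP)) : toMap (toMat A) = A := by
  refine MultilinearMap.ext fun U => ?_
  rw [toMap_apply, toMat_app]
  exact congrArg A (Fin.snoc_init_self U)

theorem toVec_single (σ : Fin 2) (u : TP) : VTP.toVec (Pi.single σ u) = inc σ u := by
  funext τ j
  by_cases h : τ = σ
  · subst h; simp [inc, VTP.toVec]
  · simp [inc, VTP.toVec, h]

theorem projV_inc (n : ℕ) (σ : Fin 2) (v : Coef) : projV n (inc σ v) = Pi.single σ (proj n v) := by
  funext τ
  by_cases h : τ = σ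
  · subst h; simp [projV, inc]
  · simp only [projV, inc, Pi.single_eq_of_ne h, update_of_ne h]
    ext j
    change (if j.1.natAbs = n then (0 : ℂ) else 0) = 0
    simp

theorem toMap_proj (M : HomMat q) (σ σ' : Fin 2) (U : Fin q → Vec) (v : Coef)
    (n : Fin (q + 1) → ℕ) :
    M σ σ' (fun i => projV (n i.castSucc) (U i)) (proj (n (last q)) v) =
      toMap M (fun a => projV (n a) ((snoc U (inc σ' v) : Fin (q + 1) → Vec) a)) σ := by
  rw [toMap_apply]
  simp only [snoc_castSucc, snoc_last, projV_inc, HomMat.app]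
  rw [sum_eq_single σ' (fun τ _ h => by rw [Pi.single_eq_of_ne h, map_zero]) (by simp),
    Pi.single_eq_same]

theorem snoc_const {X : Type*} (U V : X) :
    (snoc (fun _ => U) V : Fin (q + 1) → X) = update (fun _ => U) (last q) V := by
  rw [← Fin.update_snoc_last (x := U)]
  congr 1
  funext a
  refine lastCases ?_ (fun b => ?_) a <;> simp

theorem entry_eval (M : HomMat q) {C S : ℝ} (hN : NB (toMap M) C S) {U : Vec} {v : Coef}
    (hU : InHV (S + 1) U) (hv : InH (S + 1) v) (σ σ' : Fin 2) :
    (M σ σ').eval (fun _ => U) v = ext (toMap M) (update (fun _ => U) (last q) (inc σ' v)) σ := by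
  funext j
  have hW : ∀ a, InHV (S + 1) (update (fun _ : Fin (q + 1) => U) (last q)
      (inc σ' v) a) := inHV_update (fun _ => hU) _ (inHV_inc.2 hv)
  refine Eq.trans (tsum_congr fun n => ?_) (extS_blocks (summable_term (hN.kb ⟨σ, j⟩) hW))
  rw [toMap_proj, snoc_const]
  rfl

theorem HomMat.eval_eq (M : HomMat q) {C S : ℝ} (hN : NB (toMap M) C S) {U V : Vec}
    (hU : InHV (S + 1) U) (hV : InHV (S + 1) V) :
    M.eval U V = ext (toMap M) (update (fun _ => U) (last q) V) := by
  refine Vec.ext_at fun k => ?_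
  have e : (M.eval U V).at k = ∑ σ', (M k.1 σ').eval (fun _ => U) (V σ') k.2 := by
    simp [HomMat.eval, Vec.at]
  rw [e]
  simp only [entry_eval M hN hU (hV _)]
  have h := extS_update_add (hN.kb k) (fun _ => hU) (last q) ((inHV_inc (σ := 0)).2 (hV 0))
    ((inHV_inc (σ := 1)).2 (hV 1))
  rw [← sum_univ_two (fun σ => inc σ (V σ)), sum_inc] at h
  rw [sum_univ_two]
  exact h.symm

/-! ### Reality -/

/-- The conjugation `(u⁺, u⁻) ↦ (ū⁻, ū⁺)`. -/
def cjV (U : Vec) : Vec := fun σ => conjC (U σ.rev)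

theorem cjV_at (U : Vec) (i : Idx) : (cjV U).at i = (starRingEnd ℂ) (U.at i.conj) := rfl

theorem cjV_toVec (U : VTP) : cjV U.toVec = (cj U).toVec := by
  refine Vec.ext_at fun i => ?_
  change _ = cjT (U i.1.rev) i.2
  rw [cjT_apply]; rfl

theorem isRealVec_cjV {U : Vec} (h : IsRealVec U) : cjV U = U := by
  have hc : ∀ u, conjC (conjC u) = u := fun u => by funext j; simp [conjC]
  funext σ
  fin_cases σ
  · change conjC (U 1) = U 0
    rw [h, hc]
  · exact h.symm

theorem ext_cj {α : Type*} [Fintype α] {A : ML(α, VTP)}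
    (hA : Good A) (U : α → Vec) : ext A (fun a => cjV (U a)) = cjV (ext A U) := by
  refine Vec.ext_at fun k => ?_
  rw [cjV_at, ext_at, ext_at, extS, extS, Complex.conj_tsum]
  let e : (α → Idx) ≃ (α → Idx) := Equiv.piCongrRight fun _ =>
    ⟨Idx.conj, Idx.conj, Idx.conj_conj, Idx.conj_conj⟩
  rw [← e.tsum_eq (fun i => (starRingEnd ℂ) (term (coefM k.conj A) U i))]
  refine tsum_congr fun i => ?_
  have h : (fun a => bas (e i a)) = fun a => bas (i a).conj := rfl
  simp only [term, map_mul, map_prod, cjV_at, h, coefM_apply, hA.kernel_cj i]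
  rw [← cjV_toVec, cjV_at, Idx.conj_conj, starRingEnd_self_apply]
  rfl

theorem cjV_update_const {α : Type*} [DecidableEq α] (U V : Vec) (v : α) :
    (fun a => cjV (update (fun _ => U) v V a)) = update (fun _ => cjV U) v (cjV V) := by
  funext a
  by_cases h : a = v
  · subst h; simp
  · simp [h]

theorem cjV_inc (σ : Fin 2) (v : Coef) : cjV (inc σ v) = inc σ.rev (conjC v) := by
  funext τ j
  fin_cases σ <;> fin_cases τ <;> simp [cjV, inc, conjC]

theorem inH_conjC {s : ℝ} {v : Coef} (h : InH s v) : InH s (conjC v) := by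
  have := (Freq.oppEquiv.summable_iff).2 h
  refine this.congr fun j => ?_
  simp [conjC, Freq.oppEquiv, Freq.opp]

theorem isRealToReal_toMat {A : ML(Fin (q + 1), VTP)} (hA : Good A) : (toMat A).IsRealToReal := by
  intro U hU hr v hv
  obtain ⟨C, -, S, -, hN⟩ := hA.exists_nb
  rw [← toMap_toMat A] at hN
  have e := fun σ σ' {w : Coef} (hw : ∀ s, InH s w) =>
    entry_eval (toMat A) hN (hU (S + 1)) (hw (S + 1)) σ σ'
  have hc : ∀ σ', ext A (update (fun _ => U) (last q) (inc σ' v)) =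
      cjV (ext A (update (fun _ => U) (last q) (inc σ'.rev (conjC v)))) := by
    intro σ'
    rw [← ext_cj hA, cjV_update_const, isRealVec_cjV hr, cjV_inc, Fin.rev_rev]
    congr 3
    funext j
    simp [conjC]
  dsimp only
  constructor
  · rw [e 1 1 hv, e 0 0 fun s => inH_conjC (hv s), toMap_toMat, hc]
    rfl
  · rw [e 1 0 hv, e 0 1 fun s => inH_conjC (hv s), toMap_toMat, hc]
    rfl

/-! ### Estimates on dyadic blocks -/

theorem tsum_wseq (s : ℕ) (V : VTP) : Summable (fun i => ‖wseq (s : ℝ) V.toVec i‖) ∧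
      ∑' i, ‖wseq (s : ℝ) V.toVec i‖ = nrm s V := by
  have h : ∀ i ∉ (bas.repr V).support, ‖wseq (s : ℝ) V.toVec i‖ = 0 := fun i hi => by
    rw [Finsupp.mem_support_iff, not_not, bas_repr] at hi
    rw [norm_wseq, Vec.at, VTP.toVec, hi, norm_zero, mul_zero]
  refine ⟨summable_of_ne_finset_zero h, (tsum_eq_sum h).trans ?_⟩
  rw [nrm_vtp]
  refine sum_congr rfl fun i _ => ?_
  rw [norm_wseq, Idx.abs_eq_wt, Real.rpow_natCast]
  rfl

theorem nrm_le_hnormV (s : ℕ) (V : VTP) : nrm s V ≤ c₀ * hnormV (s + 1) V.toVec := by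
  rw [← (tsum_wseq s V).2]
  exact (l1_of_inHV (inHV_toVec _ V)).2

theorem hnormV_le_nrm (V : VTP) : hnormV 0 V.toVec ≤ nrm 0 V := by
  have h := tsum_wseq 0 V
  rw [Nat.cast_zero] at h
  exact h.2 ▸ (inHV_of_l1 h.1).2

theorem hnormV_projV (s : ℕ) (n : ℕ) (U : Vec) :
    hnormV s (projV n U).toVec ≤ n ^ s * hnormV 0 (projV n U).toVec := by
  refine (sq_le_sq₀ (hnormV_nonneg _ _) (mul_nonneg (by positivity) (hnormV_nonneg _ _))).1 ?_
  rw [mul_pow, hnormV_sq (inHV_toVec _ _), hnormV_sq (inHV_toVec _ _), ← tsum_mul_left]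
  refine (tsum_congr fun i => ?_).le
  rw [norm_wseq, norm_wseq, ← mul_pow, Idx.abs_eq_wt, Real.rpow_natCast, Real.rpow_zero, one_mul,
    projV_at]
  split_ifs with h
  · rw [h]
  · simp

theorem nrm_projV (s n : ℕ) (U : Vec) :
    nrm s (projV n U) ≤ (n : ℝ) ^ (s + 1) * (c₀ * hnormV 0 (projV n U).toVec) := by
  refine (nrm_le_hnormV s _).trans ?_
  rw [mul_left_comm]
  have := hnormV_projV (s + 1) n U
  push_cast at this
  exact mul_le_mul_of_nonneg_left this c₀_nonneg

variable {Y : Type} [AddCommGroup Y] [Module ℂ Y] [Scale Y] {α : Type*} [Fintype α]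

theorem Good.block_bound {A : ML(α, Y)} (hA : Good A) :
    ∃ C > (0 : ℝ), ∃ S : ℕ, ∀ (U : α → Vec) (n : α → ℕ), nrm 0 (A fun a => projV (n a) (U a)) ≤
        C * (∏ a, (n a : ℝ) ^ S) * ∏ a, hnormV 0 (projV (n a) (U a)).toVec := by
  obtain ⟨C, hC, s, h⟩ := hA.bd 0
  refine ⟨C * c₀ ^ Fintype.card α + 1, by have := c₀_nonneg; positivity, s + 1, fun U n => ?_⟩
  refine (h _).trans ((mul_le_mul_of_nonneg_left (Finset.prod_le_prod (fun _ _ => nrm_nonneg _ _)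
    fun a _ => nrm_projV s (n a) (U a)) hC).trans ?_)
  rw [prod_mul_distrib, prod_mul_distrib, prod_const, card_univ]
  have h1 : 0 ≤ (∏ a, (n a : ℝ) ^ (s + 1)) * ∏ a, hnormV 0 (projV (n a) (U a)).toVec :=
    mul_nonneg (by positivity) (prod_nonneg fun _ _ => hnormV_nonneg _ _)
  nlinarith [h1]

theorem exists_idx_of_ne {N : Type*} [AddCommGroup N] [Module ℂ N]
    {A : ML(α, N)} {U : α → Vec} {n : α → ℕ}
    (h : A (fun a => projV (n a) (U a)) ≠ 0) :
    ∃ i : α → Idx, (∀ a, (i a).2.wt = n a) ∧ A (fun a => bas (i a)) ≠ 0 := by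
  by_contra! hc
  refine h (eq_zero_of_kernel A (fun a i => i.2.wt = n a) hc _ fun a i hi => ?_)
  by_contra hn
  exact hi (if_neg hn)

theorem exists_signs {i : α → Idx} {n : α → ℕ} (h : ∀ a, (i a).2.wt = n a) :
    ∃ ε : α → ℤˣ, ∀ a, (ε a : ℤ) * n a = (i a).2.1 := by
  refine Classical.axiom_of_choice (r := fun a (ε : ℤˣ) => (ε : ℤ) * n a = (i a).2.1) fun a => ?_
  rw [← h a]
  rcases Int.natAbs_eq (i a).2.1 with h | h
  · exact ⟨1, by rw [Units.val_one, one_mul]; exact h.symm⟩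
  · exact ⟨-1, by rw [Units.val_neg, Units.val_one, neg_one_mul]; exact h.symm⟩

theorem prod_pow_le_maxOf {k : ℕ} (n : Fin k → ℕ) (S : ℕ) :
    ∏ a, (n a : ℝ) ^ S ≤ (maxOf n : ℝ) ^ (k * S) := by
  have : ∀ a, (n a : ℝ) ≤ maxOf n := fun a => by
    exact_mod_cast le_sup (f := n) (mem_univ a)
  refine (Finset.prod_le_prod (fun _ _ => by positivity)
    fun a _ => pow_le_pow_left₀ (Nat.cast_nonneg _) (this a) S).trans_eq ?_
  rw [prod_const, card_univ, Fintype.card_fin, ← pow_mul, mul_comm]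

theorem hnorm_proj_le (n : ℕ) (V : VTP) (σ : Fin 2) : hnorm 0 (proj n (V σ)) ≤ nrm 0 V := by
  refine le_trans ?_ ((hnorm_le_hnormV 0 V.toVec σ).trans (hnormV_le_nrm V))
  refine Real.sqrt_le_sqrt (Summable.tsum_le_tsum (fun j => ?_) ?_ (inHV_toVec 0 V σ))
  · refine mul_le_mul_of_nonneg_left (pow_le_pow_left₀ (norm_nonneg _) ?_ 2) (by positivity)
    change ‖if j.1.natAbs = n then V σ j else 0‖ ≤ ‖V σ j‖
    split_ifs <;> simp
  · exact inHV_inc.1 (toVec_single 0 (proj n (V σ)) ▸ inHV_toVec 0 (Pi.single 0 (proj n (V σ))))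

variable {A : ML(Fin (q + 1), VTP)}

theorem Good.exists_isHomM (hA : Good A)
    (hs : ∀ (π : Equiv.Perm (Fin q)) U V, A (snoc (fun a => U (π a)) V) = A (snoc U V)) :
    ∃ S : ℕ, ∀ m : ℝ, (∃ μ ≥ (0 : ℝ), ∃ C > (0 : ℝ), ∀ (U : Fin (q + 1) → Vec) n, (∀ a, 1 ≤ n a) →
        A (fun a => projV (n a) (U a)) ≠ 0 →
        (maxOf n : ℝ) ^ S ≤ C * (max2Of n : ℝ) ^ μ * (maxOf n : ℝ) ^ m) →
      ∀ σ σ', IsHomM m (toMat A σ σ') := by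
  obtain ⟨D, hD, S, hb⟩ := hA.block_bound
  refine ⟨(q + 1) * S, fun m hm σ σ' => ⟨fun π U => LinearMap.ext fun v => ?_, ?_,
    fun U V n n₀ h => ?_, fun a U V => ?_⟩⟩
  · simp only [toMat_apply, hs]
  · obtain ⟨μ, hμ, C, hC, h⟩ := hm
    refine ⟨μ, hμ, D * C, by positivity, fun U v n n₀ => ?_⟩
    rw [toMap_proj, toMap_toMat]
    set W : Fin (q + 1) → Vec := snoc U (inc σ' v)
    have e : hnorm 0 (proj (n (last q)) v) = hnormV 0 (projV (n (last q)) (W (last q))).toVec := by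
      rw [show W (last q) = inc σ' v from snoc_last _ _, projV_inc, toVec_single, hnormV_inc]
    have e' : ∀ i, U i = W i.castSucc := fun i => (snoc_castSucc (α := fun _ => Vec) _ _ i).symm
    simp only [e, e']
    clear_value W
    rw [mul_assoc _ _ (hnormV 0 _), ← Fin.prod_univ_castSucc
      (fun a => hnormV 0 (projV (n a) (W a)).toVec)]
    have hP : 0 ≤ ∏ a, hnormV 0 (projV (n a) (W a)).toVec :=
      prod_nonneg fun _ _ => hnormV_nonneg _ _
    refine (hnorm_proj_le n₀ _ σ).trans ?_
    by_cases h0 : A (fun a => projV (n a) (W a)) = 0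
    · rw [h0, nrm_zero]; exact mul_nonneg (by positivity) hP
    · obtain ⟨i, hi, -⟩ := exists_idx_of_ne h0
      have h1 : ∀ a, 1 ≤ n a := fun a => hi a ▸ Freq.one_le_wt _
      refine (hb W n).trans (mul_le_mul_of_nonneg_right ?_ hP)
      rw [mul_assoc, mul_assoc, ← mul_assoc C]
      exact mul_le_mul_of_nonneg_left ((prod_pow_le_maxOf n S).trans (h W n h1 h0)) hD.le
  · rw [toMap_proj, toMap_toMat] at h
    obtain ⟨j, hj⟩ := DFunLike.ne_iff.1 h
    have hj' : j.wt = n₀ := by by_contra hn; exact hj (if_neg hn)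
    have hk : A (fun a => projV (n a) ((snoc U (inc σ' V) : Fin (q + 1) → Vec) a)) σ j ≠ 0 :=
      fun h0 => hj ((if_pos hj').trans h0)
    obtain ⟨i, hi, hi'⟩ := exists_idx_of_ne (A := coefM ⟨σ, j⟩ A) hk
    have hm := hA.momentum i ⟨σ, j⟩ hi'
    obtain ⟨ε, hε⟩ := exists_signs hi
    obtain ⟨η, hη⟩ := exists_signs (α := Unit) (i := fun _ => ⟨σ, j⟩) (n := fun _ => n₀) fun _ => hj'
    refine ⟨-η (), ε, ?_⟩
    rw [Units.val_neg, neg_mul, hη (), sum_congr rfl fun a _ => hε a]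
    exact neg_add_eq_zero.2 hm
  · have := congrFun (hA.tr a (snoc U (Pi.single σ' V))) σ
    refine Eq.trans ?_ this
    rw [toMat_apply]
    refine congrFun (congrArg A (funext fun b => ?_)) σ
    refine lastCases ?_ (fun c => ?_) b
    · simp only [snoc_last]
      funext τ
      by_cases h : τ = σ'
      · subst h; simp [tr_vtp, transV]
      · ext j; simp [tr_vtp, transV, h]
    · simp [tr_vtp]

theorem Good.isHomM (hA : Good A)
    (hs : ∀ (π : Equiv.Perm (Fin q)) U V, A (snoc (fun a => U (π a)) V) = A (snoc U V)) :
    ∀ᶠ m in atTop, ∀ σ σ', IsHomM m (toMat A σ σ') := by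
  obtain ⟨S, h⟩ := hA.exists_isHomM hs
  refine (eventually_ge_atTop (S : ℝ)).mono fun m hm => h m ⟨0, le_rfl, 1, one_pos, fun U n hn _ => ?_⟩
  rw [Real.rpow_zero, one_mul, one_mul, ← Real.rpow_natCast]
  refine Real.rpow_le_rpow_of_exponent_le ?_ hm
  exact_mod_cast (hn 0).trans (le_sup (f := n) (mem_univ _))

theorem Balanced.isHomM (hA : Good A) (hB : Balanced A)
    (hs : ∀ (π : Equiv.Perm (Fin q)) U V, A (snoc (fun a => U (π a)) V) = A (snoc U V))
    {ϱ : ℝ} (hϱ : 0 < ϱ) (σ σ' : Fin 2) : IsHomM (-ϱ) (toMat A σ σ') := by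
  obtain ⟨S, h⟩ := hA.exists_isHomM hs
  obtain ⟨D, hD⟩ := hB
  refine h _ ⟨S + ϱ, by positivity, ((D + 1 : ℕ) : ℝ) ^ (S + ϱ), by positivity,
    fun U n hn h0 => ?_⟩ σ σ'
  obtain ⟨a, -, ha⟩ := Finset.exists_mem_eq_sup univ Finset.univ_nonempty n
  have hle : ∀ b, n b ≤ n a := fun b => ha ▸ le_sup (f := n) (mem_univ b)
  have hmax : maxOf n ≤ (D + 1) * max2Of n := by
    obtain ⟨i, hi, hi'⟩ := exists_idx_of_ne h0
    by_contra! hc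
    refine hi' (hD (max2Of n) i a (fun b hb => ?_) ?_)
    · rw [hi]
      have := le_sup (f := fun ij : Fin (q + 1) × Fin (q + 1) => min (n ij.1) (n ij.2))
        (b := (b, a)) (Finset.mem_offDiag.2 ⟨mem_univ b, mem_univ a, hb⟩)
      exact (le_min le_rfl (hle b)).trans this
    · rw [hi, ← ha]
      exact lt_of_le_of_lt (by gcongr; omega) hc
  have hpos : (0 : ℝ) < maxOf n := by
    rw [maxOf, ha]
    exact_mod_cast hn a
  rw [← Real.mul_rpow (by positivity) (by positivity), Real.rpow_neg hpos.le,
    ← div_eq_mul_inv, le_div_iff₀ (by positivity), ← Real.rpow_natCast, ← Real.rpow_add hpos]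
  exact Real.rpow_le_rpow hpos.le (by exact_mod_cast hmax) (by positivity)

end

section

variable {q r k : ℕ}

/-! ### Forms as multilinear maps -/

theorem ext_real {α : Type*} [Fintype α] {N : Type*} [AddCommGroup N] [Module ℂ N]
    {A : ML(α, N)}
    (h : ∀ U : α → VTP, (∀ a, cj (U a) = U a) → A U = 0) : A = 0 := by
  refine MultilinearMap.ext fun U => ?_
  have := multilinear_closure_mem A (fun _ => {W | ∃ (c : ℂ) (V : VTP), cj V = V ∧ W = c • V}) ⊥
    (fun x hx => ?_) U fun a => ?_
  · exact this
  · choose c V hV hx using hx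
    rw [show x = fun a => c a • V a from funext hx, A.map_smul_univ, h V hV, smul_zero]
    exact zero_mem _
  · have e : U a = (1 / 2 : ℂ) • (U a + cj (U a)) +
        (-Complex.I / 2) • (Complex.I • (U a - cj (U a))) := by
      rw [smul_smul, show -Complex.I / 2 * Complex.I = 1 / 2 by
        linear_combination (-1 / 2 : ℂ) * Complex.I_mul_I]
      module
    rw [e]
    refine add_mem (AddSubmonoid.subset_closure ⟨_, _, ?_, rfl⟩)
      (AddSubmonoid.subset_closure ⟨_, _, ?_, rfl⟩)
    · rw [cj_add, cj_cj, add_comm]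
    · rw [cj_smul, cj_sub, cj_cj, Complex.conj_I]
      module

def evalL (V : Fin k → VTP) : (VTP [⋀^Fin k]→ₗ[ℂ] ℂ) →ₗ[ℂ] ℂ where
  toFun f := f V
  map_add' _ _ := rfl
  map_smul' _ _ := rfl

/-- The multilinear map of a `0`-form. -/
def toScal (H : KForm q 0) : ML(Fin q, ℂ) := (evalL ![]).compMultilinearMap H

theorem projV_bas (i : Idx) : projV i.2.wt (bas i).toVec = bas i := by
  refine vtp_ext fun j => ?_
  change (if j.2.wt = i.2.wt then bas i j.1 j.2 else 0) = _
  split_ifs with h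
  · rfl
  · rw [bas_apply_apply, if_neg]
    rintro ⟨-, h'⟩
    exact h (by rw [h'])

theorem hnormV_bas (i : Idx) : hnormV 0 (bas i).toVec ≤ 1 :=
  (hnormV_le_nrm _).trans_eq (by rw [nrm_bas, pow_zero])

theorem IsForm.good {H : KForm q 0} (h : IsForm H) : Good (toScal H) where
  bd s := by
    obtain ⟨m, hm, C, hC, hb⟩ := h.bound
    refine ⟨C, hC.le, ⌈m⌉₊, nrm_le_of_kernel _ fun i => ?_⟩
    have := hb (fun a => (bas (i a)).toVec) ![] (fun a => (i a).2.wt) ![]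
    simp only [projV_bas, Matrix.empty_eq, Finset.univ_eq_empty, Finset.prod_empty, mul_one] at this
    rw [nrm_complex]
    refine this.trans ((mul_le_of_le_one_right (by positivity) (prod_le_one
      (fun _ _ => hnormV_nonneg _ _) fun a _ => hnormV_bas (i a))).trans ?_)
    refine mul_le_mul_of_nonneg_left ?_ hC.le
    have h1 : (max (maxOf fun a => (i a).2.wt) (maxOf (![] : Fin 0 → ℕ)) : ℕ) ≤
        ∏ a, (i a).2.wt := by
      refine max_le (Finset.sup_le fun a _ => wt_le_prod i a) ?_
      simp [maxOf]
    refine (Real.rpow_le_rpow (by positivity) (Nat.cast_le.2 h1) hm).trans ?_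
    have h2 : (1 : ℝ) ≤ (∏ a, (i a).2.wt : ℕ) := by
      exact_mod_cast Nat.succ_le_iff.2 (prod_pos fun a _ => Freq.one_le_wt _)
    refine (Real.rpow_le_rpow_of_exponent_le h2 (Nat.le_ceil m)).trans_eq ?_
    rw [Real.rpow_natCast, prod_pow]
    push_cast
    rfl
  tr x U := by
    have := h.translation x U ![]
    rw [show (fun i : Fin 0 => transV x ((![] : Fin 0 → VTP) i)) = ![] from Matrix.empty_eq _] at this
    exact this
  cj U := by
    have h0 : toScal H - cjConj (toScal H) = 0 := ext_real fun V hV => by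
      have := h.real V ![] (fun i => (isRealVec_iff _).2 (hV i)) fun i => i.elim0
      rw [sub_apply, cjConj_apply, funext hV, cj_complex, sub_eq_zero]
      exact (Complex.conj_eq_iff_im.2 this).symm
    have := congrArg (fun A => A fun a => cj (U a)) h0
    simp only [sub_apply, cjConj_apply, cj_cj, zero_apply] at this
    exact sub_eq_zero.1 this

theorem IsForm.isSymm {H : KForm q 0} (h : IsForm H) : IsSymm (toScal H) := fun π U =>
  congrArg (fun f => f ![]) (h.symm π U)

def altL (k : ℕ) : ML(Fin k, ℂ) →ₗ[ℂ] (VTP [⋀^Fin k]→ₗ[ℂ] ℂ) where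
  toFun m := MultilinearMap.alternatization m
  map_add' := map_add _
  map_smul' c m := by
    ext V
    simp [MultilinearMap.alternatization_apply, mul_sum, mul_left_comm, Units.smul_def]

/-- The form obtained by symmetrizing in the first and alternating in the final arguments. -/
def altForm (T : ML(Fin r ⊕ Fin k, ℂ)) : KForm r k := symmz ((altL k).compMultilinearMap T.currySum)

def altMap (T : ML(Fin r ⊕ Fin k, ℂ)) : ML(Fin r ⊕ Fin k, ℂ) :=
  (((Fintype.card (Equiv.Perm (Fin r)) : ℝ)⁻¹ : ℝ) : ℂ) • ∑ π : Equiv.Perm (Fin r),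
    ∑ σ : Equiv.Perm (Fin k), (((Equiv.Perm.sign σ : ℤ) : ℝ) : ℂ) •
      T.domDomCongr (Equiv.sumCongr π σ)

variable {T : ML(Fin r ⊕ Fin k, ℂ)}

theorem altL_currySum (U : Fin r → VTP) (V : Fin k → VTP) :
    altL k (T.currySum U) V = ∑ σ : Equiv.Perm (Fin k),
      (((Equiv.Perm.sign σ : ℤ) : ℝ) : ℂ) • T (Sum.elim U fun i => V (σ i)) := by
  change MultilinearMap.alternatization (T.currySum U) V = _
  rw [MultilinearMap.alternatization_apply]
  refine sum_congr rfl fun σ _ => ?_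
  rw [MultilinearMap.domDomCongr_apply, MultilinearMap.currySum_apply, Units.smul_def,
    ← Int.cast_smul_eq_zsmul ℂ]
  push_cast
  rfl

theorem altForm_apply (U : Fin r → VTP) (V : Fin k → VTP) :
    altForm T U V = altMap T (Sum.elim U V) := by
  have e : ∀ (π : Equiv.Perm (Fin r)) (σ : Equiv.Perm (Fin k)),
      (T.domDomCongr (Equiv.sumCongr π σ)) (Sum.elim U V) =
        T (Sum.elim (fun a => U (π a)) fun i => V (σ i)) := fun π σ => by
    rw [MultilinearMap.domDomCongr_apply]
    congr 1
    funext x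
    cases x <;> rfl
  change evalL V (altForm T U) = _
  rw [altForm, symmz_apply, altMap, smul_apply, map_smul, sum_apply, map_sum]
  congr 1
  refine sum_congr rfl fun π _ => ?_
  change altL k _ V = _
  rw [sum_apply, altL_currySum]
  refine sum_congr rfl fun σ _ => ?_
  rw [smul_apply, e]

theorem good_altMap (hT : Good T) : Good (altMap T) :=
  Good.smul _ (Good.sum _ _ fun _ _ => Good.sum _ _ fun _ _ => Good.smul _ (hT.domDomCongr _))

theorem isForm_altForm (hT : Good T) : IsForm (altForm T) where
  symm := symmz_symm _
  bound := by
    obtain ⟨C, hC, S, h⟩ := (good_altMap hT).block_bound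
    refine ⟨((r + k) * S : ℕ), by positivity, C, hC, fun U V n l => ?_⟩
    have h := h (Sum.elim U V) (Sum.elim n l)
    have e : (fun a => projV (Sum.elim n l a) (Sum.elim U V a)) =
      Sum.elim (fun i => projV (n i) (U i)) fun i => projV (l i) (V i) := by
        funext x; cases x <;> rfl
    rw [e, nrm_complex, ← altForm_apply, Fintype.prod_sum_type, Fintype.prod_sum_type] at h
    simp only [Sum.elim_inl, Sum.elim_inr] at h
    refine h.trans ?_
    rw [← mul_assoc]
    refine mul_le_mul_of_nonneg_right (mul_le_mul_of_nonneg_right (mul_le_mul_of_nonneg_left ?_ hC.le)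
      (prod_nonneg fun _ _ => hnormV_nonneg _ _))
      (prod_nonneg fun _ _ => hnormV_nonneg _ _)
    rw [Real.rpow_natCast, add_mul, pow_add]
    refine mul_le_mul ((prod_pow_le_maxOf n S).trans ?_) ((prod_pow_le_maxOf l S).trans ?_)
      (by positivity) (by positivity)
    · exact pow_le_pow_left₀ (by positivity) (by exact_mod_cast le_max_left _ _) _
    · exact pow_le_pow_left₀ (by positivity) (by exact_mod_cast le_max_right _ _) _
  momentum U V n l h := by
    rw [altForm_apply] at h
    have e : (Sum.elim (fun i => projV (n i) (U i)) fun i => projV (l i) (V i)) =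
      fun a => projV (Sum.elim n l a) (Sum.elim U V a) := by funext x; cases x <;> rfl
    rw [e] at h
    obtain ⟨i, hi, hi'⟩ := exists_idx_of_ne h
    have hm := (good_altMap hT).momentum_scalar i hi'
    obtain ⟨ε, hε⟩ := exists_signs hi
    refine ⟨fun a => ε (Sum.inl a), fun a => ε (Sum.inr a), ?_⟩
    rw [mom, sum_congr rfl fun a _ => (hε a).symm, Fintype.sum_sum_type] at hm
    exact hm
  translation a U V := by
    rw [altForm_apply, altForm_apply]
    refine Eq.trans (congrArg _ (funext fun x => ?_)) ((good_altMap hT).tr a (Sum.elim U V))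
    cases x <;> rfl
  real U V hU hV := by
    rw [altForm_apply, ← Complex.conj_eq_iff_im, ← cj_complex, ← (good_altMap hT).cj]
    congr 1
    funext x
    cases x
    exacts [(isRealVec_iff _).1 (hU _), (isRealVec_iff _).1 (hV _)]

def fromScal (H : ML(Fin q, ℂ)) : KForm q 0 :=
  altForm (H.domDomCongr (Equiv.sumEmpty (Fin q) (Fin 0)).symm)

theorem toScal_fromScal {H : ML(Fin q, ℂ)} (hs : IsSymm H) : toScal (fromScal H) = H := by
  refine MultilinearMap.ext fun U => ?_
  change evalL ![] (altForm _ U) = _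
  rw [altForm, symmz_apply, map_smul, map_sum]
  refine Eq.trans ?_ (avg_const (α := Fin q) (H U))
  congr 1
  refine sum_congr rfl fun π _ => ?_
  change altL 0 _ ![] = _
  rw [altL_currySum, Finset.univ_unique, Finset.sum_singleton]
  simp only [Subsingleton.elim (default : Equiv.Perm (Fin 0)) 1, Equiv.Perm.sign_one, Units.val_one,
    Int.cast_one, Complex.ofReal_one, one_smul]
  rw [MultilinearMap.domDomCongr_apply]
  exact hs π U

/-- The exterior derivative of `T`, as a `2`-form. -/
theorem exists_twoForm {T : ML(Fin (k + 2), ℂ)} (hT : Good T) :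
    ∃ Λ : KForm k 2, IsForm Λ ∧ ∀ U V W : VTP,
      Λ (fun _ => U) ![V, W] = d2 (last (k + 1)) T U V W := by
  let e : Fin (k + 1) → (Fin (k + 2) ≃ Fin k ⊕ Fin 2) := fun a =>
    (Equiv.swap a.castSucc (last k).castSucc).trans (finSumFinEquiv (m := k) (n := 2)).symm
  have he1 : ∀ a, e a a.castSucc = Sum.inr 0 := fun a => by
    change (finSumFinEquiv (m := k) (n := 2)).symm (Equiv.swap a.castSucc (last k).castSucc a.castSucc) = _
    rw [Equiv.swap_apply_left, Equiv.symm_apply_eq]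
    rfl
  have he2 : ∀ a, e a (last (k + 1)) = Sum.inr 1 := fun a => by
    change (finSumFinEquiv (m := k) (n := 2)).symm (Equiv.swap a.castSucc (last k).castSucc (last _)) = _
    rw [Equiv.swap_apply_of_ne_of_ne (castSucc_lt_last _).ne' (castSucc_lt_last _).ne',
      Equiv.symm_apply_eq]
    rfl
  let T' : ML(Fin k ⊕ Fin 2, ℂ) := ∑ a, T.domDomCongr (e a)
  refine ⟨altForm T', isForm_altForm (Good.sum _ _ fun a _ => hT.domDomCongr _), fun U V W => ?_⟩
  have hval : ∀ x : Fin 2 → VTP, T' (Sum.elim (fun _ => U) x) =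
      ∑ a : Fin (k + 1), T (snoc (update (fun _ => U) a (x 0)) (x 1)) := by
    intro x
    rw [sum_apply]
    refine sum_congr rfl fun a _ => ?_
    rw [MultilinearMap.domDomCongr_apply]
    congr 1
    funext b
    refine lastCases ?_ (fun c => ?_) b
    · rw [he2, snoc_last]; rfl
    · rw [snoc_castSucc]
      by_cases h : c = a
      · rw [h, he1, update_self]; rfl
      · rw [update_of_ne h]
        rcases hx : e a c.castSucc with i | i
        · rfl
        · exfalso
          fin_cases i
          · exact h (Fin.castSucc_injective _ ((e a).injective (hx.trans (he1 a).symm)))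
          · exact (castSucc_lt_last c).ne ((e a).injective (hx.trans (he2 a).symm))
  rw [altForm, symmz_diag, LinearMap.compMultilinearMap_apply, altL_currySum, d2_last]
  simp only [hval]
  rw [show (univ : Finset (Equiv.Perm (Fin 2))) = {1, Equiv.swap 0 1} by decide,
    Finset.sum_pair (by decide)]
  simp [sub_eq_add_neg]

/-! ### Hamiltonian vector fields -/

theorem extS_mode {T : ML(Fin q, ℂ)} {C S : ℝ} (hC : 0 ≤ C)
    (hT : KB T C S) {U : Vec} (hU : InHV (S + 2) U) (a : Fin q) (i : Idx) :
    Tendsto (fun n => T (update (fun _ => trunc n U) a (bas i))) atTop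
      (𝓝 (extS T (update (fun _ => U) a (bas i).toVec))) := by
  have e : ∀ n, T (update (fun _ => trunc n U) a (bas i)) =
      extS T fun b => (update (fun _ => trunc n U) a (bas i) b).toVec := fun n =>
    (extS_toVec _).symm
  simp only [e]
  refine extS_tendsto hC hT (fun b => ?_) fun b j => ?_
  · by_cases h : b = a
    · subst h
      simp only [update_self]
      exact ⟨_, Eventually.of_forall fun _ => ⟨inHV_toVec _ _, le_rfl⟩⟩
    · simp only [update_of_ne h]
      exact ⟨_, Eventually.of_forall fun n => ⟨inHV_toVec _ _, hnormV_trunc_le hU n⟩⟩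
  · by_cases h : b = a
    · subst h; simp
    · simp only [update_of_ne h]
      exact tendsto_trunc U j

theorem Ec_Ec (V : Vec) : Ec (Ec V) = V := by
  funext σ j
  fin_cases σ <;> simp [Ec, ← mul_assoc]

theorem IsForm.ec_grad {H : KForm (k + 2) 0} (hH : IsForm H) :
    ∀ᶠ L in atTop, ∀ U, InHV L U → Ec (H.grad U) = ext (hamMap (toScal H)) fun _ => U := by
  obtain ⟨C, hC, S, hS, hT⟩ := hH.good.exists_kb
  filter_upwards [Extends.ext (good_hamMap hH.good) (fun _ : Fin (k + 1) => Extends.fst) 0,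
    eventually_ge_atTop (S + 2)] with L hL hS U hU
  have hg : ∀ i : Idx, (H.grad U).at i =
      ∑ a, extS (toScal H) (update (fun _ => U) a (bas ⟨i.1, i.2.opp⟩).toVec) := fun i => by
    change ∑ a : Fin (k + 2), _ = _
    refine sum_congr rfl fun a _ => ?_
    have e : mode i.1 i.2.opp = (bas ⟨i.1, i.2.opp⟩).toVec := by
      refine Vec.ext_at fun j => ?_
      change (if _ then (1 : ℂ) else 0) = bas _ j.1 j.2
      rw [bas_apply_apply]
      simp only [eq_comm]
    rw [e]
    exact extS_blocks (summable_term hT (inHV_update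
      (fun _ => hU.mono (by linarith)) _ (inHV_toVec _ _)))
  have hlim := (hL U U hU hU).2
  rw [← Ec_Ec (ext (hamMap (toScal H)) fun _ => U)]
  congr 1
  refine Vec.ext_at fun i => ?_
  rw [hg]
  refine tendsto_nhds_unique (tendsto_finsetSum _ fun a _ =>
    extS_mode hC hT (hU.mono hS) a _) ?_
  have e : ∀ n, ∑ a, toScal H (update (fun _ => trunc n U) a (bas ⟨i.1, i.2.opp⟩)) =
      (Ec (hamMap (toScal H) fun _ => trunc n U).toVec).at i := fun n => by
    rw [← om_hamMap hH.good hH.isSymm, om_apply, pr_bas_right, Freq.opp_opp, ← toVec_EcL]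
    rfl
  simp only [e]
  rcases i with ⟨σ, j⟩
  fin_cases σ
  · exact (hlim ⟨1, j⟩).const_mul (-Complex.I)
  · exact (hlim ⟨0, j⟩).const_mul Complex.I

theorem hamField_eq {N : ℕ} {H : ∀ q, KForm q 0} (hH : ∀ q ∈ Icc 2 (N + 2), IsForm (H q)) :
    ∀ᶠ L in atTop, ∀ U, InHV L U → hamField N H U =
      ∑ k ∈ range (N + 1), ext (hamMap (toScal (H (k + 2)))) fun _ => U := by
  filter_upwards [(eventually_all_finset (range (N + 1))).2 fun k hk => (hH (k + 2) (mem_Icc.2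
    ⟨by omega, by have := mem_range.1 hk; omega⟩)).ec_grad] with L hL U hU
  have hEc : ∀ (s : Finset ℕ) (f : ℕ → Vec), Ec (∑ q ∈ s, f q) = ∑ q ∈ s, Ec (f q) := by
    intro s f
    refine Vec.ext_at fun i => ?_
    rcases i with ⟨σ, j⟩
    rw [Vec.sum_at]
    fin_cases σ <;> simp [Ec, Vec.at, mul_sum]
  rw [hamField, hEc, Finset.sum_bij' (t := range (N + 1)) (fun q _ => q - 2)
    (fun k _ => k + 2) (g := fun k => Ec ((H (k + 2)).grad U))]
  · refine sum_congr rfl fun k hk => hL k hk U hU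
  · intro q hq; simp only [mem_Icc, mem_range] at *; omega
  · intro q hq; simp only [mem_Icc, mem_range] at *; omega
  · intro q hq; simp only [mem_Icc] at hq; omega
  · intro q hq; omega
  · intro q hq
    simp only [mem_Icc] at hq
    rw [Nat.sub_add_cancel hq.1]

end

section

variable {q : ℕ} {m : ℝ} {M : HomMat q}

/-! ### Kernels of homogeneous operators -/

theorem toMap_bas (M : HomMat q) (i : Fin (q + 1) → Idx) (σ : Fin 2) :
    toMap M (fun a => bas (i a)) σ = M σ (i (last q)).1
      (fun a => projV (i a.castSucc).2.wt (bas (i a.castSucc)).toVec)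
      (proj (i (last q)).2.wt (Finsupp.single (i (last q)).2 1 : TP)) := by
  rw [toMap_proj M σ _ _ _ fun a => (i a).2.wt]
  refine congrFun (congrArg _ (funext fun a => ?_)) σ
  have e : (snoc (fun a : Fin q => (bas (i a.castSucc)).toVec) (inc (i (last q)).1
      (Finsupp.single (i (last q)).2 1 : TP)) : Fin (q + 1) → Vec) a = (bas (i a)).toVec := by
    refine lastCases ?_ (fun b => ?_) a
    · rw [snoc_last, bas_apply, toVec_single]
    · rw [snoc_castSucc]
  rw [e, projV_bas]

theorem norm_le_hnorm_proj (V : VTP) (k : Idx) : ‖V k.1 k.2‖ ≤ hnorm 0 (proj k.2.wt (V k.1)) := by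
  have := norm_wseq_le (inHV_toVec 0 (Pi.single k.1 (proj k.2.wt (V k.1)))) k
  rw [toVec_single, hnormV_inc, norm_wseq, Real.rpow_zero, one_mul] at this
  refine le_trans (le_of_eq ?_) this
  rw [Vec.at, inc, update_self]
  exact congrArg norm (if_pos rfl).symm

theorem one_le_prod_wt {α : Type*} [Fintype α] (i : α → Idx) : 1 ≤ ∏ a, (i a).2.wt :=
  Nat.succ_le_iff.2 (prod_pos fun a _ => Freq.one_le_wt _)

theorem IsHomM.kernel_bound (hm : 0 ≤ m) (h : ∀ σ σ', IsHomM m (M σ σ')) :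
    ∃ C ≥ (0 : ℝ), ∃ s : ℕ, ∀ (i : Fin (q + 1) → Idx) (k : Idx),
      ‖toMap M (fun a => bas (i a)) k.1 k.2‖ ≤ C * (∏ a, (i a).2.wt : ℕ) ^ s := by
  choose μ hμ C hC hb using fun x : Fin 2 × Fin 2 => (h x.1 x.2).bound
  refine ⟨∑ x, C x, sum_nonneg fun x _ => (hC x).le, ⌈∑ x, μ x + m⌉₊, fun i k => ?_⟩
  set x : Fin 2 × Fin 2 := (k.1, (i (last q)).1)
  have hP : (1 : ℝ) ≤ (∏ a, (i a).2.wt : ℕ) := by exact_mod_cast one_le_prod_wt i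
  have hmax : maxOf (fun a => (i a).2.wt) ≤ ∏ a, (i a).2.wt := Finset.sup_le fun a _ => wt_le_prod i a
  have hmax2 : max2Of (fun a => (i a).2.wt) ≤ ∏ a, (i a).2.wt :=
    Finset.sup_le fun a _ => (min_le_left _ _).trans (wt_le_prod i _)
  have := hb x (fun a => (bas (i a.castSucc)).toVec) (Finsupp.single (i (last q)).2 1 : TP)
    (fun a => (i a).2.wt) k.2.wt
  rw [← toMap_bas] at this
  refine (norm_le_hnorm_proj _ k).trans (this.trans ?_)
  have e1 : hnorm 0 (proj (i (last q)).2.wt (Finsupp.single (i (last q)).2 1 : TP)) ≤ 1 := by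
    have := hnormV_bas (i (last q))
    rw [← projV_bas, bas_apply, toVec_single, projV_inc, toVec_single, hnormV_inc] at this
    exact this
  have e2 : ∏ a : Fin q, hnormV 0 (projV (i a.castSucc).2.wt (bas (i a.castSucc)).toVec).toVec ≤ 1 :=
    prod_le_one (fun _ _ => hnormV_nonneg _ _) fun a _ => by
      rw [projV_bas]; exact hnormV_bas _
  have e3 : 0 ≤ ∏ a : Fin q, hnormV 0 (projV (i a.castSucc).2.wt (bas (i a.castSucc)).toVec).toVec :=
    prod_nonneg fun _ _ => hnormV_nonneg _ _
  have e4 : ((max2Of fun a => (i a).2.wt : ℕ) : ℝ) ^ μ x * ((maxOf fun a => (i a).2.wt : ℕ) : ℝ) ^ m ≤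
      (∏ a, (i a).2.wt : ℕ) ^ ⌈∑ x, μ x + m⌉₊ := by
    refine (mul_le_mul (Real.rpow_le_rpow (by positivity) (Nat.cast_le.2 hmax2) (hμ x))
      (Real.rpow_le_rpow (by positivity) (Nat.cast_le.2 hmax) hm) (by positivity)
      (by positivity)).trans ?_
    rw [← Real.rpow_add (by linarith), ← Real.rpow_natCast]
    refine Real.rpow_le_rpow_of_exponent_le hP (le_trans ?_ (Nat.le_ceil _))
    gcongr
    exact single_le_sum (fun x _ => hμ x) (mem_univ x)
  have e5 : C x ≤ ∑ x, C x := single_le_sum (fun x _ => (hC x).le) (mem_univ x)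
  have h0 : (0 : ℝ) ≤ ((max2Of fun a => (i a).2.wt : ℕ) : ℝ) ^ μ x *
    ((maxOf fun a => (i a).2.wt : ℕ) : ℝ) ^ m := by positivity
  refine (mul_le_mul_of_nonneg_left e1 (mul_nonneg (by have := hC x; positivity) e3)).trans ?_
  rw [mul_one]
  refine (mul_le_mul_of_nonneg_left e2 (by have := hC x; positivity)).trans ?_
  rw [mul_one, mul_assoc]
  exact mul_le_mul e5 e4 h0 ((hC x).le.trans e5)

theorem IsHomS.kernel (h : ∀ σ σ', IsHomS m (M σ σ')) : ∃ c : ℕ, ∀ (i : Fin (q + 1) → Idx) (k : Idx),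
    toMap M (fun a => bas (i a)) k.1 k.2 ≠ 0 →
      (∀ a : Fin q, (i a.castSucc).2.wt ≤ c * (i (last q)).2.wt) ∧
      (i (last q)).2.wt ≤ c * k.2.wt := by
  choose δ hδ C hC hb using fun x : Fin 2 × Fin 2 => (h x.1 x.2).spectral
  refine ⟨⌈∑ x, (δ x + C x)⌉₊, fun i k hk => ?_⟩
  rw [toMap_bas] at hk
  obtain ⟨h1, -, h2⟩ := hb (k.1, (i (last q)).1) _ _ (fun a => (i a).2.wt) k.2.wt fun h0 =>
    hk ((if_pos rfl).symm.trans (DFunLike.congr_fun h0 k.2))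
  set x : Fin 2 × Fin 2 := (k.1, (i (last q)).1)
  have e : δ x + C x ≤ ⌈∑ x, (δ x + C x)⌉₊ := le_trans (single_le_sum
    (f := fun x => δ x + C x) (fun x _ => by have := hδ x; have := hC x; positivity)
    (mem_univ x)) (Nat.le_ceil _)
  have := hδ x
  have := hC x
  refine ⟨fun a => Nat.cast_le.1 ((h1 a).trans ?_), Nat.cast_le.1 (h2.trans ?_)⟩ <;> push_cast <;>
    gcongr <;> linarith

theorem IsHomM.toMap_tr (h : ∀ σ σ', IsHomM m (M σ σ')) (x : ℝ) (U : Fin (q + 1) → VTP) :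
    toMap M (fun a => tr x (U a)) = tr x (toMap M U) := by
  refine vtp_ext fun k => ?_
  change toMap M _ k.1 k.2 = trans x (toMap M U k.1) k.2
  rw [toMap_apply, toMap_apply, trans_apply]
  simp only [HomMat.app, Finsupp.finsetSum_apply, mul_sum, ← trans_apply]
  exact sum_congr rfl fun σ' _ => by rw [← (h k.1 σ').translation]; rfl

theorem IsHomM.toMap_bd (hm : 0 ≤ m) (h : ∀ σ σ', IsHomM m (M σ σ')) (s : ℕ) :
    ∃ C ≥ (0 : ℝ), ∃ s' : ℕ, ∀ i : Fin (q + 1) → Idx,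
      nrm s (toMap M fun a => bas (i a)) ≤ C * ∏ a, ((i a).2.wt : ℝ) ^ s' := by
  obtain ⟨C, hC, s', hb⟩ := IsHomM.kernel_bound hm h
  refine ⟨2 * (((q + 1 : ℕ) : ℝ) ^ s * C), by positivity, s + s', fun i => ?_⟩
  have hP := one_le_prod_wt i
  rw [prod_pow, ← Nat.cast_prod]
  set V := toMap M fun a => bas (i a)
  have hmom : ∀ k : Idx, V k.1 k.2 ≠ 0 → k.2.1 = mom i := fun k hk => phase_injective fun x => by
    have e : tr x V = (∏ a, (i a).ph x) • V := by
      rw [← IsHomM.toMap_tr h, ← MultilinearMap.map_smul_univ]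
      exact congrArg _ (funext fun a => tr_bas x (i a))
    have e := DFunLike.congr_fun (congrFun e k.1) k.2
    rw [prod_ph] at e
    exact mul_right_cancel₀ hk e
  by_cases h0 : mom i = 0
  · have : V = 0 := vtp_ext fun k => by
      by_contra hk
      exact k.2.2 ((hmom k hk).trans h0)
    rw [this, nrm_zero]
    positivity
  · rw [nrm_vtp_of_subset s V (univ.map ⟨fun σ : Fin 2 => (⟨σ, ⟨mom i, h0⟩⟩ : Idx),
      fun σ τ h => by simpa using h⟩) fun k hk => Finset.mem_map.2 ⟨k.1, mem_univ _,
        Sigma.ext rfl (heq_of_eq (Subtype.ext (hmom k hk).symm))⟩, Finset.sum_map]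
    have hw : Freq.wt ⟨mom i, h0⟩ ≤ (q + 1) * ∏ a, (i a).2.wt := by
      have h1 := abs_mom_le i
      have h2 := sum_wt_le i
      rw [Fintype.card_fin] at h2
      zify at h2
      change (mom i).natAbs ≤ _
      zify
      exact h1.trans h2
    have hx : ∀ σ : Fin 2, ((Freq.wt ⟨mom i, h0⟩ : ℕ) : ℝ) ^ s * ‖V σ ⟨mom i, h0⟩‖ ≤
        ((q + 1 : ℕ) : ℝ) ^ s * C * (∏ a, (i a).2.wt : ℕ) ^ (s + s') := fun σ => by
      refine (mul_le_mul (pow_le_pow_left₀ (by positivity) (Nat.cast_le.2 hw) s)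
        (hb i ⟨σ, ⟨mom i, h0⟩⟩) (norm_nonneg _) (by positivity)).trans_eq ?_
      rw [Nat.cast_mul]
      ring
    exact (sum_le_sum fun σ _ => hx σ).trans_eq (by
      rw [sum_const, card_univ, Fintype.card_fin]; ring)

theorem IsHomM.good (hm : 0 ≤ m) (h : ∀ σ σ', IsHomM m (M σ σ'))
    (hcj : ∀ U, toMap M (fun a => cj (U a)) = cj (toMap M U)) : Good (toMap M) where
  tr := IsHomM.toMap_tr h
  cj := hcj
  bd s := by
    obtain ⟨C, hC, s', hb⟩ := IsHomM.toMap_bd hm h s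
    exact ⟨C, hC, s', nrm_le_of_kernel _ hb⟩

theorem IsHomM.eval_toVec (hm : 0 ≤ m) (h : ∀ σ σ', IsHomM m (M σ σ')) (U V : VTP) :
    M.eval U.toVec V.toVec = (toMap M (update (fun _ => U) (last q) V)).toVec := by
  obtain ⟨C, hC, s, hb⟩ := IsHomM.toMap_bd hm h 0
  have hN : NB (toMap M) C s := fun i => (hb i).trans_eq (by
    simp only [Idx.abs_eq_wt, Real.rpow_natCast])
  rw [M.eval_eq hN (inHV_toVec _ U) (inHV_toVec _ V), ← ext_toVec, update_const_apply]
  refine congrArg _ (funext fun a => ?_)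
  by_cases h : a = last q <;> simp [h]

/-! ### Polynomials that are small near `0` -/

theorem Pn.of_small {n : ℕ} {f : ℂ → ℂ} (hf : f ∈ Pn 0 ℂ)
    (h : ∃ C : ℝ, ∀ᶠ x : ℝ in 𝓝[>] 0, ‖f x‖ ≤ C * x ^ n) : f ∈ Pn n ℂ := by
  obtain ⟨C, h⟩ := h
  suffices ∀ m ≤ n, f ∈ Pn m ℂ from this n le_rfl
  intro m
  induction m with
  | zero => exact fun _ => hf
  | succ m ih =>
    intro hm
    obtain ⟨L, y, hy, hL, hf⟩ := Pn.normal (ih (by omega))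
    let g : ℝ → ℂ := fun x => ∑ k ∈ range L, (x : ℂ) ^ (k - m) * y k
    have hg : ∀ x : ℝ, f x = (x : ℂ) ^ m * g x := fun x => by
      rw [hf, mul_sum]
      refine sum_congr rfl fun k _ => ?_
      by_cases hk : k < m
      · simp [hy k hk]
      · rw [← mul_assoc, ← pow_add, Nat.add_sub_cancel' (not_lt.1 hk), smul_eq_mul]
    have hgc : Continuous g := by fun_prop
    have h0 : y m = g 0 := by
      by_cases hmL : m < L
      · change _ = ∑ k ∈ range L, ((0 : ℝ) : ℂ) ^ (k - m) * y k
        rw [sum_eq_single m]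
        · simp
        · intro k _ hk
          rcases lt_or_gt_of_ne hk with hk | hk
          · simp [hy k hk]
          · simp [Nat.sub_ne_zero_of_lt hk]
        · simp [hmL]
      · change _ = ∑ k ∈ range L, ((0 : ℝ) : ℂ) ^ (k - m) * y k
        rw [hL m (not_lt.1 hmL), sum_eq_zero fun k hk => ?_]
        rw [hy k ((mem_range.1 hk).trans_le (not_lt.1 hmL)), mul_zero]
    have hlim : Tendsto (fun x : ℝ => ‖g x‖) (𝓝[>] 0) (𝓝 ‖g 0‖) :=
      (hgc.norm.tendsto 0).mono_left nhdsWithin_le_nhds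
    have hlim' : Tendsto (fun x : ℝ => C * x ^ (n - m)) (𝓝[>] 0) (𝓝 0) := by
      have : Continuous fun x : ℝ => C * x ^ (n - m) := by fun_prop
      simpa [Nat.sub_ne_zero_of_lt hm] using (this.tendsto 0).mono_left nhdsWithin_le_nhds
    have hle := le_of_tendsto_of_tendsto hlim hlim' (by
      filter_upwards [h, self_mem_nhdsWithin] with x hx hx0
      rw [Set.mem_Ioi] at hx0
      rw [hg, norm_mul, norm_pow, Complex.norm_real, Real.norm_of_nonneg hx0.le,
        ← Nat.add_sub_cancel' (show m ≤ n by omega), pow_add, mul_left_comm] at hx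
      simpa using le_of_mul_le_mul_left hx (pow_pos hx0 m))
    have hym : y m = 0 := by rw [h0]; exact norm_le_zero_iff.1 hle
    rw [funext hf]
    refine Pn.sum _ _ fun k _ => ?_
    by_cases hk : k < m + 1
    · have : y k = 0 := by
        rcases Nat.lt_succ_iff_lt_or_eq.1 hk with hk | rfl
        exacts [hy k hk, hym]
      simpa [this] using Pn.zero (m + 1)
    · exact Pn.monomial _ (not_lt.1 hk) _

theorem eq_zero_of_real_diag {N : Type*} [AddCommGroup N] [Module ℂ N]
    {A : ML(Fin q, N)} (hs : IsSymm A)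
    (h : ∀ U : VTP, cj U = U → A (fun _ => U) = 0) : A = 0 := by
  have hd : ∀ U, A (fun _ => U) = 0 := by
    intro U
    set X : VTP := (1 / 2 : ℂ) • (U + cj U)
    set Y : VTP := (-Complex.I / 2) • (U - cj U)
    have hX : cj X = X := by
      simp only [X, cj_smul, cj_add, cj_cj, map_div₀, map_one, map_ofNat]
      rw [add_comm]
    have hY : cj Y = Y := by
      simp only [Y, cj_smul, cj_sub, cj_cj, map_div₀, map_neg, Complex.conj_I, map_ofNat]
      module
    have hU : U = X + Complex.I • Y := by
      simp only [X, Y, smul_smul, show Complex.I * (-Complex.I / 2) = 1 / 2 by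
        linear_combination (-1 / 2 : ℂ) * Complex.I_mul_I]
      module
    clear_value X Y
    obtain ⟨L, y, -, -, hy⟩ := Pn.normal (Pn.multilinear A (fun _ => 0) (fun _ z => X + z • Y)
      fun _ => Pn.add (Pn.const X) (Pn.mono (Nat.zero_le 1) (linear_mem Y)))
    have hz := coeff_eq_zero L y (Set.range ((↑) : ℝ → ℂ))
      (Set.infinite_range_of_injective Complex.ofReal_injective) (by
        rintro _ ⟨x, rfl⟩
        rw [← hy]
        exact h _ (by rw [cj_add, cj_smul, hX, hY, Complex.conj_ofReal]))
    rw [hU, hy Complex.I]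
    exact sum_eq_zero fun k hk => by rw [hz k (mem_range.1 hk), smul_zero]
  refine MultilinearMap.ext fun U => polarization A hs ⊤ (fun U _ => hd U) U fun _ => trivial

end

section

variable {I : Set ℝ} [TimeInterval I] {K J p N : ℕ} {m r s ρ t : ℝ} {B : NHMat} {Bq : ∀ q, HomMat q}

/-! ### Operators along small constant paths -/

theorem toVec_smul (c : ℂ) (U : VTP) : (c • U).toVec = c • U.toVec := rfl

theorem eventually_inBall (K : ℕ) (s : ℝ) (hρ : 0 < ρ) (U : VTP) :
    ∀ᶠ x : ℝ in 𝓝[>] 0, InBall I K s ρ fun _ => ((x : ℂ) • U).toVec := by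
  have hc : Tendsto (fun x : ℝ => |x| * hnormV s U.toVec) (𝓝 0) (𝓝 0) := by
    have : Continuous fun x : ℝ => |x| * hnormV s U.toVec := by fun_prop
    simpa using this.tendsto 0
  filter_upwards [nhdsWithin_le_nhds (hc.eventually_lt_const (half_pos hρ))] with x hx
  refine ⟨InCStarV.const (inHV_toVec _ _), ρ / 2, half_lt_self hρ, fun t ht => ?_⟩
  rw [normKV_const _ ht, toVec_smul, hnormV_smul _ (inHV_toVec s U), Complex.norm_real]
  exact hx.le

theorem app_small {S : NHMat} (hS : ∀ σ σ', IsS I K J m (N + 1) r (S σ σ'))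
    (a : ℝ) (U V : VTP) (ht : t ∈ I) : ∃ C ≥ (0 : ℝ), ∀ᶠ x : ℝ in 𝓝[>] 0,
      InHV a (S.app (fun _ => ((x : ℂ) • U).toVec) t V.toVec) ∧
      hnormV a (S.app (fun _ => ((x : ℂ) • U).toVec) t V.toVec) ≤ C * x ^ (N + 1) := by
  have h : ∀ y : Fin 2 × Fin 2, ∃ C ≥ (0 : ℝ), ∀ᶠ x : ℝ in 𝓝[>] 0,
      InHV a (inc y.1 (S y.1 y.2 (fun _ => ((x : ℂ) • U).toVec) t (V.toVec y.2))) ∧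
      hnormV a (inc y.1 (S y.1 y.2 (fun _ => ((x : ℂ) • U).toVec) t (V.toVec y.2))) ≤
        C * x ^ (N + 1) := by
    rintro ⟨σ, σ'⟩
    obtain ⟨s₀, -, h⟩ := hS σ σ'
    obtain ⟨C, hC, rs, hrs, -, h⟩ := h (a + m)
    have hn : 0 ≤ normK I 0 (a + m) (fun _ => V.toVec σ') t :=
      sum_nonneg fun _ _ => hnorm_nonneg _ _
    refine ⟨C * (hnormV s₀ U.toVec ^ (N + 1) * normK I 0 (a + m) (fun _ => V.toVec σ') t),
      mul_nonneg hC.le (mul_nonneg (pow_nonneg (hnormV_nonneg _ _) _) hn), ?_⟩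
    filter_upwards [eventually_inBall (I := I) K s₀ hrs U, self_mem_nhdsWithin] with x hx hx0
    obtain ⟨h1, h2⟩ := h _ hx (InCStarV.const (inHV_toVec _ _)) _
      (InCStarV.const (inHV_toVec (a + m) V) σ')
    refine ⟨((h1.inc σ).inHV ht).mono (by linarith), ?_⟩
    have := h2 0 (Nat.zero_le _) t ht
    rw [dt_zero, if_neg (Nat.succ_ne_zero N), Nat.cast_zero, mul_zero, sub_zero,
      add_sub_cancel_right, zero_add, sum_range_one, normKV_const _ ht, toVec_smul,
      hnormV_smul _ (inHV_toVec s₀ U), Complex.norm_real, Real.norm_of_nonneg (le_of_lt hx0),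
      mul_pow] at this
    rw [hnormV_inc]
    refine this.trans_eq ?_
    ring
  choose C hC h using h
  refine ⟨∑ y, C y, sum_nonneg fun y _ => hC y, ?_⟩
  filter_upwards [eventually_all.2 h] with x hx
  rw [NHMat.app_eq, ← Fintype.sum_prod_type'
    (f := fun σ σ' => inc σ (S σ σ' (fun _ => ((x : ℂ) • U).toVec) t (V.toVec σ')))]
  refine ⟨InHV.sum _ fun y _ => (hx y).1, (hnormV_sum_le _ fun y _ => (hx y).1).trans ?_⟩
  rw [sum_mul]
  exact sum_le_sum fun y _ => (hx y).2

/-- The pluri-homogeneous part of `B`, as a polynomial map. -/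
def polyT (p N : ℕ) (A : ∀ q, ML(Fin (q + 1), VTP)) : Tri VTP :=
  idT + ∑ q ∈ Icc p N, tri (last q) (A q)

variable {A : ∀ q, ML(Fin (q + 1), VTP)}

theorem polyT_op (U V : VTP) : (polyT p N A).1 U V =
    V + ∑ q ∈ Icc p N, A q (update (fun _ => U) (last q) V) := by
  change V + (∑ q ∈ Icc p N, tri (last q) (A q)).1 U V = _
  rw [Poly.sum_op]
  rfl

theorem polyT_val (U : VTP) : (polyT p N A).2.1 U = U + ∑ q ∈ Icc p N, A q fun _ => U := by
  change U + (∑ q ∈ Icc p N, tri (last q) (A q)).2.1 U = _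
  rw [Poly.sum_val]
  rfl

theorem polyT_der (U V : VTP) : (polyT p N A).2.2 U V =
    V + ∑ q ∈ Icc p N, ∑ a, A q (update (fun _ => U) a V) := by
  change V + (∑ q ∈ Icc p N, tri (last q) (A q)).2.2 U V = _
  rw [Poly.sum_der]
  rfl

theorem polyT_sub : polyT p N A - idT = ∑ q ∈ Icc p N, tri (last q) (A q) := add_sub_cancel_left _ _

theorem ordT_polyT : OrdT p (polyT p N A - idT) := by
  rw [polyT_sub]
  exact OrdT.sum _ _ fun q hq => (ordT_tri (A q)).mono (mem_Icc.1 hq).1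

theorem polyT_mem (hA : ∀ q ∈ Icc p N, Good (A q)) : polyT p N A ∈ Poly VTP :=
  add_mem idT_mem (sum_mem fun q hq => tri_mem _ (hA q hq))

theorem polyT_op_smul (z : ℂ) (U V : VTP) : (polyT p N A).1 (z • U) V =
    V + ∑ q ∈ Icc p N, z ^ q • A q (update (fun _ => U) (last q) V) := by
  rw [polyT_op]
  congr 1
  exact sum_congr rfl fun q _ => by
    rw [map_update_const_smul, Fintype.card_fin, Nat.add_sub_cancel]

theorem polyT_op_mem (U V : VTP) : (fun z : ℂ => (polyT p N A).1 (z • U) V) ∈ Pn 0 VTP := by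
  simp only [polyT_op_smul]
  exact Pn.add (Pn.const V) (Pn.sum _ _ fun q _ => Pn.monomial _ (Nat.zero_le q) _)

theorem app_expand (hB : IdPlusSigmaS I K J p N r B.app Bq) (a : ℝ)
    (U V : VTP) (ht : t ∈ I) : ∃ C ≥ (0 : ℝ), ∀ᶠ x : ℝ in 𝓝[>] 0,
      ∃ E : Vec, InHV a E ∧ hnormV a E ≤ C * x ^ (N + 1) ∧
        B.app (fun _ => ((x : ℂ) • U).toVec) t V.toVec =
          ((polyT p N fun q => toMap (Bq q)).1 ((x : ℂ) • U) V).toVec + E := by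
  obtain ⟨m, hm, hS, G, hG, s₀, -, r', hr', -, h⟩ := hB
  obtain ⟨C, hC, hE⟩ := app_small hG a U V ht
  refine ⟨C, hC, ?_⟩
  filter_upwards [hE, eventually_inBall (I := I) K s₀ hr' U] with x hx hx'
  refine ⟨_, hx.1, hx.2, ?_⟩
  rw [h _ hx' t ht _ (inHV_toVec _ _), polyT_op]
  congr 1
  refine Vec.ext_at fun i => ?_
  rw [sum_congr rfl fun q hq => IsHomM.eval_toVec hm (fun σ σ' => (hS q hq σ σ').toIsHomM)
    ((x : ℂ) • U) V]
  change (V.toVec + ∑ q ∈ Icc p N, _ : Vec) i.1 i.2 = (V + ∑ q ∈ Icc p N, _ : VTP) i.1 i.2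
  simp only [Pi.add_apply, Finset.sum_apply, Finsupp.add_apply, Finsupp.finsetSum_apply]
  rfl

/-! ### Reality of the homogeneous components -/

theorem cj_sum {ι : Type*} (S : Finset ι) (f : ι → VTP) : cj (∑ i ∈ S, f i) = ∑ i ∈ S, cj (f i) :=
  map_sum (Scale.cjL (Y := VTP)) _ _

theorem app_cjV {t : ℝ} {U : ℝ → Vec} (h : HasRealForm fun σ σ' => B σ σ' U t) {V : Vec}
    (hV : ∀ s, InHV s V) : B.app U t (cjV V) = cjV (B.app U t V) := by
  have hc : ∀ u, conjC (conjC u) = u := fun u => by funext j; simp [conjC]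
  have ha : ∀ u v, conjC (u + v) = conjC u + conjC v := fun u v => by funext j; simp [conjC]
  obtain ⟨h1, h2⟩ := h (conjC (V 0)) fun s => inH_conjC (hV s 0)
  obtain ⟨h3, h4⟩ := h (V 0) fun s => hV s 0
  obtain ⟨h5, h6⟩ := h (V 1) fun s => hV s 1
  obtain ⟨h7, h8⟩ := h (conjC (V 1)) fun s => inH_conjC (hV s 1)
  dsimp only at h1 h2 h3 h4 h5 h6 h7 h8
  rw [hc] at h1 h2 h7 h8
  funext σ
  fin_cases σ
  · change ∑ σ', B 0 σ' U t (conjC (V σ'.rev)) = conjC (∑ σ', B 1 σ' U t (V σ'))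
    rw [sum_univ_two, sum_univ_two, ha]
    change B 0 0 U t (conjC (V 1)) + B 0 1 U t (conjC (V 0)) = _
    rw [h4, h5, hc, hc, add_comm]
  · change ∑ σ', B 1 σ' U t (conjC (V σ'.rev)) = conjC (∑ σ', B 0 σ' U t (V σ'))
    rw [sum_univ_two, sum_univ_two, ha]
    change B 1 0 U t (conjC (V 1)) + B 1 1 U t (conjC (V 0)) = _
    rw [h1, h8, add_comm]

theorem toMap_cj (hB : IdPlusSigmaS I K J p N r B.app Bq)
    (hL : IsLinSymplecticUpTo I K J N r B) (ht : t ∈ I) {q : ℕ} (hq : q ∈ Icc p N)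
    (U : Fin (q + 1) → VTP) : toMap (Bq q) (fun a => cj (U a)) = cj (toMap (Bq q) U) := by
  have hreal : ∀ U V : VTP, cj U = U → toMap (Bq q) (update (fun _ => U) (last q) (cj V)) =
      cj (toMap (Bq q) (update (fun _ => U) (last q) V)) := by
    intro U V hU
    obtain ⟨-, S, -, s₀, -, r', hr', -, h⟩ := hL
    obtain ⟨C, hC, h1⟩ := app_expand hB 0 U V ht
    obtain ⟨C', hC', h2⟩ := app_expand hB 0 U (cj V) ht
    let D : ℕ → VTP := fun q => toMap (Bq q) (update (fun _ => U) (last q) (cj V)) -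
      cj (toMap (Bq q) (update (fun _ => U) (last q) V))
    rw [← sub_eq_zero]
    refine vtp_ext fun k => ?_
    let y : ℕ → ℂ := fun q => if q ∈ Icc p N then D q k.1 k.2 else 0
    have hy : (fun z : ℂ => ∑ q ∈ range (N + 1), z ^ q • y q) ∈ Pn (N + 1) ℂ := by
      refine Pn.of_small (Pn.sum _ _ fun q _ => Pn.monomial _ (Nat.zero_le q) _) ⟨C + C', ?_⟩
      filter_upwards [h1, h2, eventually_inBall (I := I) K s₀ hr' U] with x hx hx' hb
      obtain ⟨E, hE, hE', e⟩ := hx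
      obtain ⟨F, hF, hF', e'⟩ := hx'
      have hr : IsRealVec ((x : ℂ) • U).toVec := (isRealVec_iff _).2 (by
        rw [cj_smul, Complex.conj_ofReal, hU])
      have key := app_cjV ((h _ hb).1 (fun _ _ => hr) t ht) (V := V.toVec) fun s => inHV_toVec s V
      rw [cjV_toVec, e, e', polyT_op_smul, polyT_op_smul] at key
      have key := congrArg (fun W : Vec => W.at k) key
      have hD : ∑ q ∈ range (N + 1), ((x : ℂ) ^ q) • y q =
          (starRingEnd ℂ) (E.at k.conj) - F.at k := by
        rw [show ∑ q ∈ range (N + 1), ((x : ℂ) ^ q) • y q =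
            (∑ q ∈ Icc p N, ((x : ℂ) ^ q) • D q) k.1 k.2 by
          simp only [y, smul_ite, smul_zero, ← sum_filter, Finset.sum_apply,
            Finsupp.finsetSum_apply]
          refine sum_congr (Finset.ext fun q => ?_) fun _ _ => rfl
          simp only [mem_filter, mem_range, mem_Icc]
          omega]
        have hc : (cjV (VTP.toVec (V + ∑ q ∈ Icc p N, (x : ℂ) ^ q • toMap (Bq q)
            (update (fun _ => U) (last q) V)) + E)).at k =
            (cj V + ∑ q ∈ Icc p N, (x : ℂ) ^ q • cj (toMap (Bq q)
              (update (fun _ => U) (last q) V))) k.1 k.2 +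
              (starRingEnd ℂ) (E.at k.conj) := by
          rw [cjV_at]
          change (starRingEnd ℂ) (_ + _) = _
          rw [map_add]
          congr 1
          change (cjV (VTP.toVec _)).at k = _
          rw [cjV_toVec, cj_add, cj_sum]
          simp only [cj_smul, map_pow, Complex.conj_ofReal]
          rfl
        rw [hc] at key
        change (cj V + ∑ q ∈ Icc p N, _ : VTP) k.1 k.2 + F.at k = _ at key
        simp only [D, smul_sub, sum_sub_distrib]
        simp only [Pi.add_apply, Finsupp.add_apply, Pi.sub_apply, Finsupp.sub_apply] at key ⊢
        linear_combination key
      have hn : ∀ {E : Vec} (i : Idx), InHV 0 E → ‖E.at i‖ ≤ hnormV 0 E := fun i h => by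
        simpa using coef_le h i
      rw [hD]
      refine (norm_sub_le _ _).trans ?_
      rw [RCLike.norm_conj, add_mul]
      exact add_le_add ((hn _ hE).trans hE') ((hn _ hF).trans hF')
    have := Pn.coeff_eq_zero hy q (by have := mem_Icc.1 hq; omega) (by have := mem_Icc.1 hq; omega)
    rwa [show y q = D q k.1 k.2 from if_pos hq] at this
  obtain ⟨m, hm, hS, -⟩ := hB
  have h0 : (toMap (Bq q) - cjConj (toMap (Bq q))).curryRight = 0 := by
    have e : ∀ (π : Equiv.Perm (Fin q)) U V,
        toMap (Bq q) (snoc (fun a => U (π a)) V) = toMap (Bq q) (snoc U V) :=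
      fun π U V => by
        rw [toMap_snoc, toMap_snoc]
        funext σ
        exact sum_congr rfl fun σ' _ => by rw [(hS q hq σ σ').symm]
    have e' : ∀ (U : Fin q → VTP) V, (fun a => cj ((snoc U V : Fin (q + 1) → VTP) a)) =
        snoc (fun a => cj (U a)) (cj V) := fun U V => by
      funext a
      refine lastCases ?_ (fun b => ?_) a <;> simp
    refine eq_zero_of_real_diag (N := VTP →ₗ[ℂ] VTP) ?_ ?_
    · intro π U
      refine LinearMap.ext fun V => ?_
      simp only [MultilinearMap.curryRight_apply, sub_apply, cjConj_apply, e', e]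
      rw [e π fun a => cj (U a)]
    · intro U hU
      refine LinearMap.ext fun V => ?_
      have := hreal U (cj V) hU
      rw [cj_cj] at this
      have e' : (fun a => cj ((update (fun _ => U) (last q) V : Fin (q + 1) → VTP) a)) =
          update (fun _ => U) (last q) (cj V) := by
        funext a
        by_cases ha : a = last q
        · subst ha; simp
        · simp [ha, hU]
      rw [MultilinearMap.curryRight_apply, snoc_const, sub_apply, cjConj_apply, e', this, sub_self]
      rfl
  have h1 := congrArg (fun f => f (init fun a => cj (U a)) (cj (U (last q)))) h0
  simp only [MultilinearMap.curryRight_apply, zero_apply, LinearMap.zero_apply] at h1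
  rw [show (snoc (init fun a => cj (U a)) (cj (U (last q))) : Fin (q + 1) → VTP) =
    fun a => cj (U a) from Fin.snoc_init_self _, sub_apply, cjConj_apply, sub_eq_zero] at h1
  simpa using h1

/-! ### Linear symplecticity -/

theorem norm_at_le {E : Vec} (h : InHV 0 E) (i : Idx) : ‖E.at i‖ ≤ hnormV 0 E := by
  simpa using coef_le h i

theorem pair_bound {V W : Vec} (hV : InHV 1 V) (hW : InHV 0 W) :
    (∀ σ, Summable fun j => V σ j * W σ j.opp) ∧ ‖pair V W‖ ≤ 2 * c₀ * hnormV 1 V * hnormV 0 W := by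
  obtain ⟨h1, h2⟩ := l1_of_inHV (s := 0) (by simpa using hV)
  have e : ∀ i, ‖wseq 0 V i‖ = ‖V.at i‖ := fun i => by rw [norm_wseq, Real.rpow_zero, one_mul]
  simp only [e, zero_add] at h1 h2
  have hs : ∀ σ : Fin 2, Summable fun j : Freq => ‖V σ j‖ := fun σ =>
    h1.comp_injective (i := fun j : Freq => (⟨σ, j⟩ : Idx)) fun a b h => by simpa using h
  have hle : ∀ σ j, ‖V σ j * W σ j.opp‖ ≤ ‖V σ j‖ * hnormV 0 W := fun σ j => by
    rw [norm_mul]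
    exact mul_le_mul_of_nonneg_left (norm_at_le hW ⟨σ, j.opp⟩) (norm_nonneg _)
  refine ⟨fun σ => .of_norm_bounded ((hs σ).mul_right _) (hle σ), ?_⟩
  have : ∀ σ : Fin 2, ‖∑' j, V σ j * W σ j.opp‖ ≤ c₀ * hnormV 1 V * hnormV 0 W := fun σ => by
    refine (tsum_of_norm_bounded ((hs σ).mul_right _).hasSum (hle σ)).trans ?_
    rw [tsum_mul_right]
    refine mul_le_mul_of_nonneg_right (le_trans ?_ h2) (hnormV_nonneg _ _)
    exact tsum_comp_le_tsum_of_inj h1 (fun i => norm_nonneg _)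
      (i := fun j : Freq => (⟨σ, j⟩ : Idx)) fun a b h => by simpa using h
  refine (norm_sum_le _ _).trans ((sum_le_sum fun σ _ => this σ).trans_eq ?_)
  rw [sum_univ_two]
  ring

theorem pair_add_left {V V' W : Vec} (hV : InHV 1 V) (hV' : InHV 1 V') (hW : InHV 0 W) :
    pair (V + V') W = pair V W + pair V' W := by
  rw [pair, pair, pair, ← sum_add_distrib]
  refine sum_congr rfl fun σ _ => ?_
  rw [← ((pair_bound hV hW).1 σ).tsum_add ((pair_bound hV' hW).1 σ)]
  exact tsum_congr fun j => add_mul _ _ _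

theorem pair_add_right {V W W' : Vec} (hV : InHV 1 V) (hW : InHV 0 W) (hW' : InHV 0 W') :
    pair V (W + W') = pair V W + pair V W' := by
  rw [pair, pair, pair, ← sum_add_distrib]
  refine sum_congr rfl fun σ _ => ?_
  rw [← ((pair_bound hV hW).1 σ).tsum_add ((pair_bound hV hW').1 σ)]
  exact tsum_congr fun j => mul_add _ _ _

theorem Ec_add (V W : Vec) : Ec (V + W) = Ec V + Ec W := by
  funext σ j
  fin_cases σ <;> simp [Ec, mul_add]

theorem Ec_bound {s : ℝ} {V : Vec} (hV : InHV s V) : InHV s (Ec V) ∧ hnormV s (Ec V) = hnormV s V := by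
  have h : ∀ (c : ℂ) (u : Coef), ‖c‖ = 1 → hnorm s (fun j => c * u j) = hnorm s u := fun c u hc => by
    simp [hnorm, hc]
  constructor
  · intro σ
    fin_cases σ
    · simpa [InH, Ec] using hV 1
    · simpa [InH, Ec] using hV 0
  · rw [hnormV, hnormV, sum_univ_two, sum_univ_two, add_comm]
    change Real.sqrt (hnorm s (fun j => Complex.I * V 0 j) ^ 2 +
      hnorm s (fun j => -Complex.I * V 1 j) ^ 2) = _
    rw [h _ _ (by simp), h _ _ (by simp)]

theorem Omega_expand {P P' E E' : Vec} (hP : InHV 1 P) (hP' : InHV 1 P') (hE : InHV 1 E)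
    (hE' : InHV 1 E') : ‖Omega (P + E) (P' + E') - Omega P P'‖ ≤
      2 * c₀ * (hnormV 1 P * hnormV 1 E' + hnormV 1 E * hnormV 1 P' +
        hnormV 1 E * hnormV 1 E') := by
  have h0 : ∀ {W : Vec}, InHV 1 W → InHV 0 W := fun h => h.mono zero_le_one
  have hb : ∀ {V W : Vec}, InHV 1 V → InHV 1 W →
      ‖pair (Ec V) W‖ ≤ 2 * c₀ * (hnormV 1 V * hnormV 1 W) := fun hV hW => by
    refine (pair_bound (Ec_bound hV).1 (h0 hW)).2.trans ?_
    rw [(Ec_bound hV).2, ← mul_assoc]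
    exact mul_le_mul_of_nonneg_left (hnormV_mono zero_le_one hW)
      (mul_nonneg (mul_nonneg zero_le_two c₀_nonneg) (hnormV_nonneg _ _))
  have e : Omega (P + E) (P' + E') - Omega P P' =
      pair (Ec P) E' + pair (Ec E) P' + pair (Ec E) E' := by
    rw [Omega, Omega, Ec_add, pair_add_left (Ec_bound hP).1 (Ec_bound hE).1 (h0 (hP'.add hE')),
      pair_add_right (Ec_bound hP).1 (h0 hP') (h0 hE'),
      pair_add_right (Ec_bound hE).1 (h0 hP') (h0 hE')]
    ring
  rw [e, mul_add, mul_add]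
  exact (norm_add₃_le).trans (add_le_add (add_le_add (hb hP hE') (hb hE hP')) (hb hE hE'))

theorem Pn.bounded {f : ℂ → VTP} (hf : f ∈ Pn 0 VTP) (a : ℝ) :
    ∃ C ≥ (0 : ℝ), ∀ᶠ x : ℝ in 𝓝[>] 0, hnormV a (f x).toVec ≤ C := by
  obtain ⟨L, y, -, -, hy⟩ := Pn.normal hf
  refine ⟨∑ k ∈ range L, hnormV a (y k).toVec, sum_nonneg fun _ _ => hnormV_nonneg _ _, ?_⟩
  filter_upwards [Ioo_mem_nhdsGT (zero_lt_one' ℝ)] with x hx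
  rw [hy, show VTP.toVec (∑ k ∈ range L, (x : ℂ) ^ k • y k) =
    ∑ k ∈ range L, (x : ℂ) ^ k • (y k).toVec by
      refine Vec.ext_at fun i => ?_
      rw [Vec.sum_at]
      simp [Vec.at, VTP.toVec]]
  refine (hnormV_sum_le _ fun k _ => (inHV_toVec a (y k)).smul _).trans (sum_le_sum fun k _ => ?_)
  rw [hnormV_smul _ (inHV_toVec a _), norm_pow, Complex.norm_real, Real.norm_of_nonneg hx.1.le]
  exact mul_le_of_le_one_left (hnormV_nonneg _ _) (pow_le_one₀ hx.1.le hx.2.le)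

theorem Pn.om_of_omega {P P' : ℂ → VTP} (hP : P ∈ Pn 0 VTP) (hP' : P' ∈ Pn 0 VTP) {n : ℕ} {c : ℂ}
    {C₁ C₂ C₃ : ℝ} (hC₁ : 0 ≤ C₁) (hC₂ : 0 ≤ C₂) (h : ∀ᶠ x : ℝ in 𝓝[>] 0, ∃ (E F : Vec) (e : ℂ),
      InHV 1 E ∧ InHV 1 F ∧ hnormV 1 E ≤ C₁ * x ^ n ∧ hnormV 1 F ≤ C₂ * x ^ n ∧
      ‖e‖ ≤ C₃ * x ^ n ∧ Omega ((P x).toVec + E) ((P' x).toVec + F) = c + e) :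
    (fun z : ℂ => om (P z) (P' z) - c) ∈ Pn n ℂ := by
  obtain ⟨A₁, hA₁, h₄⟩ := Pn.bounded hP 1
  obtain ⟨A₂, hA₂, h₅⟩ := Pn.bounded hP' 1
  have h0 : (fun z : ℂ => om (P z) (P' z)) ∈ Pn (0 + 0) ℂ := Pn.bilinear om hP hP'
  have h1 : (fun z : ℂ => om (P z) (P' z) - c) ∈ Pn 0 ℂ := Pn.sub h0 (Pn.const c)
  refine Pn.of_small h1 ⟨C₃ + 2 * c₀ * (A₁ * C₂ + C₁ * A₂ + C₁ * C₂), ?_⟩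
  filter_upwards [h, h₄, h₅, Ioo_mem_nhdsGT (zero_lt_one' ℝ)] with x h h₄ h₅ hx
  obtain ⟨E, F, e, hE, hF, hE', hF', he, key⟩ := h
  have hexp := Omega_expand (inHV_toVec 1 (P x)) (inHV_toVec 1 (P' x)) hE hF
  rw [key, omega_toVec] at hexp
  have hx0 : 0 ≤ x ^ n := pow_nonneg hx.1.le _
  have hx1 : x ^ n ≤ 1 := pow_le_one₀ hx.1.le hx.2.le
  have hn : ∀ W : Vec, 0 ≤ hnormV 1 W := hnormV_nonneg 1
  have b1 : hnormV 1 (P x).toVec * hnormV 1 F ≤ A₁ * (C₂ * x ^ n) := mul_le_mul h₄ hF' (hn _) hA₁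
  have b2 : hnormV 1 E * hnormV 1 (P' x).toVec ≤ C₁ * x ^ n * A₂ :=
    mul_le_mul hE' h₅ (hn _) (mul_nonneg hC₁ hx0)
  have b3 : hnormV 1 E * hnormV 1 F ≤ C₁ * x ^ n * C₂ :=
    mul_le_mul hE' (hF'.trans (mul_le_of_le_one_right hC₂ hx1)) (hn _) (mul_nonneg hC₁ hx0)
  have b5 := mul_le_mul_of_nonneg_left (add_le_add (add_le_add b1 b2) b3)
    (mul_nonneg zero_le_two c₀_nonneg)
  rw [show om (P x) (P' x) - c = e - (c + e - om (P x) (P' x)) by ring]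
  refine (norm_sub_le _ _).trans ?_
  have b6 := add_le_add he (hexp.trans b5)
  refine b6.trans_eq ?_
  generalize x ^ n = X
  ring

theorem lin_polyT (hB : IdPlusSigmaS I K J p N r B.app Bq)
    (hL : IsLinSymplecticUpTo I K J N r B) (ht : t ∈ I) : OmInv (N + 1) (polyT p N fun q => toMap (Bq q)).1 := by
  intro U V W
  obtain ⟨m, S, hS, s₀, -, r', hr', -, h⟩ := hL
  obtain ⟨C₁, hC₁, h₁⟩ := app_expand hB 1 U V ht
  obtain ⟨C₂, hC₂, h₂⟩ := app_expand hB 1 U W ht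
  obtain ⟨C₃, hC₃, h₃⟩ := app_small hS 1 U V ht
  refine Pn.om_of_omega (polyT_op_mem U V) (polyT_op_mem U W) hC₁ hC₂
    (C₃ := 2 * c₀ * C₃ * hnormV 0 W.toVec) ?_
  filter_upwards [h₁, h₂, h₃, eventually_inBall (I := I) K s₀ hr' U] with x h₁ h₂ h₃ hb
  obtain ⟨E, hE, hE', e⟩ := h₁
  obtain ⟨F, hF, hF', e'⟩ := h₂
  have key := (h _ hb).2 t ht V.toVec W.toVec (fun s => inHV_toVec s V) fun s => inHV_toVec s W
  rw [e, e', omega_toVec V W] at key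
  refine ⟨E, F, _, hE, hF, hE', hF', ?_, key⟩
  refine (pair_bound h₃.1 (inHV_toVec 0 W)).2.trans ?_
  have := mul_le_mul_of_nonneg_right (mul_le_mul_of_nonneg_left h₃.2
    (mul_nonneg zero_le_two c₀_nonneg)) (hnormV_nonneg 0 W.toVec)
  exact this.trans_eq (by ring)

theorem mem_lowS_highS_kernel {q : ℕ} {A : ML(Fin (q + 1), VTP)}
    (hA : Good A) {c : ℕ} (hk : ∀ (i : Fin (q + 1) → Idx) (k : Idx),
      A (fun a => bas (i a)) k.1 k.2 ≠ 0 →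
        (∀ a : Fin q, (i a.castSucc).2.wt ≤ c * (i (last q)).2.wt) ∧
        (i (last q)).2.wt ≤ c * k.2.wt) :
    (∀ L, ∀ U ∈ lowS L, A (fun _ => U) ∈ lowS ((q + 1) * L)) ∧
    (∀ L, ∀ U ∈ lowS L, ∀ V ∈ highS (c * L), ∀ a : Fin q,
      A (update (fun _ => U) a.castSucc V) = 0) ∧
    ∀ L, ∀ U, ∀ V ∈ highS (c * L), A (update (fun _ => U) (last q) V) ∈ highS L := by
  refine ⟨fun L U hU => ?_, fun L U hU V hV a => ?_, fun L U V hV => ?_⟩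
  · refine mem_of_kernel A (fun _ i => i.2.wt ≤ L) _ (fun i hi => ?_) _ fun _ => hU
    intro k hk'
    have h1 := abs_mom_le i
    rw [← hA.momentum i k hk'] at h1
    have h2 : ∑ a, (i a).2.wt ≤ (q + 1) * L := by
      simpa using sum_le_card_nsmul univ _ L fun a _ => hi a
    have : |k.2.1| = (k.2.wt : ℤ) := by simp [Freq.wt]
    rw [this] at h1
    exact Int.ofNat_le.1 (h1.trans ((Nat.cast_sum _ _).symm.le.trans (Int.ofNat_le.2 h2)))
  · refine eq_zero_of_kernel A (fun b i => if b = a.castSucc then c * L < i.2.wt else i.2.wt ≤ L)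
      (fun i hi => ?_) _ fun b => ?_
    · by_contra h0
      obtain ⟨k, hk'⟩ : ∃ k : Idx, A (fun a => bas (i a)) k.1 k.2 ≠ 0 := by
        by_contra! h
        exact h0 (vtp_ext fun k => by rw [h k]; rfl)
      have h1 := (hk i k hk').1 a
      have h2 := hi a.castSucc
      have h3 := hi (last q)
      rw [if_pos rfl] at h2
      rw [if_neg (castSucc_lt_last a).ne'] at h3
      exact absurd (h1.trans (Nat.mul_le_mul_left c h3)) (not_le.2 h2)
    · by_cases h : b = a.castSucc
      · subst h; simpa using (show V ∈ supS _ from hV)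
      · simpa [h] using (show U ∈ supS _ from hU)
  · refine mem_of_kernel A (fun b i => b = last q → c * L < i.2.wt) (highS L) (fun i hi => ?_) _
      fun b => ?_
    · intro k hk'
      exact lt_of_mul_lt_mul_left ((hi _ rfl).trans_le (hk i k hk').2) (Nat.zero_le c)
    · by_cases h : b = last q
      · subst h; simpa using (show V ∈ supS _ from hV)
      · exact fun i _ h' => absurd h' h

theorem paraLin_polyT (hp : 1 ≤ p) (hA : ∀ q ∈ Icc p N, Good (A q))
    (hk : ∀ q ∈ Icc p N, ∃ c : ℕ, ∀ (i : Fin (q + 1) → Idx) (k : Idx),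
      A q (fun a => bas (i a)) k.1 k.2 ≠ 0 →
        (∀ a : Fin q, (i a.castSucc).2.wt ≤ c * (i (last q)).2.wt) ∧
        (i (last q)).2.wt ≤ c * k.2.wt)
    (hlin : OmInv (N + 1) (polyT p N A).1) : ParaLin N (polyT p N A) := by
  have h : ∃ c : ℕ, 1 ≤ c ∧ ∀ q ∈ Icc p N, ∀ (i : Fin (q + 1) → Idx) (k : Idx),
      A q (fun a => bas (i a)) k.1 k.2 ≠ 0 →
        (∀ a : Fin q, (i a.castSucc).2.wt ≤ c * (i (last q)).2.wt) ∧
        (i (last q)).2.wt ≤ c * k.2.wt := by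
    choose! c hc using hk
    refine ⟨(Icc p N).sup c + 1, Nat.le_add_left _ _, fun q hq i k h => ?_⟩
    have hle : c q ≤ (Icc p N).sup c + 1 := (le_sup hq).trans (Nat.le_succ _)
    exact ⟨fun a => ((hc q hq i k h).1 a).trans (Nat.mul_le_mul_right _ hle),
      ((hc q hq i k h).2).trans (Nat.mul_le_mul_right _ hle)⟩
  obtain ⟨c, hc1, hc⟩ := h
  have key := fun q hq => mem_lowS_highS_kernel (hA q hq) (hc q hq)
  refine ⟨polyT_mem hA, ordT_polyT.mono hp, ⟨N + 1, fun L U hU => ?_⟩, ⟨c, fun L U hU V hV => ?_⟩,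
    ⟨c, fun L U V hV => ?_⟩, hlin⟩
  · rw [polyT_val]
    refine add_mem (lowS_mono (Nat.le_mul_of_pos_left L (Nat.succ_pos N)) hU)
      (sum_mem fun q hq => lowS_mono ?_ ((key q hq).1 L U hU))
    exact Nat.mul_le_mul_right L (Nat.succ_le_succ (mem_Icc.1 hq).2)
  · rw [polyT_der, polyT_op]
    congr 1
    refine sum_congr rfl fun q hq => ?_
    rw [Fin.sum_univ_castSucc, sum_eq_zero fun a _ => (key q hq).2.1 L U hU V hV a, zero_add]
  · rw [polyT_op]
    exact add_mem (highS_anti (Nat.le_mul_of_pos_left L hc1) hV)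
      (sum_mem fun q hq => (key q hq).2.2 L U V hV)

end

section

variable {p N q : ℕ}

/-! ### Symmetrization in all slots but the final one -/

/-- The average of `A` over the permutations of all its arguments but the last. -/
def symF (A : ML(Fin (q + 1), VTP)) : ML(Fin (q + 1), VTP) :=
  (((Fintype.card (Equiv.Perm (Fin q)) : ℝ)⁻¹ : ℝ) : ℂ) •
    ∑ π : Equiv.Perm (Fin q), A.domDomCongr (extendPerm π)

theorem symF_snoc (A : ML(Fin (q + 1), VTP)) (π : Equiv.Perm (Fin q)) (U : Fin q → VTP) (V : VTP) :
    symF A (snoc (fun a => U (π a)) V) = symF A (snoc U V) := by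
  have e : ∀ U : Fin q → VTP, symF A (snoc U V) =
      (((Fintype.card (Equiv.Perm (Fin q)) : ℝ)⁻¹ : ℝ) : ℂ) •
        ∑ π : Equiv.Perm (Fin q), A (snoc (fun a => U (π a)) V) := fun U => by
    simp only [symF, smul_apply, sum_apply, MultilinearMap.domDomCongr_apply, extendPerm_snoc]
  rw [e, e]
  congr 1
  exact Fintype.sum_equiv (Equiv.mulLeft π) _ _ fun _ => rfl

theorem tri_symF (A : ML(Fin (q + 1), VTP)) : tri (last q) (symF A) = tri (last q) A := by
  have h : ∀ π : Equiv.Perm (Fin q),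
      tri (last q) (A.domDomCongr (extendPerm π)) = tri (last q) A := fun π => by
    have := tri_domDomCongr (extendPerm π) (last q) A
    rwa [show extendPerm π (last q) = last q by simp [extendPerm]] at this
  have hs : ∀ (c : ℂ) (B : ML(Fin (q + 1), VTP)),
      tri (last q) (c • B) = c • tri (last q) B := fun c B => by
    refine Prod.ext rfl (Prod.ext rfl ?_)
    funext U V
    exact (smul_sum (r := c) (f := fun a => B (update (fun _ => U) a V)) (s := univ)).symm
  rw [symF, hs, map_sum, sum_congr rfl fun π _ => h π, sum_const, card_univ,
    ← Nat.cast_smul_eq_nsmul ℂ, smul_smul, Complex.ofReal_inv, Complex.ofReal_natCast,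
    inv_mul_cancel₀ (Nat.cast_ne_zero.2 Fintype.card_ne_zero), one_smul]

theorem Good.symF {A : ML(Fin (q + 1), VTP)} (hA : Good A) :
    Good (symF A) := Good.smul _ (Good.sum _ _ fun _ _ => hA.domDomCongr _)

/-! ### The corrected map -/

theorem ordT_subst {b : Tri VTP} (hord : OrdT 1 (b - idT)) (A : ML(Fin (q + 1), VTP)) :
    OrdT q (subst A (last q) fun _ => b) := by
  have hv : ∀ U, (fun z : ℂ => b.2.1 (z • U)) ∈ Pn 1 VTP := fun U =>
    Pn.of_sub (hord.val_sub U) one_le_two (linear_mem U)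
  have hu : ∀ (U V : VTP) a (v : ℂ → VTP), (fun z => v z - V) ∈ Pn 1 VTP →
      (fun z : ℂ => A (update (fun _ => b.2.1 (z • U)) a (v z))) ∈ Pn q VTP :=
    fun U V a v h => Pn.of_sub (subst_sub_mem A hord U a v V h) (Nat.le_succ q)
      (Pn.monomial q le_rfl _)
  refine fun U V => ⟨hu U V _ _ (hord.op_sub U V), ?_, Pn.sum univ (fun a z =>
    A (update (fun _ => b.2.1 (z • U)) a (b.2.2 (z • U) V)))
    fun a _ => hu U V a _ (hord.der_sub U V)⟩
  have := Pn.multilinear A (fun _ => 1) (fun _ z => b.2.1 (z • U)) fun _ => hv U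
  rw [sum_const, card_univ, Fintype.card_fin, smul_eq_mul, mul_one] at this
  exact this

theorem om_sub_mem {n : ℕ} {f g f' g' : ℂ → VTP} {c : ℂ} (hf : f ∈ Pn 0 VTP) (hg : g ∈ Pn 0 VTP)
    (hf' : (fun z => f z - f' z) ∈ Pn n VTP) (hg' : (fun z => g z - g' z) ∈ Pn n VTP)
    (h : (fun z => om (f z) (g z) - c) ∈ Pn n ℂ) : (fun z => om (f' z) (g' z) - c) ∈ Pn n ℂ := by
  have hg0 : g' ∈ Pn 0 VTP := by
    have := Pn.sub hg (Pn.mono (Nat.zero_le n) hg')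
    simpa using this
  have h1 : (fun z => om (f z - f' z) (g' z)) ∈ Pn (n + 0) ℂ := Pn.bilinear om hf' hg0
  have h2 : (fun z => om (f z) (g z - g' z)) ∈ Pn (0 + n) ℂ := Pn.bilinear om hf hg'
  rw [zero_add] at h2
  have := Pn.sub (Pn.sub h h1) h2
  refine (congrArg (· ∈ Pn n ℂ) (funext fun z => ?_)).mp this
  simp only [map_sub, LinearMap.sub_apply]
  ring

theorem exists_corrected_expansion (hp : 1 ≤ p) (hpN : p ≤ N) {b : Tri VTP} (hb : ParaLin N b)
    (hord : OrdT p (b - idT)) :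
    ∃ R : ∀ q, ML(Fin (q + 1), VTP), (∀ q, Good (R q) ∧ IsSymm (R q) ∧ Balanced (R q)) ∧
    ∃ (M : ℕ) (A : ∀ q, ML(Fin (q + 1), VTP)), (∀ q, Good (A q)) ∧
      (∀ q (π : Equiv.Perm (Fin q)) U V, A q (snoc (fun a => U (π a)) V) = A q (snoc U V)) ∧
      (∀ U V, b.1 U V + ∑ q ∈ Icc p N, R q (update (fun _ => b.2.1 U) (last q) (b.1 U V)) =
        V + ∑ q ∈ Icc p M, A q (update (fun _ => U) (last q) V)) ∧
      N ≤ M ∧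
      OmInv (N + 1) (polyT p N A).2.2 := by
  obtain ⟨R, hR, hC⟩ := exists_symplectic_correction hp hb hord
  have hd := hC (N + 1) (by omega) le_rfl
  set d := b + ∑ q ∈ Ico p (N + 1), subst (R q) (last q) fun _ => b with hdef
  have hdo : OrdT p (d - idT) := by
    rw [hdef, add_sub_right_comm]
    exact hord.add (OrdT.sum _ _ fun q hq =>
      (ordT_subst (hord.mono hp) (R q)).mono (Finset.mem_Ico.1 hq).1)
  obtain ⟨M, A, hA, hM, hlt, -, hsum⟩ := Poly.normal (Poly.sub hd.poly idT_mem)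
    (n := p) fun U => (hdo U 0).2.1
  have hsum := hsum fun U V => (hdo U V).1
  have hsum' : d = polyT p (M + N) fun q => symF (A q) := by
    rw [← sub_add_cancel d idT, hsum, polyT, add_comm]
    congr 1
    simp only [tri_symF]
    refine Finset.sum_congr_of_eq_on_inter (fun q hq hq' => ?_) (fun q hq hq' => ?_)
      fun _ _ _ => rfl
    · rw [hlt q (by simp only [mem_range, mem_Icc] at hq hq'; omega), map_zero]
    · rw [hM q (by simp only [mem_range, mem_Icc] at hq hq'; omega), map_zero]
  refine ⟨R, hR, M + N, fun q => symF (A q), fun q => (hA q).symF, fun q => symF_snoc _, ?_,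
    Nat.le_add_left _ _, ?_⟩
  · intro U V
    have e := polyT_op (p := p) (N := M + N) (A := fun q => symF (A q)) U V
    rw [← hsum', hdef] at e
    refine Eq.trans ?_ e
    change _ = b.1 U V + (∑ q ∈ Ico p (N + 1), subst (R q) (last q) fun _ => b).1 U V
    rw [Poly.sum_op]
    rfl
  · intro U V W
    have ho : OrdT (N + 1) (d - polyT p N fun q => symF (A q) : Tri VTP) := by
      rw [hsum', polyT, polyT, add_sub_add_left_eq_sub,
        ← sum_sdiff (Finset.Icc_subset_Icc_right (Nat.le_add_left N M)), add_sub_cancel_right]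
      refine OrdT.sum _ _ fun q hq => (ordT_tri _).mono ?_
      simp only [Finset.mem_sdiff, mem_Icc] at hq
      omega
    have h0 : ∀ V, (fun z : ℂ => d.2.2 (z • U) V) ∈ Pn 0 VTP := fun V =>
      Pn.of_sub ((hd.ord).der_sub U V) (Nat.zero_le 1) (Pn.const V)
    exact om_sub_mem (h0 V) (h0 W) (ho U V).2.2 (ho U W).2.2 (hd.sym U V W)

end

section

variable {I : Set ℝ} [TimeInterval I] {K J p N : ℕ} {r : ℝ} {B : NHMat} {Bq : ∀ q, HomMat q}
  {A R : ∀ q, ML(Fin (q + 1), VTP)}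

/-! ### Pluri-homogeneous maps on Sobolev spaces -/

/-- The extension of `(polyT p N A).1`. -/
def polyV (p N : ℕ) (A : ∀ q, ML(Fin (q + 1), VTP)) (U V : Vec) : Vec :=
  V + ∑ q ∈ Icc p N, ext (A q) fun a => if a = last q then V else U

theorem update_last_eq {q : ℕ} {X : Type*} (U V : X) :
    (update (fun _ => U) (last q) V : Fin (q + 1) → X) =
      fun a => if a = last q then V else U := update_const_apply id U V _

theorem extends_ite {q : ℕ} {f : VTP → VTP → VTP} {F : Vec → Vec → Vec} (h : Extends f F)
    (h' : Extends (fun U _ => f U U) fun U _ => F U U) (a : Fin (q + 1)) :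
    Extends (fun U V => f U (if a = last q then V else U))
      fun U V => F U (if a = last q then V else U) := by
  by_cases ha : a = last q
  · simpa [ha] using h
  · simpa [ha] using h'

theorem extends_polyV (hA : ∀ q ∈ Icc p N, Good (A q)) :
    Extends (fun U V => (polyT p N A).1 U V) (polyV p N A) ∧
      Extends (fun U _ => (polyT p N A).1 U U) fun U _ => polyV p N A U U := by
  simp only [polyT_op, update_last_eq, polyV]
  constructor
  · exact Extends.snd.add (Extends.sum _ fun q hq => Extends.ext (hA q hq) fun a =>
      extends_ite (f := fun _ V => V) (F := fun _ V => V) Extends.snd Extends.fst a)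
  · simp only [ite_self]
    exact Extends.fst.add (Extends.sum _ fun q hq => Extends.ext (hA q hq) fun a => Extends.fst)

theorem polyT_val_eq (U : VTP) : (polyT p N A).2.1 U = (polyT p N A).1 U U := by
  rw [polyT_val, polyT_op]
  simp only [update_eq_self]

theorem eval_eq_ext (M : ∀ q, HomMat q) (h : ∀ q ∈ Icc p N, Good (toMap (M q))) :
    ∀ᶠ L in atTop, ∀ q ∈ Icc p N, ∀ U V, InHV L U → InHV L V →
      (M q).eval U V = ext (toMap (M q)) fun a => if a = last q then V else U := by
  refine (eventually_all_finset _).2 fun q hq => ?_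
  obtain ⟨C, -, S, -, hN⟩ := (h q hq).exists_nb
  filter_upwards [eventually_ge_atTop (S + 1)] with L hL U V hU hV
  rw [HomMat.eval_eq _ hN (hU.mono hL) (hV.mono hL), update_last_eq]

theorem app_agree (hJ : J ≤ K)
    (hB : IdPlusSigmaS I K J p N r B.app Bq) (hg : ∀ q ∈ Icc p N, Good (toMap (Bq q))) :
    ∃ E, Cls I K J (K - J) (N + 1) E ∧
      AgreeOn I K B.app fun U t V => polyV p N (fun q => toMap (Bq q)) (U t) V + E U t V := by
  obtain ⟨m, hm, -, G, hG, s₀, -, r', hr', -, h⟩ := hB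
  refine ⟨_, cls_of_isM hJ hm fun σ σ' => (hG σ σ').isM, germ_iff.2 ?_⟩
  filter_upwards [eval_eq_ext Bq hg, eventually_ge_atTop s₀] with L hL hs
  filter_upwards [small_mono hs ⟨r', hr', fun _ h => h⟩, small_inC] with U hb hU t ht V hV
  rw [h U hb t ht V (hV.mono hs), polyV]
  congr 2
  exact sum_congr rfl fun q hq => hL q hq _ _ (hU.inHV ht) hV

theorem cls_polyV (hJ : J ≤ K) (hA : ∀ q ∈ Icc p N, Good (A q)) :
    Cls I K J (K - J) 0 fun U t V => polyV p N A (U t) V := by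
  have h : ∀ q ∈ Icc p N, Cls I K J (K - J) 0 fun U t V =>
      ext (A q) fun a => if a = last q then V else U t := fun q hq =>
    Cls.ext_slots (by omega) (hA q hq) (last q) (P := fun _ => 0)
      (X := fun _ _ _ V => V) (fun _ => Cls.id) (by simp)
  exact Cls.add Cls.id (Cls.sum (Icc p N) h)

theorem corrected_agree (hJ : J ≤ K)
    (hB : IdPlusSigmaS I K J p N r B.app Bq) (hg : ∀ q ∈ Icc p N, Good (toMap (Bq q)))
    (hR : ∀ q, Good (R q)) (hA : ∀ q, Good (A q)) {M : ℕ} (hM : N ≤ M)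
    (he : ∀ U V, (polyT p N fun q => toMap (Bq q)).1 U V + ∑ q ∈ Icc p N,
        R q (update (fun _ => (polyT p N fun q => toMap (Bq q)).2.1 U) (last q)
          ((polyT p N fun q => toMap (Bq q)).1 U V)) =
      V + ∑ q ∈ Icc p M, A q (update (fun _ => U) (last q) V)) :
    ∃ G, Cls I K J (K - J) (N + 1) G ∧
      AgreeOn I K (corrected p N (fun q => toMat (R q)) B) fun U t V =>
        polyV p N A (U t) V + G U t V := by
  obtain ⟨E, hE, h₁⟩ := app_agree hJ hB hg
  set F := polyV p N fun q => toMap (Bq q) with hFdef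
  have hF : Cls I K J (K - J) 0 fun U t V => F (U t) V := cls_polyV hJ hg
  have hL₁ : ∀ᶠ L in atTop, ∀ U V, InHV L U → InHV L V →
      F U V + ∑ q ∈ Icc p N, ext (R q) (fun a => F U (if a = last q then V else U)) =
        polyV p M A U V := by
    obtain ⟨e1, e2⟩ := extends_polyV hg
    refine Extends.eq (f := fun U V => (polyT p M A).1 U V) ?_ (extends_polyV fun q _ => hA q).1
    have := e1.add (Extends.sum (Icc p N) fun q _ => Extends.ext (hR q) (extends_ite e1 e2))
    refine (congrArg (Extends · _) (funext₂ fun U V => ?_)).mp this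
    rw [polyT_op (N := M) (A := A), ← he, polyT_val_eq]
    congr 1
    refine sum_congr rfl fun q _ => ?_
    rw [update_const_apply]
  obtain ⟨L, hL⟩ := (eval_eq_ext (p := p) (N := N) (fun q => toMat (R q)) fun q _ => by
    rw [toMap_toMat]; exact hR q).exists
  simp only [toMap_toMat] at hL
  have hG := (hE.add (Cls.sum (Icc p N) fun q _ =>
    Cls.ext_add_sub (by omega) (hR q) (last q) hF hE)).add
    (Cls.sum (Icc p M \ Icc p N) fun q hq => Cls.ext_slots (by omega) (hA q)
      (last q) (p := N + 1) (P := fun _ => 0) (X := fun _ _ _ V => V) (fun _ => Cls.id) (by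
        simp only [Finset.mem_sdiff, mem_Icc] at hq
        simp
        omega))
  refine ⟨_, hG, ?_⟩
  filter_upwards [h₁, (hF.add (hE.mono_p (by omega) (Nat.zero_le _))).inHV L, germ_fst hL₁,
    germ_inHV] with ⟨s, U⟩ h₁ h₂ h₃ hU t ht V hV
  have hUt := hU t ht
  have key := h₃ (U t) V hUt hV
  have hsplit : polyV p M A (U t) V = polyV p N A (U t) V +
      ∑ q ∈ Icc p M \ Icc p N, ext (A q) fun a => if a = last q then V else U t := by
    rw [polyV, polyV, ← sum_sdiff (Finset.Icc_subset_Icc_right hM), add_assoc,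
      add_comm (∑ q ∈ Icc p M \ Icc p N, _)]
  rw [hsplit] at key
  rw [corrected, h₁ t ht _ hUt, h₁ t ht _ hV, sum_congr rfl fun q hq =>
    hL q hq _ _ (h₂ t ht _ hUt) (h₂ t ht _ hV), sum_sub_distrib]
  have hfun : ∀ q, (fun a : Fin (q + 1) => if a = last q then F (U t) V + E U t V else
      F (U t) (U t) + E U t (U t)) = fun a => F (U t) (if a = last q then V else U t) +
        E U t (if a = last q then V else U t) := fun q => by
    funext a; split_ifs <;> rfl
  simp only [hfun]
  rw [← sub_eq_zero] at key ⊢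
  rw [← key]
  abel

/-! ### Symplecticity of the corrected map -/

theorem dPluri_toMat (U V : VTP) :
    dPluri p N (fun q => toMat (A q)) U V = (polyT p N A).2.2 U V := by
  rw [dPluri, polyT_der]
  congr 1
  refine sum_congr rfl fun q _ => ?_
  rw [HomMat.dApp, Fin.sum_univ_castSucc, toMat_app, snoc_const, add_comm]
  congr 1
  refine sum_congr rfl fun a _ => ?_
  rw [toMat_app, snoc_update_const, update_eq_self]

theorem exists_twoForms (hA : ∀ q, Good (A q)) (hsym : OmInv (N + 1) (polyT p N A).2.2) :
    ∃ (L : ℕ) (Λ : ∀ q, KForm q 2), (∀ q ∈ Icc (N + 1) L, IsForm (Λ q)) ∧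
      ∀ U V W : VTP, Omega (dPluri p N (fun q => toMat (A q)) U V).toVec
          (dPluri p N (fun q => toMat (A q)) U W).toVec =
        Omega V.toVec W.toVec + ∑ q ∈ Icc (N + 1) L, Λ q (fun _ => U) ![V, W] := by
  obtain ⟨M, T, hT, hM, h⟩ := om_pullback_scaled (polyT_mem (p := p) (N := N) fun q _ => hA q)
  choose Λ hΛ hv using fun k => exists_twoForm (hT k)
  refine ⟨M, Λ, fun q _ => hΛ q, fun U V W => ?_⟩
  simp only [dPluri_toMat, omega_toVec, hv]
  let y : ℕ → ℂ := fun k => d2 (last (k + 1)) (T k) U V W - if k = 0 then om V W else 0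
  have hy : ∀ z : ℂ, om ((polyT p N A).2.2 (z • U) V) ((polyT p N A).2.2 (z • U) W) - om V W =
      ∑ k ∈ range (M + 1), z ^ k • y k := fun z => by
    simp only [h, y, smul_sub, sum_sub_distrib]
    rw [sum_range_succ, hM M le_rfl, map_zero]
    simp
  have h0 := Pn.coeff_eq_zero (n := N + 1) (L := M + 1) (y := y) (by
    rw [← funext hy]; exact hsym U V W)
  have h1 := hy 1
  simp only [one_smul, one_pow] at h1
  rw [← sub_eq_iff_eq_add', h1]
  refine (Finset.sum_subset_zero_on_sdiff (fun k hk => ?_) (fun k hk => ?_) fun k hk => ?_).symm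
  · exact mem_range.2 (Nat.lt_succ_of_le (mem_Icc.1 hk).2)
  · simp only [Finset.mem_sdiff, mem_range, mem_Icc] at hk
    exact h0 k hk.1 (by omega)
  · have : k ≠ 0 := by have := (mem_Icc.1 hk).1; omega
    simp [y, this]

theorem isSymplecticUpTo_corrected (hr : 0 < r) (hA : ∀ q, Good (A q))
    (hs : ∀ q (π : Equiv.Perm (Fin q)) U V, A q (snoc (fun a => U (π a)) V) = A q (snoc U V))
    (hsym : OmInv (N + 1) (polyT p N A).2.2) {F G : Op} (hG : Cls I K J (K - J) (N + 1) G)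
    (hF : AgreeOn I K F fun U t V => polyV p N A (U t) V + G U t V) :
    IsSymplecticUpTo I K J p N r F := by
  obtain ⟨m, ⟨⟨M, hM, h₁⟩, hm₀⟩, hm⟩ := (((hG.exists_mat (Nat.succ_ne_zero N) hr).and
    ((eventually_all_finset (Icc p N)).2 fun q _ => (hA q).isHomM (hs q))).and
      (eventually_ge_atTop 0)).exists
  obtain ⟨c, ⟨⟨ρ, hρ, h⟩, hL⟩, hc⟩ := (((germ_iff.1 (h₁.and hF)).and
    (eval_eq_ext (p := p) (N := N) (fun q => toMat (A q)) fun q _ => by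
      rw [toMap_toMat]; exact hA q)).and (eventually_gt_atTop 0)).exists
  simp only [toMap_toMat] at hL
  refine ⟨fun q => toMat (A q), ⟨m, hm, hm₀, M, hM, c, hc, min r ρ, lt_min hr hρ, min_le_left _ _,
    fun U ⟨hU, x, hx, hb⟩ t ht V hV => ?_⟩, exists_twoForms hA hsym⟩
  obtain ⟨h₁, h₂⟩ := h U ⟨hU, x, hx.trans_le (min_le_right _ _), hb⟩
  rw [h₂ t ht V hV, h₁ t ht V hV]
  simp only [polyV]
  congr 2
  exact sum_congr rfl fun q hq => (hL q hq _ _ (hU.inHV ht) hV).symm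

end

section

variable {I : Set ℝ} [TimeInterval I] {K J n p q N : ℕ} {w w' : (ℝ → Vec) → ℝ → Vec}
  {A : ∀ q, ML(Fin (q + 1), VTP)}

theorem PathOK.germ {K₁ : ℕ} (hK₁ : K₁ ≤ K) {Z : (ℝ → Vec) → ℝ → Vec} (hZ : PathOK I K K₁ Z)
    {P : ℝ × (ℝ → Vec) → Prop} (h : ∀ᶠ x in germ I K₁, P x) : ∀ᶠ x in germ I K, P (x.1, Z x.2) := by
  refine germ_iff.2 ?_
  filter_upwards [germ_iff.1 h, hZ.tendsto hK₁] with s h hT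
  exact hT.eventually h

theorem Rem.ext_add_sub {α : Type*} [Fintype α] [DecidableEq α] [Nonempty α] (hK : J + n ≤ K)
    {A : ML(α, VTP)} (hA : Good A) (hw : Rem I K J n 0 w)
    (hw' : Rem I K J n p w') : Rem I K J n p fun U t =>
      PluriHom.ext A (fun _ => w U t + w' U t) - PluriHom.ext A fun _ => w U t := by
  obtain ⟨F, hF, e⟩ := hw
  obtain ⟨E, hE, e'⟩ := hw'
  refine (Cls.ext_add_sub hK hA (Classical.arbitrary α) hF hE).rem.congr ?_
  filter_upwards [e, e'] with x e e' t ht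
  simp only [ite_self, e t ht, e' t ht]

/-! ### The derivative of a pluri-homogeneous map -/

/-- The extension of `(polyT p N A).2.2`. -/
def polyD (p N : ℕ) (A : ∀ q, ML(Fin (q + 1), VTP)) (U V : Vec) : Vec :=
  V + ∑ q ∈ Icc p N, ∑ a, ext (A q) fun b => if b = a then V else U

theorem polyD_add (hA : ∀ q, Good (A q)) : ∀ᶠ L in atTop, ∀ U V W, InHV L U → InHV L V →
    InHV L W → polyD p N A U (V + W) = polyD p N A U V + polyD p N A U W := by
  choose C hC S hS hN using fun q => (hA q).exists_nb
  filter_upwards [(eventually_all_finset (Icc p N)).2 fun q _ => eventually_ge_atTop (S q + 1)]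
    with L hL U V W hU hV hW
  have h : ∀ q ∈ Icc p N, ∀ a : Fin (q + 1), ext (A q) (fun b => if b = a then V + W else U) =
      ext (A q) (fun b => if b = a then V else U) + ext (A q) fun b => if b = a then W else U := by
    refine fun q hq a => Vec.ext_at fun k => ?_
    have e : ∀ X : Vec, (fun b => if b = a then X else U) = update (fun _ => U) a X :=
      fun X => (update_const_apply id U X a).symm
    rw [e, e, e]
    have := hL q hq
    exact extS_update_add ((hN q).kb k) (fun _ => hU.mono this) a (hV.mono this) (hW.mono this)
  rw [polyD, sum_congr rfl fun q hq => sum_congr rfl fun a _ => h q hq a]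
  simp only [sum_add_distrib, polyD]
  abel

theorem extends_polyD (hA : ∀ q, Good (A q)) {f : VTP → VTP → VTP} {F : Vec → Vec → Vec}
    (h : Extends f F) : Extends (fun U V => (polyT p N A).2.2 U (f U V))
      fun U V => polyD p N A U (F U V) := by
  simp only [polyT_der, polyD]
  refine h.add (Extends.sum _ fun q _ => Extends.sum _ fun a _ => ?_)
  have e : ∀ U V : VTP, update (fun _ => U) a V = fun b => if b = a then V else U :=
    fun U V => update_const_apply id U V a
  simp only [e]
  refine Extends.ext (hA q) fun b => ?_
  by_cases hb : b = a
  · simpa [hb] using h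
  · simpa [hb] using Extends.fst

/-- The extension of `(fieldT (N + 1) H).2.1`. -/
def fieldV (N : ℕ) (H : ∀ k, ML(Fin (k + 2), ℂ)) (U : Vec) : Vec :=
  ∑ k ∈ range (N + 1), ext (hamMap (H k)) fun _ => U

theorem extends_fieldV {H : ∀ k, ML(Fin (k + 2), ℂ)}
    (hH : ∀ k, Good (H k)) {f : VTP → VTP → VTP} {F : Vec → Vec → Vec} (h : Extends f F) :
    Extends (fun U V => (fieldT (N + 1) H).2.1 (f U V)) fun U V => fieldV N H (F U V) := by
  have e : ∀ U, (fieldT (N + 1) H).2.1 U = ∑ k ∈ range (N + 1), hamMap (H k) fun _ => U :=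
    fun U => Poly.sum_val _ _ U
  simp only [e, fieldV]
  exact Extends.sum _ fun k _ => Extends.ext (good_hamMap (hH k)) fun _ => h

theorem exists_transported_fieldV (hp : 1 ≤ p) (hA : ∀ q, Good (A q))
    (hsym : OmInv (N + 1) (polyT p N A).2.2)
    {H : ∀ k, ML(Fin (k + 2), ℂ)}
    (hH : ∀ k, Good (H k)) (hs : ∀ k, IsSymm (H k)) :
    ∃ H' : ∀ k, ML(Fin (k + 2), ℂ), (∀ k, Good (H' k)) ∧ (∀ k, IsSymm (H' k)) ∧
      ∃ (M : ℕ) (P : ∀ k, ML(Fin (k + 1), VTP)),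
        (∀ k, Good (P k)) ∧ ∀ᶠ L in atTop, ∀ U, InHV L U → polyD p N A U (fieldV N H U) =
          fieldV N H' (polyV p N A U U) + ∑ k ∈ Ico (N + 1) M, ext (P k) fun _ => U := by
  obtain ⟨H', hH', hs', M, P, hP, h⟩ := transported_field (n := N + 1)
    (polyT_mem (p := p) (N := N) fun q _ => hA q) (ordT_polyT.mono hp) hsym hH hs
  refine ⟨H', hH', hs', M, P, hP, ?_⟩
  refine ((extends_polyD (p := p) (N := N) hA (extends_fieldV (N := N) hH Extends.fst)).eq
    (F' := fun U _ => fieldV N H' (polyV p N A U U) + ∑ k ∈ Ico (N + 1) M, ext (P k) fun _ => U) (by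
      have := (extends_fieldV (N := N) hH' (extends_polyV (p := p) (N := N) fun q _ => hA q).2).add
        (Extends.sum (Ico (N + 1) M) fun k _ => Extends.ext (hP k) fun _ => Extends.fst)
      refine (congrArg (Extends · _) (funext₂ fun U V => ?_)).mp this
      rw [← h, polyT_val_eq]
      abel)).mono fun L hL U hU => hL U U hU hU

theorem fieldV_rem (hK : J + n ≤ K)
    {H : ∀ k, ML(Fin (k + 2), ℂ)} (hH : ∀ k, Good (H k)) (N : ℕ)
    (h : Rem I K J n 0 w) : Rem I K J n 0 fun U t => fieldV N H (w U t) :=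
  Rem.sum _ fun k _ => Rem.ext hK (good_hamMap (hH k)) (P := fun _ => 0) (fun _ => h) (by simp)

theorem fieldV_sub_rem (hK : J + n ≤ K)
    {H : ∀ k, ML(Fin (k + 2), ℂ)} (hH : ∀ k, Good (H k)) (N : ℕ)
    (h : Rem I K J n 0 w) (h' : Rem I K J n p w') :
    Rem I K J n p fun U t => fieldV N H (w U t + w' U t) - fieldV N H (w U t) := by
  simp only [fieldV, ← sum_sub_distrib]
  exact Rem.sum _ fun k _ => Rem.ext_add_sub hK (good_hamMap (hH k)) h h'

theorem polyD_rem (hK : J + n ≤ K) {m : ℕ}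
    (hA : ∀ q, Good (A q)) (h : Rem I K J n 0 w) (h' : Rem I K J n m w') :
    Rem I K J n m fun U t => polyD p N A (w U t) (w' U t) := by
  refine h'.add (Rem.sum _ fun q _ => Rem.sum _ fun a _ => ?_)
  refine Rem.ext hK (hA q) (w := fun b U t => if b = a then w' U t else w U t)
    (P := fun b => if b = a then m else 0) (fun b => ?_) (by simp)
  by_cases hb : b = a
  · simpa [hb] using h'
  · simpa [hb] using h

end

section

variable {I : Set ℝ} [TimeInterval I] {K K' K₁ J₁ n p q N : ℕ} {r : ℝ}
  {A : ∀ q, ML(Fin (q + 1), VTP)}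

/-! ### The transformed system -/

/-- The Hamiltonian with given homogeneous components of degree at least `2`. -/
def hamOf (H : ∀ k, ML(Fin (k + 2), ℂ)) : ∀ q, KForm q 0
  | 0 => 0
  | 1 => 0
  | k + 2 => fromScal (H k)

theorem isForm_hamOf {H : ∀ k, ML(Fin (k + 2), ℂ)}
    (hH : ∀ k, Good (H k)) {q : ℕ} (hq : 2 ≤ q) : IsForm (hamOf H q) := by
  obtain ⟨k, rfl⟩ := Nat.exists_eq_add_of_le' hq
  exact isForm_altForm ((hH k).domDomCongr _)

theorem exists_hamField_eq {H : ∀ q, KForm q 0} (hH : ∀ q ∈ Icc 2 (N + 2), IsForm (H q)) :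
    ∃ H₀ : ∀ k, ML(Fin (k + 2), ℂ), (∀ k, Good (H₀ k)) ∧
      (∀ k, IsSymm (H₀ k)) ∧ ∀ᶠ L in atTop, ∀ U, InHV L U → hamField N H U = fieldV N H₀ U := by
  have h : ∀ k, k < N + 1 → IsForm (H (k + 2)) := fun k hk => hH _ (mem_Icc.2 (by omega))
  refine ⟨fun k => if k < N + 1 then toScal (H (k + 2)) else 0, fun k => ?_, fun k => ?_,
    (hamField_eq hH).mono fun L hL U hU => ?_⟩
  · beta_reduce
    split_ifs with hk
    exacts [(h k hk).good, Good.zero]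
  · beta_reduce
    split_ifs with hk
    exacts [(h k hk).isSymm, fun _ _ => rfl]
  · rw [hL U hU, fieldV]
    exact sum_congr rfl fun k hk => by rw [if_pos (mem_range.1 hk)]

theorem hamField_hamOf {H : ∀ k, ML(Fin (k + 2), ℂ)}
    (hH : ∀ k, Good (H k)) (hs : ∀ k, IsSymm (H k)) :
    ∀ᶠ L in atTop, ∀ U, InHV L U → hamField N (hamOf H) U = fieldV N H U := by
  refine (hamField_eq (N := N) (H := hamOf H) fun q hq => isForm_hamOf hH (mem_Icc.1 hq).1).mono
    fun L hL U hU => (hL U hU).trans (sum_congr rfl fun k _ => ?_)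
  change ext (hamMap (toScal (fromScal (H k)))) _ = _
  rw [toScal_fromScal (hs k)]

theorem polyV_hasDeriv (hA : ∀ q, Good (A q)) :
    ∀ᶠ L in atTop, ∀ Z : ℝ → Vec, InCStarV I 1 L Z → ∀ t ∈ I, ∀ i,
      HasDerivWithinAt (fun τ => (polyV p N A (Z τ) (Z τ)).at i)
        ((polyD p N A (Z t) (dtV I 1 Z t)).at i) I t := by
  choose C hC S hS hN using fun q => (hA q).exists_nb
  filter_upwards [(eventually_all_finset (Icc p N)).2 fun q _ => eventually_ge_atTop (S q + 5)]
    with L hL Z hZ t ht i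
  simp only [polyV, polyD, ite_self]
  have h1 := HasDerivWithinAt.fun_sum fun q hq => by
    have := hL q hq
    exact ext_hasDerivWithinAt (hC q) (hN q) ht (w := fun _ => Z) (w' := fun _ => dtV I 1 Z)
      (fun _ => (hZ.mono (by linarith)).bdd ht)
      (fun _ => ((InCStarV.dt hZ).mono (by linarith)).bdd ht)
      (fun _ τ hτ i => InCStarV.hasDeriv hZ hτ i) i
  simp only [show ∀ (q : ℕ) (a : Fin (q + 1)) (U V : Vec), update (fun _ => U) a V =
    fun b => if b = a then V else U from fun _ a U V => update_const_apply id U V a] at h1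
  have h2 := (InCStarV.hasDeriv hZ ht i).add h1
  have e : ∀ (V : Vec) (f : ℕ → Vec), (V + ∑ q ∈ Icc p N, f q).at i =
      V.at i + ∑ q ∈ Icc p N, (f q).at i := fun V f => by
    rw [← Vec.sum_at]; rfl
  simp only [e]
  exact h2

theorem exists_transformed_system (hp : 1 ≤ p)
    (hK : K' + 1 ≤ K) (hr : 0 < r) {M₀ : NHMat} (hM₀ : ∀ σ σ', IsM I K K' 0 0 r (M₀ σ σ'))
    {H : ∀ q, KForm q 0} {Mgt : NHMat} (hHam : IsHamDataUpTo I K K' N r H Mgt)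
    (hK₁ : K₁ ≤ K) (hJ₁ : J₁ ≤ K') (hKJ : K₁ - J₁ = K - K') (hZ : PathOK I K K₁ (pathOf M₀.app))
    (hA : ∀ q, Good (A q))
    (hsym : OmInv (N + 1) (polyT p N A).2.2) {F G : Op} (hG : Cls I K₁ J₁ (K₁ - J₁) (N + 1) G)
    (hF : AgreeOn I K₁ F fun U t V => polyV p N A (U t) V + G U t V) :
    ∃ (H' : ∀ q, KForm q 0) (Mgt' : NHMat), IsHamDataUpTo I K K' N r H' Mgt' ∧
      ∃ s₀ > (0 : ℝ), ∃ r₀ > (0 : ℝ), r₀ ≤ r ∧ ∀ U : ℝ → Vec, InBall I K s₀ r₀ U →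
        Solves I N H Mgt U (pathOf M₀.app U) →
        Solves I N H' Mgt' U (pathOf F (pathOf M₀.app U)) := by
  obtain ⟨H₀, hH₀, hHs, hL₁⟩ := exists_hamField_eq hHam.ham
  obtain ⟨H', hH', hHs', M, P, hP, hL₂⟩ := exists_transported_fieldV hp hA hsym hH₀ hHs
  obtain ⟨mg, hmg, hMgt⟩ := hHam.rem
  have hn : K₁ - J₁ = (K - (K' + 1)) + 1 := by omega
  set n := K - (K' + 1) with hndef
  rw [hn] at hG
  have hJn : K' + 1 + n ≤ K := by omega
  obtain ⟨G₁, hG₁, hder⟩ := hG.exists_deriv (by omega)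
  -- the remainder terms
  have rZ : Rem I K (K' + 1) n 0 (pathOf M₀.app) := by
    have := ((cls_of_isM (by omega) le_rfl hM₀).of_le (by omega) (l := n)
      (by omega)).mono_J (Nat.le_succ K')
    exact this.rem
  have rm : Rem I K (K' + 1) n (N + 1) fun U t => Mgt.app U t (U t) := (cls_of_isM hK hmg hMgt).rem
  have hGn := hG.of_le (by omega) (Nat.le_succ n)
  have gZ := hGn.path hK₁ (show J₁ ≤ K' + 1 by omega) (by omega) hZ
  have gZ₁ := hG₁.path hK₁ (show J₁ + 1 ≤ K' + 1 by omega) (by omega) hZ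
  have rX := fieldV_rem hJn hH₀ N rZ
  have rX' := rX.add (rm.mono_p hJn (Nat.zero_le _))
  have rG := gZ.apply hJn rZ
  have rG₁ := gZ₁.apply hJn rZ
  have rG' := gZ.apply hJn rX'
  rw [add_zero] at rG rG₁ rG'
  have rP : Rem I K (K' + 1) n 0 fun U t => polyV p N A (pathOf M₀.app U t) (pathOf M₀.app U t) := by
    simp only [polyV, ite_self]
    exact rZ.add (Rem.sum _ fun q _ => Rem.ext hJn (hA q) (P := fun _ => 0) (fun _ => rZ) (by simp))
  have rS : Rem I K (K' + 1) n (N + 1) fun U t =>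
      ∑ k ∈ Ico (N + 1) M, ext (P k) fun _ => pathOf M₀.app U t :=
    Rem.sum _ fun k hk => Rem.ext hJn (hP k) (P := fun _ => 0) (fun _ => rZ) (by
      have := (Finset.mem_Ico.1 hk).1
      simp
      omega)
  have rD := polyD_rem (p := p) (N := N) hJn hA rZ rm
  have rF := fieldV_sub_rem hJn hH' N rP rG
  have rW := (((rS.add rD).add rG₁).add rG').sub rF
  have rP' := rP.add (rG.mono_p hJn (Nat.zero_le _))
  obtain ⟨W, hW, eW⟩ := rW
  obtain ⟨m', ⟨Mgt', hMgt', hagr⟩, hm'⟩ :=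
    ((hW.exists_mat (Nat.succ_ne_zero N) hr).and (eventually_ge_atTop 0)).exists
  refine ⟨hamOf H', Mgt', ⟨fun q hq => isForm_hamOf hH' (mem_Icc.1 hq).1, m', hm', hMgt'⟩, ?_⟩
  obtain ⟨L₃, hL₃⟩ := (hamField_hamOf (N := N) hH' hHs').exists
  obtain ⟨L, ⟨⟨hL₁, hL₂⟩, hL₄⟩, hL₅⟩ := (((hL₁.and hL₂).and
    (polyD_add (p := p) (N := N) hA)).and (polyV_hasDeriv (I := I) (p := p) (N := N) hA)).exists
  have hin : ∀ᶠ x in germ I K₁, InCStarV I K₁ x.1 x.2 :=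
    germ_iff.2 (Eventually.of_forall fun _ => small_inC)
  have hg := ((hZ.germ hK₁ ((hder.and hF).and hin)).and ((rZ.inHV L).and (rP'.inHV L₃))).and
      (((rX.inHV L).and (rm.inHV L)).and ((eW.and hagr).and germ_inHV))
  obtain ⟨s₀, ⟨⟨r₀, hr₀, h⟩, hs₀⟩, hs⟩ := (((germ_iff.1 hg).and (eventually_gt_atTop 0)).and
    (eventually_ge_atTop L)).exists
  refine ⟨s₀, hs₀, min r₀ r, lt_min hr₀ hr, min_le_right _ _, fun U ⟨hU, x, hx, hb⟩ hsol t ht σ j => ?_⟩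
  obtain ⟨⟨⟨⟨h2, h3⟩, h1⟩, h4, h5⟩, ⟨h6, h7⟩, ⟨h8, h9⟩, hU'⟩ :=
    h U ⟨hU, x, hx.trans_le (min_le_left _ _), hb⟩
  set Z := pathOf M₀.app U with hZdef
  have hZ1 : InCStarV I 1 s₀ Z := h1.of_le (by omega)
  have hZ' : dtV I 1 Z t = fieldV N H₀ (Z t) + Mgt.app U t (U t) := by
    rw [← hL₁ _ (h4 t ht)]
    exact dtV_one_eq ht fun i => hsol t ht i.1 i.2
  have d1 := (hL₅ Z (hZ1.mono hs) t ht ⟨σ, j⟩).add (h2 Z hZ1 t ht ⟨σ, j⟩)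
  rw [hZ', hL₄ _ _ _ (h4 t ht) (h6 t ht) (h7 t ht), hL₂ _ (h4 t ht)] at d1
  have e3 : ∀ τ ∈ I, pathOf F Z τ = polyV p N A (Z τ) (Z τ) + G Z τ (Z τ) := fun τ hτ =>
    h3 τ hτ _ (hZ1.inHV hτ)
  refine (d1.congr (fun τ hτ => by rw [e3 τ hτ]; rfl) (by rw [e3 t ht]; rfl)).congr_deriv ?_
  rw [e3 t ht, hL₃ _ (h5 t ht), h9 t ht _ (hU' t ht), ← h8 t ht]
  simp only [Vec.at, Pi.add_apply, Pi.sub_apply]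
  ring

end

end PluriHom

end

open PluriHom

theorem theorem7p1 (p N K K' : ℕ) (hp : 1 ≤ p) (hpN : p ≤ N) (hK : K' + 1 ≤ K) (r : ℝ) (hr : 0 < r)
    (I : Set ℝ) (hI : I.OrdConnected) (hIsymm : ∀ t ∈ I, -t ∈ I) (hIint : (interior I).Nonempty)
    (M₀ : NHMat) (hM₀ : ∀ σ σ', IsM I K K' 0 0 r (M₀ σ σ'))
    (H : ∀ q, KForm q 0) (Mgt : NHMat) (hHam : IsHamDataUpTo I K K' N r H Mgt)
    (B : NHMat) (Bq : ∀ q, HomMat q)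
    (hB_id : M₀.IsId I K' r → IdPlusSigmaS I K K' p N r B.app Bq ∧ IsLinSymplecticUpTo I K K' N r B)
    (hB : ¬ M₀.IsId I K' r → ∀ r₁ > 0,
      (∀ κ ≤ K, IdPlusSigmaS I κ 0 p N r₁ B.app Bq) ∧ IsLinSymplecticUpTo I K 0 N r₁ B) :
    ∃ R : ∀ q, HomMat q, (∀ q ∈ Finset.Icc p N, (R q).IsRealToReal ∧
        ∀ ϱ > (0 : ℝ), ∀ σ σ', IsHomM (-ϱ) (R q σ σ')) ∧
      (M₀.IsId I K' r → IsSymplecticUpTo I K K' p N r (corrected p N R B)) ∧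
      (¬ M₀.IsId I K' r → ∀ r₁ > 0, ∀ κ ≤ K, IsSymplecticUpTo I κ 0 p N r₁ (corrected p N R B)) ∧
      ∃ (H' : ∀ q, KForm q 0) (Mgt' : NHMat), IsHamDataUpTo I K K' N r H' Mgt' ∧
        ∃ s₀ > (0 : ℝ), ∃ r₀ > (0 : ℝ), r₀ ≤ r ∧ ∀ U : ℝ → Vec, InBall I K s₀ r₀ U →
          Solves I N H Mgt U (pathOf M₀.app U) →
          Solves I N H' Mgt' U (pathOf (corrected p N R B) (pathOf M₀.app U)) := by
  have : TimeInterval I := ⟨hI, uniqueDiffOn_convex hI.convex hIint⟩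
  obtain ⟨t₀, ht₀⟩ : I.Nonempty := hIint.mono interior_subset
  obtain ⟨J, r', hb, hl⟩ : ∃ J r', IdPlusSigmaS I K J p N r' B.app Bq ∧
      IsLinSymplecticUpTo I K J N r' B := by
    by_cases h : M₀.IsId I K' r
    · exact ⟨K', r, hB_id h⟩
    · exact ⟨0, 1, (hB h 1 one_pos).1 K le_rfl, (hB h 1 one_pos).2⟩
  have hcj : ∀ q ∈ Finset.Icc p N, ∀ U, toMap (Bq q) (fun a => cj (U a)) = cj (toMap (Bq q) U) :=
    fun q hq U => toMap_cj hb hl ht₀ hq U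
  have hlin := lin_polyT hb hl ht₀
  obtain ⟨m, hm, hS, -⟩ := hb
  have hg : ∀ q ∈ Finset.Icc p N, Good (toMap (Bq q)) := fun q hq =>
    IsHomM.good hm (fun σ σ' => (hS q hq σ σ').toIsHomM) (hcj q hq)
  have hpl : ParaLin N (polyT p N fun q => toMap (Bq q)) :=
    paraLin_polyT hp hg (fun q hq => IsHomS.kernel (hS q hq)) hlin
  obtain ⟨R, hR, M, A, hA, hAs, he, hM, hsym⟩ := exists_corrected_expansion hp hpN hpl ordT_polyT
  have hagree : ∀ κ J r₁, J ≤ κ → IdPlusSigmaS I κ J p N r₁ B.app Bq → _ := fun κ J r₁ hJ h =>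
    corrected_agree hJ h hg (fun q => (hR q).1) hA hM he
  refine ⟨fun q => toMat (R q), fun q _ => ⟨isRealToReal_toMat (hR q).1, fun ϱ hϱ σ σ' =>
    (hR q).2.2.isHomM (hR q).1 (fun π U V => ?_) hϱ σ σ'⟩, fun h => ?_, fun h r₁ hr₁ κ hκ => ?_, ?_⟩
  · rw [← extendPerm_snoc]
    exact (hR q).2.1 _ _
  · obtain ⟨G, hG, hF⟩ := hagree K K' r (by omega) (hB_id h).1
    exact isSymplecticUpTo_corrected hr hA hAs hsym hG hF
  · obtain ⟨G, hG, hF⟩ := hagree κ 0 r₁ (Nat.zero_le κ) ((hB h r₁ hr₁).1 κ hκ)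
    exact isSymplecticUpTo_corrected hr₁ hA hAs hsym hG hF
  · by_cases h : M₀.IsId I K' r
    · obtain ⟨G, hG, hF⟩ := hagree K K' r (by omega) (hB_id h).1
      exact exists_transformed_system hp hK hr hM₀ hHam le_rfl le_rfl rfl
        (pathOK_of_isId (by omega) hr h) hA hsym hG hF
    · obtain ⟨G, hG, hF⟩ := hagree (K - K') 0 1 (Nat.zero_le _)
        ((hB h 1 one_pos).1 _ (Nat.sub_le _ _))
      exact exists_transformed_system hp hK hr hM₀ hHam (Nat.sub_le _ _) (Nat.zero_le _)
        (Nat.sub_zero _) (pathOK_of_isM (by omega) hM₀) hA hsym hG hF
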